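/- Let $G^{\mathbb C}$ be a connected, simply connected complex Lie group with simple Lie algebra $\mathfrak g^{\mathbb C}$, $G\subset G^{\mathbb C}$ a compact connected real form, $\mathfrak h\subset\mathfrak g^{\mathbb C}$ a Cartan subalgebra with a simple root system $\Sigma$, $\Theta\subsetneq\Sigma$, and $P=P_\Theta\subset G^{\mathbb C}$ the parabolic subgroup defined by $\Theta$, i.e. the normaliser of $\mathfrak p_\Theta=\mathfrak n^+\oplus\mathfrak h\oplus\mathfrak n(\Theta)^-$, where $\mathfrak n(\Theta)^-$ is the sum of the root spaces of the negative roots in the span $\langle\Theta\rangle$. Let $X_P=G^{\mathbb C}/P$ be the corresponding complex flag manifold, $n=\dim_{\mathbb C}X_P$, $J$ its complex structure, and $I=I(X_P)$ its Fano index, the largest integer such that $\frac1I c_1(X_P)\in H^2(X_P,\mathbb Z)$. Let $L=K_{X_P}^{\otimes 1/I}$ be the (homogeneous) $I$-th root of the canonical bundle and, for an integer $\ell\ge 1$, let $$\mathcal Q_P=Q(L),\qquad M=\mathcal Q_P/\mathbb Z_\ell=Q(L^{\otimes \ell}),$$ where $Q(\cdot)$ is the principal ${\rm U}(1)$-bundle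 of a homogeneous line bundle: if the line bundle is given by the holomorphic character $\chi$ of $P$, so that $[gp,z]=[g,\chi(p)z]$, then a local holomorphic section $s_U$ of $G^{\mathbb C}\to X_P$ defines a fibre coordinate $a_U=e^{i\theta_U}$ on $Q$, with $a_i=\frac{\chi(\psi_{ij})}{|\chi(\psi_{ij})|}a_j$ where $s_j=s_i\psi_{ij}$. Let $\frac{\partial}{\partial\theta}$ be the generator of the ${\rm U}(1)$-action on $M$. Let $\delta_P$ be the sum of the positive roots not in $\langle\Theta\rangle$, $V(\delta_P)$ the irreducible representation of $G^{\mathbb C}$ with highest weight $\delta_P$, $v^+_{\delta_P}$ a highest weight vector, and $\|\cdot\|$ a norm on $V(\delta_P)$ from a $G$-invariant Hermitian inner product. Then $\mathcal Q_P\to M$, $a_U\mapsto a_U^\ell$, is a surjective local diffeomorphism whose fibres are the orbits of $\mathbb Z_\ell\subset {\rm U}(1)$; $M$ is compact, connected and Hausdorff; and there is a real $1$-form $\eta$ on $M$ which satisfies $$\eta=-\frac{\ell\sqrt{-1}}{2I}\big(\partial-\overline\partial\big)\log\big\|s_Uv^+_{\delta_P}\big\|^2+d\theta_U$$ over $U$,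 for every local holomorphic section $s_U\colon U\subset X_P\to G^{\mathbb C}$. Moreover $M$ carries a homogeneous Sasaki-Einstein structure $$\Big(g_M,\ \phi,\ \xi=\frac{\ell(n+1)}{I}\frac{\partial}{\partial\theta},\ \frac{I}{\ell(n+1)}\eta\Big),\qquad g_M=\frac{I}{\ell(n+1)}\Big(\frac12 d\eta({\rm id}\otimes\phi)+\frac{I}{\ell(n+1)}\eta\otimes\eta\Big),$$ where $\phi\in{\rm End}(TM)$ maps $w$ to the horizontal lift of $J\pi_*w$ for the connection $\ker\eta$: $\eta(\phi w)=0$ and $\pi_*(\phi w)=J\pi_*w$. Here a Sasaki-Einstein structure $(g,\phi,\xi,\eta')$ consists of smooth tensors such that $\eta'\wedge(d\eta')^n\ne0$ everywhere, $\eta'(\xi)=1$, $\phi^2=-{\rm id}+\eta'\otimes\xi$, $g(\phi\otimes\phi)=g-\eta'\otimes\eta'$, $d\eta'=2g(\phi\otimes{\rm id})$, $\mathscr L_\xi g=0$, $[\phi,\phi]+d\eta'\otimes\xi=0$ and $g$ is Einstein, with $d\eta'(X,Y)=X(\eta'(Y))-Y(\eta'(X))-\eta'([X,Y])$; it is homogeneous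 because the natural action of $G$ on $M$ is transitive and, modulo the kernel of the action, is the effective action of a connected Lie group by isometries that preserve $\phi$, $\xi$ and $\eta'$. -/

import Mathlib

open scoped Manifold ContDiff Topology
open Bundle Set

noncomputable section

namespace SasakiGeom

/-! ## Tensors, exterior derivative and Ricci curvature on a real manifold -/

section General

variable {E : Type*} [NormedAddCommGroup E] [NormedSpace ℝ E]
  {H : Type*} [TopologicalSpace H] (I : ModelWithCorners ℝ E H)
  {M : Type*} [TopologicalSpace M] [ChartedSpace H M]

/-- A `1`-form on `M`, written in the preferred chart at `p`. -/
def chartForm (η : ∀ p : M, TangentSpace I p →L[ℝ] ℝ) (p : M) (y : E) : E →L[ℝ] ℝ :=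
  (η ((extChartAt I p).symm y)).comp (mfderiv 𝓘(ℝ, E) I (extChartAt I p).symm y)

/-- The exterior derivative of a `1`-form, computed in the preferred chart at `p`, with the
normalisation `dη(X, Y) = X(η(Y)) - Y(η(X)) - η([X, Y])` (no factor `1/2`). -/
def extD (η : ∀ p : M, TangentSpace I p →L[ℝ] ℝ) (p : M) (u v : TangentSpace I p) : ℝ :=
  fderiv ℝ (chartForm I η p) (extChartAt I p p) u v
    - fderiv ℝ (chartForm I η p) (extChartAt I p p) v u

/-- The value of `η ∧ τⁿ` on `v₀, …, v₂ₙ`, for a linear form `η` and a `2`-form `τ`, up to the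
positive constant `2ⁿ`. -/
def wedgePow (n : ℕ) {V : Type*} (η : V → ℝ) (τ : V → V → ℝ) (v : Fin (2 * n + 1) → V) : ℝ :=
  ∑ σ : Equiv.Perm (Fin (2 * n + 1)), ((Equiv.Perm.sign σ : ℤ) : ℝ) * (η (v (σ 0)) *
    ∏ i : Fin n, τ (v (σ ⟨2 * i + 1, by omega⟩)) (v (σ ⟨2 * i + 2, by omega⟩)))

/-- A metric tensor on `M`, written in the preferred chart at `p`. -/
def chartMetric (g : ∀ p : M, TangentSpace I p →L[ℝ] TangentSpace I p →L[ℝ] ℝ) (p : M) (y : E) :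
    E →L[ℝ] E →L[ℝ] ℝ :=
  let A : E →L[ℝ] E := mfderiv 𝓘(ℝ, E) I (extChartAt I p).symm y
  let G : E →L[ℝ] E →L[ℝ] ℝ := g ((extChartAt I p).symm y)
  G.bilinearComp A A

/-- The Christoffel symbols `Γ(u, v)` of a metric `G` on an open subset of a vector space:
`G(Γ(u, v), w) = (∂ᵤ G(v, w) + ∂ᵥ G(u, w) - ∂_w G(u, v)) / 2`. -/
def christoffel (G : E → E →L[ℝ] E →L[ℝ] ℝ) (u v y : E) : E :=
  (G y).inverse ((1 / 2 : ℝ) • (fderiv ℝ G y u v + fderiv ℝ G y v u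
    - ((fderiv ℝ G y).flip u).flip v))

/-- The curvature `R(u, v) w` of the Levi-Civita connection of a metric `G` on an open subset
of a vector space:
`R(u, v) w = ∂ᵤ Γ(v, w) - ∂ᵥ Γ(u, w) + Γ(u, Γ(v, w)) - Γ(v, Γ(u, w))`. -/
def curvature (G : E → E →L[ℝ] E →L[ℝ] ℝ) (u v w y : E) : E :=
  fderiv ℝ (christoffel G v w) y u - fderiv ℝ (christoffel G u w) y v
    + christoffel G u (christoffel G v w y) y - christoffel G v (christoffel G u w y) y

variable [FiniteDimensional ℝ E]

/-- The Ricci tensor `Ric(v, w) = tr (u ↦ R(u, v) w)` of a metric on `M`; the trace is computed in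
a basis of the model space. -/
def ricci (g : ∀ p : M, TangentSpace I p →L[ℝ] TangentSpace I p →L[ℝ] ℝ) (p : M)
    (v w : TangentSpace I p) : ℝ :=
  ∑ i, (Module.finBasis ℝ E).coord i
    (curvature (chartMetric I g p) (Module.finBasis ℝ E i) v w (extChartAt I p p))

/-- `g` is an Einstein metric. -/
def IsEinstein (g : ∀ p : M, TangentSpace I p →L[ℝ] TangentSpace I p →L[ℝ] ℝ) : Prop :=
  ∃ c : ℝ, ∀ (p : M) (v w : TangentSpace I p), ricci I g p v w = c * g p v w

/-- The derivative `X(f)` of a function `f` along a vector field `X`. -/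
def lieDeriv (X : ∀ p : M, TangentSpace I p) (f : M → ℝ) (p : M) : ℝ :=
  mfderiv I 𝓘(ℝ, ℝ) f p (X p)

variable [IsManifold I ∞ M]

/-- A smooth vector field on `M`. -/
def IsSmoothField (X : ∀ p : M, TangentSpace I p) : Prop :=
  ContMDiff I I.tangent ∞ (fun p => (⟨p, X p⟩ : TangentBundle I M))

variable (M) in
/-- Smooth tensors `(g, φ, ξ, η)` on `M`: a Riemannian metric, a field of endomorphisms, a vector
field and a `1`-form. -/
structure StructureTensors where
  g : ContMDiffRiemannianMetric I ∞ E (fun p : M => TangentSpace I p)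
  φ : ∀ p : M, TangentSpace I p →L[ℝ] TangentSpace I p
  ξ : ∀ p : M, TangentSpace I p
  η : ∀ p : M, TangentSpace I p →L[ℝ] ℝ
  smooth_φ : ContMDiff I (I.prod 𝓘(ℝ, E →L[ℝ] E)) ∞ (fun p => TotalSpace.mk' (E →L[ℝ] E)
    (E := fun p : M => TangentSpace I p →L[ℝ] TangentSpace I p) p (φ p))
  smooth_ξ : IsSmoothField I ξ
  smooth_η : ContMDiff I (I.prod 𝓘(ℝ, E →L[ℝ] ℝ)) ∞ (fun p => TotalSpace.mk' (E →L[ℝ] ℝ)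
    (E := fun p : M => TangentSpace I p →L[ℝ] Trivial M ℝ p) p (η p))

variable {I}

/-- `(g, φ, ξ, η)` is a contact metric structure on the `(2n+1)`-dimensional manifold `M`. -/
structure IsContactMetric (n : ℕ) (S : StructureTensors I M) : Prop where
  finrank_eq : Module.finrank ℝ E = 2 * n + 1
  contact : ∀ p : M, ∃ v : Fin (2 * n + 1) → TangentSpace I p,
    wedgePow n (S.η p) (extD I S.η p) v ≠ 0
  eta_xi : ∀ p : M, S.η p (S.ξ p) = 1
  phi_phi : ∀ (p : M) (u : TangentSpace I p), S.φ p (S.φ p u) = -u + S.η p u • S.ξ p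
  metric_phi : ∀ (p : M) (u v : TangentSpace I p),
    S.g.inner p (S.φ p u) (S.φ p v) = S.g.inner p u v - S.η p u * S.η p v
  extD_eta : ∀ (p : M) (u v : TangentSpace I p), extD I S.η p u v = 2 * S.g.inner p (S.φ p u) v

/-- `(g, φ, ξ, η)` is K-contact: it is a contact metric structure and `ξ` is a Killing field,
`(L_ξ g)(X, Y) = ξ(g(X, Y)) - g([ξ, X], Y) - g(X, [ξ, Y]) = 0`. -/
structure IsKContact (n : ℕ) (S : StructureTensors I M) : Prop extends IsContactMetric n S where
  killing : ∀ X Y : ∀ p : M, TangentSpace I p, IsSmoothField I X → IsSmoothField I Y → ∀ p : M,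
    lieDeriv I S.ξ (fun q => S.g.inner q (X q) (Y q)) p
      - S.g.inner p (VectorField.mlieBracket I S.ξ X p) (Y p)
      - S.g.inner p (X p) (VectorField.mlieBracket I S.ξ Y p) = 0

/-- `(g, φ, ξ, η)` is Sasakian: it is K-contact and `[φ, φ] + dη ⊗ ξ = 0`, where
`[φ, φ](X, Y) = φ²[X, Y] + [φX, φY] - φ[φX, Y] - φ[X, φY]`. -/
structure IsSasakian (n : ℕ) (S : StructureTensors I M) : Prop extends IsKContact n S where
  normal : ∀ X Y : ∀ p : M, TangentSpace I p, IsSmoothField I X → IsSmoothField I Y → ∀ p : M,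
    S.φ p (S.φ p (VectorField.mlieBracket I X Y p))
      + VectorField.mlieBracket I (fun q => S.φ q (X q)) (fun q => S.φ q (Y q)) p
      - S.φ p (VectorField.mlieBracket I (fun q => S.φ q (X q)) Y p)
      - S.φ p (VectorField.mlieBracket I X (fun q => S.φ q (Y q)) p)
      + extD I S.η p (X p) (Y p) • S.ξ p = 0

/-- `(g, φ, ξ, η)` is Sasaki-Einstein. -/
structure IsSasakiEinstein (n : ℕ) (S : StructureTensors I M) : Prop
    extends IsSasakian n S where
  einstein : IsEinstein I S.g.inner

/-- The map `F : M → M` is an isometry that preserves `φ`, `ξ` and `η`. -/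
structure IsPreservedBy (S : StructureTensors I M) (F : M → M) : Prop where
  metric : ∀ (p : M) (u v : TangentSpace I p),
    S.g.inner (F p) (mfderiv I I F p u) (mfderiv I I F p v) = S.g.inner p u v
  phi : ∀ (p : M) (u : TangentSpace I p),
    mfderiv I I F p (S.φ p u) = S.φ (F p) (mfderiv I I F p u)
  xi : ∀ p : M, mfderiv I I F p (S.ξ p) = S.ξ (F p)
  eta : ∀ (p : M) (u : TangentSpace I p), S.η (F p) (mfderiv I I F p u) = S.η p u

/-- The structure is homogeneous, through the action of the group `K`: the quotient of `K` by the
kernel of its action on `M` is a connected Lie group `A`, which acts smoothly, transitively and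
effectively on `M`, by isometries preserving the structure. -/
def IsHomogeneousUnder.{u} (S : StructureTensors I M) (K : Type u) [Group K] (act : K → M → M) :
    Prop :=
  ∃ (d : ℕ) (A : Type u) (_ : TopologicalSpace A)
    (_ : ChartedSpace (EuclideanSpace ℝ (Fin d)) A) (_ : Group A) (_ : MulAction A M) (q : K →* A),
    LieGroup (𝓡 d) ∞ A ∧ ConnectedSpace A ∧ ContMDiffSMul (𝓡 d) I ∞ A M ∧
    MulAction.IsPretransitive A M ∧ FaithfulSMul A M ∧
    (∀ a : A, IsPreservedBy S (fun p => a • p)) ∧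
    Function.Surjective q ∧ ∀ (k : K) (p : M), q k • p = act k p

end General

/-! ## Parabolic subalgebras and the weight `δ_P` -/

section LieAlgebra

open LieAlgebra LieAlgebra.IsKilling

variable {L : Type*} [LieRing L] [LieAlgebra ℂ L] [FiniteDimensional ℂ L] [IsKilling ℂ L]
  {𝔥 : LieSubalgebra ℂ L} [𝔥.IsCartanSubalgebra]

/-- The root `α` belongs to `⟨Θ⟩`, the set of roots spanned by the set `Θ` of simple roots. -/
def IsLeviRoot (Θ : Finset 𝔥.root) (α : 𝔥.root) : Prop :=
  (rootSystem 𝔥).root α ∈ Submodule.span ℤ ((rootSystem 𝔥).root '' (Θ : Set 𝔥.root))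

/-- The parabolic subalgebra `𝔭_Θ = 𝔫⁺ ⊕ 𝔥 ⊕ 𝔫(Θ)⁻`, where `𝔫(Θ)⁻` is the sum of the root spaces of
the negative roots in `⟨Θ⟩`. -/
def parabolicSubalgebra (b : (rootSystem 𝔥).Base) (Θ : Finset 𝔥.root) : Submodule ℂ L :=
  𝔥.toSubmodule
    ⊔ (⨆ α : {α : 𝔥.root // b.IsPos α}, (rootSpace 𝔥 (α.1 : LieModule.Weight ℂ 𝔥 L)).toSubmodule)
    ⊔ (⨆ α : {α : 𝔥.root // ¬ b.IsPos α ∧ IsLeviRoot Θ α},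
        (rootSpace 𝔥 (α.1 : LieModule.Weight ℂ 𝔥 L)).toSubmodule)

open Classical in
/-- The weight `δ_P`: the sum of the positive roots that do not belong to `⟨Θ⟩`. -/
def deltaWeight (b : (rootSystem 𝔥).Base) (Θ : Finset 𝔥.root) : Module.Dual ℂ 𝔥 :=
  ∑ α : 𝔥.root, if b.IsPos α ∧ ¬ IsLeviRoot Θ α then (rootSystem 𝔥).root α else 0

/-- `V` is an irreducible `L`-module with highest weight `μ` and highest weight vector `v`. -/
structure IsHighestWeightModule (b : (rootSystem 𝔥).Base) (μ : Module.Dual ℂ 𝔥) (V : Type*)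
    [AddCommGroup V] [Module ℂ V] [LieRingModule L V] [LieModule ℂ L V] (v : V) : Prop where
  irreducible : LieModule.IsIrreducible ℂ L V
  ne_zero : v ≠ 0
  weight : ∀ h : 𝔥, ⁅(h : L), v⁆ = μ h • v
  highest : ∀ α : 𝔥.root, b.IsPos α → ∀ x ∈ rootSpace 𝔥 (α : LieModule.Weight ℂ 𝔥 L), ⁅x, v⁆ = 0

end LieAlgebra

/-! ## Complex Lie groups, parabolic subgroups and compact real forms -/

section LieGroups

variable {𝔼 : Type*} [NormedAddCommGroup 𝔼] [NormedSpace ℂ 𝔼]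
  {Gc : Type*} [TopologicalSpace Gc] [ChartedSpace 𝔼 Gc] [Group Gc]

instance completeSpace_of_finiteDimensional [FiniteDimensional ℂ 𝔼] : CompleteSpace 𝔼 :=
  FiniteDimensional.complete ℂ 𝔼

instance finiteDimensional_groupLieAlgebra [FiniteDimensional ℂ 𝔼] :
    FiniteDimensional ℂ (GroupLieAlgebra 𝓘(ℂ, 𝔼) Gc) :=
  inferInstanceAs (FiniteDimensional ℂ 𝔼)

/-- The adjoint representation: `Ad g` is the derivative at `1` of `x ↦ g x g⁻¹`. -/
def Ad (g : Gc) (x : GroupLieAlgebra 𝓘(ℂ, 𝔼) Gc) : GroupLieAlgebra 𝓘(ℂ, 𝔼) Gc :=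
  mfderiv 𝓘(ℂ, 𝔼) 𝓘(ℂ, 𝔼) (fun y : Gc => g * y * g⁻¹) 1 x

theorem Ad_one (x : GroupLieAlgebra 𝓘(ℂ, 𝔼) Gc) : Ad (1 : Gc) x = x := by
  have : (fun x : Gc => 1 * x * 1⁻¹) = id := by ext; simp
  rw [Ad, this, mfderiv_id]
  rfl

variable [LieGroup 𝓘(ℂ, 𝔼) ω Gc]

theorem Ad_mul (g h : Gc) (x : GroupLieAlgebra 𝓘(ℂ, 𝔼) Gc) : Ad (g * h) x = Ad g (Ad h x) := by
  have hc : ∀ k : Gc, ContMDiff 𝓘(ℂ, 𝔼) 𝓘(ℂ, 𝔼) ω (fun x : Gc => k * x * k⁻¹) := fun k =>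
    (contMDiff_const.mul contMDiff_id).mul contMDiff_const
  have hd : ∀ k x : Gc, MDifferentiableAt 𝓘(ℂ, 𝔼) 𝓘(ℂ, 𝔼) (fun x : Gc => k * x * k⁻¹) x :=
    fun k x => ((hc k) x).mdifferentiableAt (by simp)
  have e : (fun x : Gc => g * h * x * (g * h)⁻¹)
      = (fun x : Gc => g * x * g⁻¹) ∘ (fun x : Gc => h * x * h⁻¹) := by
    ext x; simp [mul_assoc]
  have h1 : h * 1 * h⁻¹ = (1 : Gc) := by simp
  have key := mfderiv_comp (1 : Gc) (hd g _) (hd h 1)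
  rw [h1] at key
  rw [Ad, e, key]
  rfl

/-- The normaliser in `Gc`, for the adjoint action, of a subspace `𝔭` of the Lie algebra. -/
def adNormalizer (𝔭 : Submodule ℂ (GroupLieAlgebra 𝓘(ℂ, 𝔼) Gc)) : Subgroup Gc where
  carrier := {g | ∀ x, Ad g x ∈ 𝔭 ↔ x ∈ 𝔭}
  one_mem' x := by rw [Ad_one]
  mul_mem' hg hh x := by rw [Ad_mul, hg, hh]
  inv_mem' {g} hg x := by rw [← hg, ← Ad_mul, mul_inv_cancel, Ad_one]

/-- The differential at `1` of a homomorphism from a real Lie group to `Gc`. -/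
def realDifferential {d : ℕ} {K : Type*} [TopologicalSpace K]
    [ChartedSpace (EuclideanSpace ℝ (Fin d)) K] [Group K] (ι : K →* Gc)
    (x : GroupLieAlgebra (𝓡 d) K) : 𝔼 :=
  mfderiv (𝓡 d) 𝓘(ℝ, 𝔼) ι 1 x

variable (𝔼) in
/-- `K`, embedded in the complex Lie group `Gc` by `ι`, is a compact connected real form of `Gc`:
its Lie algebra `𝔤` satisfies `𝔤ᶜ = 𝔤 ⊕ i 𝔤`. -/
structure IsCompactRealForm {d : ℕ} {K : Type*} [TopologicalSpace K]
    [ChartedSpace (EuclideanSpace ℝ (Fin d)) K] [Group K] (ι : K →* Gc) : Prop where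
  lieGroup : LieGroup (𝓡 d) ∞ K
  compact : CompactSpace K
  connected : ConnectedSpace K
  injective : Function.Injective ι
  smooth : ContMDiff (𝓡 d) 𝓘(ℝ, 𝔼) ∞ ι
  real_form : ∀ z : 𝔼, ∃! xy : GroupLieAlgebra (𝓡 d) K × GroupLieAlgebra (𝓡 d) K,
    z = realDifferential ι xy.1 + Complex.I • (realDifferential ι xy.2 : 𝔼)

end LieGroups

/-! ## Flag manifolds and principal circle bundles over them -/

section Bundles

variable (𝔼 : Type*) [NormedAddCommGroup 𝔼] [NormedSpace ℂ 𝔼]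
  (E : Type*) [NormedAddCommGroup E] [NormedSpace ℂ E]
  {Gc : Type*} [TopologicalSpace Gc] [ChartedSpace 𝔼 Gc] [Group Gc]
  (P : Subgroup Gc) [ChartedSpace E (Gc ⧸ P)]

/-- The given atlas on the quotient space `Gc ⧸ P` is its standard structure of complex manifold:
the one for which the projection `Gc → Gc ⧸ P` is holomorphic and has local holomorphic sections.
There is at most one such structure. -/
class IsHolomorphicQuotient : Prop where
  isManifold : IsManifold 𝓘(ℂ, E) ω (Gc ⧸ P)
  contMDiff_mk : ContMDiff 𝓘(ℂ, 𝔼) 𝓘(ℂ, E) ω (QuotientGroup.mk : Gc → Gc ⧸ P)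
  exists_section : ∀ x : Gc ⧸ P, ∃ (U : Set (Gc ⧸ P)) (s : Gc ⧸ P → Gc), IsOpen U ∧ x ∈ U ∧
    ContMDiffOn 𝓘(ℂ, E) 𝓘(ℂ, 𝔼) ω s U ∧ ∀ y ∈ U, (QuotientGroup.mk (s y) : Gc ⧸ P) = y

/-- A local holomorphic section `s_U : U → Gc` of the projection `Gc → Gc ⧸ P`. -/
structure LocalSection where
  U : Set (Gc ⧸ P)
  isOpen : IsOpen U
  s : Gc ⧸ P → Gc
  holomorphic : ContMDiffOn 𝓘(ℂ, E) 𝓘(ℂ, 𝔼) ω s U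
  mk_s : ∀ y ∈ U, (QuotientGroup.mk (s y) : Gc ⧸ P) = y

/-- A holomorphic character `P → ℂˣ`: near `1`, hence near every point of `P`, it is the
restriction of a holomorphic function on `Gc`. -/
structure HolomorphicCharacter where
  toHom : P →* ℂˣ
  exists_extension : ∃ F : Gc → ℂ, ContMDiffAt 𝓘(ℂ, 𝔼) 𝓘(ℂ, ℂ) ω F 1 ∧
    ∀ᶠ g in 𝓝 (1 : Gc), ∀ hg : g ∈ P, F g = (toHom ⟨g, hg⟩ : ℂ)

/-- The phase `z / |z|`. -/
def phase : ℂˣ →* Circle where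
  toFun z := ⟨(z : ℂ) / ‖(z : ℂ)‖, mem_sphere_zero_iff_norm.2 (by simp)⟩
  map_one' := by
    apply Circle.ext
    change ((1 : ℂˣ) : ℂ) / ‖((1 : ℂˣ) : ℂ)‖ = 1
    simp
  map_mul' z w := by
    apply Circle.ext
    change ((z * w : ℂˣ) : ℂ) / ‖((z * w : ℂˣ) : ℂ)‖ = (z : ℂ) / ‖(z : ℂ)‖ * ((w : ℂ) / ‖(w : ℂ)‖)
    simp [mul_div_mul_comm]

theorem coe_phase (z : ℂˣ) : (phase z : ℂ) = (z : ℂ) / ‖(z : ℂ)‖ := rfl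

variable {𝔼 E P}

/-- The powers of a holomorphic character. -/
def HolomorphicCharacter.pow (χ : HolomorphicCharacter 𝔼 P) (k : ℕ) :
    HolomorphicCharacter 𝔼 P where
  toHom := χ.toHom ^ k
  exists_extension := by
    obtain ⟨F, hF, h⟩ := χ.exists_extension
    refine ⟨fun g => F g ^ k, hF.pow k, ?_⟩
    filter_upwards [h] with g hg hgP
    simp [hg hgP]

section
variable [hq : IsHolomorphicQuotient 𝔼 E P]

variable (𝔼 E P) in
/-- A chosen local section around the point `x`. -/
def sectionAt (x : Gc ⧸ P) : LocalSection 𝔼 E P :=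
  let h := hq.exists_section x
  { U := h.choose
    isOpen := h.choose_spec.choose_spec.1
    s := h.choose_spec.choose
    holomorphic := h.choose_spec.choose_spec.2.2.1
    mk_s := h.choose_spec.choose_spec.2.2.2 }

theorem mem_sectionAt (x : Gc ⧸ P) : x ∈ (sectionAt 𝔼 E P x).U :=
  (hq.exists_section x).choose_spec.choose_spec.2.1
end

open Classical in
/-- Two elements `g, h` of `Gc` with the same image in `Gc ⧸ P` differ by `g⁻¹ h ∈ P`, at which
`χ` can be evaluated. The value is `1` if the images differ. -/
def HolomorphicCharacter.ratio (χ : HolomorphicCharacter 𝔼 P) (g h : Gc) : ℂˣ :=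
  if hgh : g⁻¹ * h ∈ P then χ.toHom ⟨g⁻¹ * h, hgh⟩ else 1

theorem HolomorphicCharacter.ratio_eq (χ : HolomorphicCharacter 𝔼 P) {g h : Gc}
    (hgh : (QuotientGroup.mk g : Gc ⧸ P) = QuotientGroup.mk h) :
    χ.ratio g h = χ.toHom ⟨g⁻¹ * h, QuotientGroup.eq.1 hgh⟩ := by
  rw [ratio, dif_pos]

theorem HolomorphicCharacter.ratio_self (χ : HolomorphicCharacter 𝔼 P) (g : Gc) :
    χ.ratio g g = 1 := by
  rw [χ.ratio_eq rfl]
  have : (⟨g⁻¹ * g, QuotientGroup.eq.1 rfl⟩ : P) = 1 := by ext; simp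
  rw [this, map_one]

theorem HolomorphicCharacter.ratio_mul (χ : HolomorphicCharacter 𝔼 P) {g h k : Gc}
    (hgh : (QuotientGroup.mk g : Gc ⧸ P) = QuotientGroup.mk h)
    (hhk : (QuotientGroup.mk h : Gc ⧸ P) = QuotientGroup.mk k) :
    χ.ratio g h * χ.ratio h k = χ.ratio g k := by
  rw [χ.ratio_eq hgh, χ.ratio_eq hhk, χ.ratio_eq (hgh.trans hhk), ← map_mul]
  congr 1
  ext; simp [mul_assoc]

theorem HolomorphicCharacter.ratio_mul_left (χ : HolomorphicCharacter 𝔼 P) (a g h : Gc) :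
    χ.ratio (a * g) (a * h) = χ.ratio g h := by
  have : (a * g)⁻¹ * (a * h) = g⁻¹ * h := by group
  unfold ratio
  rw! [this]
  rfl

section
variable [LieGroup 𝓘(ℂ, 𝔼) ω Gc]

/-- `x ↦ χ(s₁(x)⁻¹ s₂(x))` is holomorphic on the intersection of the domains of two local
sections. -/
theorem HolomorphicCharacter.contMDiffOn_ratio (χ : HolomorphicCharacter 𝔼 P)
    (s₁ s₂ : LocalSection 𝔼 E P) :
    ContMDiffOn 𝓘(ℂ, E) 𝓘(ℂ, ℂ) ω (fun x => (χ.ratio (s₁.s x) (s₂.s x) : ℂ)) (s₁.U ∩ s₂.U) := by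
  intro x₀ hx₀
  obtain ⟨F, hF, h⟩ := χ.exists_extension
  have hmk : ∀ x ∈ s₁.U ∩ s₂.U, (QuotientGroup.mk (s₁.s x) : Gc ⧸ P) = QuotientGroup.mk (s₂.s x) :=
    fun x hx => by rw [s₁.mk_s x hx.1, s₂.mk_s x hx.2]
  have hψ : ContMDiffOn 𝓘(ℂ, E) 𝓘(ℂ, 𝔼) ω (fun x => (s₁.s x)⁻¹ * s₂.s x) (s₁.U ∩ s₂.U) :=
    (s₁.holomorphic.mono inter_subset_left).inv.mul (s₂.holomorphic.mono inter_subset_right)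
  set p₀ : Gc := (s₁.s x₀)⁻¹ * s₂.s x₀ with hp₀
  have hp₀P : p₀ ∈ P := QuotientGroup.eq.1 (hmk x₀ hx₀)
  have hτ : ContMDiffWithinAt 𝓘(ℂ, E) 𝓘(ℂ, 𝔼) ω (fun x => p₀⁻¹ * ((s₁.s x)⁻¹ * s₂.s x))
      (s₁.U ∩ s₂.U) x₀ := contMDiffWithinAt_const.mul (hψ x₀ hx₀)
  have hτ0 : p₀⁻¹ * ((s₁.s x₀)⁻¹ * s₂.s x₀) = 1 := by rw [← hp₀, inv_mul_cancel]
  have hcomp : ContMDiffWithinAt 𝓘(ℂ, E) 𝓘(ℂ, ℂ) ω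
      (fun x => (χ.toHom ⟨p₀, hp₀P⟩ : ℂ) * F (p₀⁻¹ * ((s₁.s x)⁻¹ * s₂.s x)))
      (s₁.U ∩ s₂.U) x₀ := by
    refine contMDiffWithinAt_const.mul ?_
    rw [← hτ0] at hF
    exact ContMDiffAt.comp_contMDiffWithinAt x₀ hF hτ
  have hev : ∀ᶠ x in 𝓝[s₁.U ∩ s₂.U] x₀, (χ.ratio (s₁.s x) (s₂.s x) : ℂ)
      = (χ.toHom ⟨p₀, hp₀P⟩ : ℂ) * F (p₀⁻¹ * ((s₁.s x)⁻¹ * s₂.s x)) := by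
    have ht := hτ.continuousWithinAt.tendsto
    rw [hτ0] at ht
    filter_upwards [ht.eventually h, self_mem_nhdsWithin] with x hx hxU
    have hxP : (s₁.s x)⁻¹ * s₂.s x ∈ P := QuotientGroup.eq.1 (hmk x hxU)
    rw [hx (P.mul_mem (P.inv_mem hp₀P) hxP), χ.ratio_eq (hmk x hxU), ← Units.val_mul, ← map_mul]
    refine congrArg (fun q : P => (χ.toHom q : ℂ)) (Subtype.ext ?_)
    change _ = p₀ * (p₀⁻¹ * _)
    rw [mul_inv_cancel_left]
  exact hcomp.congr_of_eventuallyEq hev (hev.self_of_nhdsWithin hx₀)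

theorem HolomorphicCharacter.continuousOn_phase_ratio (χ : HolomorphicCharacter 𝔼 P)
    (s₁ s₂ : LocalSection 𝔼 E P) :
    ContinuousOn (fun x => phase (χ.ratio (s₁.s x) (s₂.s x))) (s₁.U ∩ s₂.U) := by
  have h := (χ.contMDiffOn_ratio s₁ s₂).continuousOn
  have hi : Topology.IsInducing (fun z : Circle => (z : ℂ)) := ⟨rfl⟩
  refine hi.continuousOn_iff.2 ?_
  refine ContinuousOn.div h (Complex.continuous_ofReal.comp_continuousOn h.norm) ?_
  intro x _
  simp

variable [IsHolomorphicQuotient 𝔼 E P]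

variable (E) in
/-- The cocycle of the circle bundle `Q(L)` of the homogeneous line bundle `L` on `Gc ⧸ P` with
transition functions `g_{ij} = χ ∘ ψ_{ij}`, where `s_j = s_i ψ_{ij}`: the fibre coordinates are
related by `a_i = t_{ij} a_j`, with `t_{ij} = g_{ij} / |g_{ij}|`. -/
def circleCore (χ : HolomorphicCharacter 𝔼 P) :
    FiberBundleCore (LocalSection 𝔼 E P) (Gc ⧸ P) Circle where
  baseSet i := i.U
  isOpen_baseSet i := i.isOpen
  indexAt x := sectionAt 𝔼 E P x
  mem_baseSet_at x := mem_sectionAt x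
  coordChange i j x a := phase (χ.ratio (j.s x) (i.s x)) * a
  coordChange_self i x _ a := by rw [χ.ratio_self, map_one, one_mul]
  continuousOn_coordChange i j := by
    refine ContinuousOn.mul ?_ continuous_snd.continuousOn
    exact ((χ.continuousOn_phase_ratio j i).comp continuous_fst.continuousOn
      (fun p hp => ⟨hp.1.2, hp.1.1⟩))
  coordChange_comp i j k x hx a := by
    have hij : (QuotientGroup.mk (j.s x) : Gc ⧸ P) = QuotientGroup.mk (i.s x) := by
      rw [j.mk_s x hx.1.2, i.mk_s x hx.1.1]
    have hjk : (QuotientGroup.mk (k.s x) : Gc ⧸ P) = QuotientGroup.mk (j.s x) := by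
      rw [j.mk_s x hx.1.2, k.mk_s x hx.2]
    rw [← mul_assoc, ← map_mul, χ.ratio_mul hjk hij]

variable (E) in
/-- The principal circle bundle `Q(L)` over `Gc ⧸ P`, where `L = Gc ×_P ℂ` is the homogeneous line
bundle in which `[g p, z] = [g, χ(p) z]`. -/
abbrev CircleBundle (χ : HolomorphicCharacter 𝔼 P) : Type _ := (circleCore E χ).TotalSpace
end

/-! ### The real manifold underlying a circle bundle -/

section RestrictScalars

variable {F F' : Type*} [NormedAddCommGroup F] [NormedSpace ℂ F] [NormedAddCommGroup F']
  [NormedSpace ℂ F'] {X Y : Type*} [TopologicalSpace X] [ChartedSpace F X] [TopologicalSpace Y]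
  [ChartedSpace F' Y]

theorem contMDiffOn_real_of_complex {f : X → Y} {s : Set X}
    (h : ContMDiffOn 𝓘(ℂ, F) 𝓘(ℂ, F') ω f s) : ContMDiffOn 𝓘(ℝ, F) 𝓘(ℝ, F') ∞ f s := by
  intro x hx
  have h1 := contMDiffWithinAt_iff.1 (h x hx)
  refine contMDiffWithinAt_iff.2 ⟨h1.1, ?_⟩
  exact (h1.2.restrict_scalars ℝ).of_le (by simp)

theorem isManifold_real_of_complex (h : IsManifold 𝓘(ℂ, F) ω X) : IsManifold 𝓘(ℝ, F) ∞ X := by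
  refine isManifold_of_contDiffOn 𝓘(ℝ, F) ∞ X fun e e' he he' => ?_
  have h1 := (contDiffGroupoid ω 𝓘(ℂ, F)).compatible he he'
  rw [contDiffGroupoid, mem_groupoid_of_pregroupoid] at h1
  have h2 : ContDiffOn ℂ ω (𝓘(ℂ, F) ∘ e.symm ≫ₕ e' ∘ 𝓘(ℂ, F).symm)
      (𝓘(ℂ, F).symm ⁻¹' (e.symm ≫ₕ e').source ∩ range 𝓘(ℂ, F)) := h1.1
  exact (h2.restrict_scalars ℝ).of_le (by simp)

theorem contMDiff_phase : ContMDiff 𝓘(ℝ, ℂ) (𝓡 1) ∞ phase := by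
  have key : ContMDiff 𝓘(ℝ, ℂ) 𝓘(ℝ, ℂ) ∞ (fun z : ℂˣ => (z : ℂ) / ‖(z : ℂ)‖) := by
    intro z
    have h0 : ContDiffAt ℝ ∞ (fun w : ℂ => (‖w‖ : ℂ)) (z : ℂ) :=
      Complex.ofRealCLM.contDiff.contDiffAt.comp _ (contDiffAt_norm ℝ z.ne_zero)
    have h1 : ContDiffAt ℝ ∞ (fun w : ℂ => w / (‖w‖ : ℂ)) (z : ℂ) :=
      contDiffAt_id.mul (h0.inv (Complex.ofReal_ne_zero.2 (norm_ne_zero_iff.2 z.ne_zero)))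
    exact h1.contMDiffAt.comp z (Units.contMDiff_val.contMDiffAt)
  have : Fact (Module.finrank ℝ ℂ = 1 + 1) := ⟨Complex.finrank_real_complex⟩
  exact key.codRestrict_sphere (fun z => (phase z).2)

end RestrictScalars

section
variable [LieGroup 𝓘(ℂ, 𝔼) ω Gc]

theorem HolomorphicCharacter.contMDiffOn_phase_ratio (χ : HolomorphicCharacter 𝔼 P)
    (s₁ s₂ : LocalSection 𝔼 E P) :
    ContMDiffOn 𝓘(ℝ, E) (𝓡 1) ∞ (fun x => phase (χ.ratio (s₁.s x) (s₂.s x))) (s₁.U ∩ s₂.U) := by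
  have h := contMDiffOn_real_of_complex (χ.contMDiffOn_ratio s₁ s₂)
  have h' : ContMDiffOn 𝓘(ℝ, E) 𝓘(ℝ, ℂ) ∞ (fun x => χ.ratio (s₁.s x) (s₂.s x))
      (s₁.U ∩ s₂.U) := by
    intro x hx
    rw [contMDiffWithinAt_iff_target]
    refine ⟨?_, h x hx⟩
    exact Units.isEmbedding_val₀.isInducing.continuousWithinAt_iff.2 (h x hx).continuousWithinAt
  exact contMDiff_phase.comp_contMDiffOn h'

/-- The model space `E × ℝ` of `Q(L)`, `ℝ` being the fibre direction. -/
abbrev CircleModel (E : Type*) := E × EuclideanSpace ℝ (Fin 1)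

variable [hq : IsHolomorphicQuotient 𝔼 E P]

/-- The charts of `Q(L)` are obtained from the local trivialisations `(x, a)` of the bundle and the
charts of `Gc ⧸ P` and of the circle. -/
instance circleBundleChartedSpace (χ : HolomorphicCharacter 𝔼 P) :
    ChartedSpace (CircleModel E) (CircleBundle E χ) :=
  ChartedSpace.comp (ModelProd E (EuclideanSpace ℝ (Fin 1))) ((Gc ⧸ P) × Circle) (CircleBundle E χ)

instance circleBundleIsManifold (χ : HolomorphicCharacter 𝔼 P) :
    IsManifold 𝓘(ℝ, CircleModel E) ∞ (CircleBundle E χ) := by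
  have := isManifold_real_of_complex (F := E) (X := Gc ⧸ P) hq.isManifold
  refine isManifold_of_contDiffOn _ _ _ ?_
  rintro _ _ ⟨e, ⟨t, ⟨i, rfl⟩, rfl⟩, c, hc, rfl⟩ ⟨e', ⟨t', ⟨j, rfl⟩, rfl⟩, c', hc', rfl⟩
  have hc1 := contMDiffOn_symm_of_mem_maximalAtlas
    (IsManifold.subset_maximalAtlas (I := 𝓘(ℝ, E).prod (𝓡 1)) (n := ∞) hc)
  have hc2 := contMDiffOn_of_mem_maximalAtlas
    (IsManifold.subset_maximalAtlas (I := 𝓘(ℝ, E).prod (𝓡 1)) (n := ∞) hc')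
  have hm : ContMDiffOn (𝓘(ℝ, E).prod (𝓡 1)) (𝓘(ℝ, E).prod (𝓡 1)) ∞
      (fun p : (Gc ⧸ P) × Circle => (p.1, phase (χ.ratio (j.s p.1) (i.s p.1)) * p.2))
      ((j.U ∩ i.U) ×ˢ univ) := by
    refine contMDiffOn_fst.prodMk (ContMDiffOn.mul ?_ contMDiffOn_snd)
    exact (χ.contMDiffOn_phase_ratio j i).comp contMDiffOn_fst (fun p hp => hp.1)
  have htrans : ∀ q : (Gc ⧸ P) × Circle, q.1 ∈ j.U ∩ i.U →
      (circleCore E χ).localTriv j (((circleCore E χ).localTriv i).toOpenPartialHomeomorph.symm q)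
        = (q.1, phase (χ.ratio (j.s q.1) (i.s q.1)) * q.2) := by
    intro q hq
    rw [FiberBundleCore.localTriv_symm_apply, FiberBundleCore.localTriv_apply]
    exact Prod.ext rfl ((circleCore E χ).coordChange_comp i _ j q.1
      ⟨⟨hq.2, (circleCore E χ).mem_baseSet_at q.1⟩, hq.1⟩ q.2)
  have hsrc : ∀ y ∈ ((((circleCore E χ).localTriv i).toOpenPartialHomeomorph ≫ₕ c).symm ≫ₕ
      (((circleCore E χ).localTriv j).toOpenPartialHomeomorph ≫ₕ c')).source,
      y ∈ c.target ∧ c.symm y ∈ (j.U ∩ i.U) ×ˢ (univ : Set Circle) ∧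
      ((c.symm y).1, phase (χ.ratio (j.s (c.symm y).1) (i.s (c.symm y).1)) * (c.symm y).2)
        ∈ c'.source := by
    intro y hy
    simp only [OpenPartialHomeomorph.trans_source, OpenPartialHomeomorph.symm_source,
      OpenPartialHomeomorph.trans_target, mem_inter_iff, mem_preimage] at hy
    obtain ⟨⟨h1, h2⟩, h3, h4⟩ := hy
    have hi : (c.symm y).1 ∈ i.U := ((circleCore E χ).mem_localTriv_target i _).1 h2
    have hj : (c.symm y).1 ∈ j.U := by
      have := ((circleCore E χ).mem_localTriv_source j _).1 h3
      exact this
    refine ⟨h1, ⟨⟨hj, hi⟩, mem_univ _⟩, ?_⟩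
    rw [← htrans _ ⟨hj, hi⟩]
    exact h4
  have hcomp : ContMDiffOn (𝓘(ℝ, E).prod (𝓡 1)) (𝓘(ℝ, E).prod (𝓡 1)) ∞
      (c' ∘ (fun p : (Gc ⧸ P) × Circle => (p.1, phase (χ.ratio (j.s p.1) (i.s p.1)) * p.2))
        ∘ c.symm) ((((circleCore E χ).localTriv i).toOpenPartialHomeomorph ≫ₕ c).symm ≫ₕ
          (((circleCore E χ).localTriv j).toOpenPartialHomeomorph ≫ₕ c')).source := by
    refine hc2.comp (hm.comp (hc1.mono fun y hy => (hsrc y hy).1)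
      fun y hy => (hsrc y hy).2.1) fun y hy => (hsrc y hy).2.2
  rw [← modelWithCornersSelf_prod] at hcomp
  let f : CircleModel E → CircleModel E :=
    c' ∘ (fun p : (Gc ⧸ P) × Circle => (p.1, phase (χ.ratio (j.s p.1) (i.s p.1)) * p.2)) ∘ c.symm
  have hcomp' : ContDiffOn ℝ ∞ f ((((circleCore E χ).localTriv i).toOpenPartialHomeomorph ≫ₕ
      c).symm ≫ₕ (((circleCore E χ).localTriv j).toOpenPartialHomeomorph ≫ₕ c')).source :=
    contMDiffOn_iff_contDiffOn.1 hcomp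
  refine (ContDiffOn.congr hcomp' fun y hy => ?_).mono fun y hy => hy.1
  exact congrArg c' (htrans (c.symm y) (hsrc y hy).2.1.1)

namespace CircleBundle

variable {χ : HolomorphicCharacter 𝔼 P}

/-- The fibre coordinate of `p`, for the chosen local section around its projection. -/
def coord (p : CircleBundle E χ) : Circle := p.snd

/-- The natural action of `g ∈ Gc` on `Q(L) = Gc ×_P U(1)`, by `g [h, z] = [g h, z]`, written in
the fibre coordinates of the chosen local sections. -/
def translate (g : Gc) (p : CircleBundle E χ) : CircleBundle E χ :=
  ⟨g • p.proj, phase (χ.ratio ((sectionAt 𝔼 E P (g • p.proj)).s (g • p.proj))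
    (g * (sectionAt 𝔼 E P p.proj).s p.proj)) * p.coord⟩

/-- The principal action of the circle. -/
def rotate (p : CircleBundle E χ) (z : Circle) : CircleBundle E χ :=
  ⟨p.proj, p.coord * z⟩

/-- The map `Q(L) → Q(L^ℓ)`, `a ↦ a^ℓ` in the fibre coordinates. -/
def powMap (ℓ : ℕ) (p : CircleBundle E χ) : CircleBundle E (χ.pow ℓ) :=
  ⟨p.proj, p.coord ^ ℓ⟩

/-- The vector field `∂/∂θ` generating the principal action. -/
def angular (p : CircleBundle E χ) : TangentSpace 𝓘(ℝ, CircleModel E) p :=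
  mfderiv 𝓘(ℝ, ℝ) 𝓘(ℝ, CircleModel E) (fun t : ℝ => p.rotate (Circle.exp t)) 0 (1 : ℝ)

/-- The differential of the bundle projection. -/
def projDeriv (p : CircleBundle E χ) :
    TangentSpace 𝓘(ℝ, CircleModel E) p →L[ℝ] TangentSpace 𝓘(ℝ, E) p.proj :=
  mfderiv 𝓘(ℝ, CircleModel E) 𝓘(ℝ, E) (fun q : CircleBundle E χ => q.proj) p

/-- The fibre coordinate `a_U = e^{i θ_U}` defined by a local section `s_U`. -/
def fiberCoord (s : LocalSection 𝔼 E P) (p : CircleBundle E χ) : Circle :=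
  ((circleCore E χ).localTriv s p).2

/-- The form `dθ_U = da_U / (i a_U)`. -/
def dTheta (s : LocalSection 𝔼 E P) (p : CircleBundle E χ) :
    TangentSpace 𝓘(ℝ, CircleModel E) p →L[ℝ] ℂ :=
  let da : CircleModel E →L[ℝ] ℂ := mfderiv 𝓘(ℝ, CircleModel E) 𝓘(ℝ, ℂ)
    (fun q : CircleBundle E χ => (fiberCoord s q : ℂ)) p
  (Complex.I * fiberCoord s p : ℂ)⁻¹ • da

end CircleBundle

end

/-! ### Forms on a complex manifold and the canonical bundle -/

section Complex

variable {X : Type*} [TopologicalSpace X] [ChartedSpace E X]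

/-- The differential of a real function `f` on a complex manifold, with complex values. -/
def complexDifferential (f : X → ℝ) (x : X) : E →L[ℝ] ℂ :=
  let df : E →L[ℝ] ℝ := mfderiv 𝓘(ℝ, E) 𝓘(ℝ, ℝ) f x
  Complex.ofRealCLM.comp df

variable (E) in
/-- The complex structure `J` of the model space, that is, of every tangent space. -/
def complexStructure : E →L[ℝ] E :=
  (Complex.I • ContinuousLinearMap.id ℂ E).restrictScalars ℝ

/-- `∂f = (df - i df ∘ J) / 2`, the `(1, 0)`-part of `df`. -/
def del (f : X → ℝ) (x : X) : E →L[ℝ] ℂ :=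
  (1 / 2 : ℂ) • (complexDifferential f x
    - Complex.I • (complexDifferential f x).comp (complexStructure E))

/-- `∂̄f = (df + i df ∘ J) / 2`, the `(0, 1)`-part of `df`. -/
def delbar (f : X → ℝ) (x : X) : E →L[ℝ] ℂ :=
  (1 / 2 : ℂ) • (complexDifferential f x
    + Complex.I • (complexDifferential f x).comp (complexStructure E))

variable (E X) in
/-- The Fano index of the complex manifold `X`: the largest `k` such that `c₁(X)` is divisible
by `k` in `H²(X, ℤ)`, that is, such that the canonical line bundle, whose transition functions are
the Jacobian determinants of the charts, has a topological `k`-th root, with transition functions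
`t x y`. -/
def fanoIndex [IsManifold 𝓘(ℂ, E) 1 X] : ℕ :=
  sSup {k : ℕ | ∃ (U : X → Set X) (t : X → X → X → ℂ),
    (∀ x, IsOpen (U x) ∧ x ∈ U x ∧ U x ⊆ (chartAt E x).source) ∧
    (∀ x y, ContinuousOn (t x y) (U x ∩ U y)) ∧
    (∀ x y z, ∀ q ∈ U x ∩ U y ∩ U z, t x y q * t y z q = t x z q) ∧
    (∀ x y, ∀ q ∈ U x ∩ U y, t x y q ^ k =
      LinearMap.det (tangentCoordChange 𝓘(ℂ, E) x y q : E →ₗ[ℂ] E))}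

end Complex

variable (𝔼 E P) in
/-- The Fano index `I(X_P)` of `X_P = Gc ⧸ P`. -/
def flagFanoIndex [hq : IsHolomorphicQuotient 𝔼 E P] : ℕ :=
  have : IsManifold 𝓘(ℂ, E) 1 (Gc ⧸ P) :=
    have := hq.isManifold
    IsManifold.of_le (n := ω) (by simp)
  fanoIndex E (Gc ⧸ P)

/-- The homogeneous line bundle `L` defined by `χ` is a `k`-th root of the canonical bundle of
`Gc ⧸ P`: `χ^k` is the character `p ↦ det(p_*)⁻¹`, where `p_*` is the differential of
`x ↦ p x` at the base point. -/
def HolomorphicCharacter.IsCanonicalRoot (χ : HolomorphicCharacter 𝔼 P) (k : ℕ) : Prop :=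
  ∀ p : P,
    let D : E →L[ℂ] E := mfderiv 𝓘(ℂ, E) 𝓘(ℂ, E) (fun x : Gc ⧸ P => (p : Gc) • x)
      (QuotientGroup.mk (1 : Gc))
    (χ.toHom p : ℂ) ^ k * LinearMap.det (D : E →ₗ[ℂ] E) = 1

section
variable [LieGroup 𝓘(ℂ, 𝔼) ω Gc] [IsHolomorphicQuotient 𝔼 E P]

/-- The local expression
`-(ℓ i / (2 k)) (∂ - ∂̄) log ‖s_U v‖² + dθ_U`
of the contact form, for a local section `s_U`. -/
def contactFormAt {χ : HolomorphicCharacter 𝔼 P} {V : Type*} [NormedAddCommGroup V]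
    [InnerProductSpace ℂ V] (ρ : Representation ℂ Gc V) (v : V) (ℓ k : ℕ)
    (s : LocalSection 𝔼 E P) (p : CircleBundle E χ) :
    TangentSpace 𝓘(ℝ, CircleModel E) p →L[ℝ] ℂ :=
  let f : Gc ⧸ P → ℝ := fun x => Real.log (‖ρ (s.s x) v‖ ^ 2)
  let A : E →L[ℝ] ℂ := (-(ℓ * Complex.I / (2 * k)) : ℂ) • (del f p.proj - delbar f p.proj)
  A.comp p.projDeriv + CircleBundle.dTheta s p

end

end Bundles

end SasakiGeom

end

open SasakiGeom

/-!
The differential geometry takes place in charts. Let `B` be a Kähler metric on an open subset of a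
complex vector space `E` of dimension `n`, `N` a real line, and `τ` a `1`-form on an open subset of
`E × N` with `dτ = 2 B(J·, ·)` that does not vanish on `N`. The metric `B + τ ⊗ τ`, the vertical
field `ξ` with `τ(ξ) = 1` and the horizontal lift `φ` of `J` form a Sasaki structure. If the Gram
determinant of `B` is `C |j|⁴ e⁻²ᶠ` with `j` holomorphic, the Ricci tensor of `B + τ ⊗ τ` is half
the Levi form of `F`, minus `2 B`, plus `2 n τ ⊗ τ` (`IsConnectionOn.ricci_eq`); the metric is then
Einstein if the Levi form of `F` is `4 (n + 1) B`. A manifold whose tensors have this form in each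
preferred chart (`IsLocalModel`) is Sasaki–Einstein.

The Kähler metric of the flag manifold is `1 / (n + 1)` times the pullback of the Fubini–Study
metric under the orbit map `g ↦ [g v]` of the highest weight vector `v` of `V(δ_P)`, and `F` is
`log ‖s_U v‖²`. Highest weight theory enters only through `IsFlagModel`: `P` is the stabiliser of
the line `ℂ v`, and `𝔭` acts on `𝔤 / 𝔭` with trace `-δ_P`. For a grading of the roots adapted to
`Θ`, whose part of nonnegative degree is `𝔭`, both are computations with roots
(`mem_parabolicSubalgebra_iff`, `trace_quotient_parabolic`).

The claim on the Gram determinant says that `volumeRatio`, the Gram determinant of the pulled back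
metric times `‖g v‖⁴`, is constant on the complex group. It is invariant under the compact form on
the left; an element of `P` on the right multiplies it by the fourth power of the modulus of
`δ_P · det`, where `det` is the determinant of the isotropy representation. By the trace formula
this factor is `1` along one-parameter curves of `P`, and `𝔤` is the sum of `𝔭` and any conjugate of
`𝔨`, so the derivative vanishes everywhere (`eq_of_invariant`). It follows that `|δ_P · det| = 1` on
all of `P`, and that a character `χ` with `χ ^ I · det = 1` satisfies `|χ| ^ I = |δ_P|`
(`norm_char_eq`). This makes the contact form independent of the local section (`contactAt_eq`).

The compact form is transitive on the flag manifold because its orbits are open (`orbit_mem_nhds`).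
This is the same decomposition of `𝔤` (`exists_incl_add`); it follows from the positivity of
`- tr (dR x · dR y)` on `𝔨`, since the orthogonal complement of `𝔭` is isotropic for the trace form.
The compact form is transitive on the fibres of the circle bundle because the element of `𝔨` dual to
the moment map at `[g v]` multiplies `g v` by a nonzero imaginary number (`exists_moment`). Elements
which act trivially on the circle bundle are scalars on `V`, hence form a discrete subgroup
(`isDiscrete_of_scalar`), and the quotient by it is a Lie group that acts effectively.
-/

noncomputable section

namespace SasakiGeom

open Module
open Complex (I)
open VectorField (mlieBracket)
open LinearMap (toContinuousLinearMap)

set_option linter.unusedSectionVars false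

/-! ### Gradings of the root system -/

section RootTheory
open LieAlgebra LieAlgebra.IsKilling

variable {L : Type*} [LieRing L] [LieAlgebra ℂ L] [FiniteDimensional ℂ L] [IsKilling ℂ L]
  {𝔥 : LieSubalgebra ℂ L} [𝔥.IsCartanSubalgebra]
local notation "𝚽" => rootSystem 𝔥
local notation "𝐖" => LieModule.Weight ℂ 𝔥 L

lemma exists_grading_element (b : 𝚽.Base) (c : 𝔥.root → ℕ) :
    ∃ (h : 𝔥) (m : 𝔥.root → ℤ), (∀ α : 𝔥.root, 𝚽.root α h = m α) ∧
      (∀ α ∈ b.support, m α = c α) ∧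
      ∀ α, b.IsPos α → ∃ f : 𝔥.root → ℕ,
        𝚽.root α = ∑ γ ∈ b.support, f γ • 𝚽.root γ ∧ m α = ∑ γ ∈ b.support, (f γ * c γ : ℕ) := by
  classical
  let F : Module.Dual ℂ (Module.Dual ℂ 𝔥) := b.toWeightBasis.constr ℂ fun γ => (c γ : ℂ)
  let h : 𝔥 := (Module.evalEquiv ℂ 𝔥).symm F
  have hF : ∀ φ : Module.Dual ℂ 𝔥, φ h = F φ := fun φ => by simp [h]
  have hγ : ∀ γ ∈ b.support, 𝚽.root γ h = c γ := fun γ hγ => by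
    rw [hF]
    have := b.toWeightBasis.constr_basis ℂ (fun γ => (c γ : ℂ)) ⟨γ, hγ⟩
    simpa [F] using this
  have hex : ∀ α : 𝔥.root, ∃ z : ℤ, 𝚽.root α h = z := fun α => by
    obtain ⟨f, -, -, hf⟩ := b.exists_root_eq_sum_int α
    refine ⟨∑ γ ∈ b.support, f γ * c γ, ?_⟩
    rw [hf, LinearMap.sum_apply]
    push_cast
    refine Finset.sum_congr rfl fun γ hg => ?_
    rw [LinearMap.smul_apply, hγ γ hg, zsmul_eq_mul]
  choose m hm using hex
  refine ⟨h, m, hm, fun α hα => ?_, fun α hα => ?_⟩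
  · have := (hm α).symm.trans (hγ α hα)
    exact_mod_cast this
  · obtain ⟨f, -, hf | hf⟩ := b.exists_root_eq_sum_nat_or_neg α
    · refine ⟨f, hf, ?_⟩
      have h1 := hm α
      rw [hf, LinearMap.sum_apply] at h1
      have : (m α : ℂ) = ((∑ γ ∈ b.support, (f γ * c γ : ℕ) : ℤ) : ℂ) := by
        rw [← h1]
        push_cast
        refine Finset.sum_congr rfl fun γ hg => ?_
        rw [LinearMap.smul_apply, hγ γ hg, nsmul_eq_mul]
      exact_mod_cast this
    · exfalso
      have h2 : 𝚽.root α = ∑ γ ∈ b.support, (fun γ => -(f γ : ℤ)) γ •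
          𝚽.root γ := by
        rw [hf]; simp
      have h3 := b.height_eq_sum h2
      rw [RootPairing.Base.isPos_iff, h3] at hα
      have : ∑ γ ∈ b.support, -(f γ : ℤ) ≤ 0 := Finset.sum_nonpos fun γ _ => by simp
      omega

lemma root_indexNeg (α : 𝔥.root) : ∃ β : 𝔥.root, 𝚽.root β = -𝚽.root α :=
  ⟨𝚽.reflectionPerm α α, by rw [RootPairing.root_reflectionPerm, RootPairing.reflection_apply_self]⟩

lemma isPos_of_root_eq_neg (b : 𝚽.Base) {α β : 𝔥.root}
    (h : 𝚽.root β = -𝚽.root α) : b.IsPos β ↔ ¬ b.IsPos α := by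
  have h0 : 𝚽.root β = -𝚽.root α := h
  obtain ⟨f, -, -, hf⟩ := b.exists_root_eq_sum_int α
  have h2 : 𝚽.root β = ∑ γ ∈ b.support, (-f) γ • 𝚽.root γ := by rw [h, hf]; simp
  have e1 := b.height_eq_sum hf
  have e2 := b.height_eq_sum h2
  have e3 := b.height_ne_zero α
  simp only [Pi.neg_apply, Finset.sum_neg_distrib] at e2
  rw [RootPairing.Base.isPos_iff, RootPairing.Base.isPos_iff]
  omega

/-- The grading element of the parabolic subalgebra: its eigenvalues on the root spaces are integers,
of the sign of the root, and vanish exactly on the roots in `⟨Θ⟩`. -/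
lemma exists_parabolic_grading (b : 𝚽.Base) (Θ : Finset 𝔥.root) :
    ∃ (h : 𝔥) (m : 𝔥.root → ℤ), (∀ α : 𝔥.root, 𝚽.root α h = m α) ∧
      (∀ α, b.IsPos α → 0 ≤ m α) ∧ (∀ α, ¬ b.IsPos α → m α ≤ 0) ∧
      (∀ γ ∈ b.support, γ ∉ Θ → 0 < m γ) ∧
      (Θ ⊆ b.support → ∀ α, IsLeviRoot Θ α ↔ m α = 0) := by
  classical
  obtain ⟨h, m, hm, hs, hp⟩ := exists_grading_element b (fun γ => if γ ∈ Θ then 0 else 1)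
  have hneg : ∀ α β : 𝔥.root, 𝚽.root β = -𝚽.root α → m β = - m α := by
    intro α β hβ
    have h1 := hm β
    rw [hβ, LinearMap.neg_apply, hm α] at h1
    exact_mod_cast h1.symm
  have hpos : ∀ α, b.IsPos α → 0 ≤ m α := by
    intro α hα
    obtain ⟨f, -, h2⟩ := hp α hα
    rw [h2]
    positivity
  have hlp : Θ ⊆ b.support → ∀ α, b.IsPos α → m α = 0 → IsLeviRoot Θ α := by
    intro hΘ α hα h0
    obtain ⟨f, h1, h2⟩ := hp α hα
    rw [h0] at h2
    have h3 : ∀ γ ∈ b.support, f γ * (if γ ∈ Θ then 0 else 1) = 0 := by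
      have := h2.symm
      rw [Nat.cast_eq_zero] at this
      exact fun γ hγ => Finset.sum_eq_zero_iff.1 this γ hγ
    rw [IsLeviRoot, h1]
    refine Submodule.sum_mem _ fun γ hγ => ?_
    by_cases hγΘ : γ ∈ Θ
    · exact Submodule.smul_of_tower_mem _ _ (Submodule.subset_span ⟨γ, hγΘ, rfl⟩)
    · have := h3 γ hγ
      simp only [hγΘ, if_false, mul_one] at this
      simp [this]
  refine ⟨h, m, hm, hpos, fun α hα => ?_, fun γ hγ hγΘ => ?_, fun hΘ α => ⟨fun hl => ?_, fun h0 => ?_⟩⟩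
  · obtain ⟨β, hβ⟩ := root_indexNeg α
    have := hpos β ((isPos_of_root_eq_neg b hβ).2 hα)
    have := hneg α β hβ
    omega
  · rw [hs γ hγ]; simp [hγΘ]
  · have key : ∀ φ ∈ Submodule.span ℤ (𝚽.root '' (Θ : Set 𝔥.root)), φ h = 0 := by
      intro φ hφ
      induction hφ using Submodule.span_induction with
      | mem x hx =>
        obtain ⟨γ, hγ, rfl⟩ := hx
        rw [hm, hs γ (hΘ hγ)]
        simp [Finset.mem_coe.1 hγ]
      | zero => simp
      | add x y _ _ hx hy => simp [hx, hy]
      | smul a x _ hx => simp [hx]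
    have := key _ hl
    rw [hm] at this
    exact_mod_cast this
  · by_cases hα : b.IsPos α
    · exact hlp hΘ α hα h0
    · obtain ⟨β, hβ⟩ := root_indexNeg α
      have h1 := hlp hΘ β ((isPos_of_root_eq_neg b hβ).2 hα) (by rw [hneg α β hβ, h0, neg_zero])
      rw [IsLeviRoot, hβ] at h1
      exact neg_mem_iff.1 h1

lemma root_coroot_eq_intCast (β α : 𝔥.root) : 𝚽.root β (𝚽.coroot α) = (𝚽.pairingIn ℤ β α : ℤ) :=
  (𝚽.algebraMap_pairingIn ℤ β α).symm

lemma pairingIn_reflectionPerm_neg (α β : 𝔥.root) :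
    𝚽.pairingIn ℤ (𝚽.reflectionPerm α β) α = - 𝚽.pairingIn ℤ β α := by
  have h1 := root_coroot_eq_intCast (𝚽.reflectionPerm α β) α
  have e : 𝚽.root α (𝚽.coroot α) = 2 := by
    have := root_coroot_eq_intCast α α
    simpa using this
  have h2 : 𝚽.coroot' α (𝚽.root β) = (𝚽.pairingIn ℤ β α : ℤ) := root_coroot_eq_intCast β α
  rw [RootPairing.root_reflectionPerm, RootPairing.reflection_apply, LinearMap.sub_apply,
    LinearMap.smul_apply, h2, root_coroot_eq_intCast, e, smul_eq_mul] at h1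
  have h3 : (𝚽.pairingIn ℤ (𝚽.reflectionPerm α β) α : ℂ)
    = ((- 𝚽.pairingIn ℤ β α : ℤ) : ℂ) := by rw [← h1]; push_cast; ring
  exact_mod_cast h3

section Grading
variable {h : 𝔥} {m : 𝔥.root → ℤ} (hm : ∀ α : 𝔥.root, (rootSystem 𝔥).root α h = m α)
include hm

lemma grading_reflectionPerm (α β : 𝔥.root) :
    m (𝚽.reflectionPerm α β) = m β - 𝚽.pairingIn ℤ β α * m α := by
  have h1 := hm (𝚽.reflectionPerm α β)
  rw [RootPairing.root_reflectionPerm, RootPairing.reflection_apply, LinearMap.sub_apply,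
    LinearMap.smul_apply, hm, hm] at h1
  have h2 : 𝚽.coroot' α (𝚽.root β) = (𝚽.pairingIn ℤ β α : ℤ) := root_coroot_eq_intCast β α
  rw [h2, smul_eq_mul] at h1
  exact_mod_cast h1.symm

/-- The sum of the pairings with `α` of the roots of positive degree is twice itself minus its image
under the reflection in `α`, which has only terms of one sign. -/
lemma two_mul_sum_pairingIn (α : 𝔥.root) :
    2 * ∑ β, (if 0 < m β then 𝚽.pairingIn ℤ β α else 0)
      = ∑ β, ((if 0 < m β then 𝚽.pairingIn ℤ β α else 0)
        - (if 0 < m β - 𝚽.pairingIn ℤ β α * m α then 𝚽.pairingIn ℤ β α else 0)) := by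
  rw [Finset.sum_sub_distrib, two_mul, sub_eq_add_neg]
  congr 1
  rw [← Equiv.sum_comp (𝚽.reflectionPerm α), ← Finset.sum_neg_distrib]
  refine Finset.sum_congr rfl fun β _ => ?_
  rw [grading_reflectionPerm hm, pairingIn_reflectionPerm_neg]
  split_ifs <;> simp

lemma sum_pairingIn_eq_zero {α : 𝔥.root} (hα : m α = 0) :
    ∑ β, (if 0 < m β then 𝚽.pairingIn ℤ β α else 0) = 0 := by
  have := two_mul_sum_pairingIn hm α
  simp only [hα, mul_zero, sub_zero, sub_self, Finset.sum_const_zero] at this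
  omega

lemma sum_pairingIn_pos {α : 𝔥.root} (hα : 0 < m α) :
    0 < ∑ β, (if 0 < m β then 𝚽.pairingIn ℤ β α else 0) := by
  have h1 := two_mul_sum_pairingIn hm α
  have h2 : 0 < ∑ β, ((if 0 < m β then 𝚽.pairingIn ℤ β α else 0)
        - (if 0 < m β - 𝚽.pairingIn ℤ β α * m α then 𝚽.pairingIn ℤ β α else 0)) := by
    refine Finset.sum_pos' (fun β _ => ?_) ⟨α, Finset.mem_univ _, ?_⟩
    · rcases le_or_gt 0 (𝚽.pairingIn ℤ β α) with hp | hp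
      · have : 0 ≤ 𝚽.pairingIn ℤ β α * m α := by positivity
        split_ifs <;> omega
      · have : 𝚽.pairingIn ℤ β α * m α ≤ 0 := mul_nonpos_of_nonpos_of_nonneg hp.le hα.le
        split_ifs <;> omega
    · have : 𝚽.pairingIn ℤ α α = 2 := by simp
      rw [this, if_pos hα, if_neg (by omega)]
      norm_num
  omega

end Grading

lemma deltaWeight_coroot (b : 𝚽.Base) (Θ : Finset 𝔥.root) {m : 𝔥.root → ℤ}
    (hS : ∀ β, (b.IsPos β ∧ ¬ IsLeviRoot Θ β) ↔ 0 < m β) (α : 𝔥.root) :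
    deltaWeight b Θ (𝚽.coroot α) = ((∑ β, (if 0 < m β then 𝚽.pairingIn ℤ β α else 0) : ℤ) : ℂ) := by
  rw [deltaWeight, LinearMap.sum_apply]
  push_cast
  refine Finset.sum_congr rfl fun β _ => ?_
  simp only [hS]
  split_ifs
  · exact root_coroot_eq_intCast β α
  · simp

lemma exists_root_decomposition (x : L) : ∃ (h : 𝔥) (y : 𝔥.root → L),
    (∀ α : 𝔥.root, y α ∈ rootSpace 𝔥 (α : 𝐖)) ∧ x = h + ∑ α, y α := by
  classical
  have htop : (⊤ : Submodule ℂ L) ≤ 𝔥.toSubmodule ⊔ ⨆ α : 𝔥.root,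
      (rootSpace 𝔥 (α.1 : 𝐖)).toSubmodule := by
    rw [← LieSubmodule.top_toSubmodule (R := ℂ) (L := 𝔥),
      ← LieModule.iSup_genWeightSpace_eq_top' ℂ 𝔥 L, LieSubmodule.iSup_toSubmodule]
    refine iSup_le fun χ => ?_
    by_cases hχ : χ.IsZero
    · refine le_sup_of_le_left ?_
      intro z hz
      have : z ∈ rootSpace 𝔥 (0 : 𝔥 → ℂ) := by
        have h0 : (χ : 𝔥 → ℂ) = 0 := hχ
        rw [← h0]; exact hz
      rwa [rootSpace_zero_eq, LieSubalgebra.mem_toLieSubmodule] at this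
    · refine le_sup_of_le_right ?_
      have hmem : χ ∈ 𝔥.root := by simpa using hχ
      exact le_iSup (fun α : 𝔥.root => (rootSpace 𝔥 (α.1 : 𝐖)).toSubmodule) ⟨χ, hmem⟩
  obtain ⟨h, hh, z, hz, rfl⟩ := Submodule.mem_sup.1 (htop (Submodule.mem_top (x := x)))
  obtain ⟨f, rfl⟩ := (Submodule.mem_iSup_iff_exists_dfinsupp' _ _).1 hz
  refine ⟨⟨h, hh⟩, fun α => f α, fun α => (f α).2, ?_⟩
  rw [DFinsupp.sum_eq_sum_fintype _ fun _ => rfl]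
  rfl

end RootTheory

/-! ### The stabiliser of the highest weight line -/

section HighestWeight
open LieAlgebra LieAlgebra.IsKilling

variable {L : Type*} [LieRing L] [LieAlgebra ℂ L] [FiniteDimensional ℂ L] [IsKilling ℂ L]
  {𝔥 : LieSubalgebra ℂ L} [𝔥.IsCartanSubalgebra]
  {V : Type*} [AddCommGroup V] [Module ℂ V] [LieRingModule L V] [LieModule ℂ L V]
local notation "𝚽" => rootSystem 𝔥
local notation "𝐖" => LieModule.Weight ℂ 𝔥 L

/-- If `w` has weight `μ` and is annihilated by the positive root spaces, then the irreducible
module `V` is the sum of the line through `w` and of eigenspaces of the height element `h₀` with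
eigenvalues `μ(h₀) - 1, μ(h₀) - 2, …`. -/
lemma top_le_span_sup_eigenspaces (b : 𝚽.Base)
    (hV : LieModule.IsIrreducible ℂ L V) {h₀ : 𝔥}
    (hh₀ : ∀ α : 𝔥.root, 𝚽.root α h₀ = b.height α) {w : V} (hw : w ≠ 0) {μ : 𝔥 → ℂ}
    (hμ : ∀ h : 𝔥, ⁅(h : L), w⁆ = μ h • w)
    (hpos : ∀ α : 𝔥.root, b.IsPos α → ∀ x ∈ rootSpace 𝔥 (α : 𝐖), ⁅x, w⁆ = 0) :
    (⊤ : Submodule ℂ V) ≤ (ℂ ∙ w) ⊔ ⨆ j : ℕ,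
      Module.End.eigenspace (LieModule.toEnd ℂ L V h₀) (μ h₀ - (j + 1)) := by
  let St : Set (Submodule ℂ V) := {N | w ∈ N ∧ ∀ α : 𝔥.root, ¬ b.IsPos α →
    ∀ x ∈ rootSpace 𝔥 (α : 𝐖), ∀ n ∈ N, ⁅x, n⁆ ∈ N}
  let M : Submodule ℂ V := sInf St
  have hwM : w ∈ M := Submodule.mem_sInf.2 fun N hN => hN.1
  have hMn : ∀ α : 𝔥.root, ¬ b.IsPos α →
    ∀ x ∈ rootSpace 𝔥 (α : 𝐖), ∀ n ∈ M, ⁅x, n⁆ ∈ M :=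
    fun α hα x hx n hn => Submodule.mem_sInf.2 fun N hN =>
      hN.2 α hα x hx n (Submodule.mem_sInf.1 hn N hN)
  -- the vectors of `M` which the Borel subalgebra maps into `M`
  let M' : Submodule ℂ V :=
    { carrier := {n | n ∈ M ∧ (∀ h : 𝔥, ⁅(h : L), n⁆ ∈ M) ∧ ∀ α : 𝔥.root, b.IsPos α →
        ∀ x ∈ rootSpace 𝔥 (α : 𝐖), ⁅x, n⁆ ∈ M}
      add_mem' := fun {x y} hx hy => ⟨M.add_mem hx.1 hy.1,
        fun h => by rw [lie_add]; exact M.add_mem (hx.2.1 h) (hy.2.1 h),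
        fun α hα z hz => by rw [lie_add]; exact M.add_mem (hx.2.2 α hα z hz) (hy.2.2 α hα z hz)⟩
      zero_mem' := ⟨M.zero_mem, fun h => by simp, fun α hα z hz => by simp⟩
      smul_mem' := fun c x hx => ⟨M.smul_mem c hx.1,
        fun h => by rw [lie_smul]; exact M.smul_mem c (hx.2.1 h),
        fun α hα z hz => by rw [lie_smul]; exact M.smul_mem c (hx.2.2 α hα z hz)⟩ }
  have hall : ∀ n ∈ M', ∀ x : L, ⁅x, n⁆ ∈ M := by
    intro n hn x
    obtain ⟨h, y, hy, rfl⟩ := exists_root_decomposition (𝔥 := 𝔥) x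
    rw [add_lie, sum_lie]
    refine M.add_mem (hn.2.1 h) (Submodule.sum_mem _ fun α _ => ?_)
    by_cases hα : b.IsPos α
    · exact hn.2.2 α hα _ (hy α)
    · exact hMn α hα _ (hy α) n hn.1
  have hM' : M ≤ M' := by
    refine sInf_le ⟨⟨hwM, fun h => ?_, fun α hα x hx => ?_⟩, fun α hα x hx n hn =>
      ⟨hMn α hα x hx n hn.1, fun h => ?_, fun β hβ y hy => ?_⟩⟩
    · rw [hμ]; exact M.smul_mem _ hwM
    · rw [hpos α hα x hx]; exact M.zero_mem
    · rw [leibniz_lie]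
      exact M.add_mem (hall n hn _) (hMn α hα x hx _ (hn.2.1 h))
    · rw [leibniz_lie]
      exact M.add_mem (hall n hn _) (hMn α hα x hx _ (hn.2.2 β hβ y hy))
  have hMtop : M = ⊤ := by
    let ML : LieSubmodule ℂ L V := { M with lie_mem := fun {x n} hn => hall n (hM' hn) x }
    have hne : ML ≠ ⊥ := fun hb => hw (by
      have : w ∈ ML := hwM
      rwa [hb, LieSubmodule.mem_bot] at this)
    have := (hV.eq_bot_or_eq_top ML).resolve_left hne
    have h2 : (ML : Submodule ℂ V) = ⊤ := by rw [this]; rfl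
    exact h2
  rw [← hMtop]
  have hlow : ∀ (α : 𝔥.root), ¬ b.IsPos α → ∀ x ∈ rootSpace 𝔥 (α : 𝐖),
      ∀ (c : ℂ) (n : V), ⁅(h₀ : L), n⁆ = c • n → ∃ i : ℕ, ⁅(h₀ : L), ⁅x, n⁆⁆ = (c - (i + 1)) • ⁅x, n⁆ := by
    intro α hα x hx c n hn
    have h1 : ⁅(h₀ : L), x⁆ = (b.height α : ℂ) • x := by
      rw [← hh₀]; exact lie_eq_smul_of_mem_rootSpace hx h₀
    have h2 := b.height_ne_zero α
    rw [RootPairing.Base.isPos_iff] at hα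
    refine ⟨(-b.height α - 1).toNat, ?_⟩
    have h3 : (((-b.height α - 1).toNat : ℕ) : ℂ) = -(b.height α : ℂ) - 1 := by
      have : (((-b.height α - 1).toNat : ℕ) : ℤ) = -b.height α - 1 := Int.toNat_of_nonneg (by omega)
      exact_mod_cast this
    rw [leibniz_lie, h1, hn, h3, smul_lie, lie_smul, ← add_smul]
    congr 1; ring
  refine sInf_le ⟨Submodule.mem_sup_left (Submodule.mem_span_singleton_self w),
    fun α hα x hx n hn => ?_⟩
  obtain ⟨n₁, hn₁, n₂, hn₂, rfl⟩ := Submodule.mem_sup.1 hn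
  rw [lie_add]
  refine Submodule.add_mem _ ?_ ?_
  · obtain ⟨c, rfl⟩ := Submodule.mem_span_singleton.1 hn₁
    obtain ⟨i, hi⟩ := hlow α hα x hx (μ h₀) (c • w) (by rw [lie_smul, hμ, smul_comm])
    exact Submodule.mem_sup_right (Submodule.mem_iSup_of_mem i (Module.End.mem_eigenspace_iff.2 hi))
  · refine Submodule.mem_sup_right ?_
    clear hn
    induction hn₂ using Submodule.iSup_induction' with
    | mem j y hy =>
      obtain ⟨i, hi⟩ := hlow α hα x hx _ y (Module.End.mem_eigenspace_iff.1 hy)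
      refine Submodule.mem_iSup_of_mem (j + i + 1) (Module.End.mem_eigenspace_iff.2 ?_)
      have : μ h₀ - (((j + i + 1 : ℕ) : ℂ) + 1) = μ h₀ - (j + 1) - (i + 1) := by push_cast; ring
      rw [this]; exact hi
    | zero => simp
    | add y z _ _ hy hz =>
      rw [lie_add]
      exact Submodule.add_mem _ hy hz

lemma exists_height_element (b : 𝚽.Base) : ∃ h₀ : 𝔥, ∀ α : 𝔥.root, 𝚽.root α h₀ = b.height α := by
  obtain ⟨h, m, hm, -, hp⟩ := exists_grading_element b (fun _ => 1)
  have key : ∀ α : 𝔥.root, b.IsPos α → m α = b.height α := by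
    intro α hα
    obtain ⟨f, h1, h2⟩ := hp α hα
    have h3 : 𝚽.root α = ∑ γ ∈ b.support, (fun γ => (f γ : ℤ)) γ • 𝚽.root γ := by rw [h1]; simp
    rw [h2, b.height_eq_sum h3]; simp
  refine ⟨h, fun α => ?_⟩
  by_cases hα : b.IsPos α
  · rw [hm, key α hα]
  · obtain ⟨β, hβ⟩ := root_indexNeg α
    have h1 := key β ((isPos_of_root_eq_neg b hβ).2 hα)
    have h2 := hm β
    obtain ⟨f, -, -, hf⟩ := b.exists_root_eq_sum_int α
    have h3 : 𝚽.root β = ∑ γ ∈ b.support, (-f) γ • 𝚽.root γ := by rw [hβ, hf]; simp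
    have e2 := b.height_eq_sum h3
    simp only [Pi.neg_apply, Finset.sum_neg_distrib] at e2
    rw [hβ, LinearMap.neg_apply, h1, e2, ← b.height_eq_sum hf] at h2
    push_cast at h2
    exact neg_injective h2

/-- Highest weight vectors of an irreducible module are unique up to scalars. -/
lemma highestWeightVector_unique (b : 𝚽.Base)
    (hV : LieModule.IsIrreducible ℂ L V) {v w : V} (hv0 : v ≠ 0) (hw0 : w ≠ 0) {ν μ : 𝔥 → ℂ}
    (hν : ∀ h : 𝔥, ⁅(h : L), v⁆ = ν h • v) (hμ : ∀ h : 𝔥, ⁅(h : L), w⁆ = μ h • w)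
    (hvpos : ∀ α : 𝔥.root, b.IsPos α → ∀ x ∈ rootSpace 𝔥 (α : 𝐖), ⁅x, v⁆ = 0)
    (hwpos : ∀ α : 𝔥.root, b.IsPos α → ∀ x ∈ rootSpace 𝔥 (α : 𝐖), ⁅x, w⁆ = 0) :
    ∃ c : ℂ, w = c • v := by
  obtain ⟨h₀, hh₀⟩ := exists_height_element b
  have hV1 := top_le_span_sup_eigenspaces b hV hh₀ hv0 hν hvpos
  have hV2 := top_le_span_sup_eigenspaces b hV hh₀ hw0 hμ hwpos
  set T := LieModule.toEnd ℂ L V h₀ with hT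
  have hind := Module.End.eigenspaces_iSupIndep T
  -- an eigenvalue of `h₀` is one of those occurring in the decomposition
  have hval : ∀ (u u' : V) (c c' : ℂ), u' ≠ 0 → ⁅(h₀ : L), u⁆ = c • u → ⁅(h₀ : L), u'⁆ = c' • u' →
      (⊤ : Submodule ℂ V) ≤ (ℂ ∙ u) ⊔ ⨆ j : ℕ, T.eigenspace (c - (j + 1)) →
      ∃ j : ℕ, c' = c - j := by
    intro u u' c c' hu' hc hc' htop
    by_contra hcon
    push Not at hcon
    have hle : (ℂ ∙ u) ⊔ ⨆ j : ℕ, T.eigenspace (c - (j + 1)) ≤ ⨆ (d : ℂ) (_ : d ≠ c'), T.eigenspace d := by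
      refine sup_le ?_ (iSup_le fun j => ?_)
      · rw [Submodule.span_singleton_le_iff_mem]
        refine Submodule.mem_iSup_of_mem c (Submodule.mem_iSup_of_mem ?_ (Module.End.mem_eigenspace_iff.2 hc))
        have := hcon 0
        simpa using this.symm
      · refine le_iSup₂_of_le (c - (j + 1)) ?_ le_rfl
        have := hcon (j + 1)
        push_cast at this
        exact this.symm
    have h1 := (hind c').le_bot (Submodule.mem_inf.2 ⟨Module.End.mem_eigenspace_iff.2 hc',
      hle (htop Submodule.mem_top)⟩)
    exact hu' (by simpa using h1)
  obtain ⟨j, hj⟩ := hval v w _ _ hw0 (hν h₀) (hμ h₀) hV1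
  obtain ⟨j', hj'⟩ := hval w v _ _ hv0 (hμ h₀) (hν h₀) hV2
  have hjj : (j : ℂ) + j' = 0 := by
    rw [hj] at hj'
    linear_combination hj'
  have hj0 : j = 0 := by
    have : j + j' = 0 := by exact_mod_cast hjj
    omega
  rw [hj0, Nat.cast_zero, sub_zero] at hj
  obtain ⟨y, hy, z, hz, hyz⟩ := Submodule.mem_sup.1 (hV1 (Submodule.mem_top (x := w)))
  obtain ⟨c, rfl⟩ := Submodule.mem_span_singleton.1 hy
  have hz0 : z = 0 := by
    have hz1 : z ∈ T.eigenspace (ν h₀) := by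
      have : z = w - c • v := by rw [← hyz]; abel
      rw [this]
      refine Submodule.sub_mem _ (Module.End.mem_eigenspace_iff.2 ?_) (Submodule.smul_mem _ _
        (Module.End.mem_eigenspace_iff.2 (hν h₀)))
      rw [← hj]; exact hμ h₀
    have hle : (⨆ j : ℕ, T.eigenspace (ν h₀ - (j + 1))) ≤ ⨆ (d : ℂ) (_ : d ≠ ν h₀), T.eigenspace d := by
      refine iSup_le fun j => le_iSup₂_of_le (ν h₀ - (j + 1)) ?_ le_rfl
      intro h
      have : ((j + 1 : ℕ) : ℂ) = 0 := by push_cast; linear_combination -h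
      exact absurd (by exact_mod_cast this) (Nat.succ_ne_zero j)
    have := (hind (ν h₀)).le_bot (Submodule.mem_inf.2 ⟨hz1, hle hz⟩)
    simpa using this
  exact ⟨c, by rw [← hyz, hz0, add_zero]⟩

/-- A parabolic datum: the degree function `m` given by an element `hΘ` of the Cartan subalgebra, for
which `𝔭` is the sum of the root spaces of nonnegative degree and `δ` is the sum of the roots of
positive degree. -/
structure IsParabolicGrading (b : 𝚽.Base) (Θ : Finset 𝔥.root) (m : 𝔥.root → ℤ) :
    Prop where
  exists_element : ∃ h : 𝔥, ∀ α : 𝔥.root, 𝚽.root α h = m α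
  nonneg_iff : ∀ α, 0 ≤ m α ↔ b.IsPos α ∨ (¬ b.IsPos α ∧ IsLeviRoot Θ α)
  pos_iff : ∀ α, 0 < m α ↔ b.IsPos α ∧ ¬ IsLeviRoot Θ α
  exists_pos : ∃ α, 0 < m α

lemma exists_isParabolicGrading (b : 𝚽.Base) {Θ : Finset 𝔥.root}
    (hΘ : Θ ⊂ b.support) : ∃ m, IsParabolicGrading b Θ m := by
  obtain ⟨h, m, hm, hp, hn, hs, hl⟩ := exists_parabolic_grading b Θ
  obtain ⟨γ, hγ, hγ'⟩ := Finset.exists_of_ssubset hΘ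
  refine ⟨m, ⟨h, hm⟩, fun α => ?_, fun α => ?_, γ, hs γ hγ hγ'⟩
  · rw [hl hΘ.1 α]
    by_cases hα : b.IsPos α
    · simp [hα, hp α hα]
    · have := hn α hα
      simp only [hα, not_false_eq_true, true_and, false_or]
      omega
  · rw [hl hΘ.1 α]
    by_cases hα : b.IsPos α
    · have := hp α hα
      simp only [hα, true_and]
      omega
    · have := hn α hα
      simp only [hα, false_and, iff_false]
      omega

lemma exists_smul_of_mem_rootSpace {α : 𝔥.root} {f x : L} (hf0 : f ≠ 0)
    (hf : f ∈ rootSpace 𝔥 (α : 𝐖))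
    (hx : x ∈ rootSpace 𝔥 (α : 𝐖)) : ∃ c : ℂ, x = c • f := by
  have h1 := finrank_rootSpace_eq_one (α : 𝐖) (LieSubalgebra.isNonZero_coe_root α)
  obtain ⟨c, hc⟩ := (finrank_eq_one_iff_of_nonzero' (⟨f, hf⟩ : rootSpace 𝔥 α.1)
    (by simpa [Subtype.ext_iff] using hf0)).1 h1 ⟨x, hx⟩
  exact ⟨c, (congrArg Subtype.val hc).symm⟩

lemma exists_sl2Triple_neg (α : 𝔥.root) : ∃ (β : 𝔥.root) (h e f : L),
    𝚽.root β = -𝚽.root α ∧ IsSl2Triple h e f ∧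
    e ∈ rootSpace 𝔥 (β : 𝐖) ∧
    f ∈ rootSpace 𝔥 (α : 𝐖) ∧ h = 𝚽.coroot β := by
  obtain ⟨β, hβ⟩ := root_indexNeg α
  have hβ0 : (β : 𝐖).IsNonZero := LieSubalgebra.isNonZero_coe_root β
  obtain ⟨h, e, f, ht, he, hf⟩ := exists_isSl2Triple_of_weight_isNonZero hβ0
  refine ⟨β, h, e, f, hβ, ht, he, ?_, ht.h_eq_coroot hβ0 he hf⟩
  have : (-(β : 𝐖) : 𝔥 → ℂ) = (α : 𝐖) := by
    funext z
    have := LinearMap.congr_fun hβ z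
    simp only [rootSystem_root_apply, LinearMap.neg_apply, LieModule.Weight.toLinear_apply] at this
    simp [this]
  rwa [this] at hf

section Module
variable {b : (rootSystem 𝔥).Base} {Θ : Finset 𝔥.root} {m : 𝔥.root → ℤ}
  (hg : IsParabolicGrading b Θ m)
include hg

lemma neg_degree {α β : 𝔥.root} (h : 𝚽.root β = -𝚽.root α) : m β = - m α := by
  obtain ⟨h₀, hm⟩ := hg.exists_element
  have h1 := hm β
  rw [h, LinearMap.neg_apply, hm] at h1
  exact_mod_cast h1.symm

lemma mem_parabolicSubalgebra_of_decomposition {h : 𝔥} {y : 𝔥.root → L}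
    (hy : ∀ α : 𝔥.root, y α ∈ rootSpace 𝔥 (α : 𝐖))
    (h0 : ∀ α, m α < 0 → y α = 0) : (h : L) + ∑ α, y α ∈ parabolicSubalgebra b Θ := by
  refine Submodule.add_mem _ (Submodule.mem_sup_left (Submodule.mem_sup_left h.2))
    (Submodule.sum_mem _ fun α _ => ?_)
  by_cases hα : m α < 0
  · rw [h0 α hα]; exact Submodule.zero_mem _
  · rcases (hg.nonneg_iff α).1 (by omega) with hp | hl
    · exact Submodule.mem_sup_left (Submodule.mem_sup_right
        (Submodule.mem_iSup_of_mem ⟨α, hp⟩ (hy α)))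
    · exact Submodule.mem_sup_right (Submodule.mem_iSup_of_mem ⟨α, hl⟩ (hy α))

variable {v : V} (hv : IsHighestWeightModule b (deltaWeight b Θ) V v)
include hv

lemma lie_eq_zero_of_degree_nonneg [FiniteDimensional ℂ V] {α : 𝔥.root} (hα : 0 ≤ m α) {x : L}
    (hx : x ∈ rootSpace 𝔥 (α : 𝐖)) : ⁅x, v⁆ = 0 := by
  by_cases hp : b.IsPos α
  · exact hv.highest α hp x hx
  have h0 : m α = 0 := by
    have h1 := (hg.nonneg_iff α).1 hα
    have h2 := hg.pos_iff α
    simp only [hp, false_and, iff_false] at h2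
    omega
  obtain ⟨h₀, hm⟩ := hg.exists_element
  obtain ⟨β, h, e, f, hβ, ht, he, hf, hh⟩ := exists_sl2Triple_neg α
  have hmβ : m β = 0 := by rw [neg_degree hg hβ, h0, neg_zero]
  have hδ : deltaWeight b Θ (𝚽.coroot β) = 0 := by
    rw [deltaWeight_coroot b Θ (fun β => (hg.pos_iff β).symm), sum_pairingIn_eq_zero hm hmβ]
    simp
  have P : ht.HasPrimitiveVectorWith v (0 : ℂ) :=
    { ne_zero := hv.ne_zero
      lie_h := by rw [hh, hv.weight, hδ]
      lie_e := hv.highest β ((isPos_of_root_eq_neg b hβ).2 hp) e he }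
  have hfv := P.pow_toEnd_f_eq_zero_of_eq_nat (n := 0) (by simp)
  simp only [zero_add, pow_one, LieModule.toEnd_apply_apply] at hfv
  obtain ⟨c, rfl⟩ := exists_smul_of_mem_rootSpace ht.f_ne_zero hf hx
  rw [smul_lie, hfv, smul_zero]

lemma eq_zero_of_degree_neg_of_lie_eq_zero {α : 𝔥.root} (hα : m α < 0) {x : L}
    (hx : x ∈ rootSpace 𝔥 (α : 𝐖)) (hxv : ⁅x, v⁆ = 0) : x = 0 := by
  obtain ⟨h₀, hm⟩ := hg.exists_element
  obtain ⟨β, h, e, f, hβ, ht, he, hf, hh⟩ := exists_sl2Triple_neg α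
  have hmβ : 0 < m β := by rw [neg_degree hg hβ]; omega
  obtain ⟨c, rfl⟩ := exists_smul_of_mem_rootSpace ht.f_ne_zero hf hx
  by_contra hc
  have hc0 : c ≠ 0 := fun h => hc (by rw [h, zero_smul])
  rw [smul_lie, smul_eq_zero] at hxv
  have hfv := hxv.resolve_left hc0
  have hev := hv.highest β ((hg.pos_iff β).1 hmβ).1 e he
  have h1 : ⁅h, v⁆ = 0 := by rw [← ht.lie_e_f, lie_lie, hfv, hev, lie_zero, lie_zero, sub_zero]
  rw [hh, hv.weight, smul_eq_zero, deltaWeight_coroot b Θ (fun β => (hg.pos_iff β).symm)] at h1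
  have h2 := h1.resolve_right hv.ne_zero
  have h3 := sum_pairingIn_pos hm hmβ
  have h4 := Int.cast_eq_zero.1 h2
  omega

/-- An element stabilising the line through the highest weight vector has no component in the root
spaces of negative degree. -/
lemma component_eq_zero_of_lie_eq_smul {h : 𝔥} {y : 𝔥.root → L}
    (hy : ∀ α : 𝔥.root, y α ∈ rootSpace 𝔥 (α : 𝐖)) {c : ℂ}
    (hc : ⁅(h : L) + ∑ α, y α, v⁆ = c • v) {α : 𝔥.root} (hα : m α < 0) : y α = 0 := by
  classical
  refine eq_zero_of_degree_neg_of_lie_eq_zero hg hv hα (hy α) ?_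
  -- the vectors `y_α v` lie in distinct weight spaces
  let wt : 𝔥.root → (𝔥 → ℂ) := fun α => ((α : 𝐖) : 𝔥 → ℂ) + deltaWeight b Θ
  have hwt : ∀ α : 𝔥.root, wt α ≠ deltaWeight b Θ := by
    intro α he
    have hα0 : ((α : 𝐖) : 𝔥 → ℂ) = 0 := add_eq_right.1 he
    exact LieSubalgebra.isNonZero_coe_root α hα0
  have hinj : Function.Injective wt := by
    intro α β hαβ
    have : ((α : 𝐖) : 𝔥 → ℂ) = (β : 𝐖) := add_right_cancel hαβ
    exact Subtype.ext (DFunLike.coe_injective this)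
  have hvw : v ∈ LieModule.genWeightSpace V (deltaWeight b Θ : 𝔥 → ℂ) :=
    LieModule.weightSpace_le_genWeightSpace V _ ((LieModule.mem_weightSpace _ v).2 hv.weight)
  have hyw : ∀ α, ⁅y α, v⁆ ∈ LieModule.genWeightSpace V (wt α) := fun α =>
    lie_mem_genWeightSpace_of_mem_genWeightSpace (hy α) hvw
  rw [add_lie, sum_lie, hv.weight] at hc
  have hmem : ⁅y α, v⁆ ∈ ⨆ (χ : 𝔥 → ℂ) (_ : χ ≠ wt α),
      (LieModule.genWeightSpace V χ : LieSubmodule ℂ 𝔥 V) := by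
    have he : ⁅y α, v⁆ = (c - deltaWeight b Θ h) • v - ∑ β ∈ Finset.univ.erase α, ⁅y β, v⁆ := by
      rw [← Finset.add_sum_erase _ _ (Finset.mem_univ α)] at hc
      rw [sub_smul, ← hc]; abel
    rw [he]
    refine sub_mem (SMulMemClass.smul_mem _ ?_) (sum_mem fun β hβ => ?_)
    · exact LieSubmodule.mem_iSup_of_mem _ (LieSubmodule.mem_iSup_of_mem (hwt α).symm hvw)
    · exact LieSubmodule.mem_iSup_of_mem _ (LieSubmodule.mem_iSup_of_mem
        (fun h => (Finset.ne_of_mem_erase hβ) (hinj h)) (hyw β))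
  have := (LieModule.iSupIndep_genWeightSpace ℂ 𝔥 V (wt α)).le_bot ⟨hyw α, hmem⟩
  simpa using this

/-- The parabolic subalgebra is the stabiliser of the line through the highest weight vector. -/
lemma mem_parabolicSubalgebra_iff [FiniteDimensional ℂ V] (x : L) :
    x ∈ parabolicSubalgebra b Θ ↔ ∃ c : ℂ, ⁅x, v⁆ = c • v := by
  classical
  constructor
  · intro hx
    let N : Submodule ℂ L :=
      { carrier := {x | ∃ c : ℂ, ⁅x, v⁆ = c • v}
        add_mem' := by
          rintro x y ⟨c, hc⟩ ⟨d, hd⟩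
          exact ⟨c + d, by rw [add_lie, hc, hd, add_smul]⟩
        zero_mem' := ⟨0, by simp⟩
        smul_mem' := by
          rintro a x ⟨c, hc⟩
          exact ⟨a * c, by rw [smul_lie, hc, mul_smul]⟩ }
    have hle : parabolicSubalgebra b Θ ≤ N := by
      refine sup_le (sup_le ?_ (iSup_le ?_)) (iSup_le ?_)
      · intro h hh
        exact ⟨_, hv.weight ⟨h, hh⟩⟩
      · rintro ⟨α, hα⟩ z hz
        exact ⟨0, by rw [zero_smul]; exact hv.highest α hα z hz⟩
      · rintro ⟨α, hα⟩ z hz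
        exact ⟨0, by
          rw [zero_smul]
          exact lie_eq_zero_of_degree_nonneg hg hv ((hg.nonneg_iff α).2 (Or.inr hα)) hz⟩
    exact hle hx
  · rintro ⟨c, hc⟩
    obtain ⟨h, y, hy, rfl⟩ := exists_root_decomposition (𝔥 := 𝔥) x
    exact mem_parabolicSubalgebra_of_decomposition hg hy fun α hα =>
      component_eq_zero_of_lie_eq_smul hg hv hy hc hα

omit hg in
/-- A common eigenvector of the parabolic subalgebra is a multiple of the highest weight vector. -/
lemma eq_smul_of_parabolic_eigenvector [FiniteDimensional ℂ V] {w : V} (hw : w ≠ 0)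
    (hwp : ∀ x ∈ parabolicSubalgebra b Θ, ∃ c : ℂ, ⁅x, w⁆ = c • w) : ∃ c : ℂ, w = c • v := by
  have hh : ∀ h : 𝔥, ∃ c : ℂ, ⁅(h : L), w⁆ = c • w := fun h =>
    hwp h (Submodule.mem_sup_left (Submodule.mem_sup_left h.2))
  choose μ hμ using hh
  refine highestWeightVector_unique b hv.irreducible hv.ne_zero hw hv.weight hμ hv.highest ?_
  intro α hα x hx
  obtain ⟨c, hc⟩ := hwp x (Submodule.mem_sup_left (Submodule.mem_sup_right
    (Submodule.mem_iSup_of_mem ⟨α, hα⟩ hx)))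
  -- `x` is a multiple of a commutator of elements acting on `w` by scalars
  have hx2 : ⁅(𝚽.coroot α : L), x⁆ = (2 : ℂ) • x := by
    have h1 := lie_eq_smul_of_mem_rootSpace hx (𝚽.coroot α)
    have h2 : (α : 𝐖) (𝚽.coroot α) = 2 := by
      have := root_coroot_eq_intCast α α
      simpa using this
    rw [← h2]; exact h1
  have h3 : (2 : ℂ) • ⁅x, w⁆ = 0 := by
    rw [← smul_lie, ← hx2, lie_lie, hμ, hc, lie_smul, lie_smul, hμ, hc, smul_comm, sub_self]
  exact (smul_eq_zero.1 h3).resolve_left two_ne_zero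

/-- The element `a` of the parabolic subalgebra acts on the quotient `L / 𝔭` with trace minus its
eigenvalue on the highest weight vector. -/
lemma trace_quotient_parabolic [FiniteDimensional ℂ V] {E : Type*} [AddCommGroup E] [Module ℂ E]
    (pr : L →ₗ[ℂ] E) (hpr : Function.Surjective pr)
    (hker : ∀ x, pr x = 0 ↔ x ∈ parabolicSubalgebra b Θ) {a : L} {c : ℂ} (ha : ⁅a, v⁆ = c • v)
    (A : E →ₗ[ℂ] E) (hA : ∀ x, A (pr x) = pr ⁅a, x⁆) : LinearMap.trace ℂ E A = -c := by
  classical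
  have hex : ∀ α : 𝔥.root, ∃ f ∈ rootSpace 𝔥 (α : 𝐖), f ≠ 0 := fun α => (α : 𝐖).exists_ne_zero
  choose f hf hf0 using hex
  let S := {α : 𝔥.root // m α < 0}
  have hli : LinearIndependent ℂ (fun α : S => pr (f α)) := by
    rw [Fintype.linearIndependent_iff]
    intro g hg0 i
    let y : 𝔥.root → L := fun α => if hα : m α < 0 then g ⟨α, hα⟩ • f α else 0
    have hy : ∀ α : 𝔥.root, y α ∈ rootSpace 𝔥 (α : 𝐖) := by
      intro α
      by_cases hα : m α < 0
      · simp only [y, hα, dif_pos]; exact SMulMemClass.smul_mem _ (hf α)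
      · simp only [y, hα, dif_neg, not_false_eq_true]; exact zero_mem _
    have hsum : pr (((0 : 𝔥) : L) + ∑ α, y α) = 0 := by
      rw [ZeroMemClass.coe_zero, zero_add, ← hg0, map_sum]
      have h1 : ∑ α, pr (y α) = ∑ α ∈ Finset.univ.filter (fun α => m α < 0), pr (y α) := by
        rw [Finset.sum_filter]
        refine Finset.sum_congr rfl fun α _ => ?_
        split_ifs with hα
        · rfl
        · simp [y, hα]
      rw [h1, Finset.sum_subtype (p := fun α => m α < 0) _ (by simp)]
      refine Finset.sum_congr rfl fun α _ => ?_
      simp [y, α.2]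
    obtain ⟨d, hd⟩ := (mem_parabolicSubalgebra_iff hg hv _).1 ((hker _).1 hsum)
    have := component_eq_zero_of_lie_eq_smul hg hv hy hd i.2
    simp only [y, i.2, dif_pos, smul_eq_zero] at this
    exact this.resolve_right (hf0 _)
  have hspan : ⊤ ≤ Submodule.span ℂ (Set.range fun α : S => pr (f α)) := by
    intro e _
    obtain ⟨x, rfl⟩ := hpr e
    obtain ⟨h, y, hy, rfl⟩ := exists_root_decomposition (𝔥 := 𝔥) x
    rw [map_add, map_sum, (hker _).2 (Submodule.mem_sup_left (Submodule.mem_sup_left h.2)), zero_add]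
    refine Submodule.sum_mem _ fun α _ => ?_
    by_cases hα : m α < 0
    · obtain ⟨c, hc⟩ := exists_smul_of_mem_rootSpace (hf0 α) (hf α) (hy α)
      rw [hc, map_smul]
      exact Submodule.smul_mem _ _ (Submodule.subset_span ⟨⟨α, hα⟩, rfl⟩)
    · rw [(hker _).2 ((mem_parabolicSubalgebra_iff hg hv _).2 ⟨0, by
        rw [zero_smul, lie_eq_zero_of_degree_nonneg hg hv (not_lt.1 hα) (hy α)]⟩)]
      exact Submodule.zero_mem _
  let B := Module.Basis.mk hli hspan
  have hB : ∀ α : S, B α = pr (f α) := fun α => by simp [B]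
  -- the coordinate of `pr z` on `pr (f α)` vanishes if `z` has a weight other than `α`
  have hcoord : ∀ (α : S) (χ : 𝔥 → ℂ), χ ≠ ((α : 𝔥.root) : 𝐖) →
      ∀ z ∈ rootSpace 𝔥 χ, B.repr (pr z) α = 0 := by
    intro α χ hχ z hz
    by_cases hz0 : z = 0
    · simp [hz0]
    have hne : rootSpace 𝔥 χ ≠ ⊥ := fun h => hz0 (by rw [h] at hz; simpa using hz)
    let W : 𝐖 := ⟨χ, hne⟩
    by_cases hW : W.IsZero
    · have h0 : χ = 0 := hW
      rw [h0, rootSpace_zero_eq, LieSubalgebra.mem_toLieSubmodule] at hz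
      rw [(hker _).2 (Submodule.mem_sup_left (Submodule.mem_sup_left hz))]; simp
    · let β : 𝔥.root := ⟨W, by simpa using hW⟩
      by_cases hβ : m β < 0
      · obtain ⟨c, hc⟩ := exists_smul_of_mem_rootSpace (α := β) (hf0 β) (hf β) hz
        have hne : (⟨β, hβ⟩ : S) ≠ α := by
          rintro rfl
          exact hχ rfl
        rw [hc, map_smul, ← hB ⟨β, hβ⟩, map_smul, B.repr_self, Finsupp.smul_apply,
          Finsupp.single_eq_of_ne hne.symm, smul_zero]
      · rw [(hker _).2 ((mem_parabolicSubalgebra_iff hg hv _).2 ⟨0, by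
          rw [zero_smul, lie_eq_zero_of_degree_nonneg hg hv (α := β) (not_lt.1 hβ) hz]⟩)]; simp
  obtain ⟨h, y, hy, rfl⟩ := exists_root_decomposition (𝔥 := 𝔥) a
  have hdiag : ∀ α : S, B.repr (A (B α)) α = 𝚽.root α h := by
    intro α
    rw [hB, hA, add_lie, sum_lie, map_add, map_sum, map_add, map_sum, Finsupp.add_apply,
      Finsupp.finsetSum_apply]
    rw [Finset.sum_eq_zero, add_zero]
    · have h1 : ⁅(h : L), f α⁆ = 𝚽.root α h • f α := lie_eq_smul_of_mem_rootSpace (hf α) h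
      rw [h1, map_smul, ← hB, map_smul, B.repr_self]
      simp
    · intro β _
      refine hcoord α (((β : 𝐖) : 𝔥 → ℂ) + ((α : 𝔥.root) : 𝐖)) ?_ _
        (lie_mem_genWeightSpace_of_mem_genWeightSpace (hy β) (hf α))
      intro he
      have h0 : ((β : 𝐖) : 𝔥 → ℂ) = 0 := add_eq_right.1 he
      exact LieSubalgebra.isNonZero_coe_root β h0
  have hc : c = deltaWeight b Θ h := by
    have h1 : ∀ α, ⁅y α, v⁆ = 0 := by
      intro α
      by_cases hα : m α < 0
      · rw [component_eq_zero_of_lie_eq_smul hg hv hy ha hα, zero_lie]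
      · exact lie_eq_zero_of_degree_nonneg hg hv (not_lt.1 hα) (hy α)
    rw [add_lie, sum_lie, Finset.sum_eq_zero (fun α _ => h1 α), add_zero, hv.weight] at ha
    exact (smul_left_injective ℂ hv.ne_zero ha).symm
  rw [LinearMap.trace_eq_matrix_trace ℂ B, Matrix.trace]
  simp only [Matrix.diag_apply, LinearMap.toMatrix_apply, hdiag]
  rw [hc, deltaWeight, LinearMap.sum_apply, ← Finset.sum_neg_distrib]
  have hneg : ∀ α : 𝔥.root, 𝚽.root (𝚽.reflectionPerm α α)
      = -𝚽.root α := fun α => by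
    rw [RootPairing.root_reflectionPerm, RootPairing.reflection_apply_self]
  have hS : ∑ α : S, 𝚽.root α h
      = ∑ α : 𝔥.root, if m α < 0 then 𝚽.root α h else 0 := by
    rw [← Finset.sum_filter, Finset.sum_subtype (p := fun α => m α < 0) _ (by simp)]
  rw [hS]
  have hinv : ∀ α : 𝔥.root, 𝚽.reflectionPerm (𝚽.reflectionPerm α α)
      (𝚽.reflectionPerm α α) = α := fun α => by
    apply 𝚽.root.injective
    rw [hneg, hneg, neg_neg]
  refine Finset.sum_nbij' (fun α => 𝚽.reflectionPerm α α)
    (fun α => 𝚽.reflectionPerm α α) (by simp) (by simp) (fun α _ => hinv α)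
    (fun α _ => hinv α) fun α _ => ?_
  have hmα := neg_degree hg (hneg α)
  have hiff : (b.IsPos (𝚽.reflectionPerm α α) ∧
      ¬ IsLeviRoot Θ (𝚽.reflectionPerm α α)) ↔ m α < 0 := by
    rw [← hg.pos_iff, hmα]; omega
  by_cases hα : m α < 0
  · rw [if_pos hα, if_pos (hiff.2 hα), hneg]; simp
  · rw [if_neg hα, if_neg (fun h => hα (hiff.1 h))]; simp

omit [AddCommGroup V] [Module ℂ V] [LieRingModule L V] [LieModule ℂ L V] hv in
/-- For an invariant bilinear form, a vector orthogonal to the parabolic subalgebra is isotropic. -/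
lemma isotropic_of_orthogonal_parabolic {t : L →ₗ[ℂ] L →ₗ[ℂ] ℂ}
    (hinv : ∀ x y z : L, t ⁅x, y⁆ z = -t y ⁅x, z⁆) (hsymm : ∀ x y, t x y = t y x) {y : L}
    (hy : ∀ x ∈ parabolicSubalgebra b Θ, t y x = 0) : t y y = 0 := by
  classical
  obtain ⟨h, z, hz, hyz⟩ := exists_root_decomposition (𝔥 := 𝔥) y
  have horth : ∀ (χ ψ : 𝔥 → ℂ) (x x' : L), x ∈ rootSpace 𝔥 χ → x' ∈ rootSpace 𝔥 ψ → χ + ψ ≠ 0 →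
      t x x' = 0 := by
    intro χ ψ x x' hx hx' hne
    obtain ⟨k, hk⟩ := Function.ne_iff.1 hne
    have h1 := hinv (k : L) x x'
    have h2 : ⁅(k : L), x⁆ = χ k • x := lie_eq_smul_of_mem_rootSpace hx k
    have h3 : ⁅(k : L), x'⁆ = ψ k • x' := lie_eq_smul_of_mem_rootSpace hx' k
    rw [h2, h3, map_smul, map_smul, LinearMap.smul_apply, smul_eq_mul, smul_eq_mul] at h1
    have h4 : (χ + ψ) k * t x x' = 0 := by rw [Pi.add_apply]; linear_combination h1
    exact (mul_eq_zero.1 h4).resolve_left hk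
  have hh0 : (h : L) ∈ rootSpace 𝔥 (0 : 𝔥 → ℂ) := by
    rw [rootSpace_zero_eq, LieSubalgebra.mem_toLieSubmodule]; exact h.2
  have hzp : ∀ α, 0 ≤ m α → z α ∈ parabolicSubalgebra b Θ := by
    intro α hα
    rcases (hg.nonneg_iff α).1 hα with hp | hl
    · exact Submodule.mem_sup_left (Submodule.mem_sup_right
        (Submodule.mem_iSup_of_mem ⟨α, hp⟩ (hz α)))
    · exact Submodule.mem_sup_right (Submodule.mem_iSup_of_mem ⟨α, hl⟩ (hz α))
  have hcomp : ∀ α β : 𝔥.root, 𝚽.root β = -𝚽.root α →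
      t y (z α) = t (z β) (z α) := by
    intro α β hβ
    rw [hyz, map_add, map_sum, LinearMap.add_apply, LinearMap.sum_apply,
      horth _ _ _ _ hh0 (hz α) (by
        rw [zero_add]; exact LieSubalgebra.isNonZero_coe_root α), zero_add]
    refine Finset.sum_eq_single β (fun γ _ hγ => horth _ _ _ _ (hz γ) (hz α) fun h0 => hγ ?_) (by simp)
    apply 𝚽.root.injective
    rw [hβ, eq_neg_iff_add_eq_zero]
    ext k
    exact congrFun h0 k
  conv_lhs => rw [hyz]
  rw [hsymm, map_add, map_sum, ← hyz, hy _ (Submodule.mem_sup_left (Submodule.mem_sup_left h.2)),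
    zero_add]
  refine Finset.sum_eq_zero fun α _ => ?_
  by_cases hα : 0 ≤ m α
  · exact hy _ (hzp α hα)
  · obtain ⟨β, hβ⟩ := root_indexNeg α
    have hβ' : 𝚽.root α = -𝚽.root β := by rw [hβ, neg_neg]
    rw [hcomp α β hβ, hsymm, ← hcomp β α hβ']
    exact hy _ (hzp β (by rw [neg_degree hg hβ]; omega))

lemma exists_mem_cartan_lie_eq_smul : ∃ (x : L) (c : ℂ), c ≠ 0 ∧ ⁅x, v⁆ = c • v := by
  obtain ⟨h₀, hm⟩ := hg.exists_element
  obtain ⟨α, hα⟩ := hg.exists_pos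
  refine ⟨𝚽.coroot α, _, ?_, hv.weight _⟩
  rw [deltaWeight_coroot b Θ (fun β => (hg.pos_iff β).symm)]
  exact Int.cast_ne_zero.2 (sum_pairingIn_pos hm hα).ne'

/-- An element of a simple Lie algebra which acts on `V` by a scalar is zero. -/
lemma eq_zero_of_lie_eq_smul [LieAlgebra.IsSimple ℂ L] {x : L} {c : ℂ}
    (hx : ∀ w : V, ⁅x, w⁆ = c • w) : x = 0 := by
  obtain ⟨x₀, c₀, hc₀, hx₀⟩ := exists_mem_cartan_lie_eq_smul hg hv
  have hker : LieModule.ker ℂ L V = ⊥ := by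
    refine (LieAlgebra.IsSimple.eq_bot_or_eq_top _).resolve_right fun htop => ?_
    have h1 : x₀ ∈ LieModule.ker ℂ L V := by rw [htop]; trivial
    rw [LieModule.mem_ker] at h1
    rw [h1 v, eq_comm, smul_eq_zero] at hx₀
    exact hx₀.elim hc₀ hv.ne_zero
  have hcen : x ∈ LieAlgebra.center ℂ L := by
    rw [LieModule.mem_maxTrivSubmodule]
    intro y
    have : ⁅y, x⁆ ∈ LieModule.ker ℂ L V := by
      rw [LieModule.mem_ker]
      intro w
      rw [lie_lie, hx, hx, lie_smul, sub_self]
    rwa [hker, LieSubmodule.mem_bot] at this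
  rwa [LieAlgebra.center_eq_bot, LieSubmodule.mem_bot] at hcen
end Module
end HighestWeight

/-! ### Complex Lie groups as real Lie groups -/

section RealLieGroup
variable {𝔼 : Type*} [NormedAddCommGroup 𝔼] [NormedSpace ℂ 𝔼]
  {Gc : Type*} [TopologicalSpace Gc] [ChartedSpace 𝔼 Gc] [Group Gc]

lemma lieGroup_real_of_complex [LieGroup 𝓘(ℂ, 𝔼) ω Gc] : LieGroup 𝓘(ℝ, 𝔼) ∞ Gc where
  toIsManifold := isManifold_real_of_complex (F := 𝔼) inferInstance
  contMDiff_mul := by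
    have h := contMDiff_mul 𝓘(ℂ, 𝔼) ω (G := Gc)
    rw [← modelWithCornersSelf_prod] at h ⊢
    let _ : ChartedSpace (𝔼 × 𝔼) (Gc × Gc) :=
      inferInstanceAs (ChartedSpace (ModelProd 𝔼 𝔼) (Gc × Gc))
    have h' : ContMDiffOn 𝓘(ℂ, 𝔼 × 𝔼) 𝓘(ℂ, 𝔼) ω (fun p : Gc × Gc => p.1 * p.2) univ :=
      contMDiffOn_univ.2 h
    exact contMDiffOn_univ.1 (contMDiffOn_real_of_complex (F := 𝔼 × 𝔼) h')
  contMDiff_inv := by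
    have h := contMDiff_inv 𝓘(ℂ, 𝔼) ω (G := Gc)
    exact contMDiffOn_univ.1 (contMDiffOn_real_of_complex (contMDiffOn_univ.2 h))

/-- A complex differentiable map is real differentiable, with the same derivative. -/
lemma hasMFDerivAt_real_of_complex {F F' : Type*} [NormedAddCommGroup F] [NormedSpace ℂ F]
    [NormedAddCommGroup F'] [NormedSpace ℂ F'] {X Y : Type*} [TopologicalSpace X]
    [ChartedSpace F X] [TopologicalSpace Y] [ChartedSpace F' Y] {f : X → Y} {x : X}
    {f' : F →L[ℂ] F'} (h : HasMFDerivAt 𝓘(ℂ, F) 𝓘(ℂ, F') f x f') :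
    HasMFDerivAt 𝓘(ℝ, F) 𝓘(ℝ, F') f x (f'.restrictScalars ℝ : F →L[ℝ] F') := by
  refine ⟨h.1, ?_⟩
  have h2 : HasFDerivWithinAt (writtenInExtChartAt 𝓘(ℂ, F) 𝓘(ℂ, F') x f) f'
    (range 𝓘(ℂ, F)) (extChartAt 𝓘(ℂ, F) x x) := h.2
  exact h2.restrictScalars ℝ

variable {F : Type*} [NormedAddCommGroup F] [NormedSpace ℝ F] [CompleteSpace F]
  {K : Type*} [TopologicalSpace K] [ChartedSpace F K] [Group K]

/-- Local one-parameter subgroups: integral curves through `1` of a left-invariant vector field. -/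
lemma exists_integralCurve [LieGroup 𝓘(ℝ, F) ∞ K] (a : F) :
    ∃ γ : ℝ → K, γ 0 = 1 ∧ ∀ᶠ t in 𝓝 (0 : ℝ), HasMFDerivAt 𝓘(ℝ, ℝ) 𝓘(ℝ, F) γ t
      ((1 : ℝ →L[ℝ] ℝ).smulRight (mfderiv 𝓘(ℝ, F) 𝓘(ℝ, F) (γ t * ·) (1 : K) a : F)) := by
  have : LieGroup 𝓘(ℝ, F) (minSmoothness ℝ 3) K := LieGroup.of_le (n := ∞) (by
    rw [minSmoothness_of_isRCLikeNormedField]; exact WithTop.coe_le_coe.2 (le_top : (3 : ℕ∞) ≤ ⊤))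
  have : IsManifold 𝓘(ℝ, F) 1 K := IsManifold.of_le (n := ∞) (by
    exact WithTop.coe_le_coe.2 (le_top : (1 : ℕ∞) ≤ ⊤))
  have h := contMDiff_mulInvariantVectorField (I := 𝓘(ℝ, F)) (G := K) (a : GroupLieAlgebra 𝓘(ℝ, F) K)
  obtain ⟨γ, h0, hγ⟩ := exists_isMIntegralCurveAt_of_contMDiffAt_boundaryless
    (I := 𝓘(ℝ, F)) (M := K) 0 ((h.of_le (by
      rw [minSmoothness_of_isRCLikeNormedField]; exact_mod_cast one_le_two)).contMDiffAt (x := (1 : K)))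
  exact ⟨γ, h0, hγ⟩

end RealLieGroup

/-! ### The representation on the highest weight module -/

section FlagModel
variable {𝔼 : Type*} [NormedAddCommGroup 𝔼] [NormedSpace ℂ 𝔼] [FiniteDimensional ℂ 𝔼]
  {Gc : Type*} [TopologicalSpace Gc] [ChartedSpace 𝔼 Gc] [Group Gc]
  {V : Type*} [NormedAddCommGroup V] [InnerProductSpace ℂ V] [FiniteDimensional ℂ V]

/-- What the geometry of the flag manifold uses of the irreducible representation with highest
weight `δ_P` and highest weight vector `v`: `R` is the representation of the group, `dR` its
differential, `br` the Lie bracket, and `P` is the stabiliser of the line through `v`. -/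
structure IsFlagModel (E : Type*) [AddCommGroup E] [Module ℂ E] (P : Subgroup Gc)
    (R : Gc → V →L[ℂ] V) (dR : 𝔼 →L[ℂ] V →L[ℂ] V)
    (br : 𝔼 → 𝔼 → 𝔼) (v : V) : Prop where
  map_one : R 1 = 1
  map_mul : ∀ g h, R (g * h) = R g * R h
  contMDiff : ContMDiff 𝓘(ℂ, 𝔼) 𝓘(ℂ, V →L[ℂ] V) ω R
  mfderiv_one : mfderiv 𝓘(ℂ, 𝔼) 𝓘(ℂ, V →L[ℂ] V) R 1 = dR
  ne_zero : v ≠ 0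
  mem_iff : ∀ g, g ∈ P ↔ ∃ c : ℂ, R g v = c • v
  lie : ∀ a x, dR (br a x) = dR a * dR x - dR x * dR a
  /-- `δ_P` is minus the trace of the adjoint action on the tangent space of the flag manifold. -/
  trace : ∀ pr : 𝔼 →ₗ[ℂ] E,
    Function.Surjective pr → (∀ x, pr x = 0 ↔ ∃ c : ℂ, dR x v = c • v) →
    ∀ (a : 𝔼) (c : ℂ), dR a v = c • v → ∀ A : E →ₗ[ℂ] E, (∀ x, A (pr x) = pr (br a x)) →
      LinearMap.trace ℂ E A = -c
  isotropic : ∀ y, (∀ x, (∃ c : ℂ, dR x v = c • v) →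
    LinearMap.trace ℂ V ((dR y * dR x : V →L[ℂ] V) : V →ₗ[ℂ] V) = 0) →
    LinearMap.trace ℂ V ((dR y * dR y : V →L[ℂ] V) : V →ₗ[ℂ] V) = 0
  eq_zero_of_scalar : ∀ (x : 𝔼) (c : ℂ), (∀ w, dR x w = c • w) → x = 0
  exists_weight : ∃ (x : 𝔼) (c : ℂ), c ≠ 0 ∧ dR x v = c • v
  irreducible : ∀ W : Submodule ℂ V, (∀ x, ∀ w ∈ W, dR x w ∈ W) → W ≠ ⊥ → W = ⊤

variable [LieGroup 𝓘(ℂ, 𝔼) ω Gc]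

lemma contMDiff_conj (g : Gc) : ContMDiff 𝓘(ℂ, 𝔼) 𝓘(ℂ, 𝔼) ω (fun y : Gc => g * y * g⁻¹) :=
  (contMDiff_const.mul contMDiff_id).mul contMDiff_const

/-- The adjoint representation as a continuous linear map. -/
def AdL (g : Gc) : 𝔼 →L[ℂ] 𝔼 :=
  (mfderiv 𝓘(ℂ, 𝔼) 𝓘(ℂ, 𝔼) (fun y : Gc => g * y * g⁻¹) 1 : 𝔼 →L[ℂ] 𝔼)

lemma hasMFDerivAt_conj (g : Gc) :
    HasMFDerivAt 𝓘(ℂ, 𝔼) 𝓘(ℂ, 𝔼) (fun y : Gc => g * y * g⁻¹) 1 (AdL (𝔼 := 𝔼) g : 𝔼 →L[ℂ] 𝔼) :=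
  ((contMDiff_conj (𝔼 := 𝔼) g).mdifferentiableAt (by simp)).hasMFDerivAt

lemma hasMFDerivAt_representation {R : Gc → V →L[ℂ] V} (hR : ContMDiff 𝓘(ℂ, 𝔼) 𝓘(ℂ, V →L[ℂ] V) ω R)
    {dR : 𝔼 →L[ℂ] V →L[ℂ] V} (hd : mfderiv 𝓘(ℂ, 𝔼) 𝓘(ℂ, V →L[ℂ] V) R 1 = dR) :
    HasMFDerivAt 𝓘(ℂ, 𝔼) 𝓘(ℂ, V →L[ℂ] V) R 1 (dR : 𝔼 →L[ℂ] V →L[ℂ] V) := by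
  rw [← hd]
  exact (hR.mdifferentiableAt (by simp)).hasMFDerivAt

lemma dR_AdL {R : Gc → V →L[ℂ] V} (hR : ContMDiff 𝓘(ℂ, 𝔼) 𝓘(ℂ, V →L[ℂ] V) ω R)
    (hmul : ∀ g h, R (g * h) = R g * R h) {dR : 𝔼 →L[ℂ] V →L[ℂ] V}
    (hd : mfderiv 𝓘(ℂ, 𝔼) 𝓘(ℂ, V →L[ℂ] V) R 1 = dR) (g : Gc) (x : 𝔼) :
    dR (AdL g x) = R g * dR x * R g⁻¹ := by
  have h1 := hasMFDerivAt_representation hR hd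
  have h2 : HasMFDerivAt 𝓘(ℂ, 𝔼) 𝓘(ℂ, V →L[ℂ] V) R (g * 1 * g⁻¹) (dR : 𝔼 →L[ℂ] V →L[ℂ] V) := by
    have e : g * 1 * g⁻¹ = 1 := by simp
    rw [e]; exact h1
  have h3 := h2.comp (1 : Gc) (hasMFDerivAt_conj (𝔼 := 𝔼) g)
  let T : (V →L[ℂ] V) →L[ℂ] (V →L[ℂ] V) :=
    (ContinuousLinearMap.mul ℂ (V →L[ℂ] V) (R g)).comp ((ContinuousLinearMap.mul ℂ (V →L[ℂ] V)).flip (R g⁻¹))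
  have h4 : HasMFDerivAt 𝓘(ℂ, 𝔼) 𝓘(ℂ, V →L[ℂ] V) (T ∘ R) 1 (T.comp dR : 𝔼 →L[ℂ] V →L[ℂ] V) :=
    (T.hasFDerivAt.hasMFDerivAt (x := R 1)).comp (1 : Gc) h1
  have h5 : (R ∘ fun y : Gc => g * y * g⁻¹) = T ∘ R := by
    funext y
    simp only [Function.comp_apply, hmul, T, ContinuousLinearMap.comp_apply,
      ContinuousLinearMap.mul_apply', ContinuousLinearMap.flip_apply, mul_assoc]
  rw [h5] at h3
  have h6 := hasMFDerivAt_unique h3 h4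
  have h7 := congrArg (fun (l : 𝔼 →L[ℂ] V →L[ℂ] V) => l x) h6
  exact h7.trans (mul_assoc _ _ _).symm

end FlagModel

section Frozen
open LieAlgebra LieAlgebra.IsKilling
variable {𝔼 : Type*} [NormedAddCommGroup 𝔼] [NormedSpace ℂ 𝔼] [FiniteDimensional ℂ 𝔼]
    {Gc : Type*} [TopologicalSpace Gc]
    [ChartedSpace 𝔼 Gc] [Group Gc] [LieGroup 𝓘(ℂ, 𝔼) ω Gc]
    [LieAlgebra.IsSimple ℂ (GroupLieAlgebra 𝓘(ℂ, 𝔼) Gc)]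
    {𝔥 : LieSubalgebra ℂ (GroupLieAlgebra 𝓘(ℂ, 𝔼) Gc)} [𝔥.IsCartanSubalgebra]
    {V : Type*} [NormedAddCommGroup V] [InnerProductSpace ℂ V] [FiniteDimensional ℂ V]
    [LieRingModule (GroupLieAlgebra 𝓘(ℂ, 𝔼) Gc) V] [LieModule ℂ (GroupLieAlgebra 𝓘(ℂ, 𝔼) Gc) V]
local notation "𝐋" => GroupLieAlgebra 𝓘(ℂ, 𝔼) Gc
local notation "𝚽" => rootSystem 𝔥

variable (𝔼 Gc V) in
/-- The action of the Lie algebra on `V`, as a continuous linear map. -/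
def lieAction : 𝔼 →L[ℂ] V →L[ℂ] V :=
  toContinuousLinearMap
    ((toContinuousLinearMap : (V →ₗ[ℂ] V) ≃ₗ[ℂ] (V →L[ℂ] V)).toLinearMap ∘ₗ
      ((LieModule.toEnd ℂ (𝐋) V) : 𝐋 →ₗ[ℂ] Module.End ℂ V))

variable (Gc) in
/-- The Lie bracket of `Gc`, on the model space `𝔼` of the Lie algebra. -/
def lieBr (a x : 𝔼) : 𝔼 :=
  let a' : 𝐋 := a
  let x' : 𝐋 := x
  (⁅a', x'⁆ : 𝐋)

lemma contMDiff_clm_of_apply {F X : Type*} [NormedAddCommGroup F] [NormedSpace ℂ F]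
    [TopologicalSpace X] [ChartedSpace F X] {R : X → V →L[ℂ] V}
    (h : ∀ w, ContMDiff 𝓘(ℂ, F) 𝓘(ℂ, V) ω (fun x => R x w)) :
    ContMDiff 𝓘(ℂ, F) 𝓘(ℂ, V →L[ℂ] V) ω R := by
  let bV := finBasis ℂ V
  let T : (Fin (finrank ℂ V) → V) →L[ℂ] (V →L[ℂ] V) := toContinuousLinearMap
    ((toContinuousLinearMap : (V →ₗ[ℂ] V) ≃ₗ[ℂ] (V →L[ℂ] V)).toLinearMap ∘ₗ
      (bV.constr ℂ : (Fin (finrank ℂ V) → V) ≃ₗ[ℂ] (V →ₗ[ℂ] V)).toLinearMap)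
  have h1 : ContMDiff 𝓘(ℂ, F) 𝓘(ℂ, Fin (finrank ℂ V) → V) ω (fun x i => R x (bV i)) :=
    contMDiff_pi_space.2 fun i => h (bV i)
  have h2 : R = T ∘ fun x i => R x (bV i) := by
    funext x
    refine ContinuousLinearMap.coe_injective (bV.ext fun i => ?_)
    simp [T]
  rw [h2]
  exact T.contDiff.contMDiff.comp h1

/-- The module `V(δ_P)` has the required properties. An element of the group preserves the line `ℂ v`
if and only if it normalises the stabiliser of that line in the Lie algebra, which is `𝔭_Θ`. -/
lemma isFlagModel {E : Type*} [AddCommGroup E] [Module ℂ E] (b : 𝚽.Base) {Θ : Finset 𝔥.root}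
    (hΘ : Θ ⊂ b.support)
    {P : Subgroup Gc} (hP : P = adNormalizer (parabolicSubalgebra b Θ))
    {v : V} (hv : IsHighestWeightModule b (deltaWeight b Θ) V v) (ρ : Representation ℂ Gc V)
    (hρ : ∀ w : V, ContMDiff 𝓘(ℂ, 𝔼) 𝓘(ℂ, V) ω (fun g : Gc => ρ g w))
    (hρ_bracket : ∀ (x : 𝐋) (w : V), mfderiv 𝓘(ℂ, 𝔼) 𝓘(ℂ, V) (fun g : Gc => ρ g w) 1 x = ⁅x, w⁆) :
    IsFlagModel E P (fun g => toContinuousLinearMap (ρ g)) (lieAction 𝔼 Gc V) (lieBr Gc) v := by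
  obtain ⟨m, hg⟩ := exists_isParabolicGrading b hΘ
  have hmem := mem_parabolicSubalgebra_iff hg hv
  set R : Gc → V →L[ℂ] V := fun g => toContinuousLinearMap (ρ g) with hRdef
  have hone : R 1 = 1 := by ext w; simp [hRdef]
  have hmul : ∀ g h, R (g * h) = R g * R h := fun g h => by ext w; simp [hRdef]
  have hR : ContMDiff 𝓘(ℂ, 𝔼) 𝓘(ℂ, V →L[ℂ] V) ω R := contMDiff_clm_of_apply hρ
  have hd : mfderiv 𝓘(ℂ, 𝔼) 𝓘(ℂ, V →L[ℂ] V) R 1 = lieAction 𝔼 Gc V := by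
    have h1 : HasMFDerivAt 𝓘(ℂ, 𝔼) 𝓘(ℂ, V →L[ℂ] V) R 1 _ :=
      (hR.mdifferentiableAt (by simp) (x := 1)).hasMFDerivAt
    refine ContinuousLinearMap.ext fun x => ContinuousLinearMap.ext fun w => ?_
    refine Eq.trans ?_ (hρ_bracket x w)
    let ev : (V →L[ℂ] V) →L[ℂ] V := ContinuousLinearMap.apply ℂ V w
    have h2 : HasMFDerivAt 𝓘(ℂ, 𝔼) 𝓘(ℂ, V) (ev ∘ R) 1 _ :=
      (ev.hasFDerivAt.hasMFDerivAt (x := R 1)).comp (1 : Gc) h1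
    have h3 : (fun g : Gc => ρ g w) = ev ∘ R := by ext g; simp [ev, hRdef]
    rw [h3]
    exact DFunLike.congr_fun h2.mfderiv.symm x
  have hinv : ∀ g, R g⁻¹ * R g = 1 := fun g => by rw [← hmul, inv_mul_cancel, hone]
  have hinv' : ∀ g, R g * R g⁻¹ = 1 := fun g => by rw [← hmul, mul_inv_cancel, hone]
  have hinj : ∀ g w, R g w = 0 → w = 0 := fun g w h => by
    have := DFunLike.congr_fun (hinv g) w
    simpa [h] using this.symm
  have hAd := dR_AdL hR hmul hd
  have hconj : ∀ (g : Gc) (x : 𝔼) (w : V), lieAction 𝔼 Gc V (AdL g x) (R g w) = R g (lieAction 𝔼 Gc V x w) := by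
    intro g x w
    rw [hAd]
    change R g (lieAction 𝔼 Gc V x ((R g⁻¹ * R g) w)) = _
    rw [hinv]
    rfl
  refine ⟨hone, hmul, hR, hd, hv.ne_zero, fun g => ?_, fun a x => ?_, ?_, ?_, ?_, ?_,
    fun W hW hb => ?_⟩
  · rw [hP]
    constructor
    · intro hgP
      refine eq_smul_of_parabolic_eigenvector hv (fun h => hv.ne_zero (hinj g v h)) fun x hx => ?_
      have hx' : x = AdL (𝔼 := 𝔼) g (AdL (𝔼 := 𝔼) g⁻¹ x) := by
        have := Ad_mul (𝔼 := 𝔼) g g⁻¹ x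
        rw [mul_inv_cancel, Ad_one] at this
        exact this
      have h1 : AdL (𝔼 := 𝔼) g⁻¹ x ∈ parabolicSubalgebra b Θ := by
        refine (hgP _).1 ?_
        change AdL (𝔼 := 𝔼) g (AdL (𝔼 := 𝔼) g⁻¹ x) ∈ _
        rwa [← hx']
      obtain ⟨c, hc⟩ := (hmem _).1 h1
      refine ⟨c, ?_⟩
      have h2 := hconj g (AdL (𝔼 := 𝔼) g⁻¹ x) v
      rw [← hx'] at h2
      have h3 : lieAction 𝔼 Gc V (AdL (𝔼 := 𝔼) g⁻¹ x) v = c • v := hc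
      rw [h3, map_smul] at h2
      exact h2
    · rintro ⟨c, hc⟩ x
      have hc0 : c ≠ 0 := by
        rintro rfl
        rw [zero_smul] at hc
        exact hv.ne_zero (hinj g v hc)
      have h2 := hconj g x v
      rw [hc, map_smul] at h2
      have h4 : ((∃ d : ℂ, lieAction 𝔼 Gc V (AdL (𝔼 := 𝔼) g x) v = d • v) ↔
          ∃ d : ℂ, lieAction 𝔼 Gc V x v = d • v) := by
        constructor
        · rintro ⟨d, hd'⟩
          refine ⟨d, ?_⟩
          rw [hd', smul_comm, ← hc, ← map_smul] at h2
          rw [← sub_eq_zero]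
          refine hinj g _ ?_
          rw [map_sub, h2, sub_self]
        · rintro ⟨d, hd'⟩
          refine ⟨d, ?_⟩
          rw [hd', map_smul, hc, smul_comm] at h2
          exact smul_right_injective V hc0 h2
      exact (hmem _).trans (h4.trans (hmem x).symm)
  · ext w
    let a' : 𝐋 := a
    let x' : 𝐋 := x
    exact lie_lie a' x' w
  · intro pr hpr hker a c ha A hA
    exact trace_quotient_parabolic (L := 𝐋) hg hv pr hpr
      (fun x => (hker x).trans (hmem x).symm) ha A hA
  · intro y hy
    let t : 𝐋 →ₗ[ℂ] 𝐋 →ₗ[ℂ] ℂ := LieModule.traceForm ℂ (𝐋) V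
    refine isotropic_of_orthogonal_parabolic hg (t := t) (fun x y z => ?_)
      (fun x y => LieModule.traceForm_comm ℂ _ V x y) fun x hx => hy x ((hmem x).1 hx)
    rw [← lie_skew, map_neg, LinearMap.neg_apply]
    exact congrArg Neg.neg (LieModule.traceForm_apply_lie_apply ℂ _ V y x z)
  · intro x c hx
    exact eq_zero_of_lie_eq_smul (L := 𝐋) hg hv hx
  · exact exists_mem_cartan_lie_eq_smul (L := 𝐋) hg hv
  · have := hv.irreducible
    let N : LieSubmodule ℂ (𝐋) V := { W with lie_mem := fun {x w} hw => hW x w hw }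
    have hN : N = ⊤ := (eq_bot_or_eq_top N).resolve_left fun h => hb (by
      simpa [N] using congrArg LieSubmodule.toSubmodule h)
    simpa [N] using congrArg LieSubmodule.toSubmodule hN
end Frozen

/-! ### The derivative of the determinant -/

section Det
variable {n : Type*} [Fintype n] [DecidableEq n]

/-- Jacobi's formula at an invertible matrix. -/
lemma hasDerivAt_det {𝕜 𝕜' : Type*} [NontriviallyNormedField 𝕜] [NormedField 𝕜']
    [NormedAlgebra 𝕜 𝕜'] {M : 𝕜 → Matrix n n 𝕜'} {M₀' A : Matrix n n 𝕜'} {t : 𝕜}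
    (h : ∀ i j, HasDerivAt (fun s => M s i j) (M₀' i j) t) (hA : M₀' = M t * A)
    (hdet : IsUnit (M t).det) : HasDerivAt (fun s => (M s).det) ((M t).det * A.trace) t := by
  set N : 𝕜 → Matrix n n 𝕜' := fun s => (M t)⁻¹ * M s with hN
  have hMN : ∀ s, M s = M t * N s := fun s => by
    rw [hN, ← mul_assoc, Matrix.mul_nonsing_inv _ hdet, one_mul]
  have hN1 : N t = 1 := by rw [hN]; exact Matrix.nonsing_inv_mul _ hdet
  have hNA : A = (M t)⁻¹ * M₀' := by rw [hA, ← mul_assoc, Matrix.nonsing_inv_mul _ hdet, one_mul]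
  have hNd : ∀ i j, HasDerivAt (fun s => N s i j) (A i j) t := fun i j => by
    rw [hNA]
    simp only [hN, Matrix.mul_apply]
    exact HasDerivAt.fun_sum fun k _ => (h k j).const_mul _
  have key : HasDerivAt (fun s => (N s).det) A.trace t := by
    simp only [Matrix.det_apply']
    have h1 : HasDerivAt (fun s => ∑ σ : Equiv.Perm n, ((Equiv.Perm.sign σ : ℤ) : 𝕜') *
        ∏ i, N s (σ i) i) (∑ σ : Equiv.Perm n, ((Equiv.Perm.sign σ : ℤ) : 𝕜') *
          ∑ i, (∏ j ∈ Finset.univ.erase i, N t (σ j) j) • A (σ i) i) t :=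
      HasDerivAt.fun_sum fun σ _ => (HasDerivAt.fun_finsetProd fun i _ => hNd (σ i) i).const_mul _
    convert h1 using 1
    rw [Finset.sum_eq_single 1]
    · simp [hN1, Matrix.trace, Finset.prod_eq_one]
    · intro σ _ hσ
      rw [Finset.sum_eq_zero, mul_zero]
      intro i _
      obtain ⟨j, hj, hji⟩ : ∃ j, σ j ≠ j ∧ j ≠ i := by
        obtain ⟨j, hj⟩ : ∃ j, σ j ≠ j := by
          by_contra! hc
          exact hσ (Equiv.ext hc)
        by_cases hji : j = i
        · refine ⟨σ j, fun h => hj (σ.injective h), fun h => hj (h.trans hji.symm)⟩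
        · exact ⟨j, hj, hji⟩
      rw [Finset.prod_eq_zero (Finset.mem_erase.2 ⟨hji, Finset.mem_univ j⟩), zero_smul]
      rw [hN1, Matrix.one_apply_ne hj]
    · simp
  have := key.const_mul (M t).det
  refine this.congr_of_eventuallyEq (Filter.Eventually.of_forall fun s => ?_)
  simp only
  rw [hMN s, Matrix.det_mul]

/-- Jacobi's formula for a curve of automorphisms. -/
lemma hasDerivAt_linearMap_det {E : Type*} [NormedAddCommGroup E] [NormedSpace ℂ E]
    [FiniteDimensional ℂ E] {M : ℝ → E →ₗ[ℂ] E} {A : E →ₗ[ℂ] E} {t : ℝ}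
    (h : ∀ u, HasDerivAt (fun s => M s u) (M t (A u)) t) (hdet : LinearMap.det (M t) ≠ 0) :
    HasDerivAt (fun s => LinearMap.det (M s)) (LinearMap.det (M t) * LinearMap.trace ℂ E A) t := by
  let b := finBasis ℂ E
  have e : ∀ f : E →ₗ[ℂ] E, LinearMap.det f = (LinearMap.toMatrix b b f).det :=
    fun f => (LinearMap.det_toMatrix b f).symm
  simp only [e] at hdet ⊢
  rw [LinearMap.trace_eq_matrix_trace ℂ b]
  refine hasDerivAt_det (M := fun s => LinearMap.toMatrix b b (M s))
    (M₀' := LinearMap.toMatrix b b (M t ∘ₗ A)) (fun i j => ?_)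
    (LinearMap.toMatrix_comp b b b _ _) (isUnit_iff_ne_zero.2 hdet)
  simp only [LinearMap.toMatrix_apply]
  let c : E →L[ℝ] ℂ := (toContinuousLinearMap (b.coord i)).restrictScalars ℝ
  exact c.hasFDerivAt.comp_hasDerivAt t (h (b j))
end Det

/-! ### One-parameter curves -/

section Curves
variable {F : Type*} [NormedAddCommGroup F] [NormedSpace ℝ F]
  {K : Type*} [TopologicalSpace K] [ChartedSpace F K] [Group K]

/-- `γ` is, near `0`, an integral curve through `1` of the left-invariant vector field of `a`. -/
def IsExpCurve (γ : ℝ → K) (a : F) : Prop :=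
  γ 0 = 1 ∧ ∀ᶠ t in 𝓝 (0 : ℝ), HasMFDerivAt 𝓘(ℝ, ℝ) 𝓘(ℝ, F) γ t
      ((1 : ℝ →L[ℝ] ℝ).smulRight (mfderiv 𝓘(ℝ, F) 𝓘(ℝ, F) (γ t * ·) (1 : K) a : F))

lemma exists_isExpCurve [CompleteSpace F] [LieGroup 𝓘(ℝ, F) ∞ K] (a : F) :
    ∃ γ : ℝ → K, IsExpCurve γ a := exists_integralCurve a

lemma mdifferentiableAt_mul_left [LieGroup 𝓘(ℝ, F) ∞ K] (g h : K) :
    MDifferentiableAt 𝓘(ℝ, F) 𝓘(ℝ, F) (g * ·) h :=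
  (contMDiff_mul_left (I := 𝓘(ℝ, F)) (n := ∞) (a := g)).mdifferentiableAt (by simp)

lemma hasDerivAt_comp_expCurve [LieGroup 𝓘(ℝ, F) ∞ K] {γ : ℝ → K} {a : F} {t : ℝ}
    (hγ : HasMFDerivAt 𝓘(ℝ, ℝ) 𝓘(ℝ, F) γ t
      ((1 : ℝ →L[ℝ] ℝ).smulRight (mfderiv 𝓘(ℝ, F) 𝓘(ℝ, F) (γ t * ·) (1 : K) a : F)))
    {W : Type*} [NormedAddCommGroup W] [NormedSpace ℝ W] {X : Type*} [TopologicalSpace X]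
    [ChartedSpace W X] {f : K → X}
    (hf : MDifferentiableAt 𝓘(ℝ, F) 𝓘(ℝ, W) f (γ t)) :
    HasMFDerivAt 𝓘(ℝ, ℝ) 𝓘(ℝ, W) (f ∘ γ) t ((1 : ℝ →L[ℝ] ℝ).smulRight
      (mfderiv 𝓘(ℝ, F) 𝓘(ℝ, W) (fun y => f (γ t * y)) 1 a : W)) := by
  have h1 : HasMFDerivAt 𝓘(ℝ, F) 𝓘(ℝ, W) (f ∘ (γ t * ·)) 1
      ((mfderiv 𝓘(ℝ, F) 𝓘(ℝ, W) f (γ t) : F →L[ℝ] W).comp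
        (mfderiv 𝓘(ℝ, F) 𝓘(ℝ, F) (γ t * ·) (1 : K) : F →L[ℝ] F) : F →L[ℝ] W) := by
    refine HasMFDerivAt.comp (1 : K) ?_ (mdifferentiableAt_mul_left _ _).hasMFDerivAt
    rw [mul_one]
    exact hf.hasMFDerivAt
  have h2 := hf.hasMFDerivAt.comp t hγ
  have h3 : (mfderiv 𝓘(ℝ, F) 𝓘(ℝ, W) (fun y => f (γ t * y)) 1 : F →L[ℝ] W) = _ := h1.mfderiv
  rw [h3]
  refine h2.congr_mfderiv ?_
  refine ContinuousLinearMap.ext fun s => ?_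
  exact ((mfderiv 𝓘(ℝ, F) 𝓘(ℝ, W) f (γ t) : F →L[ℝ] W)).map_smul s _

lemma IsExpCurve.hasDerivAt [LieGroup 𝓘(ℝ, F) ∞ K] {γ : ℝ → K} {a : F} (hγ : IsExpCurve γ a)
    {W : Type*} [NormedAddCommGroup W] [NormedSpace ℝ W] {f : K → W}
    (hf : MDifferentiable 𝓘(ℝ, F) 𝓘(ℝ, W) f) :
    ∀ᶠ t in 𝓝 (0 : ℝ), HasDerivAt (f ∘ γ)
      ((mfderiv 𝓘(ℝ, F) 𝓘(ℝ, W) (fun y => f (γ t * y)) 1 : F →L[ℝ] W) a) t := by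
  filter_upwards [hγ.2] with t ht
  have h := hasDerivAt_comp_expCurve ht (hf (γ t))
  have h' : HasFDerivAt (f ∘ γ) ((1 : ℝ →L[ℝ] ℝ).smulRight
      ((mfderiv 𝓘(ℝ, F) 𝓘(ℝ, W) (fun y => f (γ t * y)) 1 : F →L[ℝ] W) a)) t :=
    hasMFDerivAt_iff_hasFDerivAt.1 h
  have := h'.hasDerivAt
  exact this.congr_deriv (one_smul ℝ _)

/-- Smooth homomorphisms map one-parameter curves to one-parameter curves. -/
lemma IsExpCurve.map [LieGroup 𝓘(ℝ, F) ∞ K] {γ : ℝ → K} {a : F} (hγ : IsExpCurve γ a)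
    {W : Type*} [NormedAddCommGroup W] [NormedSpace ℝ W]
    {K' : Type*} [TopologicalSpace K'] [ChartedSpace W K'] [Group K'] [LieGroup 𝓘(ℝ, W) ∞ K']
    {f : K → K'} (hf : MDifferentiable 𝓘(ℝ, F) 𝓘(ℝ, W) f) (h1 : f 1 = 1)
    (hmul : ∀ x y, f (x * y) = f x * f y) :
    IsExpCurve (F := W) (f ∘ γ) ((mfderiv 𝓘(ℝ, F) 𝓘(ℝ, W) f 1 : F →L[ℝ] W) a) := by
  refine ⟨by simp [hγ.1, h1], ?_⟩
  filter_upwards [hγ.2] with t ht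
  have h := hasDerivAt_comp_expCurve ht (hf (γ t))
  have h2 : HasMFDerivAt 𝓘(ℝ, F) 𝓘(ℝ, W) ((f (γ t) * ·) ∘ f) 1
      ((mfderiv 𝓘(ℝ, W) 𝓘(ℝ, W) (f (γ t) * ·) (1 : K') : W →L[ℝ] W).comp
        (mfderiv 𝓘(ℝ, F) 𝓘(ℝ, W) f (1 : K) : F →L[ℝ] W) : F →L[ℝ] W) := by
    refine HasMFDerivAt.comp (1 : K) ?_ (hf 1).hasMFDerivAt
    rw [h1]
    exact (mdifferentiableAt_mul_left _ _).hasMFDerivAt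
  have e : (f (γ t) * ·) ∘ f = fun y => f (γ t * y) := funext fun y => (hmul _ _).symm
  rw [e] at h2
  have h3 : (mfderiv 𝓘(ℝ, F) 𝓘(ℝ, W) (fun y => f (γ t * y)) 1 : F →L[ℝ] W) =
      (mfderiv 𝓘(ℝ, W) 𝓘(ℝ, W) (f (γ t) * ·) (1 : K') : W →L[ℝ] W).comp
        (mfderiv 𝓘(ℝ, F) 𝓘(ℝ, W) f (1 : K) : F →L[ℝ] W) := h2.mfderiv
  exact h.congr_mfderiv (congrArg (fun L : F →L[ℝ] W => (1 : ℝ →L[ℝ] ℝ).smulRight (L a)) h3)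

/-- The solution of `f' = c f` is an exponential. -/
lemma eventually_eq_exp_smul {W : Type*} [NormedAddCommGroup W] [NormedSpace ℂ W] {f : ℝ → W}
    {c : ℂ} (h : ∀ᶠ t in 𝓝 (0 : ℝ), HasDerivAt f (c • f t) t) :
    ∀ᶠ t in 𝓝 (0 : ℝ), f t = Complex.exp (c * t) • f 0 := by
  obtain ⟨ε, hε, hb⟩ := Metric.eventually_nhds_iff_ball.1 h
  have hd : ∀ t ∈ Metric.ball (0 : ℝ) ε,
      HasDerivAt (fun t : ℝ => Complex.exp (-c * t) • f t) 0 t := by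
    intro t ht
    have h1 : HasDerivAt (fun t : ℝ => Complex.exp (-c * t)) (Complex.exp (-c * t) * (-c)) t := by
      have := ((Complex.ofRealCLM.hasDerivAt (x := t)).const_mul (-c)).cexp
      simpa using this
    refine (h1.smul (hb t ht)).congr_deriv ?_
    rw [smul_smul, ← add_smul]
    simp
  filter_upwards [Metric.ball_mem_nhds (0 : ℝ) hε] with t ht
  have h1 := (convex_ball (0 : ℝ) ε).is_const_of_fderivWithin_eq_zero (𝕜 := ℝ)
    (f := fun t : ℝ => Complex.exp (-c * t) • f t)
    (fun t ht => (hd t ht).differentiableAt.differentiableWithinAt)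
    (fun t ht => by
      rw [fderivWithin_of_isOpen Metric.isOpen_ball ht]
      ext
      simpa using (hd t ht).deriv) ht (Metric.mem_ball_self hε)
  simp only [Complex.ofReal_zero, mul_zero, Complex.exp_zero, one_smul] at h1
  rw [← h1, smul_smul, ← Complex.exp_add]
  simp
end Curves

instance normedAddCommGroup_bilinear {E : Type*} [NormedAddCommGroup E] [NormedSpace ℝ E] :
    NormedAddCommGroup (E →L[ℝ] E →L[ℝ] ℝ) :=
  ContinuousLinearMap.toNormedAddCommGroup

instance normedSpace_bilinear {E : Type*} [NormedAddCommGroup E] [NormedSpace ℝ E] :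
    NormedSpace ℝ (E →L[ℝ] E →L[ℝ] ℝ) :=
  ContinuousLinearMap.toNormedSpace

instance isBoundedSMul_bilinear {E : Type*} [NormedAddCommGroup E] [NormedSpace ℝ E] :
    IsBoundedSMul ℝ (E →L[ℝ] E →L[ℝ] ℝ) :=
  @NormedSpace.toIsBoundedSMul ℝ (E →L[ℝ] E →L[ℝ] ℝ) _ _ _

/-! ### The Fubini–Study form -/

section FubiniStudy
variable {V : Type*} [NormedAddCommGroup V] [InnerProductSpace ℂ V]

variable (V) in
/-- The real part of the Hermitian inner product. -/
def reInner : V →L[ℝ] V →L[ℝ] ℝ :=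
  LinearMap.mkContinuous₂
    (LinearMap.mk₂ ℝ (fun a b : V => (inner ℂ a b).re)
      (fun a b c => by simp)
      (fun r a b => by
        have : r • a = (r : ℂ) • a := rfl
        rw [this, inner_smul_left]; simp)
      (fun a b c => by simp)
      (fun r a b => by
        have : r • b = (r : ℂ) • b := rfl
        rw [this, inner_smul_right]; simp)) 1
    (fun a b => by
      rw [one_mul]
      exact (Complex.abs_re_le_norm _).trans (norm_inner_le_norm a b))

lemma reInner_apply (a b : V) : reInner V a b = (inner ℂ a b).re := rfl

lemma reInner_self (a : V) : reInner V a a = ‖a‖ ^ 2 := by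
  rw [reInner_apply, inner_self_eq_norm_sq_to_K]
  norm_cast

lemma reInner_comm (a b : V) : reInner V a b = reInner V b a := by
  rw [reInner_apply, reInner_apply, ← inner_conj_symm, Complex.conj_re]

lemma reInner_I_left (a b : V) : reInner V (I • a) b = (inner ℂ a b).im := by
  rw [reInner_apply, inner_smul_left]
  simp

lemma reInner_I_I (a b : V) : reInner V (I • a) (I • b) = reInner V a b := by
  rw [reInner_I_left, inner_smul_right, reInner_apply]
  simp

/-- The Fubini–Study form at the line through `σ`, pulled back to `V`: the real part of the inner
product of the components of `a` and `b` orthogonal to `σ`, divided by `‖σ‖²`. -/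
def fubiniStudy (σ : V) : V →L[ℝ] V →L[ℝ] ℝ :=
  (reInner V σ σ)⁻¹ • reInner V - ((reInner V σ σ)⁻¹ ^ 2) •
    ((reInner V σ).smulRight (reInner V σ) + (reInner V (I • σ)).smulRight (reInner V (I • σ)))

lemma fubiniStudy_apply (σ a b : V) : fubiniStudy σ a b =
    (reInner V σ σ)⁻¹ * reInner V a b - (reInner V σ σ)⁻¹ ^ 2 * (reInner V σ a * reInner V σ b
      + reInner V (I • σ) a * reInner V (I • σ) b) := by
  rfl

lemma fubiniStudy_eq {σ : V} (hσ : σ ≠ 0) (a b : V) : fubiniStudy σ a b =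
    (inner ℂ a b * inner ℂ σ σ - inner ℂ a σ * inner ℂ σ b).re / ‖σ‖ ^ 4 := by
  have h0 : ‖σ‖ ≠ 0 := norm_ne_zero_iff.2 hσ
  rw [fubiniStudy_apply, reInner_self, reInner_I_left, reInner_I_left, reInner_apply, reInner_apply,
    reInner_apply, ← inner_conj_symm a σ, inner_self_eq_norm_sq_to_K]
  simp only [Complex.sub_re, Complex.mul_re, Complex.conj_re, Complex.conj_im]
  have e1 : (((‖σ‖ : ℝ) : ℂ) ^ 2).re = ‖σ‖ ^ 2 := by norm_cast
  have e2 : (((‖σ‖ : ℝ) : ℂ) ^ 2).im = 0 := by norm_cast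
  erw [e1, e2]
  field_simp
  ring

lemma fubiniStudy_comm (σ a b : V) : fubiniStudy σ a b = fubiniStudy σ b a := by
  rw [fubiniStudy_apply, fubiniStudy_apply, reInner_comm a b]
  ring

lemma fubiniStudy_add_smul {σ : V} (hσ : σ ≠ 0) (a b : V) (z w : ℂ) :
    fubiniStudy σ (a + z • σ) (b + w • σ) = fubiniStudy σ a b := by
  rw [fubiniStudy_eq hσ, fubiniStudy_eq hσ]
  congr 2
  simp only [inner_add_left, inner_add_right, inner_smul_left, inner_smul_right]
  ring

lemma fubiniStudy_smul {σ : V} (hσ : σ ≠ 0) (a b : V) {c : ℂ} (hc : c ≠ 0) :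
    fubiniStudy (c • σ) (c • a) (c • b) = fubiniStudy σ a b := by
  rw [fubiniStudy_eq (smul_ne_zero hc hσ), fubiniStudy_eq hσ, norm_smul]
  simp only [inner_smul_left, inner_smul_right]
  have e : c * ((starRingEnd ℂ) c * inner ℂ a b) * (c * ((starRingEnd ℂ) c * inner ℂ σ σ)) -
      c * ((starRingEnd ℂ) c * inner ℂ a σ) * (c * ((starRingEnd ℂ) c * inner ℂ σ b))
      = ((‖c‖ ^ 4 : ℝ) : ℂ) * (inner ℂ a b * inner ℂ σ σ - inner ℂ a σ * inner ℂ σ b) := by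
    have h : (starRingEnd ℂ) c * c = ((‖c‖ ^ 2 : ℝ) : ℂ) := by
      rw [mul_comm, Complex.mul_conj, Complex.normSq_eq_norm_sq]
    have h2 : ((‖c‖ ^ 4 : ℝ) : ℂ) = ((starRingEnd ℂ) c * c) ^ 2 := by
      rw [h, ← Complex.ofReal_pow]; congr 1; ring
    rw [h2]; ring
  rw [e, Complex.re_ofReal_mul, mul_pow]
  have := norm_ne_zero_iff.2 hc
  field_simp

lemma fubiniStudy_isometry {σ : V} (a b : V) {T : V →L[ℂ] V} (hT : ∀ w, ‖T w‖ = ‖w‖) :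
    fubiniStudy (T σ) (T a) (T b) = fubiniStudy σ a b := by
  have h : ∀ a b, reInner V (T a) (T b) = reInner V a b := fun a b =>
    congrArg Complex.re ((LinearIsometry.mk (T : V →ₗ[ℂ] V) hT).inner_map_map a b)
  simp only [fubiniStudy_apply, ← map_smul T, h]

lemma fubiniStudy_self {σ : V} (hσ : σ ≠ 0) (a : V) : fubiniStudy σ a a =
    ‖a - (inner ℂ σ a / (‖σ‖ : ℂ) ^ 2) • σ‖ ^ 2 / ‖σ‖ ^ 2 := by
  have h0 : (‖σ‖ : ℂ) ^ 2 ≠ 0 := pow_ne_zero _ (Complex.ofReal_ne_zero.2 (norm_ne_zero_iff.2 hσ))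
  have h0' : ‖σ‖ ≠ 0 := norm_ne_zero_iff.2 hσ
  set a' := a - (inner ℂ σ a / (‖σ‖ : ℂ) ^ 2) • σ with ha'
  have h1 : a = a' + (inner ℂ σ a / (‖σ‖ : ℂ) ^ 2) • σ := by rw [ha']; abel
  have h2 : inner ℂ σ a' = 0 := by
    rw [ha', inner_sub_right, inner_smul_right, inner_self_eq_norm_sq_to_K]
    exact sub_eq_zero.2 (div_mul_cancel₀ _ h0).symm
  rw [h1, fubiniStudy_add_smul hσ, fubiniStudy_eq hσ, h2, mul_zero, sub_zero,
    inner_self_eq_norm_sq_to_K, inner_self_eq_norm_sq_to_K]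
  have e : (((‖a'‖ : ℝ) : ℂ) ^ 2 * ((‖σ‖ : ℝ) : ℂ) ^ 2).re = ‖a'‖ ^ 2 * ‖σ‖ ^ 2 := by norm_cast
  erw [e]
  field_simp

lemma fubiniStudy_self_nonneg (σ a : V) : 0 ≤ fubiniStudy σ a a := by
  rcases eq_or_ne σ 0 with rfl | h
  · simp [fubiniStudy_apply]
  · rw [fubiniStudy_self h]
    positivity

lemma exists_smul_of_fubiniStudy_eq_zero {σ a : V} (hσ : σ ≠ 0) (h : fubiniStudy σ a a = 0) :
    ∃ z : ℂ, a = z • σ := by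
  rw [fubiniStudy_self hσ, div_eq_zero_iff] at h
  rcases h with h | h
  · exact ⟨_, sub_eq_zero.1 (norm_eq_zero.1 (pow_eq_zero_iff two_ne_zero |>.1 h))⟩
  · exact absurd h (pow_ne_zero _ (norm_ne_zero_iff.2 hσ))

lemma contDiffAt_fubiniStudy {n : WithTop ℕ∞} {σ : V} (hσ : σ ≠ 0) :
    ContDiffAt ℝ n (fubiniStudy : V → V →L[ℝ] V →L[ℝ] ℝ) σ := by
  have h1 : ContDiff ℝ n (fun σ : V => reInner V σ) := (reInner V).contDiff
  have h2 : ContDiff ℝ n (fun σ : V => I • σ) :=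
    ((I • ContinuousLinearMap.id ℂ V).restrictScalars ℝ).contDiff
  have h3 : ContDiff ℝ n (fun σ : V => reInner V (I • σ)) := h1.comp h2
  have h4 : ContDiff ℝ n (fun σ : V => reInner V σ σ) := h1.clm_apply contDiff_id
  have h5 : ContDiffAt ℝ n (fun σ : V => (reInner V σ σ)⁻¹) σ := h4.contDiffAt.inv (by
    rw [reInner_self]; exact pow_ne_zero _ (norm_ne_zero_iff.2 hσ))
  have h6 : ∀ f : V → V →L[ℝ] ℝ, ContDiff ℝ n f → ContDiff ℝ n (fun σ => (f σ).smulRight (f σ)) :=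
    fun f hf => (hf.smulRight hf)
  have h7 : ContDiffAt ℝ n (fun σ : V => (reInner V σ σ)⁻¹ • reInner V) σ :=
    h5.smul (contDiffAt_const (c := reInner V))
  have h8 : ContDiffAt ℝ n (fun σ : V => ((reInner V σ σ)⁻¹ ^ 2) •
    ((reInner V σ).smulRight (reInner V σ)
      + (reInner V (I • σ)).smulRight (reInner V (I • σ)))) σ :=
    (h5.pow 2).smul ((h6 _ h1).add (h6 _ h3)).contDiffAt
  exact h7.sub h8

end FubiniStudy

section GramDet
variable {E : Type*} [AddCommGroup E] [Module ℝ E] [Module.Finite ℝ E]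

/-- The determinant of a bilinear form, in a fixed basis. -/
def gramDet (β : LinearMap.BilinForm ℝ E) : ℝ :=
  (LinearMap.BilinForm.toMatrix (finBasis ℝ E) β).det

lemma gramDet_comp (β : LinearMap.BilinForm ℝ E) (T : E →ₗ[ℝ] E) :
    gramDet (β.comp T T) = LinearMap.det T ^ 2 * gramDet β := by
  rw [gramDet, LinearMap.BilinForm.toMatrix_comp (finBasis ℝ E) (finBasis ℝ E),
    Matrix.det_mul, Matrix.det_mul, Matrix.det_transpose, LinearMap.det_toMatrix, gramDet]
  ring

lemma gramDet_ne_zero {β : LinearMap.BilinForm ℝ E} (h : ∀ u, β u u = 0 → u = 0) :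
    gramDet β ≠ 0 := by
  refine (LinearMap.BilinForm.nondegenerate_iff_det_ne_zero (finBasis ℝ E)).1 ?_
  exact ⟨fun u hu => h u (hu u), fun u hu => h u (hu u)⟩

end GramDet

/-- The determinant of a complex linear map, seen as a real linear map. -/
lemma det_restrictScalars_real {E : Type*} [NormedAddCommGroup E] [NormedSpace ℂ E]
    [FiniteDimensional ℂ E] (T : E →L[ℂ] E) :
    LinearMap.det ((T.restrictScalars ℝ : E →L[ℝ] E) : E →ₗ[ℝ] E) =
      ‖LinearMap.det (T : E →ₗ[ℂ] E)‖ ^ 2 := by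
  have h := LinearMap.det_restrictScalars (R := ℝ) (S := ℂ) (A := E) (f := (T : E →ₗ[ℂ] E))
  refine h.trans ?_
  rw [Algebra.norm_complex_apply, Complex.normSq_eq_norm_sq]

/-- A function with vanishing derivative on a connected manifold is constant. -/
lemma eq_of_mfderiv_eq_zero {F : Type*} [NormedAddCommGroup F] [NormedSpace ℝ F]
    {X : Type*} [TopologicalSpace X] [ChartedSpace F X] [IsManifold 𝓘(ℝ, F) 1 X] [PreconnectedSpace X]
    {f : X → ℝ} (hf : ∀ x, HasMFDerivAt 𝓘(ℝ, F) 𝓘(ℝ, ℝ) f x (0 : F →L[ℝ] ℝ)) (x y : X) :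
    f x = f y := by
  refine IsLocallyConstant.apply_eq_of_preconnectedSpace ?_ x y
  refine (IsLocallyConstant.iff_eventually_eq f).2 fun x => ?_
  set φ := extChartAt 𝓘(ℝ, F) x with hφ
  have ho : IsOpen φ.target := isOpen_extChartAt_target x
  obtain ⟨ε, hε, hb⟩ := Metric.isOpen_iff.1 ho (φ x) (mem_extChartAt_target x)
  have hd : ∀ z ∈ Metric.ball (φ x) ε, HasFDerivAt (f ∘ φ.symm) (0 : F →L[ℝ] ℝ) z := by
    intro z hz
    have h1 : MDifferentiableAt 𝓘(ℝ, F) 𝓘(ℝ, F) φ.symm z :=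
      (contMDiffOn_extChartAt_symm (n := 1) x z (hb hz)).contMDiffAt (ho.mem_nhds (hb hz))
        |>.mdifferentiableAt (by simp)
    have h2 := (hf (φ.symm z)).comp z h1.hasMFDerivAt
    exact hasMFDerivAt_iff_hasFDerivAt.1
      (h2.congr_mfderiv (f₁' := (0 : F →L[ℝ] ℝ)) (ContinuousLinearMap.zero_comp _))
  have hn : φ ⁻¹' Metric.ball (φ x) ε ∈ 𝓝 x :=
    (continuousAt_extChartAt x).preimage_mem_nhds (Metric.ball_mem_nhds _ hε)
  filter_upwards [hn, extChartAt_source_mem_nhds (I := 𝓘(ℝ, F)) x] with z hz hz'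
  have h := (convex_ball (φ x) ε).is_const_of_fderivWithin_eq_zero (𝕜 := ℝ) (f := f ∘ φ.symm)
    (fun z hz => (hd z hz).differentiableAt.differentiableWithinAt)
    (fun z hz => by
      rw [fderivWithin_of_isOpen Metric.isOpen_ball hz, (hd z hz).fderiv]) hz
      (Metric.mem_ball_self hε)
  simpa [φ.left_inv hz', φ.left_inv (mem_extChartAt_source x)] using h

/-- A continuous bilinear form, as a bilinear form. -/
def toBilin {E : Type*} [NormedAddCommGroup E] [NormedSpace ℝ E] (B : E →L[ℝ] E →L[ℝ] ℝ) :
    LinearMap.BilinForm ℝ E :=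
  LinearMap.mk₂ ℝ (fun u w => B u w) (fun u u' w => by simp) (fun c u w => by simp)
    (fun u w w' => by simp) (fun c u w => by simp)

lemma gramDet_toBilin {E : Type*} [NormedAddCommGroup E] [NormedSpace ℝ E]
    [FiniteDimensional ℝ E] (B : E →L[ℝ] E →L[ℝ] ℝ) : gramDet (toBilin B) =
      (Matrix.of fun i j => B (finBasis ℝ E i) (finBasis ℝ E j)).det := by
  rw [gramDet]
  congr 1
  ext i j
  rw [LinearMap.BilinForm.toMatrix_apply]
  rfl

lemma contDiffAt_det {𝕜 : Type*} [NontriviallyNormedField 𝕜] {k : WithTop ℕ∞} {W n : Type*}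
    [NormedAddCommGroup W] [NormedSpace 𝕜 W] [Fintype n] [DecidableEq n] {M : W → Matrix n n 𝕜} {x : W}
    (h : ∀ i j, ContDiffAt 𝕜 k (fun y => M y i j) x) :
    ContDiffAt 𝕜 k (fun y => (M y).det) x := by
  simp only [Matrix.det_apply']
  exact ContDiffAt.sum fun σ _ => contDiffAt_const.mul (contDiffAt_prod fun i _ => h (σ i) i)

/-! ### Kähler metrics on open subsets of a complex vector space -/

lemma hasFDerivAt_bilinear_apply {E : Type*} [NormedAddCommGroup E] [NormedSpace ℝ E]
    {F : Type*} [NormedAddCommGroup F] [NormedSpace ℝ F]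
    {B : F → E →L[ℝ] E →L[ℝ] ℝ} {y : F} {B' : F →L[ℝ] E →L[ℝ] E →L[ℝ] ℝ}
    (h : HasFDerivAt B B' y) (w x : E) :
    HasFDerivAt (fun z => B z w x) ((B'.flip w).flip x) y := by
  have h1 := (h.clm_apply (hasFDerivAt_const w y)).clm_apply (hasFDerivAt_const x y)
  refine h1.congr_fderiv (ContinuousLinearMap.ext fun v => ?_)
  simp

section PosDef
variable {E : Type*} [NormedAddCommGroup E] [NormedSpace ℝ E] [FiniteDimensional ℝ E]

lemma exists_equiv_of_pos {B : E →L[ℝ] E →L[ℝ] ℝ} (h : ∀ u, u ≠ 0 → 0 < B u u) :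
    ∃ e : E ≃L[ℝ] (E →L[ℝ] ℝ), (e : E →L[ℝ] E →L[ℝ] ℝ) = B := by
  have hinj : Function.Injective B := by
    refine (injective_iff_map_eq_zero B).2 fun u hu => by_contra fun h0 => ?_
    have := h u h0
    rw [hu] at this
    exact lt_irrefl _ this
  have hd : finrank ℝ (E →L[ℝ] ℝ) = finrank ℝ E := by
    rw [← (toContinuousLinearMap (𝕜 := ℝ) (E := E) (F' := ℝ)).finrank_eq]
    exact Subspace.dual_finrank_eq
  let e := LinearEquiv.ofInjectiveOfFinrankEq (B : E →ₗ[ℝ] E →L[ℝ] ℝ) hinj hd.symm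
  exact ⟨e.toContinuousLinearEquiv, ContinuousLinearMap.ext fun u => rfl⟩

lemma apply_inverse_of_pos {B : E →L[ℝ] E →L[ℝ] ℝ} (h : ∀ u, u ≠ 0 → 0 < B u u)
    (f : E →L[ℝ] ℝ) : B (B.inverse f) = f := by
  obtain ⟨e, rfl⟩ := exists_equiv_of_pos h
  rw [ContinuousLinearMap.inverse_equiv]
  exact e.apply_symm_apply f

lemma eq_of_forall_apply_of_pos {B : E →L[ℝ] E →L[ℝ] ℝ} (h : ∀ u, u ≠ 0 → 0 < B u u) {u v : E}
    (huv : ∀ x, B u x = B v x) : u = v := by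
  by_contra h0
  have := h (u - v) (sub_ne_zero.2 h0)
  rw [map_sub B, sub_apply, huv, sub_self] at this
  exact lt_irrefl _ this

lemma contDiffAt_inverse_of_pos {F : Type*} [NormedAddCommGroup F] [NormedSpace ℝ F]
    {B : F → E →L[ℝ] E →L[ℝ] ℝ} {y : F} (h : ∀ u, u ≠ 0 → 0 < B y u u) (hB : ContDiffAt ℝ ∞ B y) :
    ContDiffAt ℝ ∞ (fun z => (B z).inverse) y := by
  obtain ⟨e, he⟩ := exists_equiv_of_pos h
  have : CompleteSpace E := FiniteDimensional.complete ℝ E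
  have h1 := contDiffAt_map_inverse (𝕜 := ℝ) (n := ∞) e
  rw [he] at h1
  exact h1.comp y hB

lemma sum_coord_eq_trace (f : E →ₗ[ℝ] E) :
    ∑ i, (finBasis ℝ E).coord i (f (finBasis ℝ E i)) = LinearMap.trace ℝ E f := by
  rw [LinearMap.trace_eq_matrix_trace ℝ (finBasis ℝ E) f, Matrix.trace]
  refine Finset.sum_congr rfl fun i _ => ?_
  rw [Matrix.diag_apply, LinearMap.toMatrix_apply, Module.Basis.coord_apply]

/-- An endomorphism that is skew for a definite symmetric form has trace zero. -/
lemma trace_eq_zero_of_skew {B : E →L[ℝ] E →L[ℝ] ℝ} (h : ∀ u, u ≠ 0 → 0 < B u u)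
    (hs : ∀ u x, B u x = B x u) {S : E →ₗ[ℝ] E} (hS : ∀ u x, B (S u) x = -B (S x) u) :
    LinearMap.trace ℝ E S = 0 := by
  obtain ⟨e, he⟩ := exists_equiv_of_pos h
  have he' : ∀ u x, e u x = B u x := fun u x => by rw [← he]; rfl
  let β : E ≃ₗ[ℝ] Module.Dual ℝ E :=
    e.toLinearEquiv.trans (toContinuousLinearMap (𝕜 := ℝ) (E := E) (F' := ℝ)).symm
  have hβ : ∀ u x, β u x = B u x := fun u x => he' u x
  have h1 : Module.Dual.transpose (R := ℝ) S ∘ₗ (β : E →ₗ[ℝ] Module.Dual ℝ E)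
      = -((β : E →ₗ[ℝ] Module.Dual ℝ E) ∘ₗ S) := by
    ext u x
    change β u (S x) = -(β (S u) x)
    rw [hβ, hβ, hs, hS x u]
  have h2 : Module.Dual.transpose (R := ℝ) S
      = (-1 : ℝ) • ((β : E →ₗ[ℝ] Module.Dual ℝ E) ∘ₗ S ∘ₗ (β.symm : Module.Dual ℝ E →ₗ[ℝ] E)) := by
    ext f x
    have := LinearMap.congr_fun (LinearMap.congr_fun h1 (β.symm f)) x
    simpa using this
  have h3 := LinearMap.trace_transpose' S
  rw [h2, map_smul, LinearMap.trace_comp_comm', LinearMap.comp_assoc, LinearEquiv.symm_comp,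
    LinearMap.comp_id, smul_eq_mul] at h3
  linarith

end PosDef

section Kaehler
variable {E : Type*} [NormedAddCommGroup E] [NormedSpace ℂ E]

lemma complexStructure_apply (u : E) : complexStructure E u = I • u := rfl

lemma complexStructure_sq (u : E) : complexStructure E (complexStructure E u) = -u := by
  rw [complexStructure_apply, complexStructure_apply, smul_smul, Complex.I_mul_I, neg_one_smul]

local notation "𝐉" => complexStructure E

/-- `B` is a Kähler metric on the open set `U`: it is symmetric, positive, invariant under the
complex structure, and its derivative of type `(1, 0)`,
`∂ᵥB(w, x) = (DᵥB(w, x) + D_{Jv}B(w, Jx)) / 2`, is symmetric in `v` and `w`. -/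
structure IsKaehlerOn (B : E → E →L[ℝ] E →L[ℝ] ℝ) (U : Set E) : Prop where
  isOpen : IsOpen U
  smooth : ∀ y ∈ U, ContDiffAt ℝ ∞ B y
  symm : ∀ y ∈ U, ∀ u w, B y u w = B y w u
  inv : ∀ y ∈ U, ∀ u w, B y (𝐉 u) (𝐉 w) = B y u w
  pos : ∀ y ∈ U, ∀ u, u ≠ 0 → 0 < B y u u
  closed : ∀ y ∈ U, ∀ v w x, fderiv ℝ B y v w x + fderiv ℝ B y (𝐉 v) w (𝐉 x)
    = fderiv ℝ B y w v x + fderiv ℝ B y (𝐉 w) v (𝐉 x)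

/-- The Levi-Civita connection form `Γᵥ = B⁻¹ ∂ᵥB` of a Kähler metric. -/
def kaehlerConn (B : E → E →L[ℝ] E →L[ℝ] ℝ) (v y : E) : E →L[ℝ] E :=
  (B y).inverse ∘L ((1 / 2 : ℝ) • (fderiv ℝ B y v
    + (ContinuousLinearMap.compL ℝ E E ℝ).flip 𝐉 ∘L fderiv ℝ B y (𝐉 v)))

namespace IsKaehlerOn
variable {B : E → E →L[ℝ] E →L[ℝ] ℝ} {U : Set E} (h : IsKaehlerOn B U)
include h
local notation "𝚪" => kaehlerConn B

lemma hasFDerivAt {y : E} (hy : y ∈ U) : HasFDerivAt B (fderiv ℝ B y) y :=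
  ((h.smooth y hy).differentiableAt (by simp)).hasFDerivAt

lemma fderiv_symm {y : E} (hy : y ∈ U) (v w x : E) : fderiv ℝ B y v w x = fderiv ℝ B y v x w := by
  have h1 := hasFDerivAt_bilinear_apply (h.hasFDerivAt hy) w x
  have h2 := hasFDerivAt_bilinear_apply (h.hasFDerivAt hy) x w
  have h3 : (fun z => B z w x) =ᶠ[𝓝 y] fun z => B z x w := by
    filter_upwards [h.isOpen.mem_nhds hy] with z hz using h.symm z hz w x
  exact DFunLike.congr_fun (h1.unique (h2.congr_of_eventuallyEq h3)) v

lemma fderiv_inv {y : E} (hy : y ∈ U) (v w x : E) :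
    fderiv ℝ B y v (𝐉 w) (𝐉 x) = fderiv ℝ B y v w x := by
  have h1 := hasFDerivAt_bilinear_apply (h.hasFDerivAt hy) (𝐉 w) (𝐉 x)
  have h2 := hasFDerivAt_bilinear_apply (h.hasFDerivAt hy) w x
  have h3 : (fun z => B z (𝐉 w) (𝐉 x)) =ᶠ[𝓝 y] fun z => B z w x := by
    filter_upwards [h.isOpen.mem_nhds hy] with z hz using h.inv z hz w x
  exact DFunLike.congr_fun (h1.unique (h2.congr_of_eventuallyEq h3)) v

lemma inv_left {y : E} (hy : y ∈ U) (u w : E) : B y (𝐉 u) w = -B y u (𝐉 w) := by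
  rw [← h.inv y hy u, complexStructure_sq, map_neg, neg_neg]

lemma fderiv_inv_left {y : E} (hy : y ∈ U) (v u w : E) :
    fderiv ℝ B y v (𝐉 u) w = -fderiv ℝ B y v u (𝐉 w) := by
  rw [← h.fderiv_inv hy v u, complexStructure_sq, map_neg, neg_neg]

lemma contDiffAt_fderiv {y : E} (hy : y ∈ U) (v : E) : ContDiffAt ℝ ∞ (fun z => fderiv ℝ B z v) y :=
  ((h.smooth y hy).fderiv_right (m := ∞) (by simp)).clm_apply contDiffAt_const

variable [FiniteDimensional ℂ E]

lemma contDiffAt_conn {y : E} (hy : y ∈ U) (v : E) : ContDiffAt ℝ ∞ (𝚪 v) y := by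
  refine (contDiffAt_inverse_of_pos (h.pos y hy) (h.smooth y hy)).clm_comp ?_
  exact (contDiffAt_const (c := (1 / 2 : ℝ))).smul ((h.contDiffAt_fderiv hy v).add
    (contDiffAt_const.clm_comp (h.contDiffAt_fderiv hy (𝐉 v))))

lemma apply_conn {y : E} (hy : y ∈ U) (v w x : E) : B y (𝚪 v y w) x
    = 1 / 2 * (fderiv ℝ B y v w x + fderiv ℝ B y (𝐉 v) w (𝐉 x)) := by
  rw [kaehlerConn, ContinuousLinearMap.comp_apply, apply_inverse_of_pos (h.pos y hy)]
  rfl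

lemma conn_comm {y : E} (hy : y ∈ U) (v w : E) : 𝚪 v y w = 𝚪 w y v :=
  eq_of_forall_apply_of_pos (h.pos y hy) fun x => by
    rw [h.apply_conn hy, h.apply_conn hy, h.closed y hy]

lemma conn_complexStructure {y : E} (hy : y ∈ U) (v w : E) :
    𝚪 v y (𝐉 w) = 𝐉 (𝚪 v y w) :=
  eq_of_forall_apply_of_pos (h.pos y hy) fun x => by
    rw [h.apply_conn hy, h.inv_left hy, h.apply_conn hy, h.fderiv_inv_left hy, h.fderiv_inv hy,
      complexStructure_sq, map_neg]
    ring

lemma conn_complexStructure_left {y : E} (hy : y ∈ U) (v w : E) :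
    𝚪 (𝐉 v) y w = 𝐉 (𝚪 v y w) := by
  rw [h.conn_comm hy, h.conn_complexStructure hy, h.conn_comm hy]

/-- The connection is the Levi-Civita connection. -/
lemma two_mul_apply_conn {y : E} (hy : y ∈ U) (u v w : E) :
    2 * B y (𝚪 u y v) w
      = fderiv ℝ B y u v w + fderiv ℝ B y v u w - fderiv ℝ B y w u v := by
  have h1 := h.closed y hy u v w
  have h2 := h.closed y hy u w v
  have h3 := h.closed y hy v w u
  have e1 := h.fderiv_symm hy u v w
  have e2 := h.fderiv_symm hy v u w
  have e3 := h.fderiv_symm hy w u v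
  have e4 := h.fderiv_symm hy (𝐉 w) u (𝐉 v)
  have e5 := h.fderiv_inv_left hy (𝐉 w) v u
  have e6 := h.fderiv_symm hy (𝐉 u) w (𝐉 v)
  have e7 := h.fderiv_inv_left hy (𝐉 u) v w
  have e8 := h.fderiv_symm hy (𝐉 v) w (𝐉 u)
  have e9 := h.fderiv_inv_left hy (𝐉 v) u w
  rw [h.apply_conn hy]
  linarith

/-- The part of type `(2, 0)` of the curvature vanishes. -/
lemma conn_flat {y : E} (hy : y ∈ U) (u v w : E) :
    (1 / 2 : ℝ) • (fderiv ℝ (𝚪 v) y u w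
        - 𝐉 (fderiv ℝ (𝚪 v) y (𝐉 u) w)) + 𝚪 u y (𝚪 v y w)
      = (1 / 2 : ℝ) • (fderiv ℝ (𝚪 u) y v w
        - 𝐉 (fderiv ℝ (𝚪 u) y (𝐉 v) w)) + 𝚪 v y (𝚪 u y w) := by
  set D2 := fderiv ℝ (fderiv ℝ B) y with hD2
  have hD2' : HasFDerivAt (fderiv ℝ B) D2 y :=
    (((h.smooth y hy).fderiv_right (m := ∞) (by simp)).differentiableAt (by simp)).hasFDerivAt
  have hD2s : ∀ a c, D2 a c = D2 c a := fun a c =>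
    ((h.smooth y hy).isSymmSndFDerivAt
      (by simpa using (WithTop.coe_le_coe.2 (le_top : (2 : ℕ∞) ≤ ⊤)))).eq a c
  have key : ∀ a c x, B y (fderiv ℝ (𝚪 c) y a w) x
      = 1 / 2 * (D2 a c w x + D2 a (𝐉 c) w (𝐉 x)) - fderiv ℝ B y a (𝚪 c y w) x := by
    intro a c x
    have hΓ := ((h.contDiffAt_conn hy c).differentiableAt (by simp)).hasFDerivAt
    have h1 := ((h.hasFDerivAt hy).clm_apply (hΓ.clm_apply (hasFDerivAt_const w y))).clm_apply
      (hasFDerivAt_const x y)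
    have h2 := hasFDerivAt_bilinear_apply (hD2'.clm_apply (hasFDerivAt_const c y)) w x
    have h3 := hasFDerivAt_bilinear_apply (hD2'.clm_apply (hasFDerivAt_const (𝐉 c) y)) w (𝐉 x)
    have h4 := (h2.add h3).const_mul (1 / 2)
    have h5 : (fun z => B z (𝚪 c z w) x) =ᶠ[𝓝 y]
        fun z => 1 / 2 * (fderiv ℝ B z c w x + fderiv ℝ B z (𝐉 c) w (𝐉 x)) := by
      filter_upwards [h.isOpen.mem_nhds hy] with z hz using h.apply_conn hz c w x
    have h6 := DFunLike.congr_fun (h1.unique (h4.congr_of_eventuallyEq h5)) a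
    simp at h6
    linarith
  refine eq_of_forall_apply_of_pos (h.pos y hy) fun x => ?_
  simp only [map_add, map_smul (B y), map_sub, add_apply, smul_apply, sub_apply, smul_eq_mul,
    h.inv_left hy, key, h.apply_conn hy, complexStructure_sq, map_neg, hD2s u v, hD2s u (𝐉 v),
    hD2s (𝐉 u) v, hD2s (𝐉 u) (𝐉 v)]
  ring

lemma trace_conn {y : E} (hy : y ∈ U) (w : E) :
    LinearMap.trace ℝ E (𝚪 w y)
      * (2 * gramDet (toBilin (B y))) = fderiv ℝ (fun z => gramDet (toBilin (B z))) y w := by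
  set S : E →L[ℝ] E := (B y).inverse ∘L fderiv ℝ B y w with hS
  have hSa : ∀ u x, B y (S u) x = fderiv ℝ B y w u x := fun u x => by
    rw [hS, ContinuousLinearMap.comp_apply, apply_inverse_of_pos (h.pos y hy)]
  have h1 : LinearMap.trace ℝ E
      ((𝚪 w y : E →ₗ[ℝ] E) - (1 / 2 : ℝ) • (S : E →ₗ[ℝ] E)) = 0 := by
    refine trace_eq_zero_of_skew (h.pos y hy) (h.symm y hy) ?_
    have e : ∀ u x, B y ((𝚪 w y : E →ₗ[ℝ] E) u
        - (1 / 2 : ℝ) • (S : E →ₗ[ℝ] E) u) x = 1 / 2 * fderiv ℝ B y (𝐉 w) u (𝐉 x) := by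
      intro u x
      rw [map_sub (B y), map_smul (B y), sub_apply, smul_apply]
      change B y (𝚪 w y u) x - (1 / 2 : ℝ) * B y (S u) x = _
      rw [h.apply_conn hy, hSa]
      ring
    intro u x
    have e1 := h.fderiv_symm hy (𝐉 w) u (𝐉 x)
    have e2 := h.fderiv_inv_left hy (𝐉 w) x u
    have := e u x
    have := e x u
    simp only [LinearMap.sub_apply, LinearMap.smul_apply]
    linarith
  have h2 : HasDerivAt (fun t : ℝ => gramDet (toBilin (B (y + t • w))))
      (gramDet (toBilin (B y)) * LinearMap.trace ℝ E S) 0 := by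
    set b := finBasis ℝ E with hb
    have hd := hasDerivAt_det (t := (0 : ℝ))
      (M := fun t : ℝ => Matrix.of fun i j => B (y + t • w) (b i) (b j))
      (M₀' := Matrix.of fun i j => fderiv ℝ B y w (b i) (b j))
      (A := LinearMap.toMatrix b b (S : E →ₗ[ℝ] E)) ?_ ?_ ?_
    · rw [← LinearMap.trace_eq_matrix_trace, zero_smul, add_zero, hb, ← gramDet_toBilin] at hd
      simpa only [gramDet_toBilin] using hd
    · intro i j
      have e1 : HasDerivAt (fun t : ℝ => y + t • w) w 0 := by
        simpa using ((hasDerivAt_id (0 : ℝ)).smul_const w).const_add y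
      have e2 := hasFDerivAt_bilinear_apply (h.hasFDerivAt hy) (b i) (b j)
      have e3 := e2.comp_hasDerivAt_of_eq (0 : ℝ) e1 (by simp)
      exact e3
    · ext i j
      rw [Matrix.mul_apply]
      simp only [Matrix.of_apply, zero_smul, add_zero, LinearMap.toMatrix_apply]
      rw [h.fderiv_symm hy, ← hSa (b j) (b i), h.symm y hy]
      conv_lhs => rw [← b.sum_repr (S (b j)), map_sum]
      refine Finset.sum_congr rfl fun k _ => ?_
      rw [map_smul, smul_eq_mul, mul_comm]
      rfl
    · simp only [zero_smul, add_zero]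
      rw [hb, ← gramDet_toBilin]
      exact (gramDet_ne_zero fun u hu => by_contra fun h0 => (h.pos y hy u h0).ne' hu).isUnit
  have hg : DifferentiableAt ℝ (fun z => gramDet (toBilin (B z))) y := by
    simp only [gramDet_toBilin]
    have : ContDiffAt ℝ ∞ (fun z => (Matrix.of fun i j => B z (finBasis ℝ E i)
        (finBasis ℝ E j)).det) y :=
      contDiffAt_det fun i j =>
        ((h.smooth y hy).clm_apply contDiffAt_const).clm_apply contDiffAt_const
    exact this.differentiableAt (by simp)
  have h3 : HasDerivAt (fun t : ℝ => gramDet (toBilin (B (y + t • w))))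
      (fderiv ℝ (fun z => gramDet (toBilin (B z))) y w) 0 := by
    have e1 : HasDerivAt (fun t : ℝ => y + t • w) w 0 := by
      simpa using ((hasDerivAt_id (0 : ℝ)).smul_const w).const_add y
    exact hg.hasFDerivAt.comp_hasDerivAt_of_eq (0 : ℝ) e1 (by simp)
  rw [h3.unique h2]
  rw [map_sub, map_smul, smul_eq_mul, sub_eq_zero] at h1
  rw [h1]
  ring

/-- The Ricci tensor of a Kähler metric in terms of the derivatives of the traces `tr Γ_w`. -/
lemma sum_coord_curvature {y : E} (hy : y ∈ U) (v w : E) {a b : E → ℝ}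
    (ha : ∀ᶠ z in 𝓝 y, LinearMap.trace ℝ E (𝚪 w z) = a z)
    (hb : ∀ᶠ z in 𝓝 y, LinearMap.trace ℝ E (𝚪 (𝐉 w) z) = b z) :
    ∑ i, (finBasis ℝ E).coord i
      (fderiv ℝ (𝚪 v) y (finBasis ℝ E i) w
        - fderiv ℝ (𝚪 (finBasis ℝ E i)) y v w
        + 𝚪 (finBasis ℝ E i) y (𝚪 v y w)
        - 𝚪 v y (𝚪 (finBasis ℝ E i) y w))
      = -(1 / 2) * (fderiv ℝ a y v + fderiv ℝ b y (𝐉 v)) := by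
  have hΓ : ∀ c, HasFDerivAt (𝚪 c) (fderiv ℝ (𝚪 c) y) y := fun c =>
    ((h.contDiffAt_conn hy c).differentiableAt (by simp)).hasFDerivAt
  have hΓa : ∀ c e, HasFDerivAt (fun z => 𝚪 c z e)
      ((fderiv ℝ (𝚪 c) y).flip e) y := fun c e => by
    refine ((hΓ c).clm_apply (hasFDerivAt_const e y)).congr_fderiv
      (ContinuousLinearMap.ext fun x => ?_)
    simp
  have hcomm : ∀ c e x, fderiv ℝ (𝚪 c) y x e = fderiv ℝ (𝚪 e) y x c := by
    intro c e x
    have h3 : (fun z => 𝚪 c z e) =ᶠ[𝓝 y] fun z => 𝚪 e z c := by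
      filter_upwards [h.isOpen.mem_nhds hy] with z hz using h.conn_comm hz c e
    exact congrArg (fun l : E →L[ℝ] E => l x)
      ((hΓa c e).unique ((hΓa e c).congr_of_eventuallyEq h3))
  have hJ : ∀ c e x, 𝐉 (fderiv ℝ (𝚪 c) y x e)
      = fderiv ℝ (𝚪 (𝐉 c)) y x e := by
    intro c e x
    have h3 : (fun z => 𝚪 (𝐉 c) z e) =ᶠ[𝓝 y] fun z => 𝐉 (𝚪 c z e) := by
      filter_upwards [h.isOpen.mem_nhds hy] with z hz using h.conn_complexStructure_left hz c e
    exact (congrArg (fun l : E →L[ℝ] E => l x) ((hΓa (𝐉 c) e).unique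
      (((𝐉).hasFDerivAt.comp y (hΓa c e)).congr_of_eventuallyEq h3))).symm
  -- the trace of `u ↦ ∂̄ᵤ Γ(v, w)` vanishes because this map is antilinear
  have e1 : ∑ i, (finBasis ℝ E).coord i ((1 / 2 : ℝ) •
      (fderiv ℝ (𝚪 v) y (finBasis ℝ E i) w
        + 𝐉 (fderiv ℝ (𝚪 v) y (𝐉 (finBasis ℝ E i)) w))) = 0 := by
    set L : E →ₗ[ℝ] E := (((fderiv ℝ (𝚪 v) y).flip w : E →L[ℝ] E) : E →ₗ[ℝ] E) with hL
    set j : E →ₗ[ℝ] E := ((𝐉 : E →L[ℝ] E) : E →ₗ[ℝ] E) with hj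
    have e2 := sum_coord_eq_trace ((1 / 2 : ℝ) • (L + j ∘ₗ L ∘ₗ j))
    refine Eq.trans ?_ (e2.trans ?_)
    · rfl
    · rw [map_smul, map_add, LinearMap.trace_comp_comm', LinearMap.comp_assoc]
      have : j ∘ₗ j = -LinearMap.id := LinearMap.ext fun u => complexStructure_sq u
      rw [this, LinearMap.comp_neg, LinearMap.comp_id, map_neg, add_neg_cancel, smul_zero]
  have htr : ∀ (c : E) (f : E → ℝ) (x : E),
      (∀ᶠ z in 𝓝 y, LinearMap.trace ℝ E (𝚪 c z) = f z) →
      fderiv ℝ f y x = ∑ i, (finBasis ℝ E).coord i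
        (fderiv ℝ (𝚪 c) y x (finBasis ℝ E i)) := by
    intro c f x hf
    let T : (E →L[ℝ] E) →L[ℝ] ℝ := toContinuousLinearMap
      (LinearMap.trace ℝ E ∘ₗ ContinuousLinearMap.coeLM ℝ)
    have h1 : HasFDerivAt f (T ∘L fderiv ℝ (𝚪 c) y) y :=
      (T.hasFDerivAt.comp y (hΓ c)).congr_of_eventuallyEq (hf.mono fun z hz => hz.symm)
    rw [h1.fderiv]
    exact (sum_coord_eq_trace (fderiv ℝ (𝚪 c) y x : E →ₗ[ℝ] E)).symm
  rw [htr w a v ha, htr (𝐉 w) b (𝐉 v) hb, ← Finset.sum_add_distrib, Finset.mul_sum,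
    ← sub_eq_zero, ← Finset.sum_sub_distrib]
  refine Eq.trans (Finset.sum_congr rfl fun i _ => ?_) e1
  set e := finBasis ℝ E i
  have hf := h.conn_flat hy e v w
  rw [← hJ w e (𝐉 v), hcomm w e v, hcomm w e (𝐉 v)]
  have hf' : fderiv ℝ (𝚪 v) y e w - fderiv ℝ (𝚪 e) y v w
        + 𝚪 e y (𝚪 v y w) - 𝚪 v y (𝚪 e y w)
      = (1 / 2 : ℝ) • (fderiv ℝ (𝚪 v) y e w
          + 𝐉 (fderiv ℝ (𝚪 v) y (𝐉 e) w))
        - (1 / 2 : ℝ) • (fderiv ℝ (𝚪 e) y v w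
          + 𝐉 (fderiv ℝ (𝚪 e) y (𝐉 v) w)) := by
    linear_combination (norm := module) hf
  rw [hf', map_sub]
  simp only [map_smul, map_add, smul_eq_mul]
  ring

end IsKaehlerOn
end Kaehler

/-! ### Metrics `B + τ ⊗ τ` over a Kähler metric `B` -/

section Congr
variable {E : Type*} [NormedAddCommGroup E] [NormedSpace ℝ E]

lemma christoffel_congr {G G' : E → E →L[ℝ] E →L[ℝ] ℝ} {y : E} (h : G =ᶠ[𝓝 y] G') (u v : E) :
    christoffel G u v =ᶠ[𝓝 y] christoffel G' u v := by
  filter_upwards [h, h.fderiv (𝕜 := ℝ)] with z hz hz'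
  rw [christoffel, christoffel, hz, hz']

lemma curvature_congr {G G' : E → E →L[ℝ] E →L[ℝ] ℝ} {y : E} (h : G =ᶠ[𝓝 y] G') (u v w : E) :
    curvature G u v w y = curvature G' u v w y := by
  have h1 := fun a c => christoffel_congr h a c
  rw [curvature, curvature, (h1 v w).fderiv_eq, (h1 u w).fderiv_eq, (h1 v w).eq_of_nhds,
    (h1 u w).eq_of_nhds, (h1 u _).eq_of_nhds, (h1 v _).eq_of_nhds]

lemma sum_coord_smul [FiniteDimensional ℝ E] (f : E →ₗ[ℝ] ℝ) (x : E) :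
    ∑ i, (finBasis ℝ E).coord i (f (finBasis ℝ E i) • x) = f x := by
  conv_rhs => rw [← (finBasis ℝ E).sum_repr x, map_sum]
  refine Finset.sum_congr rfl fun i _ => ?_
  rw [map_smul, map_smul, smul_eq_mul, smul_eq_mul, mul_comm]
  rfl

lemma two_mul_christoffel [FiniteDimensional ℝ E] {G : E → E →L[ℝ] E →L[ℝ] ℝ} {y : E}
    (h : ∀ u, u ≠ 0 → 0 < G y u u) (u v w : E) : 2 * G y (christoffel G u v y) w
      = fderiv ℝ G y u v w + fderiv ℝ G y v u w - fderiv ℝ G y w u v := by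
  rw [christoffel, apply_inverse_of_pos h]
  simp

end Congr

section Lift
variable {E : Type*} [NormedAddCommGroup E] [NormedSpace ℂ E]
  {N : Type*} [NormedAddCommGroup N] [NormedSpace ℝ N]

local notation "𝐉" => complexStructure E

/-- The metric `B + τ ⊗ τ` on an open subset of `E × N`, for a metric `B` on an open subset of `E`
and a `1`-form `τ`. -/
def liftMetric (B : E → E →L[ℝ] E →L[ℝ] ℝ) (τ : E × N → E × N →L[ℝ] ℝ) (y : E × N) :
    E × N →L[ℝ] E × N →L[ℝ] ℝ :=
  (B y.1).bilinearComp (ContinuousLinearMap.fst ℝ E N) (ContinuousLinearMap.fst ℝ E N)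
    + (τ y).smulRight (τ y)

lemma liftMetric_apply (B : E → E →L[ℝ] E →L[ℝ] ℝ) (τ : E × N → E × N →L[ℝ] ℝ)
    (y u v : E × N) : liftMetric B τ y u v = B y.1 u.1 v.1 + τ y u * τ y v := by
  simp [liftMetric]

/-- `τ` is a connection form, on the open set `Ω` over `U`, whose curvature is twice the
fundamental form of the metric `B`: `dτ(u, v) = 2 B(Ju, v)`. The fibre direction, on which `τ` does
not vanish, has dimension one. -/
structure IsConnectionOn (B : E → E →L[ℝ] E →L[ℝ] ℝ) (U : Set E) (τ : E × N → E × N →L[ℝ] ℝ)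
    (Ω : Set (E × N)) : Prop where
  isOpen : IsOpen Ω
  fst_mem : ∀ y ∈ Ω, y.1 ∈ U
  smooth : ∀ y ∈ Ω, ContDiffAt ℝ ∞ τ y
  curv : ∀ y ∈ Ω, ∀ u v : E × N, fderiv ℝ τ y u v - fderiv ℝ τ y v u = 2 * B y.1 (𝐉 u.1) v.1
  exists_vertical : ∀ y ∈ Ω, ∃ ξ : E × N, ξ.1 = 0 ∧ τ y ξ = 1
  eq_zero : ∀ y ∈ Ω, ∀ u : E × N, u.1 = 0 → τ y u = 0 → u = 0

namespace IsConnectionOn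
variable {B : E → E →L[ℝ] E →L[ℝ] ℝ} {U : Set E} {τ : E × N → E × N →L[ℝ] ℝ} {Ω : Set (E × N)}
  (hB : IsKaehlerOn B U) (h : IsConnectionOn B U τ Ω)
include hB h
local notation "𝚪" => kaehlerConn B
local notation "𝚪₁" => christoffel (liftMetric B τ)

lemma pos {y : E × N} (hy : y ∈ Ω) (u : E × N) (hu : u ≠ 0) : 0 < liftMetric B τ y u u := by
  rw [liftMetric_apply]
  by_cases h1 : u.1 = 0
  · have h2 : τ y u ≠ 0 := fun h2 => hu (h.eq_zero y hy u h1 h2)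
    rw [h1, map_zero (B y.1), zero_apply, zero_add]
    exact mul_self_pos.2 h2
  · have := hB.pos y.1 (h.fst_mem y hy) u.1 h1
    have := mul_self_nonneg (τ y u)
    linarith

lemma contDiffAt_liftMetric {y : E × N} (hy : y ∈ Ω) : ContDiffAt ℝ ∞ (liftMetric B τ) y := by
  have h1 : ContDiffAt ℝ ∞ (fun z : E × N => B z.1) y :=
    ContDiffAt.comp (g := B) (f := Prod.fst) y (hB.smooth y.1 (h.fst_mem y hy)) contDiffAt_fst
  have h2 := h.smooth y hy
  have e : liftMetric B τ = fun z => (((ContinuousLinearMap.compL ℝ (E × N) E ℝ).flip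
      (ContinuousLinearMap.fst ℝ E N)) ∘L B z.1) ∘L (ContinuousLinearMap.fst ℝ E N)
        + ContinuousLinearMap.smulRightL ℝ (E × N) (E × N →L[ℝ] ℝ) (τ z) (τ z) := by
    exact funext fun z => ContinuousLinearMap.ext fun u => ContinuousLinearMap.ext fun v => rfl
  rw [e]
  refine ContDiffAt.add ?_ ?_
  · exact (contDiffAt_const.clm_comp h1).clm_comp contDiffAt_const
  · exact (contDiffAt_const.clm_apply h2).clm_apply h2

lemma hasFDerivAt {y : E × N} (hy : y ∈ Ω) : HasFDerivAt τ (fderiv ℝ τ y) y :=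
  ((h.smooth y hy).differentiableAt (by simp)).hasFDerivAt

lemma hasFDerivAt_apply {y : E × N} (hy : y ∈ Ω) (u : E × N) :
    HasFDerivAt (fun z => τ z u) ((fderiv ℝ τ y).flip u) y := by
  refine ((h.hasFDerivAt hB hy).clm_apply (hasFDerivAt_const u y)).congr_fderiv
    (ContinuousLinearMap.ext fun x => ?_)
  simp

lemma fderiv_liftMetric {y : E × N} (hy : y ∈ Ω) (u v w : E × N) :
    fderiv ℝ (liftMetric B τ) y u v w = fderiv ℝ B y.1 u.1 v.1 w.1
      + fderiv ℝ τ y u v * τ y w + τ y v * fderiv ℝ τ y u w := by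
  have h1 := hasFDerivAt_bilinear_apply
    ((h.contDiffAt_liftMetric hB hy).differentiableAt (by simp)).hasFDerivAt v w
  have h2 := (hasFDerivAt_bilinear_apply (hB.hasFDerivAt (h.fst_mem y hy)) v.1 w.1).comp y
    (hasFDerivAt_fst (𝕜 := ℝ) (E := E) (F := N) (p := y))
  have h3 := h2.add ((h.hasFDerivAt_apply hB hy v).mul (h.hasFDerivAt_apply hB hy w))
  have h4 := congrArg (fun l : E × N →L[ℝ] ℝ => l u) (h1.unique
    (h3.congr_of_eventuallyEq (Filter.Eventually.of_forall fun z => liftMetric_apply B τ z v w)))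
  simp at h4
  linarith

variable [FiniteDimensional ℂ E] [FiniteDimensional ℝ N]

/-- The components of the Christoffel symbols: the part in `E`, and the value of `τ`. -/
lemma christoffel_liftMetric {y : E × N} (hy : y ∈ Ω) (u v : E × N) :
    (𝚪₁ u v y).1
        = 𝚪 u.1 y.1 v.1 + τ y v • 𝐉 u.1 + τ y u • 𝐉 v.1 ∧
      τ y (𝚪₁ u v y) = 1 / 2 * (fderiv ℝ τ y u v + fderiv ℝ τ y v u) := by
  obtain ⟨ξ, hξ, hξ'⟩ := h.exists_vertical y hy
  have hyU := h.fst_mem y hy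
  set a : E := 𝚪 u.1 y.1 v.1 + τ y v • 𝐉 u.1 + τ y u • 𝐉 v.1 with ha
  set t : ℝ := 1 / 2 * (fderiv ℝ τ y u v + fderiv ℝ τ y v u) with ht
  obtain ⟨c, hc, hc'⟩ : ∃ c : E × N, c.1 = a ∧ τ y c = t := by
    refine ⟨(a, 0) + (t - τ y (a, 0)) • ξ, ?_, ?_⟩
    · simp [hξ]
    · rw [map_add, map_smul, hξ', smul_eq_mul]; ring
  have key : 𝚪₁ u v y = c := by
    refine eq_of_forall_apply_of_pos (h.pos hB hy) fun w => ?_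
    have e := two_mul_christoffel (h.pos hB hy) u v w
    have e1 := hB.two_mul_apply_conn hyU u.1 v.1 w.1
    have e2 := h.curv y hy u w
    have e3 := h.curv y hy v w
    rw [h.fderiv_liftMetric hB hy, h.fderiv_liftMetric hB hy, h.fderiv_liftMetric hB hy] at e
    have e4 : liftMetric B τ y c w = B y.1 (𝚪 u.1 y.1 v.1) w.1
        + τ y v * B y.1 (𝐉 u.1) w.1 + τ y u * B y.1 (𝐉 v.1) w.1 + t * τ y w := by
      rw [liftMetric_apply, hc, hc', ha]
      simp only [map_add, map_smul (B y.1), add_apply, smul_apply, smul_eq_mul]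
    rw [e4]
    linear_combination e / 2 - e1 / 2 + τ y v * e2 / 2 + τ y u * e3 / 2
      + τ y w * (ht ▸ rfl : t = 1 / 2 * (fderiv ℝ τ y u v + fderiv ℝ τ y v u))
  rw [key]
  exact ⟨hc, hc'⟩

lemma contDiffAt_christoffel {y : E × N} (hy : y ∈ Ω) (u v : E × N) :
    ContDiffAt ℝ ∞ (𝚪₁ u v) y := by
  have h1 := h.contDiffAt_liftMetric hB hy
  have h2 : ∀ a, ContDiffAt ℝ ∞ (fun z => fderiv ℝ (liftMetric B τ) z a) y := fun a =>
    (h1.fderiv_right (m := ∞) (by simp)).clm_apply contDiffAt_const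
  have h3 : ContDiffAt ℝ ∞ (fun z => ((fderiv ℝ (liftMetric B τ) z).flip u).flip v) y := by
    have e : (fun z => ((fderiv ℝ (liftMetric B τ) z).flip u).flip v)
        = fun z => (ContinuousLinearMap.apply ℝ ℝ v ∘L
          ContinuousLinearMap.apply ℝ (E × N →L[ℝ] ℝ) u) ∘L fderiv ℝ (liftMetric B τ) z :=
      funext fun z => ContinuousLinearMap.ext fun a => rfl
    rw [e]
    exact contDiffAt_const.clm_comp (h1.fderiv_right (m := ∞) (by simp))
  refine (contDiffAt_inverse_of_pos (h.pos hB hy) h1).clm_apply ?_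
  exact (contDiffAt_const (c := (1 / 2 : ℝ))).smul
    ((((h2 u).clm_apply contDiffAt_const).add ((h2 v).clm_apply contDiffAt_const)).sub h3)

lemma fderiv_christoffel_fst {y : E × N} (hy : y ∈ Ω) (u v w : E × N) :
    (fderiv ℝ (𝚪₁ v w) y u).1
      = fderiv ℝ (𝚪 v.1) y.1 u.1 w.1 + fderiv ℝ τ y u w • 𝐉 v.1
        + fderiv ℝ τ y u v • 𝐉 w.1 := by
  have h1 := ((ContinuousLinearMap.fst ℝ E N).hasFDerivAt.comp y
    ((h.contDiffAt_christoffel hB hy v w).differentiableAt (by simp)).hasFDerivAt)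
  have hΓ := (((hB.contDiffAt_conn (h.fst_mem y hy) v.1).differentiableAt
    (by simp)).hasFDerivAt.comp y (hasFDerivAt_fst (𝕜 := ℝ) (E := E) (F := N) (p := y))).clm_apply
    (hasFDerivAt_const w.1 y)
  have h2 := (hΓ.add ((h.hasFDerivAt_apply hB hy w).smul_const (𝐉 v.1))).add
    ((h.hasFDerivAt_apply hB hy v).smul_const (𝐉 w.1))
  have h3 : (ContinuousLinearMap.fst ℝ E N ∘ 𝚪₁ v w) =ᶠ[𝓝 y] fun z =>
      𝚪 v.1 z.1 w.1 + τ z w • 𝐉 v.1 + τ z v • 𝐉 w.1 := by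
    filter_upwards [h.isOpen.mem_nhds hy] with z hz using (h.christoffel_liftMetric hB hz v w).1
  have h4 := DFunLike.congr_fun (h1.unique (h2.congr_of_eventuallyEq h3)) u
  simpa using h4

lemma apply_fderiv_christoffel {y : E × N} (hy : y ∈ Ω) (u v w : E × N) :
    τ y (fderiv ℝ (𝚪₁ v w) y u)
      = 1 / 2 * (fderiv ℝ (fderiv ℝ τ) y u v w + fderiv ℝ (fderiv ℝ τ) y u w v)
        - fderiv ℝ τ y u (𝚪₁ v w y) := by
  have h1 := (h.hasFDerivAt hB hy).clm_apply
    ((h.contDiffAt_christoffel hB hy v w).differentiableAt (by simp)).hasFDerivAt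
  have hD : HasFDerivAt (fderiv ℝ τ) (fderiv ℝ (fderiv ℝ τ) y) y :=
    (((h.smooth y hy).fderiv_right (m := ∞) (by simp)).differentiableAt (by simp)).hasFDerivAt
  have h2 := (((hD.clm_apply (hasFDerivAt_const v y)).clm_apply (hasFDerivAt_const w y)).add
    ((hD.clm_apply (hasFDerivAt_const w y)).clm_apply (hasFDerivAt_const v y))).const_mul (1 / 2)
  have h3 : (fun z => τ z (𝚪₁ v w z)) =ᶠ[𝓝 y] fun z =>
      1 / 2 * (fderiv ℝ τ z v w + fderiv ℝ τ z w v) := by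
    filter_upwards [h.isOpen.mem_nhds hy] with z hz using (h.christoffel_liftMetric hB hz v w).2
  have h4 := DFunLike.congr_fun (h1.unique (h2.congr_of_eventuallyEq h3)) u
  simp at h4
  linarith

lemma curvature_liftMetric_fst {y : E × N} (hy : y ∈ Ω) (u v w : E × N) :
    (curvature (liftMetric B τ) u v w y).1
      = (fderiv ℝ (𝚪 v.1) y.1 u.1 w.1 - fderiv ℝ (𝚪 u.1) y.1 v.1 w.1
          + 𝚪 u.1 y.1 (𝚪 v.1 y.1 w.1)
          - 𝚪 v.1 y.1 (𝚪 u.1 y.1 w.1))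
        + (2 * B y.1 (𝐉 u.1) v.1) • 𝐉 w.1 + B y.1 (𝐉 u.1) w.1 • 𝐉 v.1
        - B y.1 (𝐉 v.1) w.1 • 𝐉 u.1 + (τ y w * τ y v) • u.1 - (τ y w * τ y u) • v.1 := by
  have hyU := h.fst_mem y hy
  have e1 := fun a c => (h.christoffel_liftMetric hB hy a c).1
  have e2 := fun a c => (h.christoffel_liftMetric hB hy a c).2
  rw [← h.curv y hy]
  have c2 : B y.1 (𝐉 u.1) w.1 = 1 / 2 * (fderiv ℝ τ y u w - fderiv ℝ τ y w u) := by
    rw [h.curv y hy]; ring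
  have c3 : B y.1 (𝐉 v.1) w.1 = 1 / 2 * (fderiv ℝ τ y v w - fderiv ℝ τ y w v) := by
    rw [h.curv y hy]; ring
  rw [c2, c3, curvature]
  simp only [Prod.fst_add, Prod.fst_sub, h.fderiv_christoffel_fst hB hy, e1, e2, map_add, map_smul,
    hB.conn_complexStructure hyU, complexStructure_sq, hB.conn_comm hyU v.1 u.1]
  module

lemma apply_curvature_liftMetric {y : E × N} (hy : y ∈ Ω) (ξ v w : E × N) (hξ : ξ.1 = 0)
    (hξ' : τ y ξ = 1) : τ y (curvature (liftMetric B τ) ξ v w y) = B y.1 v.1 w.1 := by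
  have hyU := h.fst_mem y hy
  have e1 := fun a c => (h.christoffel_liftMetric hB hy a c).1
  have e2 := fun a c => (h.christoffel_liftMetric hB hy a c).2
  have hs : ∀ a c, fderiv ℝ (fderiv ℝ τ) y a c = fderiv ℝ (fderiv ℝ τ) y c a := fun a c =>
    ((h.smooth y hy).isSymmSndFDerivAt
      (by simpa using (WithTop.coe_le_coe.2 (le_top : (2 : ℕ∞) ≤ ⊤)))).eq a c
  have hD : HasFDerivAt (fderiv ℝ τ) (fderiv ℝ (fderiv ℝ τ) y) y :=
    (((h.smooth y hy).fderiv_right (m := ∞) (by simp)).differentiableAt (by simp)).hasFDerivAt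
  -- the derivative along `w` of `dτ(ξ, v) = 0`
  have h0 : fderiv ℝ (fderiv ℝ τ) y w ξ v - fderiv ℝ (fderiv ℝ τ) y w v ξ = 0 := by
    have h1 := ((hD.clm_apply (hasFDerivAt_const ξ y)).clm_apply (hasFDerivAt_const v y)).sub
      ((hD.clm_apply (hasFDerivAt_const v y)).clm_apply (hasFDerivAt_const ξ y))
    have h3 : (fun z => fderiv ℝ τ z ξ v - fderiv ℝ τ z v ξ) =ᶠ[𝓝 y] fun z => (0 : ℝ) := by
      filter_upwards [h.isOpen.mem_nhds hy] with z hz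
      rw [h.curv z hz, hξ, map_zero, map_zero (B z.1), zero_apply, mul_zero]
    have h4 := congrArg (fun l : E × N →L[ℝ] ℝ => l w)
      (h1.unique ((hasFDerivAt_const (0 : ℝ) y).congr_of_eventuallyEq h3))
    simpa using h4
  set Γvw := 𝚪₁ v w y with hΓvw
  set Γξw := 𝚪₁ ξ w y with hΓξw
  have c1 := h.curv y hy ξ Γvw
  have c2 := h.curv y hy v Γξw
  have c3 : B y.1 (𝐉 v.1) Γξw.1 = B y.1 v.1 w.1 := by
    rw [hΓξw, e1, hξ, hξ', map_zero, smul_zero, add_zero, one_smul, hB.conn_comm hyU, map_zero,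
      zero_add, hB.inv y.1 hyU]
  rw [hξ, map_zero, map_zero (B y.1), zero_apply, mul_zero] at c1
  rw [curvature, map_sub, map_add, map_sub, h.apply_fderiv_christoffel hB hy,
    h.apply_fderiv_christoffel hB hy, e2, e2, hs ξ v, hs v w, hs ξ w]
  linear_combination h0 / 2 + c1 / 2 * (-1) + c2 / 2 + c3

lemma isLinearMap_curvature {y : E × N} (hy : y ∈ Ω) (v w : E × N) :
    IsLinearMap ℝ (fun u => curvature (liftMetric B τ) u v w y) := by
  have hd := fun a => (h.contDiffAt_christoffel hB hy a w).differentiableAt (n := ∞) (by simp)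
  have e1 : ∀ a c b z, 𝚪₁ (a + c) b z
      = 𝚪₁ a b z + 𝚪₁ c b z := by
    intro a c b z
    rw [christoffel, christoffel, christoffel, ← map_add]
    congr 1
    ext <;> simp <;> ring
  have e2 : ∀ (r : ℝ) a b z, 𝚪₁ (r • a) b z
      = r • 𝚪₁ a b z := by
    intro r a b z
    rw [christoffel, christoffel, ← map_smul]
    congr 1
    ext <;> simp <;> ring
  have e3 : ∀ a c b z, 𝚪₁ a (c + b) z
      = 𝚪₁ a c z + 𝚪₁ a b z := by
    intro a c b z
    rw [christoffel, christoffel, christoffel, ← map_add]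
    congr 1
    ext <;> simp <;> ring
  have e4 : ∀ (r : ℝ) a b z, 𝚪₁ a (r • b) z
      = r • 𝚪₁ a b z := by
    intro r a b z
    rw [christoffel, christoffel, ← map_smul]
    congr 1
    ext <;> simp <;> ring
  refine ⟨fun a c => ?_, fun r a => ?_⟩
  · have : 𝚪₁ (a + c) w
        = 𝚪₁ a w + 𝚪₁ c w :=
      funext fun z => e1 a c w z
    simp only [curvature]
    rw [this, fderiv_add (hd a) (hd c)]
    simp only [map_add, add_apply, Pi.add_apply, e1, e3]
    abel
  · have : 𝚪₁ (r • a) w = r • 𝚪₁ a w :=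
      funext fun z => e2 r a w z
    simp only [curvature]
    rw [this, fderiv_const_smul (hd a)]
    simp only [map_smul, smul_apply, Pi.smul_apply, e2, e4]
    module

/-- The Ricci tensor of `B + τ ⊗ τ` in terms of the derivatives of the traces of the connection
form of `B`. -/
lemma sum_coord_curvature {y : E × N} (hy : y ∈ Ω) (v w : E × N) {a b : E → ℝ}
    (ha : ∀ᶠ z in 𝓝 y.1, LinearMap.trace ℝ E (𝚪 w.1 z) = a z)
    (hb : ∀ᶠ z in 𝓝 y.1, LinearMap.trace ℝ E (𝚪 (𝐉 w.1) z) = b z) :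
    ∑ i, (finBasis ℝ (E × N)).coord i
        (curvature (liftMetric B τ) (finBasis ℝ (E × N) i) v w y)
      = -(1 / 2) * (fderiv ℝ a y.1 v.1 + fderiv ℝ b y.1 (𝐉 v.1)) - 2 * B y.1 v.1 w.1
        + finrank ℝ E * (τ y v * τ y w) := by
  have hyU := h.fst_mem y hy
  obtain ⟨ξ, hξ, hξ'⟩ := h.exists_vertical y hy
  let R : E × N →ₗ[ℝ] E × N := IsLinearMap.mk' _ (h.isLinearMap_curvature hB hy v w)
  -- `id = hor ∘ fst + ξ ⊗ τ`, for the horizontal lift `hor`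
  let hor : E →ₗ[ℝ] E × N := LinearMap.inl ℝ E N - ((τ y : E × N →ₗ[ℝ] ℝ) ∘ₗ
    LinearMap.inl ℝ E N).smulRight ξ
  have hhor : ∀ e, hor e = (e, 0) - τ y (e, 0) • ξ := fun e => rfl
  have hhor1 : ∀ e, (hor e).1 = e := fun e => by simp [hhor, hξ]
  have hhor2 : ∀ e, τ y (hor e) = 0 := fun e => by simp [hhor, hξ']
  have hid : hor ∘ₗ LinearMap.fst ℝ E N + (τ y : E × N →ₗ[ℝ] ℝ).smulRight ξ = LinearMap.id := by
    refine LinearMap.ext fun u => sub_eq_zero.1 (h.eq_zero y hy _ ?_ ?_)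
    · simp [hhor1, hξ]
    · simp [hhor2, hξ']
  have htr : LinearMap.trace ℝ (E × N) R
      = LinearMap.trace ℝ E (LinearMap.fst ℝ E N ∘ₗ R ∘ₗ hor) + τ y (R ξ) := by
    have e1 : R = R ∘ₗ hor ∘ₗ LinearMap.fst ℝ E N + (τ y : E × N →ₗ[ℝ] ℝ).smulRight (R ξ) := by
      conv_lhs => rw [← LinearMap.comp_id R, ← hid, LinearMap.comp_add]
      congr 1
      exact LinearMap.ext fun u => by simp
    have e2 : LinearMap.trace ℝ (E × N) ((τ y : E × N →ₗ[ℝ] ℝ).smulRight (R ξ)) = τ y (R ξ) := by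
      rw [← sum_coord_eq_trace]
      exact sum_coord_smul (τ y : E × N →ₗ[ℝ] ℝ) (R ξ)
    conv_lhs => rw [e1, map_add, e2, ← LinearMap.comp_assoc, LinearMap.trace_comp_comm']
  have hRξ : τ y (R ξ) = B y.1 v.1 w.1 := h.apply_curvature_liftMetric hB hy ξ v w hξ hξ'
  have hJ : LinearMap.trace ℝ E ((𝐉 : E →L[ℝ] E) : E →ₗ[ℝ] E) = 0 :=
    trace_eq_zero_of_skew (hB.pos y.1 hyU) (hB.symm y.1 hyU) fun u x => by
      change B y.1 (𝐉 u) x = -B y.1 (𝐉 x) u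
      rw [hB.inv_left hyU, hB.symm y.1 hyU u]
  have s1 := sum_coord_smul ((2 : ℝ) • ((B y.1).flip v.1 ∘L 𝐉 : E →ₗ[ℝ] ℝ)) (𝐉 w.1)
  have s2 := sum_coord_smul ((B y.1).flip w.1 ∘L 𝐉 : E →ₗ[ℝ] ℝ) (𝐉 v.1)
  have s3 := sum_coord_eq_trace ((𝐉 : E →L[ℝ] E) : E →ₗ[ℝ] E)
  have s4 := sum_coord_eq_trace (LinearMap.id : E →ₗ[ℝ] E)
  have s5 := hB.sum_coord_curvature hyU v.1 w.1 ha hb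
  rw [LinearMap.trace_id] at s4
  rw [hJ] at s3
  have h1 := sum_coord_eq_trace R
  rw [htr, hRξ, ← sum_coord_eq_trace] at h1
  refine h1.trans ?_
  have h2 : ∀ e, (LinearMap.fst ℝ E N ∘ₗ R ∘ₗ hor) e
      = (fderiv ℝ (𝚪 v.1) y.1 e w.1 - fderiv ℝ (𝚪 e) y.1 v.1 w.1
          + 𝚪 e y.1 (𝚪 v.1 y.1 w.1)
          - 𝚪 v.1 y.1 (𝚪 e y.1 w.1))
        + ((2 : ℝ) • ((B y.1).flip v.1 ∘L 𝐉 : E →ₗ[ℝ] ℝ)) e • 𝐉 w.1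
        + ((B y.1).flip w.1 ∘L 𝐉 : E →ₗ[ℝ] ℝ) e • 𝐉 v.1
        - B y.1 (𝐉 v.1) w.1 • ((𝐉 : E →L[ℝ] E) : E →ₗ[ℝ] E) e
        + (τ y w * τ y v) • (LinearMap.id : E →ₗ[ℝ] E) e := by
    intro e
    have := h.curvature_liftMetric_fst hB hy (hor e) v w
    rw [hhor1, hhor2, mul_zero, zero_smul, sub_zero] at this
    exact this
  simp only [h2, map_add, map_sub, map_smul, Finset.sum_add_distrib, Finset.sum_sub_distrib,
    smul_eq_mul, ← Finset.mul_sum] at s1 s2 s3 s4 s5 ⊢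
  have t1 : ((2 : ℝ) • ((B y.1).flip v.1 ∘L 𝐉 : E →ₗ[ℝ] ℝ)) (𝐉 w.1) = -(2 * B y.1 v.1 w.1) := by
    change (2 : ℝ) * B y.1 (𝐉 (𝐉 w.1)) v.1 = _
    rw [complexStructure_sq, map_neg, neg_apply, hB.symm y.1 hyU w.1]
    ring
  have t2 : ((B y.1).flip w.1 ∘L 𝐉 : E →ₗ[ℝ] ℝ) (𝐉 v.1) = -B y.1 v.1 w.1 := by
    change B y.1 (𝐉 (𝐉 v.1)) w.1 = _
    rw [complexStructure_sq, map_neg, neg_apply]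
  rw [t1] at s1
  rw [t2] at s2
  linear_combination s5 + s1 + s2 - B y.1 (𝐉 v.1) w.1 * s3 + τ y w * τ y v * s4

end IsConnectionOn
end Lift

/-! ### Kähler potentials -/

section Potential
variable {E : Type*} [NormedAddCommGroup E] [NormedSpace ℂ E]

local notation "𝐉" => complexStructure E

/-- The `J`-invariant part (doubled) of the Hessian of a function. -/
def leviForm (F : E → ℝ) (y : E) : E →L[ℝ] E →L[ℝ] ℝ :=
  fderiv ℝ (fderiv ℝ F) y + (fderiv ℝ (fderiv ℝ F) y).bilinearComp 𝐉 𝐉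

lemma leviForm_apply (F : E → ℝ) (y u w : E) : leviForm F y u w
    = fderiv ℝ (fderiv ℝ F) y u w + fderiv ℝ (fderiv ℝ F) y (𝐉 u) (𝐉 w) := rfl

lemma two_le_infty : minSmoothness ℝ 2 ≤ (∞ : WithTop ℕ∞) := by
  simpa using (WithTop.coe_le_coe.2 (le_top : (2 : ℕ∞) ≤ ⊤))

lemma contDiffAt_leviForm {F : E → ℝ} {y : E} (hF : ContDiffAt ℝ ∞ F y) :
    ContDiffAt ℝ ∞ (leviForm F) y := by
  have h2 : ContDiffAt ℝ ∞ (fderiv ℝ (fderiv ℝ F)) y :=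
    (hF.fderiv_right (m := ∞) (by simp)).fderiv_right (m := ∞) (by simp)
  have e : leviForm F = fun z => fderiv ℝ (fderiv ℝ F) z
      + ((ContinuousLinearMap.compL ℝ E E ℝ).flip 𝐉 ∘L fderiv ℝ (fderiv ℝ F) z) ∘L 𝐉 :=
    funext fun z => ContinuousLinearMap.ext fun u => ContinuousLinearMap.ext fun v => rfl
  rw [e]
  exact h2.add ((contDiffAt_const.clm_comp h2).clm_comp contDiffAt_const)

/-- The symmetry of the third derivatives of the potential is the Kähler condition. -/
lemma IsKaehlerOn.of_potential {B : E → E →L[ℝ] E →L[ℝ] ℝ} {U : Set E} {F : E → ℝ} {c : ℝ}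
    (hU : IsOpen U) (hF : ∀ y ∈ U, ContDiffAt ℝ ∞ F y)
    (hB : ∀ y ∈ U, ∀ u w, B y u w = c * leviForm F y u w)
    (hpos : ∀ y ∈ U, ∀ u, u ≠ 0 → 0 < B y u u) : IsKaehlerOn B U := by
  have hB' : ∀ y ∈ U, B =ᶠ[𝓝 y] fun z => c • leviForm F z := fun y hy => by
    filter_upwards [hU.mem_nhds hy] with z hz
    exact ContinuousLinearMap.ext fun u => ContinuousLinearMap.ext fun w => hB z hz u w
  have hs : ∀ y ∈ U, ∀ u w, fderiv ℝ (fderiv ℝ F) y u w = fderiv ℝ (fderiv ℝ F) y w u :=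
    fun y hy u w => ((hF y hy).isSymmSndFDerivAt two_le_infty).eq u w
  have hsm : ∀ y ∈ U, ContDiffAt ℝ ∞ B y := fun y hy =>
    ((contDiffAt_const (c := c)).smul (contDiffAt_leviForm (hF y hy))).congr_of_eventuallyEq
      (hB' y hy)
  refine ⟨hU, hsm, fun y hy u w => ?_, fun y hy u w => ?_, hpos, fun y hy v w x => ?_⟩
  · rw [hB y hy, hB y hy, leviForm_apply, leviForm_apply, hs y hy u, hs y hy (𝐉 u)]
  · rw [hB y hy, hB y hy, leviForm_apply, leviForm_apply, complexStructure_sq, complexStructure_sq]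
    simp only [map_neg, neg_apply, neg_neg]
    ring
  · have hD : HasFDerivAt (fderiv ℝ (fderiv ℝ F)) (fderiv ℝ (fderiv ℝ (fderiv ℝ F)) y) y :=
      ((((hF y hy).fderiv_right (m := ∞) (by simp)).fderiv_right (m := ∞)
        (by simp)).differentiableAt (by simp)).hasFDerivAt
    have hs3 : ∀ a b, fderiv ℝ (fderiv ℝ (fderiv ℝ F)) y a b
        = fderiv ℝ (fderiv ℝ (fderiv ℝ F)) y b a := fun a b =>
      (((hF y hy).fderiv_right (m := ∞) (by simp)).isSymmSndFDerivAt two_le_infty).eq a b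
    have key : ∀ a b e, fderiv ℝ B y a b e = c * (fderiv ℝ (fderiv ℝ (fderiv ℝ F)) y a b e
        + fderiv ℝ (fderiv ℝ (fderiv ℝ F)) y a (𝐉 b) (𝐉 e)) := by
      intro a b e
      have h1 := hasFDerivAt_bilinear_apply ((hsm y hy).differentiableAt (by simp)).hasFDerivAt b e
      have h2 := ((hasFDerivAt_bilinear_apply hD b e).add
        (hasFDerivAt_bilinear_apply hD (𝐉 b) (𝐉 e))).const_mul c
      have h3 : (fun z => B z b e) =ᶠ[𝓝 y] fun z => c * (fderiv ℝ (fderiv ℝ F) z b e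
          + fderiv ℝ (fderiv ℝ F) z (𝐉 b) (𝐉 e)) := by
        filter_upwards [hU.mem_nhds hy] with z hz using hB z hz b e
      exact DFunLike.congr_fun (h1.unique (h2.congr_of_eventuallyEq h3)) a
    simp only [key, complexStructure_sq, map_neg]
    rw [hs3 v w, hs3 (𝐉 v) w, hs3 v (𝐉 w), hs3 (𝐉 v) (𝐉 w)]
    ring

section LogNorm
variable {V : Type*} [NormedAddCommGroup V] [InnerProductSpace ℂ V]

/-- The pull back of the Fubini–Study form by a holomorphic map `σ`. -/
def pullFubiniStudy (σ : E → V) (y : E) : E →L[ℝ] E →L[ℝ] ℝ :=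
  (fubiniStudy (σ y)).bilinearComp ((fderiv ℂ σ y).restrictScalars ℝ)
    ((fderiv ℂ σ y).restrictScalars ℝ)

lemma pullFubiniStudy_apply (σ : E → V) (y u w : E) : pullFubiniStudy σ y u w
    = fubiniStudy (σ y) (fderiv ℂ σ y u) (fderiv ℂ σ y w) := rfl

lemma hasFDerivAt_log_norm_sq {σ : E → V} {y : E} (hσ : DifferentiableAt ℂ σ y) (h0 : σ y ≠ 0) :
    HasFDerivAt (fun z => Real.log (‖σ z‖ ^ 2))
      ((2 * (reInner V (σ y) (σ y))⁻¹) •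
        (reInner V (σ y) ∘L ((fderiv ℂ σ y).restrictScalars ℝ))) y := by
  have h1 : HasFDerivAt σ ((fderiv ℂ σ y).restrictScalars ℝ) y := hσ.hasFDerivAt.restrictScalars ℝ
  have h2 := ((reInner V).hasFDerivAt.comp y h1).clm_apply h1
  have h3 : HasFDerivAt (fun z => ‖σ z‖ ^ 2) _ y :=
    h2.congr_of_eventuallyEq (Filter.Eventually.of_forall fun z => (reInner_self (σ z)).symm)
  have h4 := h3.log (pow_ne_zero _ (norm_ne_zero_iff.2 h0))
  refine h4.congr_fderiv (ContinuousLinearMap.ext fun u => ?_)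
  have e : reInner V (fderiv ℂ σ y u) (σ y) = reInner V (σ y) (fderiv ℂ σ y u) := reInner_comm _ _
  rw [← reInner_self]
  simp [e]
  ring

/-- The function `log ‖σ‖²`, for a holomorphic `σ`, is a potential of the pull back of the
Fubini–Study form. -/
lemma leviForm_log_norm_sq {σ : E → V} {U : Set E} (hU : IsOpen U)
    (hσ : ∀ y ∈ U, ContDiffAt ℂ ω σ y) (h0 : ∀ y ∈ U, σ y ≠ 0) {y : E} (hy : y ∈ U) (u w : E) :
    leviForm (fun z => Real.log (‖σ z‖ ^ 2)) y u w = 4 * pullFubiniStudy σ y u w := by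
  set F : E → ℝ := fun z => Real.log (‖σ z‖ ^ 2) with hF
  have hd : ∀ z ∈ U, DifferentiableAt ℂ σ z := fun z hz => (hσ z hz).differentiableAt (by simp)
  have hD1 : HasFDerivAt (fderiv ℂ σ) ((fderiv ℂ (fderiv ℂ σ) y).restrictScalars ℝ) y :=
    ((((hσ y hy).fderiv_right (m := ω) (by simp)).differentiableAt
      (by simp)).hasFDerivAt).restrictScalars ℝ
  have hs0 : reInner V (σ y) (σ y) ≠ 0 := by
    rw [reInner_self]; exact pow_ne_zero _ (norm_ne_zero_iff.2 (h0 y hy))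
  have h1 : HasFDerivAt σ ((fderiv ℂ σ y).restrictScalars ℝ) y :=
    (hd y hy).hasFDerivAt.restrictScalars ℝ
  have key : ∀ a b, fderiv ℝ (fderiv ℝ F) y a b
      = 2 * (reInner V (σ y) (σ y))⁻¹ * (reInner V (fderiv ℂ σ y a) (fderiv ℂ σ y b)
        + reInner V (σ y) (fderiv ℂ (fderiv ℂ σ) y a b))
        - 4 * (reInner V (σ y) (σ y))⁻¹ ^ 2 * (reInner V (σ y) (fderiv ℂ σ y a)
          * reInner V (σ y) (fderiv ℂ σ y b)) := by
    intro a b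
    have h2 := ((reInner V).hasFDerivAt.comp y h1).clm_apply h1
    have hap : HasFDerivAt (fun z => fderiv ℂ σ z b)
        ((ContinuousLinearMap.apply ℂ V b).restrictScalars ℝ ∘L
          (fderiv ℂ (fderiv ℂ σ) y).restrictScalars ℝ) y :=
      ((ContinuousLinearMap.apply ℂ V b).restrictScalars ℝ).hasFDerivAt.comp y hD1
    have h3 := (((hasDerivAt_inv hs0).comp_hasFDerivAt y h2).const_mul 2).mul
      (((reInner V).hasFDerivAt.comp y h1).clm_apply hap)
    have hFs : ContDiffAt ℝ ∞ F y := by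
      have hr : ContDiffAt ℝ ∞ σ y := ((hσ y hy).restrict_scalars ℝ).of_le (by simp)
      have hn : ContDiffAt ℝ ∞ (fun z => reInner V (σ z) (σ z)) y :=
        ((reInner V).contDiff.contDiffAt.comp y hr).clm_apply hr
      have := hn.log hs0
      refine this.congr_of_eventuallyEq (Filter.Eventually.of_forall fun z => ?_)
      rw [hF]; simp only [reInner_self]
    have h4 := ((hFs.fderiv_right (m := ∞) (by simp)).differentiableAt
      (by simp)).hasFDerivAt.clm_apply (hasFDerivAt_const b y)
    have h5 : (fun z => fderiv ℝ F z b) =ᶠ[𝓝 y] fun z => (2 * (reInner V (σ z) (σ z))⁻¹) *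
        reInner V (σ z) (fderiv ℂ σ z b) := by
      filter_upwards [hU.mem_nhds hy] with z hz
      rw [(hasFDerivAt_log_norm_sq (hd z hz) (h0 z hz)).fderiv]
      rfl
    have h6 := DFunLike.congr_fun (h4.unique (h3.congr_of_eventuallyEq h5)) a
    have e : reInner V (fderiv ℂ σ y a) (σ y) = reInner V (σ y) (fderiv ℂ σ y a) := reInner_comm _ _
    simp [e] at h6
    rw [h6]
    field_simp
    ring
  have hI : ∀ b, reInner V (σ y) (I • b) = -reInner V (I • σ y) b := fun b => by
    rw [← reInner_I_I (σ y), smul_smul, Complex.I_mul_I, neg_smul, one_smul, map_neg]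
  rw [leviForm_apply, key, key, pullFubiniStudy_apply, fubiniStudy_apply]
  simp only [complexStructure_apply, map_smul, smul_apply, reInner_I_I, smul_smul,
    Complex.I_mul_I, neg_smul, one_smul, map_neg, hI]
  ring

end LogNorm

variable [FiniteDimensional ℂ E]

/-- If the volume density of a Kähler metric `B` is `|j|⁴ e^{-2F}`, with `j` holomorphic, then the
function `F` determines the trace of the connection form. -/
lemma IsKaehlerOn.trace_conn_eq {B : E → E →L[ℝ] E →L[ℝ] ℝ} {U : Set E} (h : IsKaehlerOn B U)
    {F : E → ℝ} {j : E → ℂ} {C : ℝ} (hg : ∀ y ∈ U,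
      gramDet (toBilin (B y)) = C * (‖j y‖ ^ 2) ^ 2 * Real.exp (-2 * F y))
    {y : E} (hy : y ∈ U) (hF : DifferentiableAt ℝ F y) (hj : DifferentiableAt ℂ j y)
    (hj0 : j y ≠ 0) (w : E) : LinearMap.trace ℝ E (kaehlerConn B w y)
      = -fderiv ℝ F y w + 2 * (fderiv ℂ j y w / j y).re := by
  have h1 := h.trace_conn hy w
  have h2 : HasFDerivAt j ((fderiv ℂ j y).restrictScalars ℝ) y := hj.hasFDerivAt.restrictScalars ℝ
  have h3 := ((h2.norm_sq.pow 2).const_mul C).mul ((hF.hasFDerivAt.const_mul (-2)).exp)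
  have h4 : (fun z => gramDet (toBilin (B z))) =ᶠ[𝓝 y] fun z =>
      C * (‖j z‖ ^ 2) ^ 2 * Real.exp (-2 * F z) := by
    filter_upwards [h.isOpen.mem_nhds hy] with z hz using hg z hz
  rw [(h3.congr_of_eventuallyEq h4).fderiv] at h1
  have h5 : gramDet (toBilin (B y)) ≠ 0 :=
    gramDet_ne_zero fun u hu => by_contra fun h0 => (h.pos y hy u h0).ne' hu
  have h6 : (inner ℝ (j y) (fderiv ℂ j y w) : ℝ) = ‖j y‖ ^ 2 * (fderiv ℂ j y w / j y).re := by
    have e : fderiv ℂ j y w = fderiv ℂ j y w / j y * j y := (div_mul_cancel₀ _ hj0).symm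
    rw [Complex.inner]
    conv_lhs => rw [e]
    have e2 : (fderiv ℂ j y w / j y * j y) * (starRingEnd ℂ) (j y)
        = ((‖j y‖ ^ 2 : ℝ) : ℂ) * (fderiv ℂ j y w / j y) := by
      rw [mul_assoc, Complex.mul_conj, Complex.normSq_eq_norm_sq, mul_comm]
    rw [e2, Complex.re_ofReal_mul]
  refine mul_right_cancel₀ (mul_ne_zero two_ne_zero h5) (h1.trans ?_)
  rw [hg y hy]
  simp [h6]
  ring

/-- The derivatives of the real part of a holomorphic `1`-form along `v` and `Jv`. -/
lemma fderiv_re_add {lam : E → E →L[ℂ] ℂ} {y : E} (hl : DifferentiableAt ℂ lam y) (v w : E) :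
    fderiv ℝ (fun z => (lam z w).re) y v + fderiv ℝ (fun z => (lam z (𝐉 w)).re) y (𝐉 v) = 0 := by
  have h1 : ∀ a, HasFDerivAt (fun z => (lam z a).re) (Complex.reCLM ∘L
      (ContinuousLinearMap.apply ℂ ℂ a).restrictScalars ℝ ∘L
        (fderiv ℂ lam y).restrictScalars ℝ) y := fun a =>
    Complex.reCLM.hasFDerivAt.comp y
      (((ContinuousLinearMap.apply ℂ ℂ a).restrictScalars ℝ).hasFDerivAt.comp y
        (hl.hasFDerivAt.restrictScalars ℝ))
  rw [(h1 w).fderiv, (h1 (𝐉 w)).fderiv]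
  change (fderiv ℂ lam y v w).re + (fderiv ℂ lam y (I • v) (I • w)).re = 0
  rw [map_smul (fderiv ℂ lam y), smul_apply, map_smul, smul_smul, Complex.I_mul_I, neg_one_smul,
    Complex.neg_re,
    add_neg_cancel]

/-- The Ricci tensor of `B + τ ⊗ τ`, when the volume density of `B` is `|j|⁴ e^{-2F}`. -/
lemma IsConnectionOn.ricci_eq {N : Type*} [NormedAddCommGroup N] [NormedSpace ℝ N]
    [FiniteDimensional ℝ N] {B : E → E →L[ℝ] E →L[ℝ] ℝ} {U : Set E} {τ : E × N → E × N →L[ℝ] ℝ}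
    {Ω : Set (E × N)} (hB : IsKaehlerOn B U) (h : IsConnectionOn B U τ Ω) {F : E → ℝ}
    {j : E → ℂ} {C : ℝ} (hF : ∀ y ∈ U, ContDiffAt ℝ ∞ F y) (hj : ∀ y ∈ U, ContDiffAt ℂ ω j y)
    (hj0 : ∀ y ∈ U, j y ≠ 0) (hg : ∀ y ∈ U,
      gramDet (toBilin (B y)) = C * (‖j y‖ ^ 2) ^ 2 * Real.exp (-2 * F y))
    {y : E × N} (hy : y ∈ Ω) (v w : E × N) :
    ∑ i, (finBasis ℝ (E × N)).coord i
        (curvature (liftMetric B τ) (finBasis ℝ (E × N) i) v w y)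
      = 1 / 2 * leviForm F y.1 v.1 w.1 - 2 * B y.1 v.1 w.1 + finrank ℝ E * (τ y v * τ y w) := by
  have hyU := h.fst_mem y hy
  set lam : E → E →L[ℂ] ℂ := fun z => (j z)⁻¹ • fderiv ℂ j z with hlam
  have hl : DifferentiableAt ℂ lam y.1 :=
    (((hj _ hyU).inv (hj0 _ hyU)).smul ((hj _ hyU).fderiv_right (m := ω)
      (by simp))).differentiableAt (by simp)
  have ht : ∀ a : E, ∀ᶠ z in 𝓝 y.1, LinearMap.trace ℝ E (kaehlerConn B a z)
      = -fderiv ℝ F z a + 2 * (lam z a).re := fun a => by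
    filter_upwards [hB.isOpen.mem_nhds hyU] with z hz
    rw [hB.trace_conn_eq hg hz ((hF z hz).differentiableAt (by simp))
      ((hj z hz).differentiableAt (by simp)) (hj0 z hz), hlam, div_eq_inv_mul]
    rfl
  rw [h.sum_coord_curvature hB hy v w (ht w.1) (ht (𝐉 w.1))]
  have hFd : ∀ a : E, HasFDerivAt (fun z => fderiv ℝ F z a)
      ((fderiv ℝ (fderiv ℝ F) y.1).flip a) y.1 := fun a => by
    have := ((((hF _ hyU).fderiv_right (m := ∞) (by simp)).differentiableAt
      (by simp)).hasFDerivAt.clm_apply (hasFDerivAt_const a y.1))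
    refine this.congr_fderiv (ContinuousLinearMap.ext fun x => ?_)
    simp
  have hlr : ∀ a : E, DifferentiableAt ℝ (fun z => (lam z a).re) y.1 := fun a =>
    Complex.reCLM.differentiableAt.comp y.1
      (((ContinuousLinearMap.apply ℂ ℂ a).restrictScalars ℝ).differentiableAt.comp y.1
        (hl.restrictScalars ℝ))
  have h1 : ∀ a x : E, fderiv ℝ (fun z => -fderiv ℝ F z a + 2 * (lam z a).re) y.1 x
      = -fderiv ℝ (fderiv ℝ F) y.1 x a + 2 * fderiv ℝ (fun z => (lam z a).re) y.1 x := by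
    intro a x
    refine (congrArg (fun l : E →L[ℝ] ℝ => l x)
      ((hFd a).neg.add ((hlr a).hasFDerivAt.const_mul 2)).fderiv).trans ?_
    simp
  rw [h1, h1, leviForm_apply]
  have h2 := fderiv_re_add hl v.1 w.1
  linear_combination -h2

end Potential

/-! ### Tensors in charts -/

section Charts
variable {E : Type*} [NormedAddCommGroup E] [NormedSpace ℝ E] [FiniteDimensional ℝ E]
  {M : Type*} [TopologicalSpace M] [ChartedSpace E M]
local notation "𝐈" => 𝓘(ℝ, E)
local notation "𝐓" => TangentSpace 𝓘(ℝ, E)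
local notation:max "𝐞" p:max => extChartAt 𝓘(ℝ, E) p

/-- The differential of the inverse of the preferred chart at `p`. -/
def chartInvDeriv (p : M) (y : E) : E →L[ℝ] E :=
  mfderiv 𝐈 𝐈 (𝐞 p).symm y

/-- The differential of the preferred chart at `p`. -/
def chartDeriv (p q : M) : E →L[ℝ] E :=
  mfderiv 𝐈 𝐈 (𝐞 p) q

variable [IsManifold 𝓘(ℝ, E) ∞ M]

lemma chartDeriv_comp {p : M} {y : E} (hy : y ∈ (𝐞 p).target) :
    chartDeriv p ((𝐞 p).symm y) ∘L chartInvDeriv p y = ContinuousLinearMap.id ℝ E := by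
  have h := mfderiv_extChartAt_comp_mfderivWithin_extChartAt_symm (I := 𝐈) hy
  rw [ModelWithCorners.range_eq_univ, mfderivWithin_univ] at h
  exact h

lemma chartInvDeriv_comp {p : M} {y : E} (hy : y ∈ (𝐞 p).target) :
    chartInvDeriv p y ∘L chartDeriv p ((𝐞 p).symm y) = ContinuousLinearMap.id ℝ E := by
  have h := mfderivWithin_extChartAt_symm_comp_mfderiv_extChartAt (I := 𝐈) hy
  rw [ModelWithCorners.range_eq_univ, mfderivWithin_univ] at h
  exact h

lemma chartInvDeriv_self (p : M) : chartInvDeriv p (𝐞 p p) = ContinuousLinearMap.id ℝ E := by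
  have h := mfderivWithin_range_extChartAt_symm (I := 𝐈) (x := p)
  rw [ModelWithCorners.range_eq_univ, mfderivWithin_univ] at h
  exact h

lemma chartDeriv_self (p : M) : chartDeriv p p = ContinuousLinearMap.id ℝ E := by
  exact mfderiv_extChartAt_self (I := 𝐈) (x := p)

lemma hasMFDerivAt_extChartAt_symm {p : M} {y : E} (hy : y ∈ (𝐞 p).target) :
    HasMFDerivAt 𝐈 𝐈 (𝐞 p).symm y (chartInvDeriv p y : E →L[ℝ] E) :=
  ((contMDiffOn_extChartAt_symm (n := ∞) p y hy).contMDiffAt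
    ((isOpen_extChartAt_target p).mem_nhds hy)).mdifferentiableAt (by simp) |>.hasMFDerivAt

/-- A vector field, written in the preferred chart at `p`. -/
def chartField (X : ∀ q : M, 𝐓 q) (p : M) (y : E) : E :=
  chartDeriv p ((𝐞 p).symm y) (X ((𝐞 p).symm y))

/-- A field of endomorphisms, written in the preferred chart at `p`. -/
def chartEndo (φ : ∀ q : M, 𝐓 q →L[ℝ] 𝐓 q) (p : M) (y : E) : E →L[ℝ] E :=
  let A : E →L[ℝ] E := φ ((𝐞 p).symm y)
  chartDeriv p ((𝐞 p).symm y) ∘L A ∘L chartInvDeriv p y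

lemma contMDiffAt_of_chart {F : Type*} [NormedAddCommGroup F] [NormedSpace ℝ F] {f : M → F}
    {f' : E → F} {p : M} (hf' : ContDiffAt ℝ ∞ f' (𝐞 p p))
    (h : ∀ᶠ q in 𝓝 p, f q = f' (𝐞 p q)) : ContMDiffAt 𝐈 𝓘(ℝ, F) ∞ f p :=
  (hf'.contMDiffAt.comp p contMDiffAt_extChartAt).congr_of_eventuallyEq h

lemma symmL_apply {p q : M} (hq : q ∈ (chartAt E p).source) :
    ((trivializationAt E (𝐓) p).symmL ℝ q : E →L[ℝ] E) = chartInvDeriv p (𝐞 p q) := by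
  have h := TangentBundle.symmL_trivializationAt (I := 𝐈) hq
  rw [ModelWithCorners.range_eq_univ, mfderivWithin_univ] at h
  exact h

lemma contMDiff_oneForm {η : ∀ q : M, 𝐓 q →L[ℝ] ℝ}
    (h : ∀ p, ContDiffAt ℝ ∞ (chartForm 𝐈 η p) (𝐞 p p)) :
    ContMDiff 𝐈 (𝐈.prod 𝓘(ℝ, E →L[ℝ] ℝ)) ∞ (fun p => TotalSpace.mk' (E →L[ℝ] ℝ)
      (E := fun p : M => 𝐓 p →L[ℝ] Trivial M ℝ p) p (η p)) := by
  intro p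
  refine (contMDiffAt_hom_bundle _).2 ⟨contMDiffAt_id, contMDiffAt_of_chart (h p) ?_⟩
  filter_upwards [chart_source_mem_nhds E p] with q hq
  have e := symmL_apply hq
  have hs : (𝐞 p).symm (𝐞 p q) = q := (𝐞 p).left_inv (by rwa [extChartAt_source])
  refine ContinuousLinearMap.ext fun u => ?_
  have e2 : ContinuousLinearMap.inCoordinates E (𝐓) ℝ (Trivial M ℝ) p q p q
      (η q) u = η q ((trivializationAt E (𝐓) p).symmL ℝ q u) := by
    rw [ContinuousLinearMap.inCoordinates]
    simp
  refine e2.trans ?_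
  change _ = η ((𝐞 p).symm (𝐞 p q)) (chartInvDeriv p (𝐞 p q) u)
  rw [hs]
  exact congrArg (fun l : E →L[ℝ] E => η q (l u)) e

lemma contMDiff_endo {φ : ∀ q : M, 𝐓 q →L[ℝ] 𝐓 q}
    (h : ∀ p, ContDiffAt ℝ ∞ (chartEndo φ p) (𝐞 p p)) :
    ContMDiff 𝐈 (𝐈.prod 𝓘(ℝ, E →L[ℝ] E)) ∞ (fun p => TotalSpace.mk' (E →L[ℝ] E)
      (E := fun p : M => 𝐓 p →L[ℝ] 𝐓 p) p (φ p)) := by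
  intro p
  refine (contMDiffAt_hom_bundle _).2 ⟨contMDiffAt_id, contMDiffAt_of_chart (h p) ?_⟩
  filter_upwards [chart_source_mem_nhds E p] with q hq
  have e := symmL_apply hq
  have e' := TangentBundle.continuousLinearMapAt_trivializationAt (I := 𝐈) hq
  have hs : (𝐞 p).symm (𝐞 p q) = q := (𝐞 p).left_inv (by rwa [extChartAt_source])
  refine ContinuousLinearMap.ext fun u => ?_
  let A : M → E →L[ℝ] E := fun q => φ q
  change ((trivializationAt E (𝐓) p).continuousLinearMapAt ℝ q : E →L[ℝ] E)
      (A q (((trivializationAt E (𝐓) p).symmL ℝ q : E →L[ℝ] E) u))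
    = chartDeriv p ((𝐞 p).symm (𝐞 p q))
      (A ((𝐞 p).symm (𝐞 p q))
      (chartInvDeriv p (𝐞 p q) u))
  rw [hs]
  exact (DFunLike.congr_fun e' (A q _)).trans
    (congrArg (fun l : E →L[ℝ] E => chartDeriv p q (A q (l u))) e)

lemma contMDiff_bilinear
    {g : ∀ q : M, 𝐓 q →L[ℝ] 𝐓 q →L[ℝ] ℝ}
    (h : ∀ p, ContDiffAt ℝ ∞ (chartMetric 𝐈 g p) (𝐞 p p)) :
    ContMDiff 𝐈 (𝐈.prod 𝓘(ℝ, E →L[ℝ] E →L[ℝ] ℝ)) ∞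
      (fun p => TotalSpace.mk' (E →L[ℝ] E →L[ℝ] ℝ)
        (E := fun p : M => 𝐓 p →L[ℝ] 𝐓 p →L[ℝ] ℝ) p (g p)) := by
  intro p
  refine (contMDiffAt_hom_bundle _).2 ⟨contMDiffAt_id, contMDiffAt_of_chart (h p) ?_⟩
  filter_upwards [chart_source_mem_nhds E p] with q hq
  have e := symmL_apply hq
  have hs : (𝐞 p).symm (𝐞 p q) = q := (𝐞 p).left_inv (by rwa [extChartAt_source])
  refine ContinuousLinearMap.ext fun u => ContinuousLinearMap.ext fun w => ?_
  have e2 : ContinuousLinearMap.inCoordinates E (𝐓) (E →L[ℝ] ℝ)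
      (fun b : M => 𝐓 b →L[ℝ] ℝ) p q p q (g q) u w
      = g q ((trivializationAt E (𝐓) p).symmL ℝ q u) ((trivializationAt E (𝐓) p).symmL ℝ q w) := by
    have hb : q ∈ (trivializationAt E (𝐓) p).baseSet := by simpa using hq
    rw [inCoordinates_apply_eq₂ hb hb (mem_univ _), Trivialization.symmL_apply _ hb,
      Trivialization.symmL_apply _ hb]
    simp
  refine e2.trans ?_
  change _ = g ((𝐞 p).symm (𝐞 p q)) (chartInvDeriv p (𝐞 p q) u) (chartInvDeriv p (𝐞 p q) w)
  rw [hs]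
  exact congrArg (fun l : E →L[ℝ] E => g q (l u) (l w)) e

lemma isSmoothField_of_chart {X : ∀ q : M, 𝐓 q}
    (h : ∀ p, ContDiffAt ℝ ∞ (chartField X p) (𝐞 p p)) :
    IsSmoothField 𝐈 X := by
  intro p
  refine contMDiffAt_totalSpace.2 ⟨contMDiffAt_id, contMDiffAt_of_chart (h p) ?_⟩
  filter_upwards [chart_source_mem_nhds E p] with q hq
  have e' := TangentBundle.continuousLinearMapAt_trivializationAt (I := 𝐈) hq
  have hs : (𝐞 p).symm (𝐞 p q) = q := (𝐞 p).left_inv (by rwa [extChartAt_source])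
  rw [chartField, hs]
  refine Eq.trans ?_ (DFunLike.congr_fun e' (X q))
  exact (((trivializationAt E (𝐓) p).coe_linearMapAt_of_mem
    (R := ℝ) (b := q) (by simpa using hq) ▸ rfl))

lemma chartField_self (X : ∀ q : M, 𝐓 q) (p : M) : chartField X p (𝐞 p p) = X p := by
  have h : (𝐞 p).symm (𝐞 p p) = p := extChartAt_to_inv p
  rw [chartField, h, chartDeriv_self]
  rfl

lemma chartInvDeriv_chartField (X : ∀ q : M, 𝐓 q) {p : M} {y : E}
    (hy : y ∈ (𝐞 p).target) :
    chartInvDeriv p y (chartField X p y) = X ((𝐞 p).symm y) :=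
  DFunLike.congr_fun (chartInvDeriv_comp hy) _

/-- The Lie bracket of vector fields in the preferred chart. -/
lemma mlieBracket_eq {X Y : ∀ q : M, 𝐓 q} (p : M) :
    (mlieBracket 𝐈 X Y p : E)
      = fderiv ℝ (chartField Y p) (𝐞 p p) (X p) - fderiv ℝ (chartField X p) (𝐞 p p) (Y p) := by
  have hC : CompleteSpace E := FiniteDimensional.complete ℝ E
  have hV : ∀ X : ∀ q : M, 𝐓 q,
      VectorField.mpullbackWithin 𝐈 𝐈 (𝐞 p).symm X (range 𝐈) =ᶠ[𝓝 (𝐞 p p)] chartField X p := by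
    intro X
    filter_upwards [(isOpen_extChartAt_target p).mem_nhds (mem_extChartAt_target p)] with y hy
    rw [VectorField.mpullbackWithin_apply, ModelWithCorners.range_eq_univ, mfderivWithin_univ]
    have h : ((chartInvDeriv p y).inverse : E →L[ℝ] E)
        = chartDeriv p ((𝐞 p).symm y) :=
      ContinuousLinearMap.inverse_eq (chartInvDeriv_comp hy) (chartDeriv_comp hy)
    exact congrArg (fun l : E →L[ℝ] E => l (X ((𝐞 p).symm y))) h
  have h1 : mlieBracket 𝐈 X Y p
      = (mfderiv 𝐈 𝐈 (𝐞 p) p).inverse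
        ((VectorField.lieBracketWithin ℝ
          (VectorField.mpullbackWithin 𝐈 𝐈 (𝐞 p).symm X (range 𝐈))
          (VectorField.mpullbackWithin 𝐈 𝐈 (𝐞 p).symm Y (range 𝐈))
          ((𝐞 p).symm ⁻¹' univ ∩ range 𝐈)) (𝐞 p p)) := rfl
  have h2 : ((chartDeriv p p).inverse : E →L[ℝ] E) = ContinuousLinearMap.id ℝ E := by
    rw [chartDeriv_self]; exact ContinuousLinearMap.inverse_id
  refine h1.trans ((DFunLike.congr_fun h2 _).trans ?_)
  have h3 : ((𝐞 p).symm ⁻¹' univ ∩ range 𝐈) = (univ : Set E) := by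
    rw [ModelWithCorners.range_eq_univ, preimage_univ, inter_univ]
  let X' : E → E := VectorField.mpullbackWithin 𝐈 𝐈 (𝐞 p).symm X (range 𝐈)
  let Y' : E → E := VectorField.mpullbackWithin 𝐈 𝐈 (𝐞 p).symm Y (range 𝐈)
  change fderivWithin ℝ Y' ((𝐞 p).symm ⁻¹' univ ∩ range 𝐈) _ (X' _)
    - fderivWithin ℝ X' ((𝐞 p).symm ⁻¹' univ ∩ range 𝐈) _ (Y' _) = _
  rw [h3, fderivWithin_univ, fderivWithin_univ]
  have e1 := (hV X).eq_of_nhds.trans (chartField_self X p)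
  have e2 := (hV Y).eq_of_nhds.trans (chartField_self Y p)
  exact congrArg₂ (fun a b : E => a - b)
    (congrArg₂ (fun (l : E →L[ℝ] E) a => l a) (hV Y).fderiv_eq e1)
    (congrArg₂ (fun (l : E →L[ℝ] E) a => l a) (hV X).fderiv_eq e2)

lemma differentiableAt_chartField {X : ∀ q : M, 𝐓 q}
    (hX : IsSmoothField 𝐈 X) (p : M) :
    DifferentiableAt ℝ (chartField X p) (𝐞 p p) := by
  have h1 := (contMDiffAt_totalSpace.1 (hX p)).2
  have hs : (𝐞 p).symm (𝐞 p p) = p := extChartAt_to_inv p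
  have h2 := ContMDiffAt.comp_of_eq (h1)
    ((contMDiffOn_extChartAt_symm (n := ∞) p _ (mem_extChartAt_target p)).contMDiffAt
      ((isOpen_extChartAt_target p).mem_nhds (mem_extChartAt_target p))) hs
  refine (h2.contDiffAt.differentiableAt (by simp)).congr_of_eventuallyEq ?_
  filter_upwards [(isOpen_extChartAt_target p).mem_nhds (mem_extChartAt_target p)] with y hy
  have hq : (𝐞 p).symm y ∈ (chartAt E p).source := by
    rw [← extChartAt_source 𝐈]; exact (𝐞 p).map_target hy
  have e' := TangentBundle.continuousLinearMapAt_trivializationAt (I := 𝐈) hq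
  refine Eq.trans (DFunLike.congr_fun e' (X _)).symm ?_
  exact (((trivializationAt E (𝐓) p).coe_linearMapAt_of_mem (R := ℝ) (by simpa using hq) ▸ rfl))

end Charts

/-! ### Tensors that are locally lifted from a Kähler metric -/

section Model
variable {E : Type*} [NormedAddCommGroup E] [NormedSpace ℂ E] [FiniteDimensional ℂ E]
  {N : Type*} [NormedAddCommGroup N] [NormedSpace ℝ N] [FiniteDimensional ℝ N]
  {M : Type*} [TopologicalSpace M] [ChartedSpace (E × N) M]

local notation "𝐉" => complexStructure E
local notation "𝐈" => 𝓘(ℝ, E × N)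
local notation "𝐓" => TangentSpace 𝓘(ℝ, E × N)
local notation:max "𝐞" p:max => extChartAt 𝓘(ℝ, E × N) p

/-- In the preferred chart at `p`, the tensors `(g, φ, ξ, η)` are obtained from a Kähler metric `B`
and a connection form `τ`: `g = B + τ ⊗ τ`, `η = τ`, `φ` is the horizontal lift of the complex
structure, and `ξ` is vertical with `τ(ξ) = 1`. -/
structure IsLocalModel (g : ∀ q : M, 𝐓 q →L[ℝ]
      𝐓 q →L[ℝ] ℝ)
    (φ : ∀ q : M, 𝐓 q →L[ℝ] 𝐓 q)
    (ξ : ∀ q : M, 𝐓 q) (η : ∀ q : M, 𝐓 q →L[ℝ] ℝ)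
    (p : M) (B : E → E →L[ℝ] E →L[ℝ] ℝ) (U : Set E) (τ : E × N → E × N →L[ℝ] ℝ)
    (Ω : Set (E × N)) : Prop where
  kaehler : IsKaehlerOn B U
  conn : IsConnectionOn B U τ Ω
  mem : 𝐞 p p ∈ Ω
  subset : Ω ⊆ (𝐞 p).target
  form : ∀ y ∈ Ω, chartForm 𝐈 η p y = τ y
  metric : ∀ y ∈ Ω, chartMetric 𝐈 g p y = liftMetric B τ y
  endo_fst : ∀ y ∈ Ω, ∀ u, (chartEndo φ p y u).1 = 𝐉 u.1
  form_endo : ∀ y ∈ Ω, ∀ u, τ y (chartEndo φ p y u) = 0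
  field_fst : ∀ y ∈ Ω, (chartField ξ p y).1 = 0
  form_field : ∀ y ∈ Ω, τ y (chartField ξ p y) = 1

variable [IsManifold 𝓘(ℝ, E × N) ∞ M]

namespace IsLocalModel
variable {g : ∀ q : M, TangentSpace 𝓘(ℝ, E × N) q →L[ℝ] TangentSpace 𝓘(ℝ, E × N) q →L[ℝ] ℝ}
  {φ : ∀ q : M, TangentSpace 𝓘(ℝ, E × N) q →L[ℝ] TangentSpace 𝓘(ℝ, E × N) q}
  {ξ : ∀ q : M, TangentSpace 𝓘(ℝ, E × N) q} {η : ∀ q : M, TangentSpace 𝓘(ℝ, E × N) q →L[ℝ] ℝ}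
  {p : M} {B : E → E →L[ℝ] E →L[ℝ] ℝ} {U : Set E} {τ : E × N → E × N →L[ℝ] ℝ} {Ω : Set (E × N)}
  (h : IsLocalModel g φ ξ η p B U τ Ω)
include h

lemma mem_nhds : Ω ∈ 𝓝 (𝐞 p p) := h.conn.isOpen.mem_nhds h.mem

lemma contDiffAt_form : ContDiffAt ℝ ∞ (chartForm 𝐈 η p) (𝐞 p p) := by
  refine (h.conn.smooth _ h.mem).congr_of_eventuallyEq ?_
  filter_upwards [h.mem_nhds] with y hy using h.form y hy

lemma contDiffAt_metric : ContDiffAt ℝ ∞ (chartMetric 𝐈 g p) (𝐞 p p) := by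
  refine (h.conn.contDiffAt_liftMetric h.kaehler h.mem).congr_of_eventuallyEq ?_
  filter_upwards [h.mem_nhds] with y hy using h.metric y hy

lemma contDiffAt_field : ContDiffAt ℝ ∞ (chartField ξ p) (𝐞 p p) := by
  obtain ⟨ζ, hζ, hζ'⟩ := h.conn.exists_vertical _ h.mem
  have h1 : ContDiffAt ℝ ∞ (fun y => τ y ζ) (𝐞 p p) :=
    (h.conn.smooth _ h.mem).clm_apply contDiffAt_const
  have h2 : ContDiffAt ℝ ∞ (fun y => (τ y ζ)⁻¹ • ζ) (𝐞 p p) :=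
    (h1.inv (by rw [hζ']; exact one_ne_zero)).smul contDiffAt_const
  refine h2.congr_of_eventuallyEq ?_
  filter_upwards [h.mem_nhds, h1.continuousAt.eventually_ne (by rw [hζ']; exact one_ne_zero)]
    with y hy hy'
  refine sub_eq_zero.1 (h.conn.eq_zero y hy _ ?_ ?_)
  · rw [Prod.fst_sub, Prod.smul_fst, h.field_fst y hy, hζ, smul_zero, sub_zero]
  · rw [map_sub, map_smul, h.form_field y hy, smul_eq_mul, inv_mul_cancel₀ hy', sub_self]

lemma contDiffAt_endo : ContDiffAt ℝ ∞ (chartEndo φ p) (𝐞 p p) := by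
  set K : E × N →L[ℝ] E × N := (ContinuousLinearMap.inl ℝ E N) ∘L 𝐉 ∘L
    (ContinuousLinearMap.fst ℝ E N) with hK
  have h1 : ContDiffAt ℝ ∞ (fun y => K - ((τ y) ∘L K).smulRight (chartField ξ p y))
      (𝐞 p p) :=
    contDiffAt_const.sub (((h.conn.smooth _ h.mem).clm_comp contDiffAt_const).smulRight
      h.contDiffAt_field)
  refine h1.congr_of_eventuallyEq ?_
  filter_upwards [h.mem_nhds] with y hy
  refine ContinuousLinearMap.ext fun u => sub_eq_zero.1 (h.conn.eq_zero y hy _ ?_ ?_)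
  · have e : (K u).1 = 𝐉 u.1 := rfl
    simp [h.endo_fst y hy, h.field_fst y hy, e]
  · simp [h.form_endo y hy, h.form_field y hy]

lemma form_self (u : E × N) : η p u = τ (𝐞 p p) u := by
  rw [← h.form _ h.mem]
  have h1 := chartInvDeriv_self (E := E × N) p
  have h2 : (𝐞 p).symm (𝐞 p p) = p := extChartAt_to_inv p
  change _ = η ((𝐞 p).symm (𝐞 p p)) (chartInvDeriv p (𝐞 p p) u)
  rw [h2, h1]
  rfl

lemma metric_self (u w : E × N) : g p u w = B (𝐞 p p).1 u.1 w.1 + τ (𝐞 p p) u * τ (𝐞 p p) w := by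
  rw [← liftMetric_apply, ← h.metric _ h.mem]
  have h1 := chartInvDeriv_self (E := E × N) p
  have h2 : (𝐞 p).symm (𝐞 p p) = p := extChartAt_to_inv p
  change _ = g ((𝐞 p).symm (𝐞 p p))
    (chartInvDeriv p (𝐞 p p) u)
    (chartInvDeriv p (𝐞 p p) w)
  rw [h2, h1]
  rfl

omit h in
lemma chartEndo_self (φ : ∀ q : M, 𝐓 q →L[ℝ] 𝐓 q) (p : M) : chartEndo φ p (𝐞 p p) = φ p := by
  have h1 := chartInvDeriv_self (E := E × N) p
  have h2 : (𝐞 p).symm (𝐞 p p) = p := extChartAt_to_inv p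
  let A : M → E × N →L[ℝ] E × N := fun q => φ q
  change (chartDeriv p ((𝐞 p).symm (𝐞 p p))) ∘L
    (A ((𝐞 p).symm (𝐞 p p))) ∘L
    (chartInvDeriv p (𝐞 p p)) = A p
  rw [h2, h1, chartDeriv_self (E := E × N) p]
  rfl

lemma extD_self (u v : E × N) : extD 𝐈 η p u v = 2 * B (𝐞 p p).1 (𝐉 u.1) v.1 := by
  rw [← h.conn.curv _ h.mem]
  have h1 : chartForm 𝐈 η p =ᶠ[𝓝 (𝐞 p p)] τ := by
    filter_upwards [h.mem_nhds] with y hy using h.form y hy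
  exact congrArg (fun l : E × N →L[ℝ] E × N →L[ℝ] ℝ => l u v - l v u) (h1.fderiv_eq (𝕜 := ℝ))

lemma phi_fst (u : E × N) : (show E × N from φ p u).1 = 𝐉 u.1 := by
  rw [← h.endo_fst _ h.mem, chartEndo_self]
  rfl

lemma form_phi (u : E × N) : τ (𝐞 p p) (φ p u) = 0 := by
  rw [← h.form_endo _ h.mem u, chartEndo_self]
  rfl

lemma xi_fst : (show E × N from ξ p).1 = 0 := by
  rw [← h.field_fst _ h.mem, chartField_self]

lemma form_xi : τ (𝐞 p p) (ξ p) = 1 := by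
  rw [← h.form_field _ h.mem, chartField_self]

lemma eq_of_fst_of_form {u w : E × N} (h1 : u.1 = w.1) (h2 : τ (𝐞 p p) u = τ (𝐞 p p) w) : u = w :=
  sub_eq_zero.1 (h.conn.eq_zero _ h.mem _ (by rw [Prod.fst_sub, h1, sub_self])
    (by rw [map_sub, h2, sub_self]))

lemma phi_phi (u : 𝐓 p) : φ p (φ p u) = -u + η p u • ξ p := by
  let x : E × N := u
  let z : E × N := ξ p
  let Φ : E × N →L[ℝ] E × N := φ p
  have h1 : ∀ x, (Φ x).1 = 𝐉 x.1 := h.phi_fst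
  have h2 : ∀ x, τ (𝐞 p p) (Φ x) = 0 := h.form_phi
  have h3 : z.1 = 0 := h.xi_fst
  have h4 : τ (𝐞 p p) z = 1 := h.form_xi
  have key : Φ (Φ x) = -x + (τ (𝐞 p p) x) • z := by
    refine h.eq_of_fst_of_form ?_ ?_
    · rw [h1, h1, complexStructure_sq, Prod.fst_add, Prod.smul_fst, h3, smul_zero, add_zero,
        Prod.fst_neg]
    · rw [h2, map_add, map_neg, map_smul, h4, smul_eq_mul]
      ring
  rw [← h.form_self] at key
  exact key

lemma metric_phi (u v : 𝐓 p) : g p (φ p u) (φ p v) = g p u v - η p u * η p v := by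
  let x : E × N := u
  let y : E × N := v
  let G : E × N →L[ℝ] E × N →L[ℝ] ℝ := g p
  let Φ : E × N →L[ℝ] E × N := φ p
  have h0 : ∀ x y, G x y = _ := h.metric_self
  have h1 : ∀ x, (Φ x).1 = 𝐉 x.1 := h.phi_fst
  have h2 : ∀ x, τ (𝐞 p p) (Φ x) = 0 := h.form_phi
  have key : G (Φ x) (Φ y) = G x y - τ (𝐞 p p) x
      * τ (𝐞 p p) y := by
    rw [h0, h0, h1, h1, h2, h2, h.kaehler.inv _ (h.conn.fst_mem _ h.mem)]
    ring
  rw [← h.form_self, ← h.form_self] at key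
  exact key

lemma extD_eta (u v : 𝐓 p) : extD 𝐈 η p u v = 2 * g p (φ p u) v := by
  let x : E × N := u
  let y : E × N := v
  let G : E × N →L[ℝ] E × N →L[ℝ] ℝ := g p
  let Φ : E × N →L[ℝ] E × N := φ p
  have h0 : ∀ x y, G x y = _ := h.metric_self
  have h1 : ∀ x, (Φ x).1 = 𝐉 x.1 := h.phi_fst
  have h2 : ∀ x, τ (𝐞 p p) (Φ x) = 0 := h.form_phi
  have key : 2 * B (𝐞 p p).1 (𝐉 x.1) y.1 = 2 * G (Φ x) y := by
    rw [h0, h1, h2]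
    ring
  exact (h.extD_self x y).trans key

lemma metric_eq (u w : 𝐓 p) : g p u w = 1 / 2 * extD 𝐈 η p u (φ p w) + η p u * η p w := by
  let x : E × N := u
  let y : E × N := w
  let G : E × N →L[ℝ] E × N →L[ℝ] ℝ := g p
  let Φ : E × N →L[ℝ] E × N := φ p
  let D : E × N → E × N → ℝ := extD 𝐈 η p
  have hD : ∀ x y, D x y = _ := h.extD_self
  have h0 : ∀ x y, G x y = _ := h.metric_self
  have h1 : ∀ x, (Φ x).1 = 𝐉 x.1 := h.phi_fst
  have key : G x y = 1 / 2 * D x (Φ y) + τ (𝐞 p p) x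
      * τ (𝐞 p p) y := by
    rw [h0, hD, h1, h.kaehler.inv _ (h.conn.fst_mem _ h.mem)]
    ring
  rw [← h.form_self, ← h.form_self] at key
  exact key

lemma killing {X Y : ∀ q : M, 𝐓 q} (hX : IsSmoothField 𝐈 X)
    (hY : IsSmoothField 𝐈 Y) :
    lieDeriv 𝐈 ξ (fun q => g q (X q) (Y q)) p
      - g p (mlieBracket 𝐈 ξ X p) (Y p)
      - g p (X p) (mlieBracket 𝐈 ξ Y p) = 0 := by
  set y₀ := 𝐞 p p with hy₀
  set G := liftMetric B τ with hG
  have hdX := (differentiableAt_chartField hX p).hasFDerivAt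
  have hdY := (differentiableAt_chartField hY p).hasFDerivAt
  have hdξ := (h.contDiffAt_field.differentiableAt (by simp)).hasFDerivAt
  have hdG := ((h.conn.contDiffAt_liftMetric h.kaehler h.mem).differentiableAt
    (by simp)).hasFDerivAt
  have hf : HasFDerivAt (fun y => G y (chartField X p y) (chartField Y p y)) _ y₀ :=
    (hdG.clm_apply hdX).clm_apply hdY
  have hd : HasMFDerivAt 𝐈 𝐈 (𝐞 p) p
      (ContinuousLinearMap.id ℝ (E × N) : E × N →L[ℝ] E × N) := by
    have e : MDifferentiableAt 𝐈 𝐈 (𝐞 p) p :=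
      (contMDiffAt_extChartAt (n := ∞)).mdifferentiableAt (by simp)
    exact e.hasMFDerivAt.congr_mfderiv (chartDeriv_self (E := E × N) p)
  have hm := HasMFDerivAt.comp p hf.hasMFDerivAt hd
  have he : (fun q => g q (X q) (Y q)) =ᶠ[𝓝 p]
      (fun y => G y (chartField X p y) (chartField Y p y)) ∘ 𝐞 p := by
    have hc : 𝐞 p ⁻¹' Ω ∈ 𝓝 p := (continuousAt_extChartAt p).preimage_mem_nhds h.mem_nhds
    filter_upwards [hc, extChartAt_source_mem_nhds (I := 𝐈) p] with q hq hq'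
    have hs := (𝐞 p).left_inv hq'
    have e1 := chartInvDeriv_chartField X (h.subset hq)
    have e2 := chartInvDeriv_chartField Y (h.subset hq)
    rw [hs] at e1 e2
    have e3 := h.metric _ hq
    have e4 : chartMetric 𝐈 g p (𝐞 p q)
        (chartField X p (𝐞 p q)) (chartField Y p (𝐞 p q))
        = g q (X q) (Y q) := by
      change g ((𝐞 p).symm (𝐞 p q))
        (chartInvDeriv p (𝐞 p q) _)
        (chartInvDeriv p (𝐞 p q) _) = _
      rw [hs, e1, e2]
    rw [← e4, e3]
    rfl
  have hl : lieDeriv 𝐈 ξ (fun q => g q (X q) (Y q)) p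
      = (G y₀ (X p)) (fderiv ℝ (chartField Y p) y₀ (ξ p))
        + ((G y₀ (fderiv ℝ (chartField X p) y₀ (ξ p))) (Y p) + fderiv ℝ G y₀ (ξ p) (X p) (Y p)) := by
    have e := (hm.congr_of_eventuallyEq he).mfderiv
    refine (DFunLike.congr_fun e (ξ p)).trans ?_
    have e1 := chartField_self (E := E × N) X p
    have e2 := chartField_self (E := E × N) Y p
    simp only [e1, e2]
    rfl
  have hb : ∀ Z : ∀ q : M, 𝐓 q,
      (mlieBracket 𝐈 ξ Z p : E × N)
        = fderiv ℝ (chartField Z p) y₀ (ξ p) - fderiv ℝ (chartField ξ p) y₀ (Z p) :=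
    fun Z => mlieBracket_eq p
  have hg : ∀ u w : E × N, g p u w = G y₀ u w := fun u w => by
    rw [h.metric_self, hG, liftMetric_apply]
  -- the derivatives of `ξ` are vertical, and `τ(ξ) = 1` determines them
  have hξ1 : ∀ u, (fderiv ℝ (chartField ξ p) y₀ u).1 = 0 := fun u => by
    have e1 := (ContinuousLinearMap.fst ℝ E N).hasFDerivAt.comp y₀ hdξ
    have e2 : (ContinuousLinearMap.fst ℝ E N ∘ chartField ξ p) =ᶠ[𝓝 y₀] fun _ => (0 : E) := by
      filter_upwards [h.mem_nhds] with y hy using h.field_fst y hy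
    exact congrArg (fun l : E × N →L[ℝ] E => l u)
      (e1.unique ((hasFDerivAt_const (0 : E) y₀).congr_of_eventuallyEq e2))
  have hξ2 : ∀ u, τ y₀ (fderiv ℝ (chartField ξ p) y₀ u) = -fderiv ℝ τ y₀ u (ξ p) := fun u => by
    have e1 := (h.conn.hasFDerivAt h.kaehler h.mem).clm_apply hdξ
    have e2 : (fun y => τ y (chartField ξ p y)) =ᶠ[𝓝 y₀] fun _ => (1 : ℝ) := by
      filter_upwards [h.mem_nhds] with y hy using h.form_field y hy
    have e3 := congrArg (fun l : E × N →L[ℝ] ℝ => l u)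
      (e1.unique ((hasFDerivAt_const (1 : ℝ) y₀).congr_of_eventuallyEq e2))
    have e4 := chartField_self (E := E × N) ξ p
    rw [e4] at e3
    exact eq_neg_of_add_eq_zero_left e3
  let x : E × N := X p
  let y : E × N := Y p
  let z : E × N := ξ p
  let Dx := fderiv ℝ (chartField X p) y₀
  let Dy := fderiv ℝ (chartField Y p) y₀
  let Dz := fderiv ℝ (chartField ξ p) y₀
  have hz : z.1 = 0 := h.xi_fst
  have hDz1 : ∀ u, (Dz u).1 = 0 := hξ1
  have hDz2 : ∀ u, τ y₀ (Dz u) = -fderiv ℝ τ y₀ u z := hξ2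
  have hc : ∀ u, fderiv ℝ τ y₀ z u - fderiv ℝ τ y₀ u z = 0 := fun u => by
    rw [h.conn.curv y₀ h.mem, hz, map_zero, map_zero, zero_apply, mul_zero]
  have key : G y₀ x (Dy z) + (G y₀ (Dx z) y + fderiv ℝ G y₀ z x y)
      - G y₀ (Dx z - Dz x) y - G y₀ x (Dy z - Dz y) = 0 := by
    have e1 : G y₀ (Dz x) y = -fderiv ℝ τ y₀ x z * τ y₀ y := by
      rw [hG, liftMetric_apply, hDz1, hDz2, map_zero, zero_apply, zero_add]
    have e2 : G y₀ x (Dz y) = τ y₀ x * -fderiv ℝ τ y₀ y z := by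
      rw [hG, liftMetric_apply, hDz1, hDz2, map_zero, zero_add]
    have e3 := h.conn.fderiv_liftMetric h.kaehler h.mem z x y
    rw [hz] at e3
    simp only [map_zero, zero_apply, zero_add] at e3
    rw [map_sub, map_sub, sub_apply, e1, e2, hG, hy₀, e3]
    linear_combination τ y₀ y * hc x + τ y₀ x * hc y
  rw [hl]
  refine (congrArg₂ (fun a b => _ - a - b) (hg _ _) (hg _ _)).trans ?_
  rw [hb X, hb Y]
  exact key

lemma normal {X Y : ∀ q : M, 𝐓 q} (hX : IsSmoothField 𝐈 X)
    (hY : IsSmoothField 𝐈 Y) :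
    φ p (φ p (mlieBracket 𝐈 X Y p))
      + mlieBracket 𝐈 (fun q => φ q (X q)) (fun q => φ q (Y q)) p
      - φ p (mlieBracket 𝐈 (fun q => φ q (X q)) Y p)
      - φ p (mlieBracket 𝐈 X (fun q => φ q (Y q)) p)
      + extD 𝐈 η p (X p) (Y p) • ξ p = 0 := by
  set y₀ := 𝐞 p p with hy₀
  have hdX := (differentiableAt_chartField hX p).hasFDerivAt
  have hdY := (differentiableAt_chartField hY p).hasFDerivAt
  have hdφ := (h.contDiffAt_endo.differentiableAt (by simp)).hasFDerivAt
  set Φ' := fderiv ℝ (chartEndo φ p) y₀ with hΦ'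
  let Φ : E × N →L[ℝ] E × N := φ p
  let x : E × N := X p
  let y : E × N := Y p
  set DX := fderiv ℝ (chartField X p) y₀ with hDX
  set DY := fderiv ℝ (chartField Y p) y₀ with hDY
  have hφZ : ∀ Z : ∀ q : M, 𝐓 q,
      chartField (fun q => φ q (Z q)) p =ᶠ[𝓝 y₀] fun y => chartEndo φ p y (chartField Z p y) := by
    intro Z
    filter_upwards [h.mem_nhds] with z hz
    let A : M → E × N →L[ℝ] E × N := fun q => φ q
    change _ = chartDeriv p _ (A _ (chartInvDeriv p z (chartField Z p z)))
    rw [chartInvDeriv_chartField Z (h.subset hz)]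
    rfl
  have hΦ0 : ∀ u, chartEndo φ p y₀ u = Φ u := fun u => DFunLike.congr_fun (chartEndo_self φ p) u
  have eX : chartField X p y₀ = x := chartField_self (E := E × N) X p
  have eY : chartField Y p y₀ = y := chartField_self (E := E × N) Y p
  have hDφX : ∀ u, fderiv ℝ (chartField (fun q => φ q (X q)) p) y₀ u = Φ' u x + Φ (DX u) := by
    intro u
    rw [(hφZ X).fderiv_eq, (hdφ.clm_apply hdX).fderiv]
    refine Eq.trans ?_ (congrArg₂ (fun a b => Φ' u a + b) eX (hΦ0 (DX u)))
    exact add_comm _ _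
  have hDφY : ∀ u, fderiv ℝ (chartField (fun q => φ q (Y q)) p) y₀ u = Φ' u y + Φ (DY u) := by
    intro u
    rw [(hφZ Y).fderiv_eq, (hdφ.clm_apply hdY).fderiv]
    refine Eq.trans ?_ (congrArg₂ (fun a b => Φ' u a + b) eY (hΦ0 (DY u)))
    exact add_comm _ _
  have b1 : (mlieBracket 𝐈 X Y p : E × N) = DY x - DX y := mlieBracket_eq p
  have b2 : (mlieBracket 𝐈 (fun q => φ q (X q)) (fun q => φ q (Y q)) p : E × N)
      = (Φ' (Φ x) y + Φ (DY (Φ x))) - (Φ' (Φ y) x + Φ (DX (Φ y))) :=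
    (mlieBracket_eq p).trans (congrArg₂ (fun a b => a - b) (hDφY _) (hDφX _))
  have b3 : (mlieBracket 𝐈 (fun q => φ q (X q)) Y p : E × N)
      = DY (Φ x) - (Φ' y x + Φ (DX y)) :=
    (mlieBracket_eq p).trans (congrArg₂ (fun a b => a - b) rfl (hDφX _))
  have b4 : (mlieBracket 𝐈 X (fun q => φ q (Y q)) p : E × N)
      = (Φ' x y + Φ (DY x)) - DX (Φ y) :=
    (mlieBracket_eq p).trans (congrArg₂ (fun a b => a - b) (hDφY _) rfl)
  have hΦ1 : ∀ u, (Φ u).1 = 𝐉 u.1 := h.phi_fst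
  have hΦτ : ∀ u, τ y₀ (Φ u) = 0 := h.form_phi
  have hΦ'1 : ∀ a u, (Φ' a u).1 = 0 := fun a u => by
    have e1 := (ContinuousLinearMap.fst ℝ E N).hasFDerivAt.comp y₀
      (hdφ.clm_apply (hasFDerivAt_const u y₀))
    have e2 : (ContinuousLinearMap.fst ℝ E N ∘ fun z => chartEndo φ p z u) =ᶠ[𝓝 y₀]
        fun _ => 𝐉 u.1 := by
      filter_upwards [h.mem_nhds] with z hz using h.endo_fst z hz u
    have e3 := congrArg (fun l : E × N →L[ℝ] E => l a)
      (e1.unique ((hasFDerivAt_const (𝐉 u.1) y₀).congr_of_eventuallyEq e2))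
    simpa using e3
  have hΦ'τ : ∀ a u, τ y₀ (Φ' a u) = -fderiv ℝ τ y₀ a (Φ u) := fun a u => by
    have e1 := (h.conn.hasFDerivAt h.kaehler h.mem).clm_apply
      (hdφ.clm_apply (hasFDerivAt_const u y₀))
    have e2 : (fun z => τ z (chartEndo φ p z u)) =ᶠ[𝓝 y₀] fun _ => (0 : ℝ) := by
      filter_upwards [h.mem_nhds] with z hz using h.form_endo z hz u
    have e3 := congrArg (fun l : E × N →L[ℝ] ℝ => l a)
      (e1.unique ((hasFDerivAt_const (0 : ℝ) y₀).congr_of_eventuallyEq e2))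
    rw [← hΦ0]
    refine eq_neg_of_add_eq_zero_left (Eq.trans ?_ e3)
    simp only [ContinuousLinearMap.comp_apply, add_apply,
      ContinuousLinearMap.flip_apply, zero_add, ContinuousLinearMap.comp_zero]
    rfl
  have hext : extD 𝐈 η p (X p) (Y p) = 2 * B y₀.1 (𝐉 x.1) y.1 := h.extD_self x y
  let z : E × N := ξ p
  have key : Φ (Φ (DY x - DX y)) + ((Φ' (Φ x) y + Φ (DY (Φ x))) - (Φ' (Φ y) x + Φ (DX (Φ y))))
      - Φ (DY (Φ x) - (Φ' y x + Φ (DX y))) - Φ ((Φ' x y + Φ (DY x)) - DX (Φ y))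
      + (2 * B y₀.1 (𝐉 x.1) y.1) • z = 0 := by
    have hξf : z.1 = 0 := h.xi_fst
    have hξτ : τ y₀ z = 1 := h.form_xi
    refine h.conn.eq_zero y₀ h.mem _ ?_ ?_
    · simp only [Prod.fst_add, Prod.fst_sub, Prod.smul_fst, hΦ1, hΦ'1, hξf, map_add, map_sub,
        complexStructure_sq, map_zero, smul_zero]
      abel
    · have c := h.conn.curv y₀ h.mem (Φ x) (Φ y)
      rw [hΦ1, hΦ1, complexStructure_sq] at c
      have c2 : B y₀.1 (-x.1) (𝐉 y.1) = B y₀.1 (𝐉 x.1) y.1 := by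
        rw [h.kaehler.inv_left (h.conn.fst_mem _ h.mem), map_neg, neg_apply]
      rw [c2] at c
      simp only [map_add, map_sub, map_smul, hΦτ, hΦ'τ, hξτ, smul_eq_mul]
      linear_combination -c
  refine Eq.trans ?_ key
  rw [← hext, ← b1, ← b2, ← b3, ← b4]
  rfl

/-- The Ricci tensor, when the potential `F` of the Kähler metric is also a potential of its volume
density. -/
lemma ricci_eq {F : E → ℝ} {j : E → ℂ} {C c : ℝ} (hF : ∀ y ∈ U, ContDiffAt ℝ ∞ F y)
    (hj : ∀ y ∈ U, ContDiffAt ℂ ω j y) (hj0 : ∀ y ∈ U, j y ≠ 0) (hvol : ∀ y ∈ U,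
      gramDet (toBilin (B y)) = C * (‖j y‖ ^ 2) ^ 2 * Real.exp (-2 * F y))
    (hB : ∀ y ∈ U, ∀ u w, leviForm F y u w = c * B y u w)
    (hc : c = 2 * finrank ℝ E + 4) (v w : E × N) :
    ricci 𝐈 g p v w = finrank ℝ E * g p v w := by
  have hU := h.conn.fst_mem _ h.mem
  have h1 : chartMetric 𝐈 g p =ᶠ[𝓝 (𝐞 p p)] liftMetric B τ := by
    filter_upwards [h.mem_nhds] with y hy using h.metric y hy
  have h2 := h.conn.ricci_eq h.kaehler hF hj hj0 hvol h.mem v w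
  rw [h.metric_self]
  refine (Finset.sum_congr rfl fun i _ =>
    congrArg ((finBasis ℝ (E × N)).coord i) (curvature_congr h1 _ v w)).trans (h2.trans ?_)
  rw [hB _ hU, hc]
  ring

end IsLocalModel
end Model

/-! ### The contact condition -/

/-- The positions `0`, `2 i + 1`, `2 i + 2` of the arguments of `η ∧ τⁿ`, labelled by `none`,
`(i, 0)`, `(i, 1)`. -/
def pairIndex (n : ℕ) : Fin (2 * n + 1) ≃ Option (Fin n × Fin 2) :=
  ((finCongr (by rw [mul_comm])).trans (finSuccEquiv (n * 2))).trans
    (Equiv.optionCongr finProdFinEquiv.symm)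

lemma pairIndex_zero (n : ℕ) : pairIndex n 0 = none := by
  simp [pairIndex]

lemma pairIndex_symm_some (n : ℕ) (i : Fin n) (a : Fin 2) (h : 2 * (i : ℕ) + 1 + a < 2 * n + 1) :
    pairIndex n ⟨2 * i + 1 + a, h⟩ = some (i, a) := by
  have e : finCongr (by rw [mul_comm] : 2 * n + 1 = n * 2 + 1) ⟨2 * i + 1 + a, h⟩
      = (finProdFinEquiv (i, a)).succ := by
    ext
    simp [finProdFinEquiv]
    omega
  rw [pairIndex, Equiv.trans_apply, Equiv.trans_apply, e, finSuccEquiv_succ,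
    Equiv.optionCongr_apply, Option.map_some, Equiv.symm_apply_apply]

/-- A permutation of pairs that maps pairs to pairs has the sign of the permutations that it
induces inside the pairs, because the permutation of the set of pairs is counted twice. -/
lemma sign_eq_of_pairs {n : ℕ} (σ : Equiv.Perm (Fin n × Fin 2))
    (h : ∀ i, (σ (i, 0)).1 = (σ (i, 1)).1) :
    ∃ α : Fin n → Equiv.Perm (Fin 2), (∀ i a, (σ (i, a)).2 = α i a) ∧
      Equiv.Perm.sign σ = ∏ i, Equiv.Perm.sign (α i) := by
  have h1 : ∀ i a, (σ (i, a)).1 = (σ (i, 0)).1 := by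
    intro i a
    fin_cases a
    · rfl
    · exact (h i).symm
  have hα : ∀ i, Function.Bijective fun a => (σ (i, a)).2 := fun i =>
    (Finite.injective_iff_bijective).1 fun a b hab => by
      have : σ (i, a) = σ (i, b) := Prod.ext ((h1 i a).trans (h1 i b).symm) hab
      exact (Prod.ext_iff.1 (σ.injective this)).2
  have hρ : Function.Bijective fun i => (σ (i, 0)).1 :=
    (Finite.surjective_iff_bijective).1 fun j => by
      refine ⟨(σ.symm (j, 0)).1, ?_⟩
      rw [← h1 _ (σ.symm (j, 0)).2]
      simp
  let α : Fin n → Equiv.Perm (Fin 2) := fun i => Equiv.ofBijective _ (hα i)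
  let ρ : Equiv.Perm (Fin n) := Equiv.ofBijective _ hρ
  refine ⟨α, fun i a => rfl, ?_⟩
  have e : σ = (Equiv.prodCongrLeft fun _ : Fin 2 => ρ) * Equiv.prodCongrRight α := by
    ext x : 1
    obtain ⟨i, a⟩ := x
    exact Prod.ext (h1 i a) rfl
  rw [e, map_mul, Equiv.Perm.sign_prodCongrLeft, Equiv.Perm.sign_prodCongrRight]
  simp

/-- `η ∧ τⁿ` is positive on `v₀, e₁, f₁, …, eₙ, fₙ` when `η` vanishes on all `eᵢ, fᵢ` and the pairs
`(eᵢ, fᵢ)` are orthogonal to each other for `τ`: all the terms have the same sign. -/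
lemma wedgePow_pos {n : ℕ} {V : Type*} {η : V → ℝ} {τ : V → V → ℝ}
    (w : Option (Fin n × Fin 2) → V) (h0 : 0 < η (w none)) (h1 : ∀ x, η (w (some x)) = 0)
    (h2 : ∀ x y, x.1 ≠ y.1 → τ (w (some x)) (w (some y)) = 0)
    (h3 : ∀ i, 0 < τ (w (some (i, 0))) (w (some (i, 1))))
    (h4 : ∀ i, τ (w (some (i, 1))) (w (some (i, 0))) = -τ (w (some (i, 0))) (w (some (i, 1)))) :
    0 < wedgePow n η τ (w ∘ pairIndex n) := by
  have key : ∀ σ : Equiv.Perm (Option (Fin n × Fin 2)),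
      0 ≤ ((Equiv.Perm.sign σ : ℤ) : ℝ) * (η (w (σ none)) *
        ∏ i : Fin n, τ (w (σ (some (i, 0)))) (w (σ (some (i, 1))))) := by
    intro σ
    rcases hσ : σ none with _ | x
    swap
    · rw [h1, zero_mul, mul_zero]
    obtain ⟨π', rfl⟩ : ∃ π' : Equiv.Perm (Fin n × Fin 2), σ = Equiv.optionCongr π' := by
      refine ⟨Equiv.removeNone σ, Equiv.ext fun x => ?_⟩
      rcases x with _ | x
      · simpa using hσ
      · rw [Equiv.optionCongr_apply, Option.map_some, Equiv.removeNone_some]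
        refine Option.ne_none_iff_exists'.1 fun h => ?_
        exact Option.some_ne_none x (σ.injective (h.trans hσ.symm))
    simp only [Equiv.optionCongr_apply, Option.map_some, Equiv.optionCongr_sign]
    by_cases h : ∀ i, (π' (i, 0)).1 = (π' (i, 1)).1
    · obtain ⟨α, hα, hs⟩ := sign_eq_of_pairs π' h
      rw [hs]
      push_cast
      rw [mul_left_comm, ← Finset.prod_mul_distrib]
      refine mul_nonneg h0.le (Finset.prod_nonneg fun i _ => ?_)
      have e0 : π' (i, 0) = ((π' (i, 0)).1, α i 0) := Prod.ext rfl (hα i 0)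
      have e1 : π' (i, 1) = ((π' (i, 0)).1, α i 1) := Prod.ext (h i).symm (hα i 1)
      rw [e0, e1]
      obtain hi | hi : α i = 1 ∨ α i = Equiv.swap 0 1 := by
        generalize α i = β
        revert β
        decide
      · simpa [hi] using (h3 _).le
      · simpa [hi, h4] using (h3 _).le
    · push Not at h
      obtain ⟨i, hi⟩ := h
      rw [Finset.prod_eq_zero (Finset.mem_univ i) (h2 _ _ hi), mul_zero, mul_zero]
  have hterm : ∀ σ : Equiv.Perm (Fin (2 * n + 1)),
      ((Equiv.Perm.sign σ : ℤ) : ℝ) * (η ((w ∘ pairIndex n) (σ 0)) * ∏ i : Fin n,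
        τ ((w ∘ pairIndex n) (σ ⟨2 * i + 1, by omega⟩)) ((w ∘ pairIndex n) (σ ⟨2 * i + 2, by omega⟩)))
      = ((Equiv.Perm.sign ((pairIndex n).permCongr σ) : ℤ) : ℝ)
        * (η (w ((pairIndex n).permCongr σ none)) * ∏ i : Fin n,
        τ (w ((pairIndex n).permCongr σ (some (i, 0))))
          (w ((pairIndex n).permCongr σ (some (i, 1))))) := by
    intro σ
    have e0 : (pairIndex n).symm none = 0 := by rw [← pairIndex_zero, Equiv.symm_apply_apply]
    have e1 : ∀ i : Fin n, (pairIndex n).symm (some (i, 0)) = ⟨2 * i + 1, by omega⟩ := fun i =>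
      (Equiv.symm_apply_eq _).2 (pairIndex_symm_some n i 0 (by simp)).symm
    have e2 : ∀ i : Fin n, (pairIndex n).symm (some (i, 1)) = ⟨2 * i + 2, by omega⟩ := fun i =>
      (Equiv.symm_apply_eq _).2 (pairIndex_symm_some n i 1 (by simp; omega)).symm
    simp only [Equiv.Perm.sign_permCongr, Equiv.permCongr_apply, e0, e1, e2, Function.comp_apply]
  refine Finset.sum_pos' (fun σ _ => ?_) ⟨1, Finset.mem_univ _, ?_⟩
  · rw [hterm]
    exact key _
  · rw [hterm]
    simp only [Equiv.permCongr_apply, Equiv.Perm.one_apply, Equiv.apply_symm_apply,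
      Equiv.Perm.sign_permCongr, map_one, Units.val_one, Int.cast_one, one_mul]
    exact mul_pos h0 (Finset.prod_pos fun i _ => h3 i)

lemma exists_orthonormal_of_core {E : Type*} [AddCommGroup E] [Module ℂ E]
    [FiniteDimensional ℂ E] (c : InnerProductSpace.Core ℂ E) :
    ∃ e : Fin (finrank ℂ E) → E, ∀ i j, c.inner (e i) (e j) = if i = j then 1 else 0 := by
  let _ := c.toNormedAddCommGroup
  let _ := InnerProductSpace.ofCore c.toCore
  refine ⟨stdOrthonormalBasis ℂ E, fun i j => ?_⟩
  exact orthonormal_iff_ite.1 (stdOrthonormalBasis ℂ E).orthonormal i j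

section Model
variable {E : Type*} [NormedAddCommGroup E] [NormedSpace ℂ E] [FiniteDimensional ℂ E]

local notation "𝐉" => complexStructure E

lemma IsKaehlerOn.exists_unitary_basis {B : E → E →L[ℝ] E →L[ℝ] ℝ} {U : Set E}
    (h : IsKaehlerOn B U) {y : E} (hy : y ∈ U) :
    ∃ e : Fin (finrank ℂ E) → E, (∀ i, B y (e i) (e i) = 1) ∧
      ∀ i j, i ≠ j → B y (e i) (e j) = 0 ∧ B y (e i) (𝐉 (e j)) = 0 := by
  have hJ : ∀ u v, B y u (𝐉 v) = -B y v (𝐉 u) := fun u v => by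
    rw [← h.inv y hy u (𝐉 v), complexStructure_sq, map_neg, h.symm y hy]
  have hre : ∀ (r : ℂ) (v : E), r • v = r.re • v + r.im • 𝐉 v := fun r v => by
    conv_lhs => rw [← Complex.re_add_im r]
    rw [add_smul, mul_smul, complexStructure_apply]
    rfl
  let c : InnerProductSpace.Core ℂ E :=
    { inner := fun u v => ⟨B y u v, -B y u (𝐉 v)⟩
      conj_inner_symm := fun u v => by
        apply Complex.ext
        · exact h.symm y hy _ _
        · change - -B y v (𝐉 u) = -B y u (𝐉 v)
          rw [hJ u v]
      re_inner_nonneg := fun u => by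
        change 0 ≤ B y u u
        by_cases hu : u = 0
        · rw [hu, map_zero]
        · exact (h.pos y hy u hu).le
      add_left := fun u v w => by
        apply Complex.ext
        · change B y (u + v) w = B y u w + B y v w
          rw [map_add, add_apply]
        · change -B y (u + v) (𝐉 w) = -B y u (𝐉 w) + -B y v (𝐉 w)
          rw [map_add, add_apply, neg_add]
      smul_left := fun u v r => by
        have e : B y (𝐉 u) v = -B y u (𝐉 v) := by rw [h.symm y hy, hJ]
        apply Complex.ext
        · change B y (r • u) v = r.re * B y u v - -r.im * -B y u (𝐉 v)
          rw [hre, map_add, map_smul, map_smul, add_apply, smul_apply, smul_apply, e]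
          simp only [smul_eq_mul]
          ring
        · change -B y (r • u) (𝐉 v) = r.re * -B y u (𝐉 v) + -r.im * B y u v
          rw [hre, map_add, map_smul, map_smul, add_apply, smul_apply, smul_apply, h.inv y hy]
          simp only [smul_eq_mul]
          ring
      definite := fun u hu => by
        by_contra h0
        exact (h.pos y hy u h0).ne' (congrArg Complex.re hu) }
  obtain ⟨e, he⟩ := exists_orthonormal_of_core c
  refine ⟨e, fun i => ?_, fun i j hij => ?_⟩
  · have := congrArg Complex.re (he i i)
    rwa [if_pos rfl] at this
  · have := he i j
    rw [if_neg hij] at this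
    exact ⟨congrArg Complex.re this, neg_eq_zero.1 (congrArg Complex.im this)⟩

variable {N : Type*} [NormedAddCommGroup N] [NormedSpace ℝ N] [FiniteDimensional ℝ N]
  {M : Type*} [TopologicalSpace M] [ChartedSpace (E × N) M] [IsManifold 𝓘(ℝ, E × N) ∞ M]
local notation "𝐈" => 𝓘(ℝ, E × N)
local notation "𝐓" => TangentSpace 𝓘(ℝ, E × N)
local notation:max "𝐞" p:max => extChartAt 𝓘(ℝ, E × N) p

lemma IsLocalModel.exists_wedgePow_ne_zero
    {g : ∀ q : M, 𝐓 q →L[ℝ] 𝐓 q →L[ℝ] ℝ}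
    {φ : ∀ q : M, 𝐓 q →L[ℝ] 𝐓 q}
    {ξ : ∀ q : M, 𝐓 q} {η : ∀ q : M, 𝐓 q →L[ℝ] ℝ}
    {p : M} {B : E → E →L[ℝ] E →L[ℝ] ℝ} {U : Set E} {τ : E × N → E × N →L[ℝ] ℝ} {Ω : Set (E × N)}
    (h : IsLocalModel g φ ξ η p B U τ Ω) :
    ∃ v : Fin (2 * finrank ℂ E + 1) → 𝐓 p, wedgePow (finrank ℂ E) (η p) (extD 𝐈 η p) v ≠ 0 := by
  have hy := h.conn.fst_mem _ h.mem
  obtain ⟨e, he1, he2⟩ := h.kaehler.exists_unitary_basis hy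
  let b : E →L[ℝ] E →L[ℝ] ℝ := B (𝐞 p p).1
  have hinv : ∀ u v, b (𝐉 u) (𝐉 v) = b u v := h.kaehler.inv _ hy
  have he1 : ∀ i, b (e i) (e i) = 1 := he1
  have he2 : ∀ i j, i ≠ j → b (e i) (e j) = 0 ∧ b (e i) (𝐉 (e j)) = 0 := he2
  let z : E × N := ξ p
  have hz : τ (𝐞 p p) z = 1 := h.form_xi
  let f : Fin (finrank ℂ E) × Fin 2 → E := fun x => if x.2 = 0 then e x.1 else 𝐉 (e x.1)
  let H : E → E × N := fun a => (a, 0) - τ (𝐞 p p) (a, 0) • z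
  have hz1 : z.1 = 0 := h.xi_fst
  have hH1 : ∀ a, (H a).1 = a := fun a => by
    change a - (τ (𝐞 p p) (a, 0) • z).1 = a
    rw [Prod.smul_fst, hz1, smul_zero, sub_zero]
  have hH2 : ∀ a, τ (𝐞 p p) (H a) = 0 := fun a => by
    rw [map_sub, map_smul, hz, smul_eq_mul, mul_one, sub_self]
  have hD : ∀ a c, extD 𝐈 η p (H a) (H c)
      = 2 * b (𝐉 a) c := fun a c => by
    rw [h.extD_self, hH1, hH1]
  let w : Option (Fin (finrank ℂ E) × Fin 2) → 𝐓 p := fun x => x.elim z fun x => H (f x)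
  refine ⟨_, (wedgePow_pos w ?_ (fun x => ?_) (fun x y hxy => ?_) (fun i => ?_) fun i => ?_).ne'⟩
  · exact lt_of_lt_of_eq one_pos ((h.form_self z).trans hz).symm
  · exact (h.form_self _).trans (hH2 _)
  · refine (hD _ _).trans ?_
    have e1 := he2 _ _ hxy
    have e2 := he2 _ _ hxy.symm
    have e3 : b (𝐉 (e x.1)) (e y.1) = 0 := (h.kaehler.symm _ hy _ _).trans e2.2
    rcases eq_or_ne x.2 0 with hx | hx <;> rcases eq_or_ne y.2 0 with hy' | hy' <;>
      simp [f, hx, hy', hinv, e1, e3, complexStructure_sq]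
  · refine lt_of_lt_of_eq ?_ (hD _ _).symm
    simp [f, hinv, he1]
  · refine (hD _ _).trans (Eq.trans ?_ (congrArg (fun t => -t) (hD _ _).symm))
    simp [f, hinv, he1, complexStructure_sq]

end Model

/-! ### Quotients of Lie groups by discrete normal subgroups -/

section DiscreteQuotient
variable {F : Type*} [NormedAddCommGroup F] [NormedSpace ℝ F]
  {G : Type*} [TopologicalSpace G] [ChartedSpace F G] [Group G] [IsTopologicalGroup G]
  {N : Subgroup G}

lemma isLocalHomeomorph_mk (hN : IsDiscrete (N : Set G)) :
    IsLocalHomeomorph (QuotientGroup.mk : G → G ⧸ N) :=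
  (N.isQuotientCoveringMap hN).isCoveringMap.isLocalHomeomorph

/-- The charts of the quotient of a Lie group by a discrete subgroup, transported along the local
inverses of the projection. -/
@[reducible]
def discreteQuotientChartedSpace (hN : IsDiscrete (N : Set G)) : ChartedSpace F (G ⧸ N) :=
  (isLocalHomeomorph_mk hN).chartedSpace QuotientGroup.mk_surjective

variable [LieGroup 𝓘(ℝ, F) ∞ G]

/-- Near a point, a local inverse of the projection, composed with the projection, is the right
translation by an element of the discrete subgroup. -/
lemma contMDiffAt_localInverse_mk (hN : IsDiscrete (N : Set G)) {a x : G}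
    (hx : QuotientGroup.mk x ∈ ((isLocalHomeomorph_mk hN).localInverseAt a).source) :
    ContMDiffAt 𝓘(ℝ, F) 𝓘(ℝ, F) ∞
      (fun y : G => (isLocalHomeomorph_mk hN).localInverseAt a (QuotientGroup.mk y)) x := by
  set hf := isLocalHomeomorph_mk hN
  set e := hf.localInverseAt a
  have hc : ContinuousAt (fun y : G => e (QuotientGroup.mk y)) x :=
    (e.continuousAt hx).comp (f := QuotientGroup.mk) continuous_quot_mk.continuousAt
  have hs : ∀ᶠ y : G in 𝓝 x, (QuotientGroup.mk y : G ⧸ N) ∈ e.source :=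
    (continuous_quot_mk (X := G)).continuousAt.eventually (e.open_source.mem_nhds hx)
  have hm : ∀ y : G, (QuotientGroup.mk y : G ⧸ N) ∈ e.source →
      y⁻¹ * e (QuotientGroup.mk y) ∈ N := fun y hy =>
    QuotientGroup.eq.1 (hf.apply_localInverseAt_of_mem hy).symm
  have ht : Filter.Tendsto (fun y : G => y⁻¹ * e (QuotientGroup.mk y)) (𝓝 x)
      (𝓝[N] (x⁻¹ * e (QuotientGroup.mk x))) := tendsto_nhdsWithin_of_tendsto_nhds_of_eventually_within _
    (continuousAt_inv.mul hc).tendsto (hs.mono hm)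
  rw [isDiscrete_iff_nhdsWithin.1 hN _ (hm x hx)] at ht
  refine (contMDiff_mul_right (I := 𝓘(ℝ, F)) (n := ∞)
    (a := x⁻¹ * e (QuotientGroup.mk x)) x).congr_of_eventuallyEq ?_
  filter_upwards [Filter.tendsto_pure.1 ht] with y hy
  rw [← hy, mul_inv_cancel_left]

lemma contMDiff_mk_discrete (hN : IsDiscrete (N : Set G)) :
    letI := discreteQuotientChartedSpace (F := F) hN
    ContMDiff 𝓘(ℝ, F) 𝓘(ℝ, F) ∞ (QuotientGroup.mk : G → G ⧸ N) := by
  intro x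
  let _ := discreteQuotientChartedSpace (F := F) hN
  have h := mem_chart_source F (QuotientGroup.mk x : G ⧸ N)
  refine contMDiffAt_iff_target.2 ⟨continuous_quot_mk.continuousAt, ?_⟩
  exact (contMDiffAt_extChartAt' (I := 𝓘(ℝ, F)) h.2).comp
    (f := fun y : G => (isLocalHomeomorph_mk hN).localInverseAt _ (QuotientGroup.mk y)) x
    (contMDiffAt_localInverse_mk hN h.1)

lemma isManifold_discreteQuotient (hN : IsDiscrete (N : Set G)) :
    letI := discreteQuotientChartedSpace (F := F) hN
    IsManifold 𝓘(ℝ, F) ∞ (G ⧸ N) := by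
  let _ := discreteQuotientChartedSpace (F := F) hN
  set hf := isLocalHomeomorph_mk hN
  refine isManifold_of_contDiffOn _ _ _ ?_
  rintro _ _ ⟨q, rfl⟩ ⟨q', rfl⟩
  simp only [mfld_simps, hf.localInverseAt_symm]
  refine contMDiffOn_iff_contDiffOn.1 fun y hy => ?_
  obtain ⟨⟨h1, -⟩, h2, h3⟩ := hy
  have k1 := (contMDiffOn_chart_symm (I := 𝓘(ℝ, F)) (n := ∞) y h1).contMDiffAt
    ((chartAt F _).open_target.mem_nhds h1)
  have k2 := (contMDiffAt_localInverse_mk hN h2).comp y k1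
  exact ((contMDiffOn_chart (I := 𝓘(ℝ, F)) (n := ∞) _ h3).contMDiffAt
    ((chartAt F _).open_source.mem_nhds h3)).comp y k2 |>.contMDiffWithinAt

/-- A smooth local section of the projection to the quotient by a discrete subgroup. -/
lemma exists_contMDiffAt_section (hN : IsDiscrete (N : Set G)) (q : G ⧸ N) :
    letI := discreteQuotientChartedSpace (F := F) hN
    ∃ s : G ⧸ N → G, ContMDiffAt 𝓘(ℝ, F) 𝓘(ℝ, F) ∞ s q ∧ ∀ᶠ y in 𝓝 q, QuotientGroup.mk (s y) = y := by
  let _ := discreteQuotientChartedSpace (F := F) hN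
  set hf := isLocalHomeomorph_mk hN
  have h := mem_chart_source F q
  set a := (QuotientGroup.mk_surjective (s := N)).hasRightInverse.choose q
  refine ⟨hf.localInverseAt a, ?_, ?_⟩
  · have := isManifold_discreteQuotient (F := F) hN
    have h1 : chartAt F q q ∈ (chartAt F a).target := ((chartAt F q).map_source h).1
    refine (((contMDiffOn_chart_symm (I := 𝓘(ℝ, F)) (n := ∞) _ h1).contMDiffAt
      ((chartAt F a).open_target.mem_nhds h1)).comp q
      (contMDiffAt_extChartAt (I := 𝓘(ℝ, F)) (x := q))).congr_of_eventuallyEq ?_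
    filter_upwards [(chartAt F q).open_source.mem_nhds h] with y hy
    exact ((chartAt F a).left_inv hy.2).symm
  · filter_upwards [(hf.localInverseAt a).open_source.mem_nhds h.1] with y hy
    exact hf.apply_localInverseAt_of_mem hy

lemma lieGroup_discreteQuotient [N.Normal] (hN : IsDiscrete (N : Set G)) :
    letI := discreteQuotientChartedSpace (F := F) hN
    LieGroup 𝓘(ℝ, F) ∞ (G ⧸ N) := by
  let _ := discreteQuotientChartedSpace (F := F) hN
  have := isManifold_discreteQuotient (F := F) hN
  refine { contMDiff_mul := fun q => ?_, contMDiff_inv := fun q => ?_ }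
  · obtain ⟨s, hs, hs'⟩ := exists_contMDiffAt_section (F := F) hN q.1
    obtain ⟨t, ht, ht'⟩ := exists_contMDiffAt_section (F := F) hN q.2
    refine ((contMDiff_mk_discrete hN _).comp q ((hs.comp q contMDiffAt_fst).mul
      (ht.comp q contMDiffAt_snd))).congr_of_eventuallyEq ?_
    filter_upwards [continuousAt_fst.eventually hs', continuousAt_snd.eventually ht'] with y h1 h2
    exact (congrArg₂ (· * ·) h1 h2).symm
  · obtain ⟨s, hs, hs'⟩ := exists_contMDiffAt_section (F := F) hN q
    refine ((contMDiff_mk_discrete hN _).comp q hs.inv).congr_of_eventuallyEq ?_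
    filter_upwards [hs'] with y hy
    exact (congrArg (·⁻¹) hy).symm

/-- If `G` acts smoothly through its quotient by a discrete subgroup, then so does the quotient. -/
lemma contMDiffSMul_discreteQuotient {F' M : Type*} [NormedAddCommGroup F'] [NormedSpace ℝ F']
    [TopologicalSpace M] [ChartedSpace F' M] (hN : IsDiscrete (N : Set G)) [SMul (G ⧸ N) M]
    (h : ContMDiff (𝓘(ℝ, F).prod 𝓘(ℝ, F')) 𝓘(ℝ, F') ∞
      fun p : G × M => (QuotientGroup.mk p.1 : G ⧸ N) • p.2) :
    letI := discreteQuotientChartedSpace (F := F) hN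
    ContMDiffSMul 𝓘(ℝ, F) 𝓘(ℝ, F') ∞ (G ⧸ N) M := by
  let _ := discreteQuotientChartedSpace (F := F) hN
  refine ⟨fun q => ?_⟩
  obtain ⟨s, hs, hs'⟩ := exists_contMDiffAt_section (F := F) hN q.1
  refine ((h _).comp q ((hs.comp q contMDiffAt_fst).prodMk contMDiffAt_snd)).congr_of_eventuallyEq ?_
  filter_upwards [continuousAt_fst.eventually hs'] with y h1
  exact (congrArg (· • y.2) h1).symm

end DiscreteQuotient

section Flag

variable {𝔼 : Type*} [NormedAddCommGroup 𝔼] [NormedSpace ℂ 𝔼] [FiniteDimensional ℂ 𝔼]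
  {Gc : Type*} [TopologicalSpace Gc] [ChartedSpace 𝔼 Gc] [Group Gc] [LieGroup 𝓘(ℂ, 𝔼) ω Gc]
  {E : Type*} [NormedAddCommGroup E] [NormedSpace ℂ E] [FiniteDimensional ℂ E]
  {P : Subgroup Gc} [ChartedSpace E (Gc ⧸ P)] [hq : IsHolomorphicQuotient 𝔼 E P]
  {V : Type*} [NormedAddCommGroup V] [InnerProductSpace ℂ V] [FiniteDimensional ℂ V]
  {R : Gc → V →L[ℂ] V} {dR : 𝔼 →L[ℂ] V →L[ℂ] V} {br : 𝔼 → 𝔼 → 𝔼} {v : V}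
  {d : ℕ} {G : Type*} [TopologicalSpace G] [ChartedSpace (EuclideanSpace ℝ (Fin d)) G] [Group G]
  {ι : G →* Gc} {χ : HolomorphicCharacter 𝔼 P}
variable (hm : IsFlagModel E P R dR br v) (hG : IsCompactRealForm (d := d) 𝔼 ι)
  (hu : ∀ (k : G) (w : V), ‖R (ι k) w‖ = ‖w‖) {s : LocalSection 𝔼 E P} {p : CircleBundle E χ}
-- In the following, `𝐞` and `𝐱` are the charts of the circle bundle and of the flag manifold, `𝐈`
-- is the model of the former, `𝛑` the projection to the latter, and `𝐬 x` the preferred section.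
local notation "𝐉" => complexStructure E
local notation "𝐈" => 𝓘(ℝ, CircleModel E)
local notation:max "𝐞" p:max => extChartAt 𝓘(ℝ, CircleModel E) p
local notation "𝛑" => (QuotientGroup.mk : Gc → Gc ⧸ P)
local notation:max "𝐱" p:max => extChartAt 𝓘(ℝ, E) p
local notation "𝐑" => EuclideanSpace ℝ (Fin d)
local notation "𝐬" => sectionAt 𝔼 E P

/-! ### The tangent space and the isotropy representation of the flag manifold -/

lemma IsExpCurve.hasMFDerivAt_zero {F : Type*} [NormedAddCommGroup F] [NormedSpace ℝ F]
    {K : Type*} [TopologicalSpace K] [ChartedSpace F K] [Group K] {γ : ℝ → K} {a : F}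
    (hγ : IsExpCurve γ a) :
    HasMFDerivAt 𝓘(ℝ, ℝ) 𝓘(ℝ, F) γ 0 ((1 : ℝ →L[ℝ] ℝ).smulRight a : ℝ →L[ℝ] F) := by
  have h0 := hγ.2.self_of_nhds
  have h4 : (mfderiv 𝓘(ℝ, F) 𝓘(ℝ, F) (γ 0 * ·) (1 : K) : F →L[ℝ] F) a = a := by
    have e : (γ 0 * · : K → K) = id := by funext y; simp [hγ.1]
    rw [e, mfderiv_id]
    rfl
  exact h0.congr_mfderiv (congrArg (fun x : F => (1 : ℝ →L[ℝ] ℝ).smulRight x) h4)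

lemma IsExpCurve.hasDerivAt_zero {γ : ℝ → Gc} {a : 𝔼} (hγ : IsExpCurve γ a) {W : Type*}
    [NormedAddCommGroup W] [NormedSpace ℂ W] {f : Gc → W} {f' : 𝔼 →L[ℂ] W}
    (hf : HasMFDerivAt 𝓘(ℂ, 𝔼) 𝓘(ℂ, W) f 1 (f' : 𝔼 →L[ℂ] W)) : HasDerivAt (f ∘ γ) (f' a) 0 := by
  have h5 : HasMFDerivAt 𝓘(ℝ, 𝔼) 𝓘(ℝ, W) f (γ 0) (f'.restrictScalars ℝ : 𝔼 →L[ℝ] W) := by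
    rw [hγ.1]
    exact hasMFDerivAt_real_of_complex hf
  have h6 : HasFDerivAt (f ∘ γ) (((f'.restrictScalars ℝ : 𝔼 →L[ℝ] W)).comp
      ((1 : ℝ →L[ℝ] ℝ).smulRight a)) (0 : ℝ) :=
    hasMFDerivAt_iff_hasFDerivAt.1 (h5.comp (0 : ℝ) hγ.hasMFDerivAt_zero)
  refine h6.hasDerivAt.congr_deriv ?_
  change f' ((1 : ℝ) • a) = f' a
  rw [one_smul]

variable (𝔼 E P) in
/-- The differential at `1` of the projection `Gc → Gc ⧸ P`. -/
def dMk : 𝔼 →L[ℂ] E :=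
  mfderiv 𝓘(ℂ, 𝔼) 𝓘(ℂ, E) 𝛑 1

lemma hasMFDerivAt_mk : HasMFDerivAt 𝓘(ℂ, 𝔼) 𝓘(ℂ, E) 𝛑 1 (dMk 𝔼 E P : 𝔼 →L[ℂ] E) :=
  ((hq.contMDiff_mk).mdifferentiableAt (by simp)).hasMFDerivAt

variable (𝔼 E P) in
lemma exists_normalized_section : ∃ (U : Set (Gc ⧸ P)) (s : Gc ⧸ P → Gc), IsOpen U ∧
    𝛑 1 ∈ U ∧ ContMDiffOn 𝓘(ℂ, E) 𝓘(ℂ, 𝔼) ω s U ∧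
    (∀ y ∈ U, (𝛑 (s y)) = y) ∧ s (𝛑 1) = 1 := by
  obtain ⟨U, s, hU, ho, hs, hmk⟩ := hq.exists_section (𝛑 1)
  have hP : (s (𝛑 1))⁻¹ ∈ P := by
    have := QuotientGroup.eq.1 (hmk _ ho)
    simpa using this
  refine ⟨U, fun x => s x * (s (𝛑 1))⁻¹, hU, ho, hs.mul contMDiffOn_const,
    fun y hy => ?_, mul_inv_cancel _⟩
  rw [← hmk y hy, hmk y hy, QuotientGroup.mk_mul_of_mem _ hP, hmk y hy]

variable (𝔼 E) in
include hq in
lemma contMDiff_smul_quotient (g : Gc) : ContMDiff 𝓘(ℂ, E) 𝓘(ℂ, E) ω (fun x : Gc ⧸ P => g • x) := by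
  intro x
  obtain ⟨U, s, hU, hx, hs, hmk⟩ := hq.exists_section x
  have h1 : ContMDiffAt 𝓘(ℂ, E) 𝓘(ℂ, E) ω
      (fun y => (𝛑 (g * s y))) x :=
    (hq.contMDiff_mk _).comp x
      ((contMDiffAt_const (c := g)).mul ((hs x hx).contMDiffAt (hU.mem_nhds hx)))
  refine h1.congr_of_eventuallyEq ?_
  filter_upwards [hU.mem_nhds hx] with y hy
  conv_lhs => rw [← hmk y hy]
  rfl

lemma dMk_surjective : Function.Surjective (dMk 𝔼 E P) := by
  obtain ⟨U, s, hU, ho, hs, hmk, h1⟩ := exists_normalized_section 𝔼 E P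
  have hsd : MDifferentiableAt 𝓘(ℂ, E) 𝓘(ℂ, 𝔼) s (𝛑 1) :=
    ((hs _ ho).contMDiffAt (hU.mem_nhds ho)).mdifferentiableAt (by simp)
  intro u
  let ds : E →L[ℂ] 𝔼 := mfderiv 𝓘(ℂ, E) 𝓘(ℂ, 𝔼) s (𝛑 1)
  have h2 : HasMFDerivAt 𝓘(ℂ, E) 𝓘(ℂ, E) (𝛑 ∘ s)
      (𝛑 1) ((dMk 𝔼 E P).comp ds : E →L[ℂ] E) := by
    refine HasMFDerivAt.comp (𝛑 1) ?_ hsd.hasMFDerivAt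
    rw [h1]
    exact hasMFDerivAt_mk
  have h3 : HasMFDerivAt 𝓘(ℂ, E) 𝓘(ℂ, E) (𝛑 ∘ s)
      (𝛑 1) (ContinuousLinearMap.id ℂ E : E →L[ℂ] E) := by
    refine (hasMFDerivAt_id _).congr_of_eventuallyEq ?_
    filter_upwards [hU.mem_nhds ho] with y hy using hmk y hy
  exact ⟨ds u, DFunLike.congr_fun (hasMFDerivAt_unique h2 h3) u⟩

/-- The isotropy representation: the differential at the base point of the translation by
`p ∈ P`. -/
def isotropy (p : P) : E →L[ℂ] E :=
  mfderiv 𝓘(ℂ, E) 𝓘(ℂ, E) (fun x : Gc ⧸ P => (p : Gc) • x) (𝛑 (1 : Gc))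

include hq in
lemma isotropy_dMk (p : P) (a : 𝔼) : isotropy p (dMk 𝔼 E P a) = dMk 𝔼 E P (AdL (p : Gc) a) := by
  have hp : (p : Gc) • 𝛑 1 = 𝛑 1 := QuotientGroup.eq.2 (by simp)
  have h1 : HasMFDerivAt 𝓘(ℂ, E) 𝓘(ℂ, E) (fun x : Gc ⧸ P => (p : Gc) • x)
      (𝛑 (1 : Gc)) (isotropy p : E →L[ℂ] E) :=
    ((contMDiff_smul_quotient (P := P) 𝔼 E (p : Gc)).mdifferentiableAt (by simp)).hasMFDerivAt
  have h2 := HasMFDerivAt.comp (1 : Gc) h1 (hasMFDerivAt_mk (𝔼 := 𝔼))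
  have h3 : HasMFDerivAt 𝓘(ℂ, 𝔼) 𝓘(ℂ, E) 𝛑 ((p : Gc) * 1 * (p : Gc)⁻¹)
      (dMk 𝔼 E P : 𝔼 →L[ℂ] E) := by
    have e : (p : Gc) * 1 * (p : Gc)⁻¹ = 1 := by simp
    rw [e]; exact hasMFDerivAt_mk
  have h4 := HasMFDerivAt.comp (1 : Gc) h3 (hasMFDerivAt_conj (𝔼 := 𝔼) (p : Gc))
  have e : ((fun x : Gc ⧸ P => (p : Gc) • x) ∘ 𝛑) =
      𝛑 ∘ fun y : Gc => (p : Gc) * y * (p : Gc)⁻¹ := by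
    funext y
    change (𝛑 ((p : Gc) * y) : Gc ⧸ P) = 𝛑 _
    exact (QuotientGroup.mk_mul_of_mem _ (P.inv_mem p.2)).symm
  rw [e] at h2
  exact DFunLike.congr_fun (hasMFDerivAt_unique h2 h4) a

lemma AdL_mul (g h : Gc) (x : 𝔼) : AdL (g * h) x = AdL g (AdL (𝔼 := 𝔼) h x) := Ad_mul g h x

lemma AdL_one (x : 𝔼) : AdL (1 : Gc) x = x := Ad_one (Gc := Gc) x

include hq in
variable (𝔼 E) in
lemma isotropy_mul (p q : P) : isotropy (E := E) (p * q) = (isotropy p).comp (isotropy q) := by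
  ext u
  obtain ⟨a, rfl⟩ := dMk_surjective (𝔼 := 𝔼) (P := P) u
  rw [ContinuousLinearMap.comp_apply, isotropy_dMk, isotropy_dMk, isotropy_dMk, Subgroup.coe_mul,
    AdL_mul]

include hq in
variable (𝔼 E P) in
lemma isotropy_one : isotropy (E := E) (1 : P) = ContinuousLinearMap.id ℂ E := by
  ext u
  obtain ⟨a, rfl⟩ := dMk_surjective (𝔼 := 𝔼) (P := P) u
  rw [isotropy_dMk, Subgroup.coe_one, AdL_one]
  rfl

include hq in
variable (𝔼 E) in
lemma det_isotropy_ne_zero (p : P) : LinearMap.det (isotropy (E := E) p : E →ₗ[ℂ] E) ≠ 0 := by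
  intro h
  have h1 := isotropy_mul 𝔼 E p p⁻¹
  rw [mul_inv_cancel, isotropy_one 𝔼 E P] at h1
  have h2 := congrArg (fun l : E →L[ℂ] E => LinearMap.det (l : E →ₗ[ℂ] E)) h1
  simp only [ContinuousLinearMap.toLinearMap_comp, LinearMap.det_comp, h, zero_mul] at h2
  exact one_ne_zero (LinearMap.det_id.symm.trans h2)

namespace IsFlagModel
include hm

lemma inv_mul (g : Gc) : R g⁻¹ * R g = 1 := by rw [← hm.map_mul, inv_mul_cancel, hm.map_one]

lemma mul_inv (g : Gc) : R g * R g⁻¹ = 1 := by rw [← hm.map_mul, mul_inv_cancel, hm.map_one]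

lemma inv_apply (g : Gc) (w : V) : R g⁻¹ (R g w) = w :=
  DFunLike.congr_fun (hm.inv_mul g) w

lemma apply_mul (g h : Gc) (w : V) : R (g * h) w = R g (R h w) :=
  DFunLike.congr_fun (hm.map_mul g h) w

lemma apply_injective (g : Gc) : Function.Injective (R g) :=
  Function.LeftInverse.injective (hm.inv_apply g)

lemma apply_ne_zero (g : Gc) : R g v ≠ 0 := fun h =>
  hm.ne_zero (hm.apply_injective g (h.trans (map_zero _).symm))

lemma hasMFDerivAt_one : HasMFDerivAt 𝓘(ℂ, 𝔼) 𝓘(ℂ, V →L[ℂ] V) R 1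
    (dR : 𝔼 →L[ℂ] V →L[ℂ] V) := hasMFDerivAt_representation hm.contMDiff hm.mfderiv_one

lemma dR_AdL (g : Gc) (x : 𝔼) : dR (AdL g x) = R g * dR x * R g⁻¹ :=
  SasakiGeom.dR_AdL hm.contMDiff hm.map_mul hm.mfderiv_one g x

lemma dR_AdL_apply (g : Gc) (x : 𝔼) (w : V) : dR (AdL g x) (R g w) = R g (dR x w) := by
  rw [hm.dR_AdL]
  change R g (dR x (R g⁻¹ (R g w))) = _
  rw [hm.inv_apply]

lemma dR_injective : Function.Injective dR := by
  refine (injective_iff_map_eq_zero dR).2 fun x hx => hm.eq_zero_of_scalar x 0 fun w => ?_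
  rw [hx, zero_smul]
  rfl

lemma hasMFDerivAt_left (g : Gc) : HasMFDerivAt 𝓘(ℂ, 𝔼) 𝓘(ℂ, V →L[ℂ] V) (fun y => R (g * y)) 1
    ((ContinuousLinearMap.mul ℂ (V →L[ℂ] V) (R g)).comp dR : 𝔼 →L[ℂ] V →L[ℂ] V) := by
  have e : (fun y => R (g * y)) = (ContinuousLinearMap.mul ℂ (V →L[ℂ] V) (R g)) ∘ R :=
    funext fun y => hm.map_mul g y
  rw [e]
  exact ((ContinuousLinearMap.mul ℂ (V →L[ℂ] V) (R g)).hasFDerivAt.hasMFDerivAt (x := R 1)).comp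
    (1 : Gc) hm.hasMFDerivAt_one

/-- The character by which `P` acts on the line through the highest weight vector. -/
def char (p : P) : ℂ := ((hm.mem_iff p).1 p.2).choose

lemma apply_eq_char_smul (p : P) : R p v = hm.char p • v := ((hm.mem_iff p).1 p.2).choose_spec

lemma char_eq {p : P} {c : ℂ} (h : R p v = c • v) : hm.char p = c :=
  smul_left_injective ℂ hm.ne_zero ((hm.apply_eq_char_smul p).symm.trans h)

lemma char_ne_zero (p : P) : hm.char p ≠ 0 := fun h =>
  hm.apply_ne_zero p (by rw [hm.apply_eq_char_smul, h, zero_smul])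

lemma hasDerivAt_expCurve {γ : ℝ → Gc} {a : 𝔼} (hγ : IsExpCurve γ a) :
    ∀ᶠ t in 𝓝 (0 : ℝ), HasDerivAt (fun t => R (γ t)) (R (γ t) * dR a) t := by
  have : LieGroup 𝓘(ℝ, 𝔼) ∞ Gc := lieGroup_real_of_complex
  have hd : MDifferentiable 𝓘(ℝ, 𝔼) 𝓘(ℝ, V →L[ℂ] V) R := fun g =>
    (hasMFDerivAt_real_of_complex
      (hm.contMDiff.mdifferentiableAt (x := g) (by simp)).hasMFDerivAt).mdifferentiableAt
  filter_upwards [hγ.hasDerivAt hd] with t ht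
  have h1 : (mfderiv 𝓘(ℝ, 𝔼) 𝓘(ℝ, V →L[ℂ] V) (fun y => R (γ t * y)) 1 : 𝔼 →L[ℝ] V →L[ℂ] V) = _ :=
    (hasMFDerivAt_real_of_complex (hm.hasMFDerivAt_left (γ t))).mfderiv
  rw [h1] at ht
  exact ht

lemma apply_expCurve {γ : ℝ → Gc} {a : 𝔼} (hγ : IsExpCurve γ a) {c : ℂ} {w : V}
    (h : dR a w = c • w) : ∀ᶠ t in 𝓝 (0 : ℝ), R (γ t) w = Complex.exp (c * t) • w := by
  have h1 : ∀ᶠ t in 𝓝 (0 : ℝ), HasDerivAt (fun t => R (γ t) w) (c • R (γ t) w) t := by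
    filter_upwards [hm.hasDerivAt_expCurve hγ] with t ht
    have h2 := (((ContinuousLinearMap.apply ℂ V w).restrictScalars ℝ).hasFDerivAt).comp_hasDerivAt
      t ht
    refine h2.congr_deriv ?_
    change R (γ t) (dR a w) = _
    rw [h, map_smul]
  have h3 := eventually_eq_exp_smul h1
  simp only [hγ.1, hm.map_one, one_apply_eq_self] at h3
  exact h3

lemma dMk_eq_zero_iff (a : 𝔼) : dMk 𝔼 E P a = 0 ↔ ∃ c : ℂ, dR a v = c • v := by
  have hL : LieGroup 𝓘(ℝ, 𝔼) ∞ Gc := lieGroup_real_of_complex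
  constructor
  · intro ha
    obtain ⟨U, s, hU, ho, hs, hmk, h1⟩ := exists_normalized_section 𝔼 E P
    let l : V →L[ℂ] ℂ := ((‖v‖ : ℂ) ^ 2)⁻¹ • innerSL ℂ v
    have hl : l v = 1 := by
      change ((‖v‖ : ℂ) ^ 2)⁻¹ * inner ℂ v v = 1
      rw [inner_self_eq_norm_sq_to_K]
      exact inv_mul_cancel₀ (pow_ne_zero _ (Complex.ofReal_ne_zero.2 (norm_ne_zero_iff.2 hm.ne_zero)))
    have hs1 : ContMDiffAt 𝓘(ℂ, E) 𝓘(ℂ, 𝔼) ω s (𝛑 1) := (hs _ ho).contMDiffAt (hU.mem_nhds ho)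
    let B : Gc ⧸ P → V := fun x => R (s x) v
    let c : Gc → ℂ := fun g => l (R ((s (𝛑 g))⁻¹ * g) v)
    have hB : ContMDiffAt 𝓘(ℂ, E) 𝓘(ℂ, V) ω B (𝛑 1) :=
      ((ContinuousLinearMap.apply ℂ V v).contDiff.contMDiff.contMDiffAt).comp _
        ((hm.contMDiff _).comp _ hs1)
    have hc : ContMDiffAt 𝓘(ℂ, 𝔼) 𝓘(ℂ, ℂ) ω c 1 :=
      ((l.comp (ContinuousLinearMap.apply ℂ V v)).contDiff.contMDiff.contMDiffAt).comp _
        ((hm.contMDiff _).comp _ ((hs1.comp _ (hq.contMDiff_mk 1)).inv.mul contMDiffAt_id))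
    have hev : ∀ᶠ g in 𝓝 (1 : Gc), R g v = c g • B (𝛑 g) := by
      have hcont : ContinuousAt 𝛑 1 := (hq.contMDiff_mk 1).continuousAt
      filter_upwards [hcont.preimage_mem_nhds (hU.mem_nhds ho)] with g hg
      have hP : (s (𝛑 g))⁻¹ * g ∈ P := QuotientGroup.eq.1 (hmk _ hg)
      obtain ⟨d, hd⟩ := (hm.mem_iff _).1 hP
      have hcd : c g = d := by
        change l (R _ v) = d
        rw [hd, map_smul, hl, smul_eq_mul, mul_one]
      rw [hcd]
      change _ = d • R _ v
      rw [← map_smul, ← hd, ← hm.apply_mul, mul_inv_cancel_left]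
    obtain ⟨γ, hγ⟩ := exists_isExpCurve (K := Gc) a
    have hd1 := hγ.hasDerivAt_zero (((ContinuousLinearMap.apply ℂ V v).hasFDerivAt.hasMFDerivAt (x := R 1)).comp
      (1 : Gc) hm.hasMFDerivAt_one)
    let dB : E →L[ℂ] V := mfderiv 𝓘(ℂ, E) 𝓘(ℂ, V) B (𝛑 1)
    have hd2 := hγ.hasDerivAt_zero (HasMFDerivAt.comp (1 : Gc) (hB.mdifferentiableAt (by simp)).hasMFDerivAt
      hasMFDerivAt_mk : HasMFDerivAt 𝓘(ℂ, 𝔼) 𝓘(ℂ, V) (B ∘ 𝛑) 1 (dB.comp (dMk 𝔼 E P)))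
    let dc : 𝔼 →L[ℂ] ℂ := mfderiv 𝓘(ℂ, 𝔼) 𝓘(ℂ, ℂ) c 1
    have hd3 := hγ.hasDerivAt_zero (f' := dc) (hc.mdifferentiableAt (by simp)).hasMFDerivAt
    have hγc : ContinuousAt γ 0 := hγ.2.self_of_nhds.continuousAt
    have hev' : (fun t => R (γ t) v) =ᶠ[𝓝 0] fun t => (c ∘ γ) t • ((B ∘ 𝛑) ∘ γ) t := by
      have : Filter.Tendsto γ (𝓝 0) (𝓝 1) := by simpa [ContinuousAt, hγ.1] using hγc
      exact this.eventually hev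
    have hd4 := (hd3.smul hd2).congr_of_eventuallyEq hev'
    have h7 := hd1.unique hd4
    refine ⟨dc a, ?_⟩
    have h8 : dB (dMk 𝔼 E P a) = 0 := by rw [ha, map_zero]
    have h9 : dR a v = (c ∘ γ) 0 • dB (dMk 𝔼 E P a) + dc a • ((B ∘ 𝛑) ∘ γ) 0 := h7
    rw [h9, h8, smul_zero, zero_add]
    simp only [Function.comp_apply, hγ.1, B, h1, hm.map_one, one_apply_eq_self]
  · rintro ⟨c, hc⟩
    obtain ⟨γ, hγ⟩ := exists_isExpCurve (K := Gc) a
    have hP : ∀ᶠ t in 𝓝 (0 : ℝ), γ t ∈ P := by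
      filter_upwards [hm.apply_expCurve hγ hc] with t ht
      exact (hm.mem_iff _).2 ⟨_, ht⟩
    have hmd : HasMFDerivAt 𝓘(ℝ, 𝔼) 𝓘(ℝ, E) 𝛑 (γ 0)
        ((dMk 𝔼 E P).restrictScalars ℝ : 𝔼 →L[ℝ] E) := by
      rw [hγ.1]
      exact hasMFDerivAt_real_of_complex hasMFDerivAt_mk
    have h1 := hmd.comp (0 : ℝ) hγ.hasMFDerivAt_zero
    have h2 : HasMFDerivAt 𝓘(ℝ, ℝ) 𝓘(ℝ, E) (𝛑 ∘ γ) 0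
        (0 : ℝ →L[ℝ] E) := by
      refine (hasMFDerivAt_const (𝛑 1) (0 : ℝ)).congr_of_eventuallyEq ?_
      filter_upwards [hP] with t ht
      exact (QuotientGroup.eq.2 (by simpa using ht)).symm
    have h3 := DFunLike.congr_fun (hasMFDerivAt_unique h1 h2) 1
    have h5 : dMk 𝔼 E P ((1 : ℝ) • a) = 0 := h3
    rwa [one_smul] at h5

lemma exists_toTangent : ∃ Lf : V →L[ℂ] E, Lf v = 0 ∧ ∀ a, Lf (dR a v) = dMk 𝔼 E P a := by
  let T : 𝔼 × ℂ →ₗ[ℂ] V :=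
    (((ContinuousLinearMap.apply ℂ V v).comp dR : 𝔼 →L[ℂ] V) : 𝔼 →ₗ[ℂ] V).coprod
      (LinearMap.toSpanSingleton ℂ V v)
  let S : 𝔼 × ℂ →ₗ[ℂ] E := (dMk 𝔼 E P : 𝔼 →ₗ[ℂ] E) ∘ₗ LinearMap.fst ℂ 𝔼 ℂ
  have hker : LinearMap.ker T ≤ LinearMap.ker S := by
    rintro ⟨a, c⟩ h
    have h' : dR a v + c • v = 0 := h
    exact (hm.dMk_eq_zero_iff a).2 ⟨-c, by rw [neg_smul]; exact eq_neg_of_add_eq_zero_left h'⟩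
  obtain ⟨f, hf⟩ := LinearMap.exists_extend ((LinearMap.ker T).liftQ S hker ∘ₗ
    T.quotKerEquivRange.symm.toLinearMap)
  have hfT : ∀ x, f (T x) = S x := fun x => by
    have h1 := congrArg (fun g => g ⟨T x, LinearMap.mem_range_self T x⟩) hf
    have h2 : f (T x) = (LinearMap.ker T).liftQ S hker
      (T.quotKerEquivRange.symm ⟨T x, LinearMap.mem_range_self T x⟩) := h1
    rw [h2, LinearMap.quotKerEquivRange_symm_apply_image]
    rfl
  refine ⟨toContinuousLinearMap f, ?_, fun a => ?_⟩
  · have := hfT (0, 1)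
    simpa [T, S] using this
  · have := hfT (a, 0)
    simpa [T, S] using this

lemma isotropy_eq {Lf : V →L[ℂ] E} (hL : ∀ a, Lf (dR a v) = dMk 𝔼 E P a) (p : P) {a : 𝔼} {u : E}
    (ha : dMk 𝔼 E P a = u) : isotropy p u = (hm.char p)⁻¹ • Lf (R p (dR a v)) := by
  rw [← ha, isotropy_dMk, ← hL, hm.dR_AdL]
  have h1 : R (p : Gc)⁻¹ v = (hm.char p)⁻¹ • v := by
    rw [eq_inv_smul_iff₀ (hm.char_ne_zero p), ← map_smul, ← hm.apply_eq_char_smul, hm.inv_apply]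
  change Lf (R p (dR a (R (p : Gc)⁻¹ v))) = _
  rw [h1, map_smul, map_smul, map_smul]

/-- Near the identity, the determinant of the isotropy representation is the inverse of the
character `δ_P`, because the trace of its differential is `-δ_P`. -/
lemma det_isotropy_expCurve {γ : ℝ → Gc} {a : 𝔼} (hγ : IsExpCurve γ a) {c : ℂ}
    (h : dR a v = c • v) : ∀ᶠ t in 𝓝 (0 : ℝ), ∀ hP : γ t ∈ P,
      LinearMap.det (isotropy (E := E) ⟨γ t, hP⟩ : E →ₗ[ℂ] E) = Complex.exp (-c * t) := by
  obtain ⟨Lf, hLv, hL⟩ := hm.exists_toTangent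
  obtain ⟨κ, hκ⟩ := (dMk 𝔼 E P : 𝔼 →ₗ[ℂ] E).exists_rightInverse_of_surjective
    (LinearMap.range_eq_top.2 dMk_surjective)
  have hκ' : ∀ u, dMk 𝔼 E P (κ u) = u := fun u => congrArg (fun l : E →ₗ[ℂ] E => l u) hκ
  let ad : (V →L[ℂ] V) →L[ℂ] (V →L[ℂ] V) := ContinuousLinearMap.mul ℂ (V →L[ℂ] V) (dR a) -
    (ContinuousLinearMap.mul ℂ (V →L[ℂ] V)).flip (dR a)
  let A : E →ₗ[ℂ] E := ((Lf.comp ((ContinuousLinearMap.apply ℂ V v).comp (ad.comp dR)) :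
    𝔼 →L[ℂ] E) : 𝔼 →ₗ[ℂ] E) ∘ₗ κ
  have hAa : ∀ u, A u = Lf (dR (br a (κ u)) v) := fun u => by
    rw [hm.lie]
    rfl
  have hbr : ∀ y, dMk 𝔼 E P y = 0 → dR (br a y) v = 0 := fun y hy => by
    obtain ⟨d, hd⟩ := (hm.dMk_eq_zero_iff y).1 hy
    rw [hm.lie]
    change dR a (dR y v) - dR y (dR a v) = 0
    rw [hd, h, map_smul, map_smul, hd, h, smul_comm, sub_self]
  have hbr_sub : ∀ x y, dR (br a (x - y)) = dR (br a x) - dR (br a y) := fun x y => by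
    simp only [hm.lie, map_sub, mul_sub, sub_mul]
    abel
  have hA : ∀ x, A (dMk 𝔼 E P x) = dMk 𝔼 E P (br a x) := fun x => by
    rw [hAa, ← hL (br a x), ← sub_eq_zero, ← map_sub]
    have := hbr (κ (dMk 𝔼 E P x) - x) (by rw [map_sub, hκ', sub_self])
    rw [hbr_sub] at this
    change Lf ((dR (br a (κ (dMk 𝔼 E P x))) - dR (br a x)) v) = 0
    rw [this, map_zero]
  have htr : LinearMap.trace ℂ E A = -c := hm.trace (dMk 𝔼 E P : 𝔼 →ₗ[ℂ] E) dMk_surjective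
    hm.dMk_eq_zero_iff a c h A hA
  let M : ℝ → E →ₗ[ℂ] E := fun t => Complex.exp (-c * t) •
    ((Lf.comp (R (γ t)) : V →L[ℂ] E) : V →ₗ[ℂ] E) ∘ₗ
      (((ContinuousLinearMap.apply ℂ V v).comp dR : 𝔼 →L[ℂ] V) : 𝔼 →ₗ[ℂ] V) ∘ₗ κ
  have hMa : ∀ t u, M t u = Complex.exp (-c * t) • Lf (R (γ t) (dR (κ u) v)) := fun _ _ => rfl
  have hev := hm.apply_expCurve hγ h
  have hMiso : ∀ᶠ t in 𝓝 (0 : ℝ), ∀ hP : γ t ∈ P,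
      (isotropy (E := E) ⟨γ t, hP⟩ : E →ₗ[ℂ] E) = M t := by
    filter_upwards [hev] with t ht hP
    ext u
    have hc : hm.char ⟨γ t, hP⟩ = Complex.exp (c * t) := hm.char_eq ht
    rw [hMa]
    change isotropy _ u = _
    rw [hm.isotropy_eq hL _ (hκ' u), hc, ← Complex.exp_neg, neg_mul]
  have hMd : ∀ᶠ t in 𝓝 (0 : ℝ), ∀ u, HasDerivAt (fun s => M s u) (M t (A u)) t := by
    filter_upwards [hm.hasDerivAt_expCurve hγ, hev] with t ht htv u
    have h1 : HasDerivAt (fun t : ℝ => Complex.exp (-c * t)) (Complex.exp (-c * t) * (-c)) t := by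
      have := ((Complex.ofRealCLM.hasDerivAt (x := t)).const_mul (-c)).cexp
      simpa using this
    let T : (V →L[ℂ] V) →L[ℂ] E := Lf.comp (ContinuousLinearMap.apply ℂ V (dR (κ u) v))
    have h2 : HasDerivAt (fun t => T (R (γ t))) (T (R (γ t) * dR a)) t :=
      ((T.restrictScalars ℝ).hasFDerivAt).comp_hasDerivAt t ht
    refine (h1.smul h2).congr_deriv ?_
    obtain ⟨d, hd⟩ := (hm.dMk_eq_zero_iff (κ (A u) - br a (κ u))).1 (by
      rw [map_sub, hκ', ← hA, hκ', sub_self])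
    have h3 : dR (κ (A u)) v = dR a (dR (κ u) v) - c • dR (κ u) v + d • v := by
      have e : dR (br a (κ u)) v = dR a (dR (κ u) v) - c • dR (κ u) v := by
        rw [hm.lie, ← map_smul, ← h]
        rfl
      rw [← e, ← hd, map_sub]
      simp
    rw [hMa, h3, map_add, map_sub, map_smul, map_smul, htv, map_add, map_sub, map_smul, map_smul,
      map_smul, hLv, smul_zero, smul_zero, add_zero]
    change Complex.exp (-c * t) • Lf (R (γ t) (dR a (dR (κ u) v))) +
      (Complex.exp (-c * t) * -c) • Lf (R (γ t) (dR (κ u) v)) = _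
    rw [smul_sub, smul_smul, mul_neg, neg_smul, sub_eq_add_neg]
  have hPev : ∀ᶠ t in 𝓝 (0 : ℝ), γ t ∈ P := by
    filter_upwards [hev] with t ht using (hm.mem_iff _).2 ⟨_, ht⟩
  have hdet : ∀ᶠ t in 𝓝 (0 : ℝ), HasDerivAt (fun t => LinearMap.det (M t))
      ((-c) • LinearMap.det (M t)) t := by
    filter_upwards [hMd, hMiso, hPev] with t h1 h2 h3
    have h4 : LinearMap.det (M t) ≠ 0 := by
      rw [← h2 h3]
      exact det_isotropy_ne_zero 𝔼 E _
    refine (hasDerivAt_linearMap_det h1 h4).congr_deriv ?_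
    rw [htr, smul_eq_mul, mul_comm]
  filter_upwards [eventually_eq_exp_smul hdet, hMiso] with t h1 h2 hP
  rw [h2 hP, h1]
  have h3 : M 0 = LinearMap.id := by
    have h4 : γ 0 ∈ P := by rw [hγ.1]; exact P.one_mem
    have h5 : (⟨γ 0, h4⟩ : P) = 1 := Subtype.ext hγ.1
    rw [← hMiso.self_of_nhds h4, h5, isotropy_one 𝔼 E P]
    rfl
  rw [h3, LinearMap.det_id, smul_eq_mul, mul_one]

end IsFlagModel

/-! ### The compact real form -/

variable (𝔼) in
/-- The differential at `1` of the inclusion of the compact form. -/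
def dIncl (ι : G →* Gc) : 𝐑 →L[ℝ] 𝔼 :=
  mfderiv (𝓡 d) 𝓘(ℝ, 𝔼) ι 1

local notation "𝐝" => dIncl 𝔼 ι
namespace IsFlagModel
include hm hG hu

omit hm hu in
lemma hasMFDerivAt_incl : HasMFDerivAt (𝓡 d) 𝓘(ℝ, 𝔼) ι 1 (𝐝 : 𝐑 →L[ℝ] 𝔼) :=
  (hG.smooth.mdifferentiableAt (by simp)).hasMFDerivAt

omit hm hu in
lemma isExpCurve_incl {γ : ℝ → G} {x : 𝐑} (hγ : IsExpCurve γ x) :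
    IsExpCurve (F := 𝔼) (ι ∘ γ) (𝐝 x) := by
  have : LieGroup 𝓘(ℝ, 𝔼) ∞ Gc := lieGroup_real_of_complex
  have := hG.lieGroup
  exact hγ.map (fun g => hG.smooth.mdifferentiableAt (by simp)) ι.map_one ι.map_mul

/-- The Lie algebra of the compact form acts by skew-adjoint operators. -/
lemma inner_dR_incl (x : 𝐑) (w w' : V) :
    inner ℂ (dR (𝐝 x) w) w' = -inner ℂ w (dR (𝐝 x) w') := by
  have := hG.lieGroup
  obtain ⟨γ, hγ⟩ := exists_isExpCurve (K := G) x
  have hγ' := isExpCurve_incl hG hγ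
  have hin : ∀ k w w', inner ℂ (R (ι k) w) (R (ι k) w') = inner ℂ w w' := fun k w w' =>
    (LinearIsometry.mk (R (ι k) : V →ₗ[ℂ] V) (hu k)).inner_map_map w w'
  have hd : ∀ w, HasDerivAt (fun t => R (ι (γ t)) w) (dR (𝐝 x) w) 0 := fun w =>
    hγ'.hasDerivAt_zero (((ContinuousLinearMap.apply ℂ V w).hasFDerivAt.hasMFDerivAt
      (x := R 1)).comp (1 : Gc) hm.hasMFDerivAt_one)
  have h1 := (hd w).inner ℂ (hd w')
  simp only [hin] at h1
  have h2 := h1.unique (hasDerivAt_const _ _)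
  simp only [hγ.1, _root_.map_one, hm.map_one, one_apply_eq_self] at h2
  rw [add_comm] at h2
  exact eq_neg_of_add_eq_zero_left h2

omit hu in
lemma exists_real_parts (z : 𝔼) : ∃ x y : 𝐑, z = 𝐝 x + I • 𝐝 y := by
  obtain ⟨⟨x, y⟩, h, -⟩ := hG.real_form z
  exact ⟨x, y, h⟩

omit hm hG hu in
/-- The trace form of the representation. -/
def traceForm (dR : 𝔼 →L[ℂ] V →L[ℂ] V) : 𝔼 →ₗ[ℂ] 𝔼 →ₗ[ℂ] ℂ :=
  LinearMap.mk₂ ℂ (fun x y => LinearMap.trace ℂ V ((dR x * dR y : V →L[ℂ] V) : V →ₗ[ℂ] V))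
    (fun x y z => by rw [map_add, add_mul, ContinuousLinearMap.toLinearMap_add, map_add])
    (fun c x y => by rw [map_smul, smul_mul_assoc, ContinuousLinearMap.toLinearMap_smul, map_smul])
    (fun x y z => by rw [map_add, mul_add, ContinuousLinearMap.toLinearMap_add, map_add])
    (fun c x y => by rw [map_smul, mul_smul_comm, ContinuousLinearMap.toLinearMap_smul, map_smul])

omit hm hG hu in
lemma traceForm_apply (x y : 𝔼) : traceForm dR x y =
    LinearMap.trace ℂ V ((dR x * dR y : V →L[ℂ] V) : V →ₗ[ℂ] V) := rfl

omit hm hG hu in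
lemma traceForm_comm (x y : 𝔼) : traceForm dR x y = traceForm dR y x :=
  LinearMap.trace_mul_comm ℂ (dR x : V →ₗ[ℂ] V) (dR y : V →ₗ[ℂ] V)

omit hG hu in
lemma traceForm_AdL (g : Gc) (x y : 𝔼) : traceForm dR (AdL g x) (AdL g y) = traceForm dR x y := by
  rw [traceForm_apply, hm.dR_AdL, hm.dR_AdL]
  have e : R g * dR x * R g⁻¹ * (R g * dR y * R g⁻¹) = R g * (dR x * dR y * R g⁻¹) := by
    rw [show R g * dR x * R g⁻¹ * (R g * dR y * R g⁻¹)
      = R g * dR x * (R g⁻¹ * R g) * (dR y * R g⁻¹) by simp only [mul_assoc], hm.inv_mul, mul_one]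
    simp only [mul_assoc]
  rw [e]
  have h1 := LinearMap.trace_mul_comm ℂ (R g : V →ₗ[ℂ] V)
    ((dR x * dR y * R g⁻¹ : V →L[ℂ] V) : V →ₗ[ℂ] V)
  refine h1.trans ?_
  have e2 : (dR x * dR y * R g⁻¹ : V →L[ℂ] V) * R g = dR x * dR y := by
    rw [mul_assoc, hm.inv_mul, mul_one]
  exact congrArg (fun T : V →L[ℂ] V => LinearMap.trace ℂ V (T : V →ₗ[ℂ] V)) e2

lemma traceForm_incl (x y : 𝐑) :
    traceForm dR (𝐝 x) (𝐝 y) = -∑ i, inner ℂ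
      (dR (𝐝 x) (stdOrthonormalBasis ℂ V i)) (dR (𝐝 y) (stdOrthonormalBasis ℂ V i)) := by
  rw [traceForm_apply, LinearMap.trace_eq_sum_inner _ (stdOrthonormalBasis ℂ V), ← Finset.sum_neg_distrib]
  refine Finset.sum_congr rfl fun i _ => ?_
  rw [hm.inner_dR_incl hG hu, neg_neg]
  rfl

lemma traceForm_incl_im (x y : 𝐑) : (traceForm dR (𝐝 x) (𝐝 y)).im = 0 := by
  rw [← Complex.conj_eq_iff_im]
  conv_rhs => rw [traceForm_comm]
  rw [hm.traceForm_incl hG hu, hm.traceForm_incl hG hu]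
  simp only [map_neg, map_sum, inner_conj_symm]

lemma incl_eq_zero {x : 𝐑}
    (h : traceForm dR (𝐝 x) (𝐝 x) = 0) : 𝐝 x = 0 := by
  rw [hm.traceForm_incl hG hu, neg_eq_zero] at h
  have h1 : ∀ i, dR (𝐝 x) (stdOrthonormalBasis ℂ V i) = 0 := by
    have h2 : ∑ i, ‖dR (𝐝 x) (stdOrthonormalBasis ℂ V i)‖ ^ 2 = 0 := by
      have := congrArg Complex.re h
      rw [Complex.re_sum] at this
      simp only [inner_self_eq_norm_sq_to_K] at this
      simpa [← Complex.ofReal_pow] using this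
    intro i
    have := (Finset.sum_eq_zero_iff_of_nonneg (fun i _ => by positivity)).1 h2 i (Finset.mem_univ i)
    simpa using this
  refine hm.dR_injective ?_
  rw [map_zero]
  refine ContinuousLinearMap.coe_injective ((stdOrthonormalBasis ℂ V).toBasis.ext fun i => ?_)
  simpa using h1 i

lemma eq_zero_of_traceForm_incl {z : 𝔼}
    (h : ∀ x : 𝐑, (traceForm dR z (𝐝 x)).re = 0) :
    ∃ x : 𝐑, z = I • 𝐝 x := by
  obtain ⟨x, y, rfl⟩ := hm.exists_real_parts hG z
  refine ⟨y, ?_⟩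
  have h1 := h x
  rw [map_add, LinearMap.add_apply, map_smul, LinearMap.smul_apply, Complex.add_re, smul_eq_mul,
    Complex.I_mul_re, hm.traceForm_incl_im hG hu y x, neg_zero, add_zero] at h1
  rw [hm.incl_eq_zero hG hu (Complex.ext h1 (hm.traceForm_incl_im hG hu x x)), zero_add]

omit hm hG hu in
lemma traceForm_I (y : 𝔼) : traceForm dR (I • y) (I • y) = -traceForm dR y y := by
  simp only [map_smul, LinearMap.smul_apply, smul_eq_mul, ← mul_assoc, Complex.I_mul_I]
  ring

/-- The trace form is negative definite on the compact form, and the Lie algebra is its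
complexification. -/
lemma traceForm_nondegenerate {z : 𝔼} (h : ∀ a, (traceForm dR z a).re = 0) : z = 0 := by
  obtain ⟨x, rfl⟩ := hm.eq_zero_of_traceForm_incl hG hu (fun x => h _)
  have h1 := h (I • 𝐝 x)
  rw [traceForm_I, Complex.neg_re, neg_eq_zero] at h1
  rw [hm.incl_eq_zero hG hu (Complex.ext h1 (hm.traceForm_incl_im hG hu x x)), smul_zero]

/-- The Lie algebra of the compact form and every conjugate of the parabolic subalgebra span the
Lie algebra of `Gc`: the orthogonal of the sum for the trace form is isotropic and consists of
imaginary elements, on which the trace form is positive definite. -/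
lemma exists_incl_add (g : Gc) (a : 𝔼) : ∃ (x : 𝐑) (y : 𝔼),
    dMk 𝔼 E P y = 0 ∧ a = AdL g⁻¹ (𝐝 x) + y := by
  let S : Submodule ℝ 𝔼 := LinearMap.range (((AdL (𝔼 := 𝔼) g⁻¹).restrictScalars ℝ : 𝔼 →ₗ[ℝ] 𝔼) ∘ₗ
    ((𝐝 : 𝐑 →L[ℝ] 𝔼) : 𝐑 →ₗ[ℝ] 𝔼)) ⊔
    LinearMap.ker ((dMk 𝔼 E P).restrictScalars ℝ : 𝔼 →ₗ[ℝ] E)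
  suffices hS : S = ⊤ by
    have : a ∈ S := hS ▸ Submodule.mem_top
    obtain ⟨_, ⟨x, rfl⟩, y, hy, rfl⟩ := Submodule.mem_sup.1 this
    exact ⟨x, y, hy, rfl⟩
  by_contra hne
  obtain ⟨f, hf0, hf⟩ := Submodule.exists_le_ker_of_lt_top S (lt_top_iff_ne_top.2 hne)
  have : FiniteDimensional ℝ 𝔼 := FiniteDimensional.complexToReal 𝔼
  let Φ : 𝔼 →ₗ[ℝ] Module.Dual ℝ 𝔼 := LinearMap.mk₂ ℝ (fun z a => (traceForm dR z a).re)
    (fun x y z => by simp) (fun c x y => by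
      have : c • x = (c : ℂ) • x := rfl
      rw [this]; simp) (fun x y z => by simp) (fun c x y => by
      have : c • y = (c : ℂ) • y := rfl
      rw [this]; simp)
  have hinj : Function.Injective Φ := (injective_iff_map_eq_zero Φ).2 fun z hz =>
    hm.traceForm_nondegenerate hG hu fun a => congrArg (fun l : Module.Dual ℝ 𝔼 => l a) hz
  obtain ⟨y, rfl⟩ := (LinearMap.injective_iff_surjective_of_finrank_eq_finrank
    Subspace.dual_finrank_eq.symm).1 hinj f
  have hf' : ∀ z ∈ S, (traceForm dR y z).re = 0 := fun z hz => hf hz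
  have hker : ∀ z, dMk 𝔼 E P z = 0 → (traceForm dR y z).re = 0 := fun z hz =>
    hf' z (Submodule.mem_sup_right hz)
  have hyy : traceForm dR y y = 0 := by
    refine hm.isotropic y fun z hz => ?_
    have hz' := (hm.dMk_eq_zero_iff z).2 hz
    have h1 := hker z hz'
    have h2 := hker (I • z) (by rw [map_smul, hz', smul_zero])
    rw [map_smul, smul_eq_mul, Complex.I_mul_re, neg_eq_zero] at h2
    exact Complex.ext h1 h2
  obtain ⟨x, hx⟩ := hm.eq_zero_of_traceForm_incl hG hu (z := AdL g y) fun x => by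
    have h1 : (traceForm dR y (AdL g⁻¹ (𝐝 x))).re = 0 :=
      hf' _ (Submodule.mem_sup_left ⟨x, rfl⟩)
    rwa [← hm.traceForm_AdL g, ← AdL_mul, mul_inv_cancel, AdL_one] at h1
  have hz : AdL g y = 0 := by
    rw [← hm.traceForm_AdL g, hx, traceForm_I, neg_eq_zero] at hyy
    rw [hx, hm.incl_eq_zero hG hu hyy, smul_zero]
  have hy0 : y = 0 := by rw [← AdL_one (Gc := Gc) y, ← inv_mul_cancel g, AdL_mul, hz, map_zero]
  exact hf0 (by rw [hy0, map_zero])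

end IsFlagModel

/-! ### The invariant volume of the flag manifold -/

variable (𝔼 E P) in
include hq in
lemma exists_tangentLift : ∃ κ : E →L[ℂ] 𝔼, ∀ u, dMk 𝔼 E P (κ u) = u := by
  obtain ⟨κ, hκ⟩ := (dMk 𝔼 E P : 𝔼 →ₗ[ℂ] E).exists_rightInverse_of_surjective
    (LinearMap.range_eq_top.2 dMk_surjective)
  exact ⟨toContinuousLinearMap κ, fun u => congrArg (fun l : E →ₗ[ℂ] E => l u) hκ⟩

variable (𝔼 E P) in
/-- A right inverse of the differential of the projection `Gc → Gc ⧸ P` at `1`. -/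
def tangentLift : E →L[ℂ] 𝔼 := (exists_tangentLift 𝔼 E P).choose

lemma dMk_tangentLift (u : E) : dMk 𝔼 E P (tangentLift 𝔼 E P u) = u :=
  (exists_tangentLift 𝔼 E P).choose_spec u

variable (E P) in
/-- The map `u ↦ dR(u) v` from the tangent space of `Gc ⧸ P` to `V`, well defined up to multiples
of `v`. -/
def tangentOrbit (dR : 𝔼 →L[ℂ] V →L[ℂ] V) (v : V) : E →L[ℂ] V :=
  ((ContinuousLinearMap.apply ℂ V v).comp dR).comp (tangentLift 𝔼 E P)

variable (E P) in
/-- The pull back of the Fubini–Study form at the line of `T v` to the tangent space of `Gc ⧸ P` at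
the base point, by `u ↦ T (dR(u) v)`. -/
def isoForm (dR : 𝔼 →L[ℂ] V →L[ℂ] V) (v : V) (T : V →L[ℂ] V) : E →L[ℝ] E →L[ℝ] ℝ :=
  (fubiniStudy (T v)).bilinearComp ((T.comp (tangentOrbit E P dR v)).restrictScalars ℝ : E →L[ℝ] V)
    ((T.comp (tangentOrbit E P dR v)).restrictScalars ℝ : E →L[ℝ] V)

lemma isoForm_apply (T : V →L[ℂ] V) (u w : E) : isoForm E P dR v T u w =
    fubiniStudy (T v) (T (dR (tangentLift 𝔼 E P u) v)) (T (dR (tangentLift 𝔼 E P w) v)) := rfl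

variable (E P) in
/-- The ratio of the volume of the Fubini–Study metric and of the invariant volume defined by the
norm of the highest weight vector. -/
def volumeRatio (dR : 𝔼 →L[ℂ] V →L[ℂ] V) (v : V) (T : V →L[ℂ] V) : ℝ :=
  gramDet (toBilin (isoForm E P dR v T)) * ‖T v‖ ^ 4

namespace IsFlagModel
include hm

lemma dR_eq_add_smul {a b : 𝔼} (h : dMk 𝔼 E P a = dMk 𝔼 E P b) :
    ∃ z : ℂ, dR a v = dR b v + z • v := by
  obtain ⟨z, hz⟩ := (hm.dMk_eq_zero_iff (a - b)).1 (by rw [map_sub, h, sub_self])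
  refine ⟨z, ?_⟩
  rw [← hz, map_sub]
  simp

lemma isoForm_dMk {T : V →L[ℂ] V} (hT : T v ≠ 0) (a b : 𝔼) :
    isoForm E P dR v T (dMk 𝔼 E P a) (dMk 𝔼 E P b) =
      fubiniStudy (T v) (T (dR a v)) (T (dR b v)) := by
  obtain ⟨z, hz⟩ := hm.dR_eq_add_smul (dMk_tangentLift (𝔼 := 𝔼) (dMk 𝔼 E P a))
  obtain ⟨z', hz'⟩ := hm.dR_eq_add_smul (dMk_tangentLift (𝔼 := 𝔼) (dMk 𝔼 E P b))
  rw [isoForm_apply, hz, hz', map_add T, map_add T, map_smul T, map_smul T, fubiniStudy_add_smul hT]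

lemma isoForm_self_eq_zero (g : Gc) {u : E} (h : isoForm E P dR v (R g) u u = 0) : u = 0 := by
  rw [isoForm_apply] at h
  obtain ⟨z, hz⟩ := exists_smul_of_fubiniStudy_eq_zero (hm.apply_ne_zero g) h
  rw [← map_smul] at hz
  rw [← dMk_tangentLift (𝔼 := 𝔼) (P := P) u]
  exact (hm.dMk_eq_zero_iff _).2 ⟨z, hm.apply_injective g hz⟩

lemma isoForm_mul_right (g : Gc) (p : P) (u w : E) :
    isoForm E P dR v (R (g * p)) u w = isoForm E P dR v (R g) (isotropy p u) (isotropy p w) := by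
  have h1 : ∀ u : E, R (g * p) (dR (tangentLift 𝔼 E P u) v) =
      hm.char p • R g (dR (AdL (p : Gc) (tangentLift 𝔼 E P u)) v) := fun u => by
    rw [hm.apply_mul, ← hm.dR_AdL_apply, hm.apply_eq_char_smul, map_smul, map_smul]
  rw [isoForm_apply, h1, h1, hm.apply_mul, hm.apply_eq_char_smul, map_smul (R g),
    fubiniStudy_smul (hm.apply_ne_zero g) _ _ (hm.char_ne_zero p),
    ← hm.isoForm_dMk (hm.apply_ne_zero g), ← isotropy_dMk, ← isotropy_dMk, dMk_tangentLift,
    dMk_tangentLift]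

lemma volumeRatio_mul_right (g : Gc) (p : P) : volumeRatio E P dR v (R (g * p)) =
    volumeRatio E P dR v (R g) *
      (‖hm.char p‖ * ‖LinearMap.det (isotropy (E := E) p : E →ₗ[ℂ] E)‖) ^ 4 := by
  have h : toBilin (isoForm E P dR v (R (g * p))) = LinearMap.BilinForm.comp
      (toBilin (isoForm E P dR v (R g)))
      (((isotropy p).restrictScalars ℝ : E →L[ℝ] E) : E →ₗ[ℝ] E)
      (((isotropy p).restrictScalars ℝ : E →L[ℝ] E) : E →ₗ[ℝ] E) :=
    LinearMap.ext₂ fun u w => hm.isoForm_mul_right g p u w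
  have : FiniteDimensional ℝ E := FiniteDimensional.complexToReal E
  rw [volumeRatio, h, gramDet_comp, det_restrictScalars_real, hm.apply_mul, hm.apply_eq_char_smul,
    map_smul, norm_smul, volumeRatio]
  ring

lemma volumeRatio_ne_zero (g : Gc) : volumeRatio E P dR v (R g) ≠ 0 := by
  have : FiniteDimensional ℝ E := FiniteDimensional.complexToReal E
  exact mul_ne_zero (gramDet_ne_zero fun u hu => hm.isoForm_self_eq_zero g hu)
    (pow_ne_zero _ (norm_ne_zero_iff.2 (hm.apply_ne_zero g)))

include hu in
lemma volumeRatio_mul_left (k : G) (g : Gc) :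
    volumeRatio E P dR v (R (ι k * g)) = volumeRatio E P dR v (R g) := by
  have h : isoForm E P dR v (R (ι k * g)) = isoForm E P dR v (R g) := by
    ext u w
    rw [isoForm_apply, isoForm_apply, hm.apply_mul, hm.apply_mul, hm.apply_mul,
      fubiniStudy_isometry _ _ (hu k)]
  rw [volumeRatio, volumeRatio, h, hm.apply_mul, hu]

omit hm in
lemma differentiableAt_volumeRatio {T : V →L[ℂ] V} (hT : T v ≠ 0) :
    DifferentiableAt ℝ (volumeRatio E P dR v) T := by
  have : FiniteDimensional ℝ E := FiniteDimensional.complexToReal E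
  refine ContDiffAt.differentiableAt (n := 1) ?_ one_ne_zero
  have hap : ∀ w : V, ContDiffAt ℝ 1 (fun T : V →L[ℂ] V => T w) T := fun w =>
    ((ContinuousLinearMap.apply ℂ V w).restrictScalars ℝ).contDiff.contDiffAt
  have hfs : ContDiffAt ℝ 1 (fun T : V →L[ℂ] V => fubiniStudy (T v)) T :=
    ContDiffAt.comp (g := fubiniStudy) (f := fun T : V →L[ℂ] V => T v) T
      (contDiffAt_fubiniStudy hT) (hap v)
  refine ContDiffAt.mul ?_ ?_
  · simp only [gramDet_toBilin]
    refine contDiffAt_det fun i j => ?_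
    exact (hfs.clm_apply (hap _)).clm_apply (hap _)
  · have h4 : ∀ T : V →L[ℂ] V, ‖T v‖ ^ 4 = (reInner V (T v) (T v)) ^ 2 := fun T => by
      rw [reInner_self]; ring
    simp only [h4]
    exact (((reInner V).contDiff.contDiffAt.comp T (hap v)).clm_apply (hap v)).pow 2

include hG hu in
/-- The derivative of such a function vanishes along the compact form and along `P`, hence
everywhere. -/
lemma eq_of_invariant [PreconnectedSpace Gc] {N : Gc → ℝ} (hNd : MDifferentiable 𝓘(ℝ, 𝔼) 𝓘(ℝ, ℝ) N)
    (hr : ∀ (g : Gc) (p : P), N (g * p) =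
      N g * (‖hm.char p‖ * ‖LinearMap.det (isotropy (E := E) p : E →ₗ[ℂ] E)‖) ^ 4)
    (hl : ∀ (k : G) (g : Gc), N (ι k * g) = N g) (g h : Gc) : N g = N h := by
  have hL : LieGroup 𝓘(ℝ, 𝔼) ∞ Gc := lieGroup_real_of_complex
  have : IsManifold 𝓘(ℝ, 𝔼) 1 Gc :=
    IsManifold.of_le (n := ∞) (WithTop.coe_le_coe.2 (le_top : (1 : ℕ∞) ≤ ⊤))
  have hleft : ∀ g, MDifferentiableAt 𝓘(ℝ, 𝔼) 𝓘(ℝ, ℝ) (fun y => N (g * y)) 1 := fun g =>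
    (hNd _).comp (1 : Gc) (mdifferentiableAt_mul_left g 1)
  have key : ∀ g, (mfderiv 𝓘(ℝ, 𝔼) 𝓘(ℝ, ℝ) (fun y => N (g * y)) 1 : 𝔼 →L[ℝ] ℝ) = 0 := by
    intro g
    let D : 𝔼 →L[ℝ] ℝ := mfderiv 𝓘(ℝ, 𝔼) 𝓘(ℝ, ℝ) (fun y => N (g * y)) 1
    have hD : HasMFDerivAt 𝓘(ℝ, 𝔼) 𝓘(ℝ, ℝ) (fun y => N (g * y)) 1 (D : 𝔼 →L[ℝ] ℝ) :=
      (hleft g).hasMFDerivAt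
    have hDP : ∀ y, dMk 𝔼 E P y = 0 → D y = 0 := by
      intro y hy
      obtain ⟨c, hc⟩ := (hm.dMk_eq_zero_iff y).1 hy
      obtain ⟨γ, hγ⟩ := exists_isExpCurve (K := Gc) y
      have h1 : HasMFDerivAt 𝓘(ℝ, 𝔼) 𝓘(ℝ, ℝ) (fun y => N (g * y)) (γ 0) (D : 𝔼 →L[ℝ] ℝ) := by
        rw [hγ.1]; exact hD
      have h2 : HasFDerivAt ((fun y => N (g * y)) ∘ γ) (D.comp ((1 : ℝ →L[ℝ] ℝ).smulRight y)) 0 :=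
        hasMFDerivAt_iff_hasFDerivAt.1 (h1.comp (0 : ℝ) hγ.hasMFDerivAt_zero)
      have h3 : HasDerivAt ((fun y => N (g * y)) ∘ γ) 0 0 := by
        refine (hasDerivAt_const (0 : ℝ) (N g)).congr_of_eventuallyEq ?_
        filter_upwards [hm.apply_expCurve hγ hc, hm.det_isotropy_expCurve hγ hc] with t ht ht'
        have hP : γ t ∈ P := (hm.mem_iff _).2 ⟨_, ht⟩
        have h4 := hr g ⟨γ t, hP⟩
        rw [ht' hP, hm.char_eq (p := ⟨γ t, hP⟩) ht, ← norm_mul, ← Complex.exp_add, neg_mul,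
          add_neg_cancel, Complex.exp_zero, norm_one, one_pow, mul_one] at h4
        exact h4
      have h5 : D ((1 : ℝ) • y) = 0 := h2.hasDerivAt.unique h3
      rwa [one_smul] at h5
    have hDG : ∀ x : 𝐑, D (AdL g⁻¹ (𝐝 x)) = 0 := by
      intro x
      have h1 : HasMFDerivAt 𝓘(ℝ, 𝔼) 𝓘(ℝ, ℝ) (fun y => N (g * y)) (g⁻¹ * ι 1 * g⁻¹⁻¹)
          (D : 𝔼 →L[ℝ] ℝ) := by
        have e : g⁻¹ * ι 1 * g⁻¹⁻¹ = 1 := by simp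
        rw [e]; exact hD
      have h0 : HasMFDerivAt 𝓘(ℝ, 𝔼) 𝓘(ℝ, 𝔼) (fun y : Gc => g⁻¹ * y * g⁻¹⁻¹) (ι 1)
          ((AdL (𝔼 := 𝔼) g⁻¹).restrictScalars ℝ : 𝔼 →L[ℝ] 𝔼) := by
        rw [_root_.map_one]
        exact hasMFDerivAt_real_of_complex (hasMFDerivAt_conj (𝔼 := 𝔼) g⁻¹)
      have h2 := (HasMFDerivAt.comp (ι 1) h1 h0).comp (1 : G) (hasMFDerivAt_incl hG)
      have e : ((fun y => N (g * y)) ∘ fun y : Gc => g⁻¹ * y * g⁻¹⁻¹) ∘ ι = fun _ => N g := by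
        funext k
        change N (g * (g⁻¹ * ι k * g⁻¹⁻¹)) = N g
        rw [inv_inv, ← mul_assoc, ← mul_assoc, mul_inv_cancel, one_mul]
        exact hl k g
      rw [e] at h2
      exact congrArg (fun l : 𝐑 →L[ℝ] ℝ => l x)
        (hasMFDerivAt_unique h2 (hasMFDerivAt_const (N g) (1 : G)))
    ext a
    obtain ⟨x, y, hy, rfl⟩ := hm.exists_incl_add hG hu g a
    change D _ = 0
    rw [map_add, hDG, hDP y hy, add_zero]
  refine eq_of_mfderiv_eq_zero (f := N) (F := 𝔼) (fun g => ?_) g h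
  have h1 : HasMFDerivAt 𝓘(ℝ, 𝔼) 𝓘(ℝ, ℝ) (fun y => N (g * y)) (g⁻¹ * g) (0 : 𝔼 →L[ℝ] ℝ) := by
    rw [inv_mul_cancel]
    exact (hleft g).hasMFDerivAt.congr_mfderiv (key g)
  have h2 := h1.comp g (mdifferentiableAt_mul_left (F := 𝔼) g⁻¹ g).hasMFDerivAt
  have e : (fun y => N (g * y)) ∘ (g⁻¹ * ·) = N := by
    funext y
    simp only [Function.comp_apply, mul_inv_cancel_left]
  rw [e] at h2
  exact h2.congr_mfderiv (ContinuousLinearMap.zero_comp _)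

include hG hu in
lemma volumeRatio_eq [PreconnectedSpace Gc] (g h : Gc) :
    volumeRatio E P dR v (R g) = volumeRatio E P dR v (R h) := by
  refine hm.eq_of_invariant hG hu (N := fun g => volumeRatio E P dR v (R g)) (fun g => ?_)
    hm.volumeRatio_mul_right (hm.volumeRatio_mul_left hu) g h
  have h1 := (hasMFDerivAt_real_of_complex
    (hm.contMDiff.mdifferentiableAt (x := g) (by simp)).hasMFDerivAt).mdifferentiableAt
  exact MDifferentiableAt.comp g (differentiableAt_volumeRatio
    (hm.apply_ne_zero g)).mdifferentiableAt h1

include hG hu in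
/-- The characters `δ_P` and `det` of the isotropy representation have inverse moduli, although `P`
need not be assumed connected. -/
lemma norm_char_mul_norm_det [PreconnectedSpace Gc] (p : P) :
    ‖hm.char p‖ * ‖LinearMap.det (isotropy (E := E) p : E →ₗ[ℂ] E)‖ = 1 := by
  have h1 := hm.volumeRatio_mul_right 1 p
  rw [hm.volumeRatio_eq hG hu (1 * p) 1] at h1
  have h2 := mul_left_cancel₀ (hm.volumeRatio_ne_zero 1) ((mul_one _).trans h1)
  exact (pow_eq_one_iff_of_nonneg (by positivity) (by norm_num)).1 h2.symm

end IsFlagModel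

/-! ### The orbits of the compact real form and its moment map -/

/-- A map whose differential is surjective is open at the point. -/
lemma nhds_le_map_of_surjective {F F' : Type*} [NormedAddCommGroup F] [NormedSpace ℝ F]
    [CompleteSpace F] [NormedAddCommGroup F'] [NormedSpace ℝ F'] [CompleteSpace F']
    {X Y : Type*} [TopologicalSpace X] [ChartedSpace F X] [TopologicalSpace Y] [ChartedSpace F' Y]
    {f : X → Y} {x : X} {f' : F →L[ℝ] F'} (hf : ContMDiffAt 𝓘(ℝ, F) 𝓘(ℝ, F') 1 f x)
    (hf' : HasMFDerivAt 𝓘(ℝ, F) 𝓘(ℝ, F') f x (f' : F →L[ℝ] F')) (hs : Function.Surjective f') :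
    𝓝 (f x) ≤ Filter.map f (𝓝 x) := by
  set φ := extChartAt 𝓘(ℝ, F) x with hφ
  set ψ := extChartAt 𝓘(ℝ, F') (f x) with hψ
  have h1 : ContDiffAt ℝ 1 (ψ ∘ f ∘ φ.symm) (φ x) := by
    have := (contMDiffAt_iff.1 hf).2
    simpa [hφ, hψ, contDiffWithinAt_univ] using this
  have h2 : HasFDerivAt (ψ ∘ f ∘ φ.symm) f' (φ x) := by
    have h : HasFDerivWithinAt (ψ ∘ f ∘ φ.symm) f' (range 𝓘(ℝ, F)) (φ x) := hf'.2
    rwa [ModelWithCorners.range_eq_univ, hasFDerivWithinAt_univ] at h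
  have h3 := h1.hasStrictFDerivAt (one_ne_zero)
  rw [h2.fderiv] at h3
  have h4 := h3.map_nhds_eq_of_surj (LinearMap.range_eq_top.2 hs)
  have e : (ψ ∘ f ∘ φ.symm) (φ x) = ψ (f x) := by
    simp only [Function.comp_apply, hφ, extChartAt_to_inv]
  rw [e] at h4
  have h5 : Filter.map ψ.symm (𝓝 (ψ (f x))) = 𝓝 (f x) := by
    have := map_extChartAt_symm_nhdsWithin_range (I := 𝓘(ℝ, F')) (f x)
    simpa [hψ] using this
  have h6 : Filter.map φ.symm (𝓝 (φ x)) = 𝓝 x := by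
    have := map_extChartAt_symm_nhdsWithin_range (I := 𝓘(ℝ, F)) x
    simpa [hφ] using this
  rw [← h5, ← h4, Filter.map_map, ← h6, Filter.map_map]
  refine le_of_eq (Filter.map_congr ?_)
  have h7 : ∀ᶠ y in 𝓝 x, f y ∈ ψ.source :=
    hf.continuousAt.eventually (extChartAt_source_mem_nhds (I := 𝓘(ℝ, F')) (f x))
  rw [← h6, Filter.eventually_map] at h7
  filter_upwards [h7] with z hz
  simp only [Function.comp_apply]
  rw [ψ.left_inv hz]

namespace IsFlagModel
include hm hG

omit hm in
lemma dIncl_injective : Function.Injective (dIncl (d := d) 𝔼 ι) := by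
  refine (injective_iff_map_eq_zero _).2 fun x hx => ?_
  have h0 : dIncl (d := d) 𝔼 ι 0 = 0 := map_zero _
  have h1 := (hG.real_form 0).unique (y₁ := (x, 0)) (y₂ := (0, 0))
    (by
      change (0 : 𝔼) = 𝐝 x + I • dIncl (d := d) 𝔼 ι 0
      rw [hx, h0, smul_zero, add_zero])
    (by
      change (0 : 𝔼) = dIncl (d := d) 𝔼 ι 0 + I • dIncl (d := d) 𝔼 ι 0
      rw [h0, smul_zero, add_zero])
  exact congrArg Prod.fst h1

include hu

lemma inner_dR_incl_re (y : 𝐑) (w : V) : (inner ℂ w (dR (𝐝 y) w)).re = 0 := by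
  have h1 := hm.inner_dR_incl hG hu y w w
  rw [← inner_conj_symm] at h1
  have h2 := congrArg Complex.re h1
  rw [Complex.conj_re, Complex.neg_re] at h2
  linarith

/-- The value of the moment map at the line of `R g v`, seen in the Lie algebra of the compact
form, fixes this line, and acts on it by a non-zero scalar. -/
lemma exists_moment (g : Gc) : ∃ (x : 𝐑) (β : ℝ), β ≠ 0 ∧
    dR (𝐝 x) (R g v) = (β * I) • R g v := by
  set w := R g v with hw
  have hw0 : w ≠ 0 := hm.apply_ne_zero g
  have hn0 : ‖w‖ ≠ 0 := norm_ne_zero_iff.2 hw0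
  let q : 𝐑 →ₗ[ℝ] Module.Dual ℝ (𝐑) :=
    LinearMap.mk₂ ℝ (fun x y => -(traceForm dR (𝐝 x) (𝐝 y)).re)
      (fun x y z => by simp; ring) (fun c x y => by
        have : 𝐝 (c • x) = (c : ℂ) • 𝐝 x := map_smul (𝐝) c x
        rw [this]; simp) (fun x y z => by simp; ring) (fun c x y => by
        have : 𝐝 (c • y) = (c : ℂ) • 𝐝 y := map_smul (𝐝) c y
        rw [this]; simp)
  have hqi : ∀ x, q x x = 0 → x = 0 := fun x hx => by
    have hx' : -(traceForm dR (𝐝 x) (𝐝 x)).re = 0 := hx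
    refine dIncl_injective hG ?_
    rw [map_zero]
    exact hm.incl_eq_zero hG hu (Complex.ext (neg_eq_zero.1 hx') (hm.traceForm_incl_im hG hu x x))
  have hinj : Function.Injective q := (injective_iff_map_eq_zero q).2 fun x hx =>
    hqi x (by rw [hx]; rfl)
  let m : 𝔼 →ₗ[ℂ] ℂ := ((innerSL ℂ w).comp ((ContinuousLinearMap.apply ℂ V w).comp dR) : 𝔼 →L[ℂ] ℂ)
  have hma : ∀ z, m z = inner ℂ w (dR z w) := fun z => rfl
  let μ : Module.Dual ℝ (𝐑) := Complex.imLm ∘ₗ (m.restrictScalars ℝ) ∘ₗ (𝐝 : 𝐑 →L[ℝ] 𝔼)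
  have hm_incl : ∀ y, m (𝐝 y) = I * (μ y : ℂ) := fun y => by
    have h1 : (m (𝐝 y)).re = 0 := hm.inner_dR_incl_re hG hu y w
    refine Complex.ext ?_ ?_
    · rw [h1]; simp
    · simp [μ]
  obtain ⟨a, ha⟩ := (LinearMap.injective_iff_surjective_of_finrank_eq_finrank
    Subspace.dual_finrank_eq.symm).1 hinj μ
  have hta : ∀ y : 𝐑,
      traceForm dR (𝐝 a) (𝐝 y) = I * m (𝐝 y) := fun y => by
    have h1 : -(traceForm dR (𝐝 a) (𝐝 y)).re = μ y :=
      congrArg (fun l : Module.Dual ℝ (𝐑) => l y) ha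
    rw [hm_incl, ← mul_assoc, Complex.I_mul_I, ← h1]
    refine Complex.ext ?_ ?_
    · simp
    · rw [hm.traceForm_incl_im hG hu]; simp
  have htz : ∀ z, traceForm dR (𝐝 a) z = I * m z := fun z => by
    obtain ⟨x, y, rfl⟩ := hm.exists_real_parts hG z
    rw [map_add, map_smul, hta, hta, map_add, map_smul, smul_eq_mul, smul_eq_mul]
    ring
  set A := dR (𝐝 a) with hA
  -- the bracket of `a` with `y` is orthogonal to `a`
  have hAY : ∀ y : 𝐑, (inner ℂ (A w) (dR (𝐝 y) w)).im = 0 := by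
    intro y
    set Y := dR (𝐝 y) with hY
    have h1 := htz (br (𝐝 a) (𝐝 y))
    have h2 : traceForm dR (𝐝 a) (br (𝐝 a) (𝐝 y)) = 0 := by
      rw [traceForm_apply, hm.lie, ← hA, ← hY, mul_sub, ContinuousLinearMap.toLinearMap_sub,
        map_sub, sub_eq_zero, ← mul_assoc, ← mul_assoc]
      have := LinearMap.trace_mul_comm ℂ (A : V →ₗ[ℂ] V) ((A * Y : V →L[ℂ] V) : V →ₗ[ℂ] V)
      rw [mul_assoc A A Y]
      exact this
    rw [h2] at h1
    have h3 : m (br (𝐝 a) (𝐝 y)) = 0 := by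
      rcases mul_eq_zero.1 h1.symm with h | h
      · exact absurd h Complex.I_ne_zero
      · exact h
    rw [hma, hm.lie, ← hA, ← hY] at h3
    have h4 : inner ℂ w (A (Y w)) - inner ℂ w (Y (A w)) = 0 := by rw [← inner_sub_right]; exact h3
    have h5 := hm.inner_dR_incl hG hu a w (Y w)
    have h6 := hm.inner_dR_incl hG hu y w (A w)
    rw [← hA] at h5
    rw [← hY] at h6
    have h7 : inner ℂ (Y w) (A w) = inner ℂ (A w) (Y w) := by
      rw [h5, h6, neg_inj]; exact (sub_eq_zero.1 h4).symm
    rw [← inner_conj_symm] at h7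
    exact Complex.conj_eq_iff_im.1 h7
  -- `i A w` is tangent to the orbit of the compact form
  obtain ⟨x, c, hx⟩ : ∃ (x : 𝐑) (c : ℂ),
      dR (𝐝 x) w = I • A w - c • w := by
    obtain ⟨x, y, hy, h⟩ := hm.exists_incl_add hG hu g (AdL g⁻¹ (I • 𝐝 a))
    obtain ⟨c, hc⟩ := (hm.dMk_eq_zero_iff y).1 hy
    refine ⟨x, c, ?_⟩
    have h1 := congrArg (fun z => dR (AdL g z) w) h
    simp only [map_add, ← AdL_mul, mul_inv_cancel, AdL_one] at h1
    rw [add_apply, hw, hm.dR_AdL_apply, hc, ← hw, map_smul, map_smul, ← hw] at h1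
    rw [eq_sub_iff_add_eq]
    exact h1.symm
  set α := μ a with hα
  have hAw : inner ℂ w (A w) = I * (α : ℂ) := hm_incl a
  have hAw' : inner ℂ (A w) w = -(I * (α : ℂ)) := by rw [← inner_conj_symm, hAw]; simp
  have hre : c.re * ‖w‖ ^ 2 = -α := by
    have h1 := hm.inner_dR_incl_re hG hu x w
    rw [hx, inner_sub_right, inner_smul_right, inner_smul_right, hAw,
      inner_self_eq_norm_sq_to_K] at h1
    have e : (c * ((‖w‖ : ℝ) : ℂ) ^ 2).re = c.re * ‖w‖ ^ 2 := by
      rw [← Complex.ofReal_pow, Complex.re_mul_ofReal]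
    have e2 : (I * (I * (α : ℂ))).re = -α := by rw [← mul_assoc, Complex.I_mul_I]; simp
    rw [Complex.sub_re, e2] at h1
    erw [e] at h1
    linarith
  have hnorm : ‖A w‖ ^ 2 * ‖w‖ ^ 2 = α ^ 2 := by
    have h1 := hAY x
    rw [hx, inner_sub_right, inner_smul_right, inner_smul_right, hAw',
      inner_self_eq_norm_sq_to_K] at h1
    have e : (I * ((‖A w‖ : ℝ) : ℂ) ^ 2).im = ‖A w‖ ^ 2 := by rw [Complex.I_mul_im]; norm_cast
    have e2 : (c * -(I * (α : ℂ))).im = -(c.re * α) := by simp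
    rw [Complex.sub_im, e2] at h1
    erw [e] at h1
    have : ‖A w‖ ^ 2 = -(c.re * α) := by linarith
    rw [this]
    linear_combination -α * hre
  obtain ⟨z, hz⟩ : ∃ z : ℂ, A w = z • w := by
    refine exists_smul_of_fubiniStudy_eq_zero hw0 ?_
    rw [fubiniStudy_eq hw0, hAw, hAw', inner_self_eq_norm_sq_to_K, inner_self_eq_norm_sq_to_K]
    have e : (((‖A w‖ : ℝ) : ℂ) ^ 2 * ((‖w‖ : ℝ) : ℂ) ^ 2
        - -(I * (α : ℂ)) * (I * (α : ℂ))).re = ‖A w‖ ^ 2 * ‖w‖ ^ 2 - α ^ 2 := by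
      have : -(I * (α : ℂ)) * (I * (α : ℂ)) = ((α ^ 2 : ℝ) : ℂ) := by
        push_cast
        linear_combination (-(α : ℂ) ^ 2) * Complex.I_mul_I
      rw [this]
      norm_cast
    erw [e]
    rw [hnorm, sub_self, zero_div]
  refine ⟨a, α / ‖w‖ ^ 2, ?_, ?_⟩
  · refine div_ne_zero (fun h0 => ?_) (pow_ne_zero _ hn0)
    have ha0 : a = 0 := hqi a (by rw [ha]; exact h0)
    have hμ0 : μ = 0 := by rw [← ha, ha0, map_zero]
    have hm0 : ∀ z, m z = 0 := fun z => by
      obtain ⟨x, y, rfl⟩ := hm.exists_real_parts hG z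
      rw [map_add, map_smul, hm_incl, hm_incl, hμ0]
      simp
    obtain ⟨x0, c0, hc0, hx0⟩ := hm.exists_weight
    have h1 := hm0 (AdL g x0)
    rw [hma, hw, hm.dR_AdL_apply, hx0, map_smul, inner_smul_right, mul_eq_zero,
      inner_self_eq_zero] at h1
    exact h1.elim hc0 (hm.apply_ne_zero g)
  · rw [hz] at hAw ⊢
    rw [inner_smul_right, inner_self_eq_norm_sq_to_K] at hAw
    congr 1
    have h0 : ((‖w‖ : ℝ) : ℂ) ^ 2 ≠ 0 := pow_ne_zero _ (Complex.ofReal_ne_zero.2 hn0)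
    push_cast
    rw [div_mul_eq_mul_div, eq_div_iff h0, mul_comm (α : ℂ)]
    exact hAw

/-- The orbits of the compact form on the flag manifold are open. -/
lemma orbit_mem_nhds (g : Gc) : {x : Gc ⧸ P | ∃ k : G, x = 𝛑 (ι k * g)} ∈ 𝓝 (𝛑 g) := by
  let f : G → Gc ⧸ P := fun k => 𝛑 (g⁻¹ * ι k * g⁻¹⁻¹)
  have hmul : (g⁻¹ * ι 1 * g⁻¹⁻¹ : Gc) = 1 := by simp
  have hf1 : f 1 = 𝛑 1 := congrArg 𝛑 hmul
  have hc : ContMDiff 𝓘(ℝ, 𝔼) 𝓘(ℝ, E) ∞ 𝛑 :=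
    contMDiffOn_univ.1 (contMDiffOn_real_of_complex (contMDiffOn_univ.2 hq.contMDiff_mk))
  have hconj : ContMDiff 𝓘(ℝ, 𝔼) 𝓘(ℝ, 𝔼) ∞ (fun y : Gc => g⁻¹ * y * g⁻¹⁻¹) :=
    contMDiffOn_univ.1 (contMDiffOn_real_of_complex
      (contMDiffOn_univ.2 (contMDiff_conj (𝔼 := 𝔼) g⁻¹)))
  have hfs : ContMDiff (𝓡 d) 𝓘(ℝ, E) ∞ f := hc.comp (hconj.comp hG.smooth)
  have h0 : HasMFDerivAt 𝓘(ℝ, 𝔼) 𝓘(ℝ, 𝔼) (fun y : Gc => g⁻¹ * y * g⁻¹⁻¹) (ι 1)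
      ((AdL (𝔼 := 𝔼) g⁻¹).restrictScalars ℝ : 𝔼 →L[ℝ] 𝔼) := by
    rw [_root_.map_one]
    exact hasMFDerivAt_real_of_complex (hasMFDerivAt_conj (𝔼 := 𝔼) g⁻¹)
  have h1 : HasMFDerivAt 𝓘(ℝ, 𝔼) 𝓘(ℝ, E) 𝛑 (g⁻¹ * ι 1 * g⁻¹⁻¹)
      ((dMk 𝔼 E P).restrictScalars ℝ : 𝔼 →L[ℝ] E) := by
    rw [hmul]
    exact hasMFDerivAt_real_of_complex hasMFDerivAt_mk
  have h2 := HasMFDerivAt.comp (1 : G) h1 (HasMFDerivAt.comp (1 : G) h0 (hasMFDerivAt_incl hG))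
  have : CompleteSpace E := FiniteDimensional.complete ℂ E
  have h3 := nhds_le_map_of_surjective (f := f) (f' := ((dMk 𝔼 E P).restrictScalars ℝ).comp
    (((AdL (𝔼 := 𝔼) g⁻¹).restrictScalars ℝ : 𝔼 →L[ℝ] 𝔼).comp (𝐝)))
    ((hfs 1).of_le (WithTop.coe_le_coe.2 (le_top : (1 : ℕ∞) ≤ ⊤))) h2 (fun u => by
      obtain ⟨a, rfl⟩ := dMk_surjective (𝔼 := 𝔼) (P := P) u
      obtain ⟨x, y, hy, rfl⟩ := hm.exists_incl_add hG hu g a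
      refine ⟨x, ?_⟩
      rw [map_add, hy, add_zero]
      rfl)
  rw [hf1] at h3
  have h4 : Set.range f ∈ 𝓝 (𝛑 1) := h3 (Filter.mem_map.2 (by
    rw [Set.preimage_range]; exact Filter.univ_mem))
  have h5 : ContinuousAt (fun x : Gc ⧸ P => g⁻¹ • x) (𝛑 g) :=
    (contMDiff_smul_quotient 𝔼 E g⁻¹).continuous.continuousAt
  have e : g⁻¹ • 𝛑 g = 𝛑 1 := congrArg 𝛑 (inv_mul_cancel g)
  rw [ContinuousAt, e] at h5
  filter_upwards [h5 h4] with x hx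
  obtain ⟨k, hk⟩ := hx
  refine ⟨k, ?_⟩
  have h6 := congrArg (fun y : Gc ⧸ P => g • y) hk
  simp only [smul_inv_smul] at h6
  rw [← h6]
  change (𝛑 (g * (g⁻¹ * ι k * g⁻¹⁻¹)) : Gc ⧸ P) = _
  rw [inv_inv, ← mul_assoc, ← mul_assoc, mul_inv_cancel, one_mul]

/-- The compact form acts transitively on the flag manifold. -/
lemma exists_mk_incl_mul [PreconnectedSpace Gc] (g h : Gc) : ∃ k : G, 𝛑 h = 𝛑 (ι k * g) := by
  have hpre : PreconnectedSpace (Gc ⧸ P) := by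
    have h1 := isPreconnected_range (hq.contMDiff_mk).continuous
    rw [(QuotientGroup.mk_surjective (s := P)).range_eq] at h1
    exact ⟨h1⟩
  have hop : ∀ g : Gc, IsOpen {x : Gc ⧸ P | ∃ k : G, x = 𝛑 (ι k * g)} := by
    intro g
    rw [isOpen_iff_mem_nhds]
    rintro _ ⟨k, rfl⟩
    filter_upwards [hm.orbit_mem_nhds hG hu (ι k * g)] with x hx
    obtain ⟨k', rfl⟩ := hx
    exact ⟨k' * k, by rw [_root_.map_mul, mul_assoc]⟩
  have hclopen : IsClopen {x : Gc ⧸ P | ∃ k : G, x = 𝛑 (ι k * g)} := by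
    refine ⟨⟨?_⟩, hop g⟩
    rw [isOpen_iff_mem_nhds]
    intro x hx
    obtain ⟨g', rfl⟩ := QuotientGroup.mk_surjective x
    filter_upwards [hm.orbit_mem_nhds hG hu g'] with y hy ⟨k', hk'⟩
    obtain ⟨k, rfl⟩ := hy
    refine hx ⟨k⁻¹ * k', ?_⟩
    have h1 := congrArg (fun y : Gc ⧸ P => (ι k)⁻¹ • y) hk'
    have h2 : (𝛑 ((ι k)⁻¹ * (ι k * g')) : Gc ⧸ P) = 𝛑 ((ι k)⁻¹ * (ι k' * g)) := h1
    rw [inv_mul_cancel_left] at h2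
    rw [h2, _root_.map_mul, map_inv, mul_assoc]
  have hun := hclopen.eq_univ ⟨𝛑 g, 1, by rw [_root_.map_one, one_mul]⟩
  have : 𝛑 h ∈ (univ : Set (Gc ⧸ P)) := mem_univ _
  rw [← hun] at this
  exact this

end IsFlagModel

/-! ### The action of the isotropy group on the fibre -/

lemma phase_exp_mul_I (θ : ℝ) (z : ℂˣ) (hz : (z : ℂ) = Complex.exp (θ * I)) :
    phase z = Circle.exp θ := by
  apply Circle.ext
  rw [coe_phase, hz, Complex.norm_exp_ofReal_mul_I, Circle.coe_exp]
  simp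

namespace IsFlagModel
include hm hG hu

/-- A curve in the isotropy group of a point, in the compact form, on which the determinant of the
isotropy representation runs through the circle. -/
lemma exists_isotropy_curve (g : Gc) : ∃ (γ : ℝ → G) (β : ℝ), β ≠ 0 ∧
    ∀ᶠ t in 𝓝 (0 : ℝ), ∃ hP : g⁻¹ * ι (γ t) * g ∈ P,
      LinearMap.det (isotropy (E := E) ⟨g⁻¹ * ι (γ t) * g, hP⟩ : E →ₗ[ℂ] E) =
        (Complex.exp ((β * t : ℝ) * I))⁻¹ := by
  have := hG.lieGroup
  have hL : LieGroup 𝓘(ℝ, 𝔼) ∞ Gc := lieGroup_real_of_complex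
  obtain ⟨x, β, hβ, hx⟩ := hm.exists_moment hG hu g
  obtain ⟨γ, hγ⟩ := exists_isExpCurve (K := G) x
  have hγ1 := isExpCurve_incl hG hγ
  have hγ2 := hγ1.map (f := fun y : Gc => g⁻¹ * y * g⁻¹⁻¹) (W := 𝔼)
    (fun y => (hasMFDerivAt_real_of_complex
      ((contMDiff_conj (𝔼 := 𝔼) g⁻¹).mdifferentiableAt (x := y) (by simp)).hasMFDerivAt)
        |>.mdifferentiableAt) (by simp) (fun x y => by group)
  have hAd : (mfderiv 𝓘(ℝ, 𝔼) 𝓘(ℝ, 𝔼) (fun y : Gc => g⁻¹ * y * g⁻¹⁻¹) 1 : 𝔼 →L[ℝ] 𝔼)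
      = (AdL (𝔼 := 𝔼) g⁻¹).restrictScalars ℝ :=
    (hasMFDerivAt_real_of_complex (hasMFDerivAt_conj (𝔼 := 𝔼) g⁻¹)).mfderiv
  rw [hAd] at hγ2
  have hx' : dR (AdL g⁻¹ (𝐝 x)) v = (β * I) • v := by
    apply hm.apply_injective g
    rw [← hm.dR_AdL_apply, ← AdL_mul, mul_inv_cancel, AdL_one, hx, map_smul]
  refine ⟨γ, β, hβ, ?_⟩
  filter_upwards [hm.det_isotropy_expCurve hγ2 hx', hm.apply_expCurve hγ2 hx'] with t h1 h2
  simp only [Function.comp_apply, inv_inv] at h1 h2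
  have hP : g⁻¹ * ι (γ t) * g ∈ P := (hm.mem_iff _).2 ⟨_, h2⟩
  refine ⟨hP, (h1 hP).trans ?_⟩
  rw [← Complex.exp_neg]
  congr 1
  push_cast
  ring

variable {k : ℕ}

/-- The determinant of the isotropy representation is not constant, so it is no zeroth power. -/
lemma canonicalRoot_ne_zero (hχ : χ.IsCanonicalRoot (E := E) k) : k ≠ 0 := by
  rintro rfl
  obtain ⟨γ, β, hβ, h⟩ := hm.exists_isotropy_curve hG hu 1
  obtain ⟨ε, hε, hb⟩ := Metric.eventually_nhds_iff_ball.1 h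
  set t : ℝ := min (ε / 2) (1 / |β|) with ht
  have hβ' : 0 < |β| := abs_pos.2 hβ
  have ht0 : 0 < t := lt_min (by linarith) (by positivity)
  obtain ⟨hP, hdet⟩ := hb t (by
    rw [Metric.mem_ball, Real.dist_eq, sub_zero, abs_of_pos ht0]
    exact lt_of_le_of_lt (min_le_left _ _) (by linarith))
  have h1 : (χ.toHom ⟨_, hP⟩ : ℂ) ^ 0 *
      LinearMap.det (isotropy (E := E) ⟨_, hP⟩ : E →ₗ[ℂ] E) = 1 := hχ ⟨_, hP⟩
  have h2 : LinearMap.det (isotropy (E := E) ⟨_, hP⟩ : E →ₗ[ℂ] E) = 1 := by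
    rwa [pow_zero, one_mul] at h1
  rw [hdet, inv_eq_one, Complex.exp_eq_one_iff] at h2
  obtain ⟨n, hn⟩ := h2
  have h3 : β * t = n * (2 * Real.pi) := by
    have : ((β * t : ℝ) : ℂ) = ((n * (2 * Real.pi) : ℝ) : ℂ) := by
      apply mul_right_cancel₀ Complex.I_ne_zero
      rw [hn]; push_cast; ring
    exact_mod_cast this
  have h4 : |β * t| ≤ 1 := by
    rw [abs_mul, abs_of_pos ht0]
    calc |β| * t ≤ |β| * (1 / |β|) := by gcongr; exact min_le_right _ _
      _ = 1 := by field_simp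
  have h5 : n ≠ 0 := by
    rintro rfl
    rw [Int.cast_zero, zero_mul] at h3
    exact (mul_ne_zero hβ ht0.ne') h3
  have h6 : (1 : ℝ) ≤ |(n : ℝ)| := by exact_mod_cast Int.one_le_abs h5
  rw [h3, abs_mul, abs_of_pos Real.two_pi_pos] at h4
  nlinarith [Real.pi_gt_three]

/-- Both sides are inverse to the modulus of the determinant of the isotropy representation. -/
lemma norm_char_eq [PreconnectedSpace Gc] (hχ : χ.IsCanonicalRoot (E := E) k) (p : P) :
    ‖hm.char p‖ = ‖(χ.toHom p : ℂ)‖ ^ k := by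
  have h1 := hm.norm_char_mul_norm_det hG hu p
  have h2 : (χ.toHom p : ℂ) ^ k * LinearMap.det (isotropy (E := E) p : E →ₗ[ℂ] E) = 1 := hχ p
  have h3 := congrArg norm h2
  rw [norm_mul, norm_pow, norm_one] at h3
  have h4 : ‖LinearMap.det (isotropy (E := E) p : E →ₗ[ℂ] E)‖ ≠ 0 :=
    norm_ne_zero_iff.2 (det_isotropy_ne_zero 𝔼 E p)
  exact mul_right_cancel₀ h4 (h1.trans h3.symm)

/-- The isotropy group of a point in the compact form acts transitively on the fibre of the circle
bundle. -/
lemma exists_phase_eq (hχ : χ.IsCanonicalRoot (E := E) k) {ℓ : ℕ} (hℓ : 0 < ℓ) (g : Gc)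
    (z : Circle) : ∃ (a : G) (hP : g⁻¹ * ι a * g ∈ P),
      phase ((χ.pow ℓ).toHom ⟨g⁻¹ * ι a * g, hP⟩) = z := by
  obtain ⟨γ, β, hβ, h⟩ := hm.exists_isotropy_curve hG hu g
  obtain ⟨ε, hε, hb⟩ := Metric.eventually_nhds_iff_ball.1 h
  -- the subgroup of the isotropy group and its character
  let c : G →* Gc := (MulAut.conj g⁻¹).toMonoidHom.comp ι
  have hc : ∀ a, c a = g⁻¹ * ι a * g := fun a => by simp [c]
  let S : Subgroup G := P.comap c
  let ψ : S →* Circle := (phase.comp (χ.pow ℓ).toHom).comp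
    ((c.comp S.subtype).codRestrict P (fun a => a.2))
  have hψ : ∀ (a : G) (hP : g⁻¹ * ι a * g ∈ P), ∃ ha : a ∈ S,
      ψ ⟨a, ha⟩ = phase ((χ.pow ℓ).toHom ⟨g⁻¹ * ι a * g, hP⟩) := by
    intro a hP
    refine ⟨by rw [Subgroup.mem_comap, hc]; exact hP, ?_⟩
    simp only [ψ, MonoidHom.comp_apply]
    congr 2
    exact Subtype.ext (hc a)
  obtain ⟨θ, rfl⟩ : ∃ θ : ℝ, Circle.exp θ = z := ⟨_, Circle.exp_arg z⟩
  have hℓβ : (ℓ : ℝ) * β ≠ 0 := mul_ne_zero (by positivity) hβ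
  obtain ⟨n, hn⟩ := exists_nat_gt (|θ / (ℓ * β)| / ε)
  have hn0 : (0 : ℝ) < n := lt_of_le_of_lt (by positivity) hn
  obtain ⟨hP, hdet⟩ := hb (θ / (ℓ * β) / n) (by
    rw [Metric.mem_ball, Real.dist_eq, sub_zero, abs_div, abs_of_pos hn0, div_lt_iff₀ hn0]
    rw [div_lt_iff₀ hε] at hn
    linarith)
  obtain ⟨ha, hψa⟩ := hψ _ hP
  have h2 : (χ.toHom ⟨_, hP⟩ : ℂ) ^ k *
      LinearMap.det (isotropy (E := E) ⟨_, hP⟩ : E →ₗ[ℂ] E) = 1 := hχ ⟨_, hP⟩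
  rw [hdet, mul_inv_eq_one₀ (Complex.exp_ne_zero _)] at h2
  have h3 : ψ ⟨_, ha⟩ ^ k = Circle.exp (θ / n) := by
    rw [hψa]
    have e : phase ((χ.pow ℓ).toHom ⟨_, hP⟩) ^ k = phase (χ.toHom ⟨_, hP⟩ ^ k) ^ ℓ := by
      change phase (χ.toHom ⟨_, hP⟩ ^ ℓ) ^ k = _
      rw [map_pow, map_pow, ← pow_mul, ← pow_mul, mul_comm ℓ k]
    rw [e, phase_exp_mul_I (β * (θ / (ℓ * β) / n)) _ (by rw [Units.val_pow_eq_pow_val, h2]),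
      ← Circle.exp_nsmul]
    congr 1
    rw [nsmul_eq_mul]
    have : (ℓ : ℝ) ≠ 0 := by positivity
    field_simp
  have h4 : ψ (⟨_, ha⟩ ^ (k * n)) = Circle.exp θ := by
    rw [map_pow, pow_mul, h3, ← Circle.exp_nsmul]
    congr 1
    rw [nsmul_eq_mul]
    field_simp
  set s := (⟨_, ha⟩ : S) ^ (k * n) with hs
  have hsP : g⁻¹ * ι (s : G) * g ∈ P := by rw [← hc]; exact s.2
  obtain ⟨ha', hψ'⟩ := hψ _ hsP
  exact ⟨s, hsP, hψ'.symm.trans h4⟩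

end IsFlagModel

/-! ### Points and charts of the circle bundle -/

section Smooth
variable {F : Type*} [NormedAddCommGroup F] [NormedSpace ℝ F] {H : Type*} [TopologicalSpace H]
  {I : ModelWithCorners ℝ F H} {T : Type*} [TopologicalSpace T] [ChartedSpace H T]

lemma HolomorphicCharacter.contMDiffAt_ratio [LieGroup 𝓘(ℝ, 𝔼) ∞ Gc]
    (χ : HolomorphicCharacter 𝔼 P) {α β : T → Gc} {t₀ : T}
    (hα : ContMDiffAt I 𝓘(ℝ, 𝔼) ∞ α t₀) (hβ : ContMDiffAt I 𝓘(ℝ, 𝔼) ∞ β t₀)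
    (h : ∀ᶠ t in 𝓝 t₀, (𝛑 (α t)) = 𝛑 (β t)) :
    ContMDiffAt I 𝓘(ℝ, ℂ) ∞ (fun t => (χ.ratio (α t) (β t) : ℂ)) t₀ := by
  obtain ⟨F, hF, hFχ⟩ := χ.exists_extension
  set p₀ : Gc := (α t₀)⁻¹ * β t₀ with hp₀
  have hp₀P : p₀ ∈ P := QuotientGroup.eq.1 h.self_of_nhds
  have h1 : ContMDiffAt I 𝓘(ℝ, 𝔼) ∞ (fun t => p₀⁻¹ * ((α t)⁻¹ * β t)) t₀ :=
    contMDiffAt_const.mul (hα.inv.mul hβ)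
  have h0 : p₀⁻¹ * ((α t₀)⁻¹ * β t₀) = 1 := by rw [← hp₀, inv_mul_cancel]
  have hF' : ContMDiffAt 𝓘(ℝ, 𝔼) 𝓘(ℝ, ℂ) ∞ F 1 := by
    have h1 := contMDiffAt_iff.1 hF
    exact contMDiffAt_iff.2 ⟨h1.1, (h1.2.restrict_scalars ℝ).of_le (by simp)⟩
  have h2 : ContMDiffAt I 𝓘(ℝ, ℂ) ∞
      (fun t => (χ.toHom ⟨p₀, hp₀P⟩ : ℂ) * F (p₀⁻¹ * ((α t)⁻¹ * β t))) t₀ := by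
    rw [← h0] at hF'
    exact ((ContinuousLinearMap.mul ℝ ℂ (χ.toHom ⟨p₀, hp₀P⟩ : ℂ)).contDiff.contMDiff _).comp t₀
      (ContMDiffAt.comp t₀ hF' h1)
  refine h2.congr_of_eventuallyEq ?_
  have ht := h1.continuousAt.tendsto
  rw [h0] at ht
  filter_upwards [ht.eventually hFχ, h] with t ht' htP
  have hP : (α t)⁻¹ * β t ∈ P := QuotientGroup.eq.1 htP
  rw [ht' (P.mul_mem (P.inv_mem hp₀P) hP), χ.ratio_eq htP, ← Units.val_mul, ← map_mul]
  refine congrArg (fun q : P => (χ.toHom q : ℂ)) (Subtype.ext ?_)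
  change _ = p₀ * (p₀⁻¹ * _)
  rw [mul_inv_cancel_left]

lemma HolomorphicCharacter.contMDiffAt_phase_ratio [LieGroup 𝓘(ℝ, 𝔼) ∞ Gc]
    (χ : HolomorphicCharacter 𝔼 P) {α β : T → Gc} {t₀ : T}
    (hα : ContMDiffAt I 𝓘(ℝ, 𝔼) ∞ α t₀) (hβ : ContMDiffAt I 𝓘(ℝ, 𝔼) ∞ β t₀)
    (h : ∀ᶠ t in 𝓝 t₀, (𝛑 (α t)) = 𝛑 (β t)) :
    ContMDiffAt I (𝓡 1) ∞ (fun t => phase (χ.ratio (α t) (β t))) t₀ := by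
  have h1 := χ.contMDiffAt_ratio hα hβ h
  have h2 : ContMDiffAt I 𝓘(ℝ, ℂ) ∞ (fun t => χ.ratio (α t) (β t)) t₀ := by
    rw [contMDiffAt_iff_target]
    exact ⟨Units.isEmbedding_val₀.isInducing.continuousAt_iff.2 h1.continuousAt, h1⟩
  exact contMDiff_phase.contMDiffAt.comp t₀ h2
end Smooth

lemma LocalSection.contMDiffAt (s : LocalSection 𝔼 E P) {x : Gc ⧸ P} (hx : x ∈ s.U) :
    ContMDiffAt 𝓘(ℝ, E) 𝓘(ℝ, 𝔼) ∞ s.s x :=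
  (contMDiffOn_real_of_complex s.holomorphic).contMDiffAt (s.isOpen.mem_nhds hx)

namespace CircleBundle

lemma fiberCoord_eq (s : LocalSection 𝔼 E P) (p : CircleBundle E χ) : fiberCoord s p =
    phase (χ.ratio (s.s p.proj) ((𝐬 p.proj).s p.proj)) * p.coord := rfl

lemma fiberCoord_change {s s' : LocalSection 𝔼 E P} {p : CircleBundle E χ} (h : p.proj ∈ s.U)
    (h' : p.proj ∈ s'.U) : fiberCoord s' p =
      phase (χ.ratio (s'.s p.proj) (s.s p.proj)) * fiberCoord s p := by
  rw [fiberCoord_eq, fiberCoord_eq, ← mul_assoc, ← map_mul, χ.ratio_mul]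
  · rw [s.mk_s _ h, s'.mk_s _ h']
  · rw [s.mk_s _ h, LocalSection.mk_s _ _ (mem_sectionAt _)]

lemma ext_of_fiberCoord {s : LocalSection 𝔼 E P} {p q : CircleBundle E χ} (hp : p.proj ∈ s.U)
    (h : p.proj = q.proj) (h' : fiberCoord s p = fiberCoord s q) : p = q :=
  ((circleCore E χ).localTriv s).injOn (((circleCore E χ).mem_localTriv_source s p).2 hp)
    (((circleCore E χ).mem_localTriv_source s q).2 (by rw [h] at hp; exact hp)) (Prod.ext h h')

variable (E χ) in
/-- The point `[g, z]` of `Q(L) = Gc ×_P U(1)`. -/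
def point (g : Gc) (z : Circle) : CircleBundle E χ :=
  ⟨𝛑 g, phase (χ.ratio ((𝐬 (𝛑 g)).s (𝛑 g)) g) * z⟩

lemma fiberCoord_point {s : LocalSection 𝔼 E P} {g : Gc} (h : 𝛑 g ∈ s.U)
    (z : Circle) : fiberCoord s (point E χ g z) = phase (χ.ratio (s.s (𝛑 g)) g) * z := by
  rw [fiberCoord_eq]
  change phase (χ.ratio (s.s (𝛑 g)) ((𝐬 (𝛑 g)).s
    (𝛑 g))) * (phase (χ.ratio _ g) * z) = _
  rw [← mul_assoc, ← map_mul, χ.ratio_mul]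
  · rw [s.mk_s _ h, LocalSection.mk_s _ _ (mem_sectionAt _)]
  · rw [LocalSection.mk_s _ _ (mem_sectionAt _)]

lemma eq_point (h : p.proj ∈ s.U) : p = point E χ (s.s p.proj) (fiberCoord s p) := by
  have e : (𝛑 (s.s p.proj)) = p.proj := s.mk_s _ h
  refine ext_of_fiberCoord h e.symm ?_
  rw [fiberCoord_point (by rw [e]; exact h), e, χ.ratio_self, map_one, one_mul]

lemma translate_point (h g : Gc) (z : Circle) :
    translate h (point E χ g z) = point E χ (h * g) z := by
  refine congrArg (fun a : Circle => (⟨𝛑 (h * g), a⟩ : CircleBundle E χ)) ?_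
  change phase (χ.ratio ((𝐬 (𝛑 (h * g))).s (𝛑 (h * g)))
    (h * (𝐬 (𝛑 g)).s (𝛑 g))) * (phase (χ.ratio _ g) * z) = _
  have e : (𝛑 ((𝐬 (𝛑 g)).s (𝛑 g)) :
      Gc ⧸ P) = 𝛑 g := LocalSection.mk_s _ _ (mem_sectionAt _)
  rw [← mul_assoc, ← map_mul, ← χ.ratio_mul_left h _ g, χ.ratio_mul]
  · refine (LocalSection.mk_s _ _ (mem_sectionAt _)).trans ?_
    change h • 𝛑 g = h • 𝛑 _
    rw [e]
  · change h • 𝛑 _ = h • 𝛑 g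
    rw [e]

lemma point_mul (g : Gc) (p : P) (z : Circle) :
    point E χ (g * p) z = point E χ g (phase (χ.toHom p) * z) := by
  have e : (𝛑 (g * p)) = 𝛑 g := QuotientGroup.mk_mul_of_mem g p.2
  have hs := mem_sectionAt (𝔼 := 𝔼) (E := E) (𝛑 g)
  refine ext_of_fiberCoord (s := 𝐬 (𝛑 g)) (by
    change (𝛑 (g * p)) ∈ _; rw [e]; exact hs) e ?_
  rw [fiberCoord_point (by rw [e]; exact hs), fiberCoord_point hs, e, ← mul_assoc, ← map_mul,
    ← χ.ratio_mul (h := g) (k := g * p) (by rw [LocalSection.mk_s _ _ hs]) e.symm,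
    χ.ratio_eq e.symm]
  refine congrArg (fun q : P => phase (χ.ratio _ g * χ.toHom q) * z) (Subtype.ext ?_)
  exact inv_mul_cancel_left g p

lemma eq_translate_point (p : CircleBundle E χ) : ∃ g z, p = point E χ g z :=
  ⟨_, _, eq_point (mem_sectionAt p.proj)⟩

lemma translate_one (p : CircleBundle E χ) : translate (1 : Gc) p = p := by
  obtain ⟨g, z, rfl⟩ := eq_translate_point p
  rw [translate_point, one_mul]

lemma translate_mul (h k : Gc) (p : CircleBundle E χ) :
    translate (h * k) p = translate h (translate k p) := by
  obtain ⟨g, z, rfl⟩ := eq_translate_point p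
  rw [translate_point, translate_point, translate_point, mul_assoc]

lemma fiberCoord_rotate (s : LocalSection 𝔼 E P) (p : CircleBundle E χ) (z : Circle) :
    fiberCoord s (p.rotate z) = fiberCoord s p * z := by
  rw [fiberCoord_eq, fiberCoord_eq, mul_assoc]
  rfl

lemma continuous_proj : Continuous fun p : CircleBundle E χ => p.proj :=
  FiberBundle.continuous_proj Circle (circleCore E χ).Fiber

lemma continuousAt_fiberCoord (h : p.proj ∈ s.U) : ContinuousAt (fiberCoord s) p :=
  continuous_snd.continuousAt.comp (((circleCore E χ).localTriv s).continuousAt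
    (((circleCore E χ).mem_localTriv_source s p).2 h))

lemma continuousAt_iff {T : Type*} [TopologicalSpace T] {f : T → CircleBundle E χ} {t : T}
    {s : LocalSection 𝔼 E P} (h : (f t).proj ∈ s.U) : ContinuousAt f t ↔
      ContinuousAt (fun t => (f t).proj) t ∧ ContinuousAt (fun t => fiberCoord s (f t)) t := by
  refine ⟨fun hf => ⟨continuous_proj.continuousAt.comp hf,
    (continuousAt_fiberCoord h).comp hf⟩, fun hf => ?_⟩
  have hs := ((circleCore E χ).mem_localTriv_source s (f t)).2 h
  refine (((circleCore E χ).localTriv s).toOpenPartialHomeomorph.continuousAt_iff_continuousAt_comp_left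
    ?_).2 (hf.1.prodMk hf.2)
  filter_upwards [hf.1.preimage_mem_nhds (s.isOpen.mem_nhds h)] with t' ht'
  exact ((circleCore E χ).mem_localTriv_source s (f t')).2 ht'

lemma mem_extChartAt_target {p : CircleBundle E χ} {y : CircleModel E} :
    y ∈ (𝐞 p).target ↔ (y.1 ∈ (𝐱 p.proj).target ∧
      (𝐱 p.proj).symm y.1 ∈ (𝐬 p.proj).U) ∧
      y.2 ∈ (extChartAt (𝓡 1) (fiberCoord (𝐬 p.proj) p)).target := by
  rw [extChartAt_target, extChartAt_target, extChartAt_target]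
  have e := (circleCore E χ).mem_localTriv_target (𝐬 p.proj)
    ((𝐱 p.proj).symm y.1, (extChartAt (𝓡 1) (fiberCoord (𝐬 p.proj) p)).symm y.2)
  refine ⟨fun h => ⟨⟨⟨h.1.1.1, mem_range_self y.1⟩, e.1 h.1.2⟩, h.1.1.2, mem_range_self y.2⟩,
    fun h => ?_⟩
  exact ⟨⟨⟨h.1.1.1, h.2.1⟩, e.2 h.1.2⟩, mem_range_self y⟩

lemma fiberCoord_extChartAt_symm {p : CircleBundle E χ} {y : CircleModel E}
    (hy : (𝐱 p.proj).symm y.1 ∈ (𝐬 p.proj).U) :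
    fiberCoord (𝐬 p.proj) ((𝐞 p).symm y)
      = (extChartAt (𝓡 1) (fiberCoord (𝐬 p.proj) p)).symm y.2 := by
  exact congrArg Prod.snd (((circleCore E χ).localTriv (𝐬 p.proj)).right_inv
    (((circleCore E χ).mem_localTriv_target _ ((𝐱 p.proj).symm y.1,
      (extChartAt (𝓡 1) (fiberCoord (𝐬 p.proj) p)).symm y.2)).2 hy))

section Smooth
variable {F : Type*} [NormedAddCommGroup F] [NormedSpace ℝ F] {H : Type*} [TopologicalSpace H]
  {I : ModelWithCorners ℝ F H} {T : Type*} [TopologicalSpace T] [ChartedSpace H T]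

lemma contMDiff_proj :
    ContMDiff 𝐈 𝓘(ℝ, E) ∞ (fun p : CircleBundle E χ => p.proj) := fun p => by
  refine contMDiffAt_iff_target.2 ⟨continuous_proj.continuousAt, ?_⟩
  exact (contDiff_fst.contMDiff (𝕜 := ℝ) _).comp p (contMDiffAt_extChartAt (I := 𝐈) (n := ∞) (x := p))

lemma contMDiffAt_fiberCoord (h : p.proj ∈ s.U) : ContMDiffAt 𝐈 (𝓡 1) ∞ (fiberCoord s) p := by
  have : LieGroup 𝓘(ℝ, 𝔼) ∞ Gc := lieGroup_real_of_complex
  set s₀ := 𝐬 p.proj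
  have h0 : p.proj ∈ s₀.U := mem_sectionAt _
  have h1 : ContMDiffAt 𝐈 (𝓡 1) ∞ (fiberCoord s₀ : CircleBundle E χ → _) p := by
    refine contMDiffAt_iff_target.2 ⟨continuousAt_fiberCoord h0, ?_⟩
    exact (contDiff_snd.contMDiff (𝕜 := ℝ) _).comp p
      (contMDiffAt_extChartAt (I := 𝐈) (n := ∞) (x := p))
  have hev : ∀ {s' : LocalSection 𝔼 E P}, p.proj ∈ s'.U →
      ∀ᶠ q : CircleBundle E χ in 𝓝 p, q.proj ∈ s'.U := fun {s'} hs' =>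
    continuous_proj.continuousAt.preimage_mem_nhds (s'.isOpen.mem_nhds hs')
  have h2 : ContMDiffAt 𝐈 (𝓡 1) ∞ (fun q : CircleBundle E χ =>
      phase (χ.ratio (s.s q.proj) (s₀.s q.proj)) * fiberCoord s₀ q) p := by
    refine ContMDiffAt.mul (χ.contMDiffAt_phase_ratio ((s.contMDiffAt h).comp p (contMDiff_proj p))
      ((s₀.contMDiffAt h0).comp p (contMDiff_proj p)) ?_) h1
    filter_upwards [hev h, hev h0] with q hq hq0
    exact (s.mk_s _ hq).trans (s₀.mk_s _ hq0).symm
  refine h2.congr_of_eventuallyEq ?_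
  filter_upwards [hev h, hev h0] with q hq hq0 using fiberCoord_change hq0 hq

lemma contMDiffAt_of_coord {f : T → CircleBundle E χ} {t : T} {s : LocalSection 𝔼 E P}
    (h : (f t).proj ∈ s.U) (h1 : ContMDiffAt I 𝓘(ℝ, E) ∞ (fun t => (f t).proj) t)
    (h2 : ContMDiffAt I (𝓡 1) ∞ (fun t => fiberCoord s (f t)) t) :
    ContMDiffAt I 𝐈 ∞ f t := by
  have : LieGroup 𝓘(ℝ, 𝔼) ∞ Gc := lieGroup_real_of_complex
  set s₀ := 𝐬 (f t).proj
  have h0 : (f t).proj ∈ s₀.U := mem_sectionAt _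
  have hc : ContinuousAt f t := (continuousAt_iff h).2 ⟨h1.continuousAt, h2.continuousAt⟩
  have hev : ∀ {s' : LocalSection 𝔼 E P}, (f t).proj ∈ s'.U →
      ∀ᶠ t' in 𝓝 t, (f t').proj ∈ s'.U := fun {s'} hs' =>
    h1.continuousAt.preimage_mem_nhds (s'.isOpen.mem_nhds hs')
  have h3 : ContMDiffAt I (𝓡 1) ∞ (fun t => fiberCoord s₀ (f t)) t := by
    have h4 : ContMDiffAt I (𝓡 1) ∞ (fun t =>
        phase (χ.ratio (s₀.s (f t).proj) (s.s (f t).proj)) * fiberCoord s (f t)) t := by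
      refine ContMDiffAt.mul (χ.contMDiffAt_phase_ratio ((s₀.contMDiffAt h0).comp t h1)
        ((s.contMDiffAt h).comp t h1) ?_) h2
      filter_upwards [hev h, hev h0] with q hq hq0
      exact (s₀.mk_s _ hq0).trans (s.mk_s _ hq).symm
    refine h4.congr_of_eventuallyEq ?_
    filter_upwards [hev h, hev h0] with q hq hq0 using fiberCoord_change hq hq0
  refine contMDiffAt_iff_target.2 ⟨hc, ?_⟩
  have h4 := (contMDiffAt_iff_target.1 h1).2
  have h5 := (contMDiffAt_iff_target.1 h3).2
  exact h4.prodMk_space h5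

lemma contMDiffAt_point {α : T → Gc} {z : T → Circle} {t : T}
    (hα : ContMDiffAt I 𝓘(ℝ, 𝔼) ∞ α t) (hz : ContMDiffAt I (𝓡 1) ∞ z t) :
    ContMDiffAt I 𝐈 ∞ (fun t => point E χ (α t) (z t)) t := by
  have : LieGroup 𝓘(ℝ, 𝔼) ∞ Gc := lieGroup_real_of_complex
  set s := 𝐬 (𝛑 (α t))
  have h0 : (𝛑 (α t)) ∈ s.U := mem_sectionAt _
  have hmk : ContMDiff 𝓘(ℝ, 𝔼) 𝓘(ℝ, E) ∞ 𝛑 := by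
    rw [← contMDiffOn_univ]
    exact contMDiffOn_real_of_complex hq.contMDiff_mk.contMDiffOn
  have h1 := (hmk (α t)).comp t hα
  have hev : ∀ᶠ t' in 𝓝 t, (𝛑 (α t')) ∈ s.U :=
    h1.continuousAt.preimage_mem_nhds (s.isOpen.mem_nhds h0)
  refine contMDiffAt_of_coord (s := s) h0 h1 ?_
  have h2 : ContMDiffAt I (𝓡 1) ∞ (fun t =>
      phase (χ.ratio (s.s (𝛑 (α t))) (α t)) * z t) t := by
    refine ContMDiffAt.mul (χ.contMDiffAt_phase_ratio ((s.contMDiffAt h0).comp t h1) hα ?_) hz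
    filter_upwards [hev] with t' ht' using s.mk_s _ ht'
  refine h2.congr_of_eventuallyEq ?_
  filter_upwards [hev] with t' ht' using fiberCoord_point ht' _

lemma contMDiffAt_translate {α : T → Gc} {f : T → CircleBundle E χ} {t : T}
    (hα : ContMDiffAt I 𝓘(ℝ, 𝔼) ∞ α t) (hf : ContMDiffAt I 𝐈 ∞ f t) :
    ContMDiffAt I 𝐈 ∞ (fun t => translate (α t) (f t)) t := by
  have : LieGroup 𝓘(ℝ, 𝔼) ∞ Gc := lieGroup_real_of_complex
  set s := 𝐬 (f t).proj
  have h0 : (f t).proj ∈ s.U := mem_sectionAt _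
  have h1 := (contMDiff_proj (χ := χ) (f t)).comp t hf
  have h2 : ContMDiffAt I 𝐈 ∞ (fun t =>
      point E χ (α t * s.s (f t).proj) (fiberCoord s (f t))) t :=
    contMDiffAt_point (hα.mul ((s.contMDiffAt h0).comp t h1)) ((contMDiffAt_fiberCoord h0).comp t hf)
  refine h2.congr_of_eventuallyEq ?_
  filter_upwards [h1.continuousAt.preimage_mem_nhds (s.isOpen.mem_nhds h0)] with t' ht'
  rw [← translate_point, ← eq_point ht']

end Smooth

end CircleBundle

/-! ### Powers of the fibre coordinate -/

lemma contMDiff_coe_circle : ContMDiff (𝓡 1) 𝓘(ℝ, ℂ) ∞ (fun z : Circle => (z : ℂ)) :=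
  have : Fact (finrank ℝ ℂ = 1 + 1) := ⟨Complex.finrank_real_complex⟩
  contMDiff_coe_sphere

lemma contMDiffAt_arg {z : Circle} (hz : (z : ℂ) ∈ Complex.slitPlane) :
    ContMDiffAt (𝓡 1) 𝓘(ℝ, ℝ) ∞ (fun w : Circle => Complex.arg w) z := by
  have h1 : ContDiffAt ℝ ∞ Complex.arg (z : ℂ) := by
    have := Complex.imCLM.contDiff.contDiffAt.comp (z : ℂ)
      ((Complex.contDiffAt_log (n := ∞) hz).restrict_scalars ℝ)
    refine this.congr_of_eventuallyEq (Filter.Eventually.of_forall fun w => ?_)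
    exact (Complex.log_im w).symm
  exact h1.contMDiffAt.comp z (contMDiff_coe_circle z)

/-- The principal branch of the `ℓ`-th root on the circle. -/
def circleRoot (ℓ : ℕ) (z : Circle) : Circle := Circle.exp (Complex.arg z / ℓ)

lemma circleRoot_pow {ℓ : ℕ} (hℓ : 0 < ℓ) (z : Circle) : circleRoot ℓ z ^ ℓ = z := by
  have : (ℓ : ℝ) ≠ 0 := Nat.cast_ne_zero.2 hℓ.ne'
  rw [circleRoot, ← Circle.exp_nsmul, nsmul_eq_mul, mul_div_cancel₀ _ this, Circle.exp_arg]

lemma contMDiffAt_circleRoot (ℓ : ℕ) {z : Circle} (hz : (z : ℂ) ∈ Complex.slitPlane) :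
    ContMDiffAt (𝓡 1) (𝓡 1) ∞ (circleRoot ℓ) z := by
  have h1 : ContDiff ℝ ∞ fun t : ℝ => t / ℓ := by fun_prop
  exact (contMDiff_circleExp (m := ∞) _).comp z ((h1.contMDiff _).comp z (contMDiffAt_arg hz))

lemma circleRoot_of_abs_arg_lt {ℓ : ℕ} (hℓ : 0 < ℓ) {z : Circle}
    (hz : |Complex.arg z| < Real.pi / ℓ) :
    ((z ^ ℓ : Circle) : ℂ) ∈ Complex.slitPlane ∧ circleRoot ℓ (z ^ ℓ) = z := by
  have h0 : (0 : ℝ) < ℓ := Nat.cast_pos.2 hℓ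
  have h1 : |ℓ * Complex.arg z| < Real.pi := by
    rw [abs_mul, abs_of_pos h0, mul_comm]
    exact (lt_div_iff₀ h0).1 hz
  have h2 : z ^ ℓ = Circle.exp (ℓ * Complex.arg z) := by
    rw [← nsmul_eq_mul, Circle.exp_nsmul, Circle.exp_arg]
  have h3 : Complex.arg (z ^ ℓ : Circle) = ℓ * Complex.arg z := by
    rw [h2, Circle.arg_exp (abs_lt.1 h1).1 (abs_lt.1 h1).2.le]
  refine ⟨Complex.mem_slitPlane_iff_arg.2 ⟨?_, Circle.coe_ne_zero _⟩, ?_⟩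
  · rw [h3]
    exact (abs_lt.1 h1).2.ne
  · rw [circleRoot, h3, mul_div_cancel_left₀ _ h0.ne', Circle.exp_arg]

lemma abs_arg_circleRoot_lt {ℓ : ℕ} (hℓ : 0 < ℓ) {z : Circle}
    (hz : (z : ℂ) ∈ Complex.slitPlane) : |Complex.arg (circleRoot ℓ z)| < Real.pi / ℓ := by
  have h0 : (1 : ℝ) ≤ ℓ := Nat.one_le_cast.2 hℓ
  have h0' : (0 : ℝ) < ℓ := by linarith
  have h1 : |Complex.arg z| < Real.pi := by
    refine lt_of_le_of_ne (Complex.abs_arg_le_pi _) fun h => ?_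
    rcases abs_choice (Complex.arg z) with h' | h'
    · exact (Complex.mem_slitPlane_iff_arg.1 hz).1 (h'.symm.trans h)
    · have := Complex.neg_pi_lt_arg z
      linarith
  have h2 : |Complex.arg z / ℓ| < Real.pi / ℓ := by
    rw [abs_div, abs_of_pos h0']
    exact div_lt_div_of_pos_right h1 h0'
  have h3 : |Complex.arg z / ℓ| < Real.pi := h2.trans_le (div_le_self Real.pi_pos.le h0)
  rwa [circleRoot, Circle.arg_exp (abs_lt.1 h3).1 (abs_lt.1 h3).2.le]

lemma isOpen_abs_arg_lt {ℓ : ℕ} (hℓ : 0 < ℓ) (a : Circle) :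
    IsOpen {z : Circle | |Complex.arg (a⁻¹ * z : Circle)| < Real.pi / ℓ} := by
  rw [isOpen_iff_mem_nhds]
  intro z hz
  have h1 : ((a⁻¹ * z : Circle) : ℂ) ∈ Complex.slitPlane := by
    refine Complex.mem_slitPlane_iff_arg.2 ⟨fun h => ?_, Circle.coe_ne_zero _⟩
    have h2 : |Complex.arg (a⁻¹ * z : Circle)| < Real.pi / ℓ := hz
    rw [h, abs_of_pos Real.pi_pos] at h2
    exact absurd h2 (not_lt.2 (div_le_self Real.pi_pos.le (Nat.one_le_cast.2 hℓ)))
  have h2 : ContinuousAt (fun z : Circle => |Complex.arg (a⁻¹ * z : Circle)|) z :=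
    (ContinuousAt.comp (g := Complex.arg) (f := fun z : Circle => ((a⁻¹ * z : Circle) : ℂ))
      (Complex.continuousAt_arg h1)
      (contMDiff_coe_circle.continuous.comp (continuous_const_mul a⁻¹)).continuousAt).abs
  exact h2.eventually_lt_const hz

lemma HolomorphicCharacter.ratio_pow (χ : HolomorphicCharacter 𝔼 P) (ℓ : ℕ) (g h : Gc) :
    (χ.pow ℓ).ratio g h = χ.ratio g h ^ ℓ := by
  unfold ratio
  split_ifs
  · rfl
  · rw [one_pow]

namespace CircleBundle

lemma fiberCoord_powMap (ℓ : ℕ) (s : LocalSection 𝔼 E P) (p : CircleBundle E χ) :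
    fiberCoord s (powMap ℓ p) = fiberCoord s p ^ ℓ := by
  rw [fiberCoord_eq, fiberCoord_eq, χ.ratio_pow, map_pow, mul_pow]
  rfl

lemma powMap_surjective {ℓ : ℕ} (hℓ : 0 < ℓ) :
    Function.Surjective (powMap ℓ : CircleBundle E χ → CircleBundle E (χ.pow ℓ)) := fun q =>
  ⟨⟨q.proj, circleRoot ℓ q.coord⟩, congrArg (TotalSpace.mk q.proj) (circleRoot_pow hℓ q.coord)⟩

lemma powMap_eq_iff (ℓ : ℕ) (p q : CircleBundle E χ) : powMap ℓ p = powMap ℓ q ↔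
    ∃ z : Circle, z ^ ℓ = 1 ∧ q = p.rotate z := by
  constructor
  · intro h
    have h1 : p.proj = q.proj := (congrArg (fun r : CircleBundle E (χ.pow ℓ) => r.proj) h :)
    obtain ⟨x, a⟩ := p
    obtain ⟨y, c⟩ := q
    obtain rfl : x = y := h1
    let a : Circle := a
    let c : Circle := c
    have h2 : a ^ ℓ = c ^ ℓ := TotalSpace.mk_injective x h
    refine ⟨a⁻¹ * c, ?_, ?_⟩
    · rw [mul_pow, inv_pow, h2, inv_mul_cancel]
    · exact congrArg (TotalSpace.mk x) (mul_inv_cancel_left a c).symm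
  · rintro ⟨z, hz, rfl⟩
    refine congrArg (TotalSpace.mk p.proj) ?_
    change p.coord ^ ℓ = (p.coord * z) ^ ℓ
    rw [mul_pow, hz, mul_one]

lemma isOpen_coord (s : LocalSection 𝔼 E P) {S : Set Circle} (hS : IsOpen S) :
    IsOpen {p : CircleBundle E χ | p.proj ∈ s.U ∧ fiberCoord s p ∈ S} := by
  rw [isOpen_iff_mem_nhds]
  intro p hp
  filter_upwards [continuous_proj.continuousAt.preimage_mem_nhds (s.isOpen.mem_nhds hp.1),
    (continuousAt_fiberCoord hp.1).preimage_mem_nhds (hS.mem_nhds hp.2)] with q h1 h2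
  exact ⟨h1, h2⟩

lemma contMDiffAt_mk_fiberCoord {χ' : HolomorphicCharacter 𝔼 P} {s : LocalSection 𝔼 E P}
    {p : CircleBundle E χ} (hp : p.proj ∈ s.U) {r : Circle → Circle}
    (hr : ContMDiffAt (𝓡 1) (𝓡 1) ∞ r (fiberCoord s p)) :
    ContMDiffAt 𝐈 𝐈 ∞
      (fun q : CircleBundle E χ => point E χ' (s.s q.proj) (r (fiberCoord s q))) p :=
  contMDiffAt_point ((s.contMDiffAt hp).comp p (contMDiff_proj p))
    (hr.comp p (contMDiffAt_fiberCoord hp))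

lemma proj_point_section {s : LocalSection 𝔼 E P} {x : Gc ⧸ P} (hx : x ∈ s.U) (z : Circle) :
    (point E χ (s.s x) z).proj = x := s.mk_s x hx

lemma fiberCoord_point_section {s : LocalSection 𝔼 E P} {x : Gc ⧸ P} (hx : x ∈ s.U) (z : Circle) :
    fiberCoord s (point E χ (s.s x) z) = z := by
  rw [fiberCoord_point (by rw [s.mk_s x hx]; exact hx), s.mk_s x hx, χ.ratio_self, map_one, one_mul]

/-- Local inverses are given by the branches of the `ℓ`-th root on the circle. -/
lemma isLocalDiffeomorph_powMap {ℓ : ℕ} (hℓ : 0 < ℓ) :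
    IsLocalDiffeomorph 𝐈 𝐈 ∞ (powMap ℓ : CircleBundle E χ → CircleBundle E (χ.pow ℓ)) := by
  intro p
  set s := 𝐬 p.proj
  have hs : p.proj ∈ s.U := mem_sectionAt _
  set a := fiberCoord s p with ha
  -- the branch of the `ℓ`-th root near `a ^ ℓ` with value `a`
  let r : Circle → Circle := fun z => a * circleRoot ℓ ((a ^ ℓ)⁻¹ * z)
  have hmem : ∀ q : CircleBundle E χ, q.proj ∈ s.U →
      |Complex.arg (a⁻¹ * fiberCoord s q : Circle)| < Real.pi / ℓ →
      (((a ^ ℓ)⁻¹ * fiberCoord s q ^ ℓ : Circle) : ℂ) ∈ Complex.slitPlane ∧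
        r (fiberCoord s q ^ ℓ) = fiberCoord s q := by
    intro q hq hq'
    obtain ⟨h1, h2⟩ := circleRoot_of_abs_arg_lt hℓ hq'
    have e : (a⁻¹ * fiberCoord s q) ^ ℓ = (a ^ ℓ)⁻¹ * fiberCoord s q ^ ℓ := by rw [mul_pow, inv_pow]
    rw [e] at h1 h2
    refine ⟨h1, ?_⟩
    change a * _ = _
    rw [h2, mul_inv_cancel_left]
  refine ⟨{
    toFun := powMap ℓ
    invFun := fun q => point E χ (s.s q.proj) (r (fiberCoord s q))
    source := {q | q.proj ∈ s.U ∧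
      fiberCoord s q ∈ {z : Circle | |Complex.arg (a⁻¹ * z : Circle)| < Real.pi / ℓ}}
    target := {q | q.proj ∈ s.U ∧
      fiberCoord s q ∈ {z : Circle | (((a ^ ℓ)⁻¹ * z : Circle) : ℂ) ∈ Complex.slitPlane}}
    map_source' := fun q hq => ⟨hq.1, by
      rw [fiberCoord_powMap]
      exact (hmem q hq.1 hq.2).1⟩
    map_target' := fun q hq => ⟨by rw [proj_point_section hq.1]; exact hq.1, by
      rw [fiberCoord_point_section hq.1]
      change |Complex.arg (a⁻¹ * (a * _) : Circle)| < _
      rw [inv_mul_cancel_left]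
      exact abs_arg_circleRoot_lt hℓ hq.2⟩
    left_inv' := fun q hq => by
      rw [fiberCoord_powMap, (hmem q hq.1 hq.2).2]
      exact (eq_point hq.1).symm
    right_inv' := fun q hq => by
      have e : q.proj = (powMap ℓ (point E χ (s.s q.proj) (r (fiberCoord s q)))).proj :=
        (proj_point_section (χ := χ) hq.1 (r (fiberCoord s q))).symm
      refine (ext_of_fiberCoord (s := s) hq.1 e ?_).symm
      rw [fiberCoord_powMap, fiberCoord_point_section hq.1]
      change _ = (a * _) ^ ℓ
      rw [mul_pow, circleRoot_pow hℓ, mul_inv_cancel_left]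
    open_source := isOpen_coord s (isOpen_abs_arg_lt hℓ a)
    open_target := isOpen_coord s (Complex.isOpen_slitPlane.preimage
      (contMDiff_coe_circle.continuous.comp (continuous_const_mul _)))
    contMDiffOn_toFun := fun q hq => by
      refine ContMDiffAt.contMDiffWithinAt ?_
      refine contMDiffAt_of_coord (s := s) hq.1 (contMDiff_proj q) ?_
      have h1 : (fun q : CircleBundle E χ => fiberCoord s (powMap ℓ q))
          = fun q => fiberCoord s q ^ ℓ := funext fun q => fiberCoord_powMap ℓ s q
      rw [h1]
      exact (contMDiffAt_fiberCoord hq.1).pow ℓ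
    contMDiffOn_invFun := fun q hq => by
      refine (contMDiffAt_mk_fiberCoord hq.1 ?_).contMDiffWithinAt
      exact contMDiffAt_const.mul ((contMDiffAt_circleRoot ℓ hq.2).comp (fiberCoord s q)
        (contMDiffAt_const.mul contMDiffAt_id)) }, ⟨hs, ?_⟩, fun q _ => rfl⟩
  change |Complex.arg (a⁻¹ * a : Circle)| < _
  rw [inv_mul_cancel, Circle.coe_one, Complex.arg_one, abs_zero]
  exact div_pos Real.pi_pos (Nat.cast_pos.2 hℓ)

lemma t2Space [T2Space (Gc ⧸ P)] : T2Space (CircleBundle E χ) := by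
  refine ⟨fun p q hpq => ?_⟩
  by_cases h : p.proj = q.proj
  · set s := 𝐬 p.proj
    have hs : p.proj ∈ s.U := mem_sectionAt _
    obtain ⟨A, B, hA, hB, hpA, hqB, hAB⟩ := t2_separation fun h' => hpq (ext_of_fiberCoord hs h h')
    refine ⟨_, _, isOpen_coord s hA, isOpen_coord s hB, ⟨hs, hpA⟩, ⟨by rw [← h]; exact hs, hqB⟩, ?_⟩
    exact Set.disjoint_left.2 fun r h1 h2 => Set.disjoint_left.1 hAB h1.2 h2.2
  · obtain ⟨A, B, hA, hB, hpA, hqB, hAB⟩ := t2_separation h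
    exact ⟨_, _, hA.preimage continuous_proj, hB.preimage continuous_proj, hpA, hqB, hAB.preimage _⟩

end CircleBundle

/-! ### Transitivity of the compact group -/

namespace IsFlagModel
variable {k : ℕ}
include hm

lemma t2Space_quotient : T2Space (Gc ⧸ P) := by
  have : IsTopologicalGroup Gc := topologicalGroup_of_lieGroup 𝓘(ℂ, 𝔼) ω
  have hR : Continuous fun g => R g v := hm.contMDiff.continuous.clm_apply continuous_const
  have hc : IsClosed {p : Gc × Gc | p.1⁻¹ * p.2 ∈ P} := by
    have h1 : IsClosed ((ℂ ∙ v : Submodule ℂ V) : Set V) := Submodule.closed_of_finiteDimensional _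
    have h2 := h1.preimage (hR.comp (continuous_fst.inv.mul continuous_snd))
    convert h2 using 1
    ext p
    rw [mem_ofPred_eq, hm.mem_iff, mem_preimage, SetLike.mem_coe, Submodule.mem_span_singleton]
    exact exists_congr fun c => eq_comm
  refine (t2Space_iff_of_isOpenQuotientMap (QuotientGroup.isOpenQuotientMap_mk)).2 ?_
  convert hc using 1
  ext p
  exact QuotientGroup.eq

include hG hu

lemma exists_translate_eq [PreconnectedSpace Gc] (hχ : χ.IsCanonicalRoot (E := E) k) {ℓ : ℕ}
    (hℓ : 0 < ℓ) (p q : CircleBundle E (χ.pow ℓ)) :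
    ∃ a : G, CircleBundle.translate (ι a) p = q := by
  obtain ⟨g, z, rfl⟩ := CircleBundle.eq_translate_point p
  obtain ⟨h, w, rfl⟩ := CircleBundle.eq_translate_point q
  obtain ⟨a, ha⟩ := hm.exists_mk_incl_mul hG hu g h
  obtain ⟨c, hc, hc'⟩ := hm.exists_phase_eq hG hu hχ hℓ (ι a * g)
    (phase ((χ.pow ℓ).toHom ⟨_, QuotientGroup.eq.1 ha.symm⟩) * w * z⁻¹)
  refine ⟨c * a, ?_⟩
  rw [CircleBundle.translate_point, _root_.map_mul ι]
  have e1 : ι c * ι a * g = ι a * g * (⟨_, hc⟩ : P) := by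
    change _ = ι a * g * ((ι a * g)⁻¹ * ι c * (ι a * g))
    group
  have e2 : h = ι a * g * (⟨_, QuotientGroup.eq.1 ha.symm⟩ : P) := by
    change _ = ι a * g * ((ι a * g)⁻¹ * h)
    group
  rw [e1, CircleBundle.point_mul, hc']
  conv_rhs => rw [e2, CircleBundle.point_mul]
  rw [inv_mul_cancel_right]

omit hm hu in
lemma contMDiff_incl_translate (p : CircleBundle E χ) :
    ContMDiff (𝓡 d) 𝐈 ∞ fun a : G => CircleBundle.translate (ι a) p :=
  fun a => CircleBundle.contMDiffAt_translate (hG.smooth a) contMDiffAt_const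

/-- The circle bundle is an orbit of the compact form. -/
lemma compactSpace_circleBundle [PreconnectedSpace Gc] (hχ : χ.IsCanonicalRoot (E := E) k)
    {ℓ : ℕ} (hℓ : 0 < ℓ) : CompactSpace (CircleBundle E (χ.pow ℓ)) := by
  have := hG.compact
  have h1 := isCompact_range (contMDiff_incl_translate hG (CircleBundle.point E (χ.pow ℓ) 1 1)).continuous
  rw [Function.Surjective.range_eq (hm.exists_translate_eq hG hu hχ hℓ _)] at h1
  exact ⟨h1⟩

lemma connectedSpace_circleBundle [PreconnectedSpace Gc] (hχ : χ.IsCanonicalRoot (E := E) k)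
    {ℓ : ℕ} (hℓ : 0 < ℓ) : ConnectedSpace (CircleBundle E (χ.pow ℓ)) := by
  have := hG.connected
  have h1 := isPreconnected_range
    (contMDiff_incl_translate hG (CircleBundle.point E (χ.pow ℓ) 1 1)).continuous
  rw [Function.Surjective.range_eq (hm.exists_translate_eq hG hu hχ hℓ _)] at h1
  exact { isPreconnected_univ := h1, toNonempty := ⟨CircleBundle.point E (χ.pow ℓ) 1 1⟩ }

end IsFlagModel

/-! ### The invariant Kähler metric of the flag manifold -/

/-- The differential at `x` of the translation by `g`. -/
def smulDeriv (g : Gc) (x : Gc ⧸ P) : E →L[ℂ] E :=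
  mfderiv 𝓘(ℂ, E) 𝓘(ℂ, E) (fun z : Gc ⧸ P => g • z) x

include hq in
variable (𝔼) in
lemma hasMFDerivAt_smul (g : Gc) (x : Gc ⧸ P) : HasMFDerivAt 𝓘(ℂ, E) 𝓘(ℂ, E)
    (fun z : Gc ⧸ P => g • z) x (smulDeriv g x : E →L[ℂ] E) :=
  ((contMDiff_smul_quotient 𝔼 E g).mdifferentiableAt (by simp)).hasMFDerivAt

include hq in
variable (𝔼) in
lemma smulDeriv_mul (g h : Gc) (x : Gc ⧸ P) : smulDeriv (E := E) (g * h) x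
    = (smulDeriv (E := E) g (h • x)) ∘L (smulDeriv (E := E) h x) := by
  have h1 := HasMFDerivAt.comp x (hasMFDerivAt_smul 𝔼 (E := E) g (h • x))
    (hasMFDerivAt_smul 𝔼 (E := E) h x)
  have e : (fun z : Gc ⧸ P => (g * h) • z) = (fun z => g • z) ∘ fun z => h • z :=
    funext fun z => mul_smul g h z
  rw [← e] at h1
  exact hasMFDerivAt_unique (hasMFDerivAt_smul 𝔼 (E := E) (g * h) x) h1

include hq in
variable (𝔼) in
lemma smulDeriv_inv_apply (g : Gc) (x : Gc ⧸ P) (u : E) :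
    smulDeriv g⁻¹ (g • x) (smulDeriv g x u) = u := by
  have h1 := smulDeriv_mul 𝔼 (E := E) g⁻¹ g x
  have e : (fun z : Gc ⧸ P => (1 : Gc) • z) = id := funext fun z => one_smul Gc z
  have h2 : smulDeriv (1 : Gc) x = ContinuousLinearMap.id ℂ E := by
    rw [smulDeriv, e]
    exact mfderiv_id
  rw [inv_mul_cancel, h2] at h1
  exact (DFunLike.congr_fun h1 u).symm

include hq in
variable (𝔼) in
lemma chartInvDeriv_eq {x₀ : Gc ⧸ P} {y : E} {A : E →L[ℂ] E}
    (hA : HasMFDerivAt 𝓘(ℂ, E) 𝓘(ℂ, E) (extChartAt 𝓘(ℂ, E) x₀).symm y (A : E →L[ℂ] E)) :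
    chartInvDeriv x₀ y = A.restrictScalars ℝ :=
  (hasMFDerivAt_real_of_complex hA).mfderiv

include hq in
lemma chartInvDeriv_injective {x₀ : Gc ⧸ P} {y : E} (hy : y ∈ (extChartAt 𝓘(ℂ, E) x₀).target)
    {A : E →L[ℂ] E}
    (hA : HasMFDerivAt 𝓘(ℂ, E) 𝓘(ℂ, E) (extChartAt 𝓘(ℂ, E) x₀).symm y (A : E →L[ℂ] E)) :
    Function.Injective A := by
  have := isManifold_real_of_complex (F := E) (X := Gc ⧸ P) hq.isManifold
  have h := chartDeriv_comp (E := E) (M := Gc ⧸ P) (p := x₀) (y := y) hy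
  rw [chartInvDeriv_eq 𝔼 hA] at h
  exact Function.LeftInverse.injective fun u => DFunLike.congr_fun h u

variable (E P) in
/-- The pull-back to `Gc ⧸ P` of the Fubini–Study form, by the orbit map of the line through the
highest weight vector. -/
def flagForm (dR : 𝔼 →L[ℂ] V →L[ℂ] V) (R : Gc → V →L[ℂ] V) (v : V) (x : Gc ⧸ P) :
    E →L[ℝ] E →L[ℝ] ℝ :=
  (isoForm E P dR v (R ((𝐬 x).s x))).bilinearComp
    ((smulDeriv ((𝐬 x).s x)⁻¹ x).restrictScalars ℝ)
    ((smulDeriv ((𝐬 x).s x)⁻¹ x).restrictScalars ℝ)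

namespace IsFlagModel
include hm

/-- `flagForm` at `x = g P` can be computed with any representative `g`. -/
lemma flagForm_eq {g : Gc} {x : Gc ⧸ P} (hg : 𝛑 g = x) (u w : E) :
    flagForm E P dR R v x u w = isoForm E P dR v (R g) (smulDeriv g⁻¹ x u) (smulDeriv g⁻¹ x w) := by
  set g₀ := (𝐬 x).s x
  have h0 : 𝛑 g₀ = x := LocalSection.mk_s _ _ (mem_sectionAt x)
  obtain ⟨p, hp⟩ : ∃ p : P, g₀⁻¹ * g = p := ⟨⟨_, QuotientGroup.eq.1 (h0.trans hg.symm)⟩, rfl⟩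
  have hx : g⁻¹ • x = 𝛑 1 := by
    rw [← hg]
    exact congrArg 𝛑 (inv_mul_cancel g)
  have e1 : g₀⁻¹ = p * g⁻¹ := by rw [← hp, mul_inv_cancel_right]
  have e2 : g = g₀ * p := by rw [← hp, mul_inv_cancel_left]
  have e3 : ∀ u : E, smulDeriv g₀⁻¹ x u = isotropy p (smulDeriv g⁻¹ x u) := fun u => by
    rw [e1, smulDeriv_mul 𝔼, hx]
    rfl
  change isoForm E P dR v (R g₀) (smulDeriv g₀⁻¹ x u) (smulDeriv g₀⁻¹ x w) = _
  rw [e3, e3, ← hm.isoForm_mul_right, ← e2]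

lemma flagForm_smul (hu : ∀ (k : G) (w : V), ‖R (ι k) w‖ = ‖w‖) (k : G) (x : Gc ⧸ P) (u w : E) :
    flagForm E P dR R v (ι k • x) (smulDeriv (ι k) x u) (smulDeriv (ι k) x w)
      = flagForm E P dR R v x u w := by
  obtain ⟨g, rfl⟩ := QuotientGroup.mk_surjective x
  have e : ∀ u : E, smulDeriv (ι k * g)⁻¹ (ι k • (g : Gc ⧸ P)) (smulDeriv (ι k) (g : Gc ⧸ P) u)
      = smulDeriv g⁻¹ (g : Gc ⧸ P) u := fun u => by
    have h1 := smulDeriv_mul 𝔼 (E := E) g⁻¹ (ι k)⁻¹ (ι k • (g : Gc ⧸ P))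
    rw [← mul_inv_rev, inv_smul_smul] at h1
    rw [h1, ContinuousLinearMap.comp_apply, smulDeriv_inv_apply 𝔼]
  refine (hm.flagForm_eq (g := ι k * g) (x := ι k • (g : Gc ⧸ P)) rfl _ _).trans ?_
  rw [hm.flagForm_eq rfl, e, e, isoForm_apply, isoForm_apply,
    hm.apply_mul, hm.apply_mul, hm.apply_mul, fubiniStudy_isometry _ _ (hu k)]

/-- The differential of `R(s) v` for a local section `s`. -/
lemma exists_hasMFDerivAt_section (s : LocalSection 𝔼 E P) {x : Gc ⧸ P} (hx : x ∈ s.U) :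
    ∃ D : E →L[ℂ] 𝔼, HasMFDerivAt 𝓘(ℂ, E) 𝓘(ℂ, V) (fun z => R (s.s z) v) x
        (((R (s.s x)) ∘L ((ContinuousLinearMap.apply ℂ V v) ∘L dR) ∘L D : E →L[ℂ] V)) ∧
      ∀ u, dMk 𝔼 E P (D u) = smulDeriv (s.s x)⁻¹ x u := by
  set g := s.s x with hg
  have hs : ContMDiffAt 𝓘(ℂ, E) 𝓘(ℂ, 𝔼) ω (fun z => g⁻¹ * s.s z) x :=
    contMDiffAt_const.mul (s.holomorphic.contMDiffAt (s.isOpen.mem_nhds hx))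
  have h1 : g⁻¹ * s.s x = 1 := by rw [← hg, inv_mul_cancel]
  let D : E →L[ℂ] 𝔼 := mfderiv 𝓘(ℂ, E) 𝓘(ℂ, 𝔼) (fun z => g⁻¹ * s.s z) x
  have hD : HasMFDerivAt 𝓘(ℂ, E) 𝓘(ℂ, 𝔼) (fun z => g⁻¹ * s.s z) x (D : E →L[ℂ] 𝔼) :=
    (hs.mdifferentiableAt (by simp)).hasMFDerivAt
  refine ⟨D, ?_, fun u => ?_⟩
  · have h2 := hm.hasMFDerivAt_one
    rw [← h1] at h2
    have h3 := HasMFDerivAt.comp x h2 hD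
    have h4 := HasMFDerivAt.comp x
      (((R g) ∘L (ContinuousLinearMap.apply ℂ V v)).hasFDerivAt.hasMFDerivAt
        (x := (R ∘ fun z => g⁻¹ * s.s z) x)) h3
    have e : (fun z => R (s.s z) v)
        = ((R g) ∘L (ContinuousLinearMap.apply ℂ V v)) ∘ (R ∘ fun z => g⁻¹ * s.s z) := by
      funext z
      change _ = R g (R (g⁻¹ * s.s z) v)
      rw [← hm.apply_mul, mul_inv_cancel_left]
    rw [e]
    exact h4
  · have h2 := hasMFDerivAt_mk (𝔼 := 𝔼) (E := E) (P := P)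
    rw [← h1] at h2
    have h3 := HasMFDerivAt.comp x h2 hD
    have h4 : HasMFDerivAt 𝓘(ℂ, E) 𝓘(ℂ, E) (fun z : Gc ⧸ P => g⁻¹ • z) x _ :=
      h3.congr_of_eventuallyEq (by
        filter_upwards [s.isOpen.mem_nhds hx] with z hz
        change g⁻¹ • z = g⁻¹ • (𝛑 (s.s z))
        rw [s.mk_s z hz])
    exact congrArg (fun l : E →L[ℂ] E => l u)
      (hasMFDerivAt_unique h4 (hasMFDerivAt_smul 𝔼 (E := E) g⁻¹ x))

lemma flagForm_section (s : LocalSection 𝔼 E P) {x : Gc ⧸ P} (hx : x ∈ s.U) {D : E →L[ℂ] V}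
    (hD : HasMFDerivAt 𝓘(ℂ, E) 𝓘(ℂ, V) (fun z => R (s.s z) v) x (D : E →L[ℂ] V)) (u w : E) :
    flagForm E P dR R v x u w = fubiniStudy (R (s.s x) v) (D u) (D w) := by
  obtain ⟨D', h1, h2⟩ := hm.exists_hasMFDerivAt_section s hx
  have e : ∀ u, D u = R (s.s x) (dR (D' u) v) := fun u =>
    DFunLike.congr_fun (hasMFDerivAt_unique hD h1) u
  rw [hm.flagForm_eq (s.mk_s x hx), ← h2, ← h2, hm.isoForm_dMk (hm.apply_ne_zero _), ← e, ← e]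

/-- The orbit map in the preferred chart of the flag manifold. -/
lemma contDiffAt_section_chart (s : LocalSection 𝔼 E P) (x₀ : Gc ⧸ P) {y : E}
    (hy : y ∈ (extChartAt 𝓘(ℂ, E) x₀).target) (hs : (extChartAt 𝓘(ℂ, E) x₀).symm y ∈ s.U)
    {F : Type*} [NormedAddCommGroup F] [NormedSpace ℂ F] {f : Gc → F}
    (hf : ContMDiff 𝓘(ℂ, 𝔼) 𝓘(ℂ, F) ω f) :
    ContDiffAt ℂ ω (fun z => f (s.s ((extChartAt 𝓘(ℂ, E) x₀).symm z))) y := by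
  have := hq.isManifold
  have h1 : ContMDiffAt 𝓘(ℂ, E) 𝓘(ℂ, E) ω (extChartAt 𝓘(ℂ, E) x₀).symm y :=
    (contMDiffOn_extChartAt_symm (n := ω) x₀ y hy).contMDiffAt
      ((isOpen_extChartAt_target x₀).mem_nhds hy)
  exact contMDiffAt_iff_contDiffAt.1 ((hf _).comp y
    ((s.holomorphic.contMDiffAt (s.isOpen.mem_nhds hs)).comp y h1))

lemma hasFDerivAt_section_chart (s : LocalSection 𝔼 E P) (x₀ : Gc ⧸ P) {y : E} {A : E →L[ℂ] E}
    (hA : HasMFDerivAt 𝓘(ℂ, E) 𝓘(ℂ, E) (extChartAt 𝓘(ℂ, E) x₀).symm y (A : E →L[ℂ] E))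
    {L : E →L[ℂ] V} (hL : HasMFDerivAt 𝓘(ℂ, E) 𝓘(ℂ, V) (fun z => R (s.s z) v)
      ((extChartAt 𝓘(ℂ, E) x₀).symm y) (L : E →L[ℂ] V)) :
    fderiv ℂ (fun z => R (s.s ((extChartAt 𝓘(ℂ, E) x₀).symm z)) v) y = L ∘L A := by
  have h : HasMFDerivAt 𝓘(ℂ, E) 𝓘(ℂ, V) (fun z => R (s.s ((extChartAt 𝓘(ℂ, E) x₀).symm z)) v) y
    (L ∘L A : E →L[ℂ] V) := HasMFDerivAt.comp y hL hA
  have h' : HasFDerivAt (fun z => R (s.s ((extChartAt 𝓘(ℂ, E) x₀).symm z)) v) (L ∘L A) y :=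
    hasMFDerivAt_iff_hasFDerivAt.1 h
  exact h'.fderiv

lemma flagForm_chart (s : LocalSection 𝔼 E P) (x₀ : Gc ⧸ P) {y : E}
    (hs : (extChartAt 𝓘(ℂ, E) x₀).symm y ∈ s.U)
    {A : E →L[ℂ] E} (hA : HasMFDerivAt 𝓘(ℂ, E) 𝓘(ℂ, E) (extChartAt 𝓘(ℂ, E) x₀).symm y (A : E →L[ℂ] E))
    (u w : E) : flagForm E P dR R v ((extChartAt 𝓘(ℂ, E) x₀).symm y) (A u) (A w)
      = pullFubiniStudy (fun z => R (s.s ((extChartAt 𝓘(ℂ, E) x₀).symm z)) v) y u w := by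
  obtain ⟨D, h1, -⟩ := hm.exists_hasMFDerivAt_section s hs
  rw [hm.flagForm_section s hs h1, pullFubiniStudy_apply, hm.hasFDerivAt_section_chart s x₀ hA h1]
  rfl

include hG hu in
/-- The volume density of the pulled back Fubini–Study form: the potential of the form is also the
potential of its Ricci form, up to a constant factor. -/
lemma exists_gramDet_eq [PreconnectedSpace Gc] (s : LocalSection 𝔼 E P) (x₀ : Gc ⧸ P) :
    ∃ (C : ℝ) (j : E → ℂ), ∀ y ∈ (extChartAt 𝓘(ℂ, E) x₀).target,
      (extChartAt 𝓘(ℂ, E) x₀).symm y ∈ s.U → ContDiffAt ℂ ω j y ∧ j y ≠ 0 ∧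
      gramDet (toBilin (pullFubiniStudy
          (fun z => R (s.s ((extChartAt 𝓘(ℂ, E) x₀).symm z)) v) y)) = C * (‖j y‖ ^ 2) ^ 2 *
        Real.exp (-2 * Real.log (‖R (s.s ((extChartAt 𝓘(ℂ, E) x₀).symm y)) v‖ ^ 2)) := by
  have := hq.isManifold
  obtain ⟨Lf, hL0, hL⟩ := hm.exists_toTangent
  set σ : E → V := fun z => R (s.s ((extChartAt 𝓘(ℂ, E) x₀).symm z)) v with hσ
  let W : E → E →L[ℂ] E := fun y =>
    Lf ∘L (R (s.s ((extChartAt 𝓘(ℂ, E) x₀).symm y))⁻¹) ∘L fderiv ℂ σ y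
  refine ⟨volumeRatio E P dR v (R 1), fun y => LinearMap.det (W y : E →ₗ[ℂ] E), fun y hy hs => ?_⟩
  have hA : HasMFDerivAt 𝓘(ℂ, E) 𝓘(ℂ, E) (extChartAt 𝓘(ℂ, E) x₀).symm y
      (mfderiv 𝓘(ℂ, E) 𝓘(ℂ, E) (extChartAt 𝓘(ℂ, E) x₀).symm y : E →L[ℂ] E) :=
    ((contMDiffOn_extChartAt_symm (n := ω) x₀ y hy).contMDiffAt
      ((isOpen_extChartAt_target x₀).mem_nhds hy)).mdifferentiableAt (by simp) |>.hasMFDerivAt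
  set A : E →L[ℂ] E := mfderiv 𝓘(ℂ, E) 𝓘(ℂ, E) (extChartAt 𝓘(ℂ, E) x₀).symm y
  set x := (extChartAt 𝓘(ℂ, E) x₀).symm y with hx
  set g := s.s x with hg
  obtain ⟨D, h1, h2⟩ := hm.exists_hasMFDerivAt_section s hs
  have h3 := hm.hasFDerivAt_section_chart s x₀ hA h1
  have hW : ∀ u, W y u = smulDeriv g⁻¹ x (A u) := fun u => by
    have e : fderiv ℂ σ y u = R g (dR (D (A u)) v) := DFunLike.congr_fun h3 u
    change Lf (R g⁻¹ (fderiv ℂ σ y u)) = _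
    rw [e, hm.inv_apply, hL, h2]
  have hWinj : Function.Injective (W y) := by
    have h4 : Function.Injective A := chartInvDeriv_injective (𝔼 := 𝔼) hy hA
    have h5 : Function.Injective (smulDeriv (E := E) g⁻¹ x) :=
      Function.LeftInverse.injective fun u => smulDeriv_inv_apply 𝔼 g⁻¹ x u
    rw [show ⇑(W y) = smulDeriv (E := E) g⁻¹ x ∘ A from funext hW]
    exact h5.comp h4
  have hB : toBilin (pullFubiniStudy σ y) = (toBilin (isoForm E P dR v (R g))).comp
      (((W y).restrictScalars ℝ : E →L[ℝ] E) : E →ₗ[ℝ] E)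
      (((W y).restrictScalars ℝ : E →L[ℝ] E) : E →ₗ[ℝ] E) := by
    refine LinearMap.ext fun u => LinearMap.ext fun w => ?_
    change pullFubiniStudy σ y u w = isoForm E P dR v (R g) (W y u) (W y w)
    rw [← hm.flagForm_chart s x₀ hs hA, hm.flagForm_eq (s.mk_s x hs), hW, hW]
  refine ⟨?_, ?_, ?_⟩
  · have hdet : ∀ z, LinearMap.det (W z : E →ₗ[ℂ] E)
        = (LinearMap.toMatrix (finBasis ℂ E) (finBasis ℂ E) (W z : E →ₗ[ℂ] E)).det :=
      fun z => (LinearMap.det_toMatrix (finBasis ℂ E) _).symm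
    rw [funext hdet]
    refine contDiffAt_det fun i j => ?_
    have hσc : ContDiffAt ℂ ω σ y := hm.contDiffAt_section_chart s x₀ hy hs
      (f := fun g => R g v) (hm.contMDiff.clm_apply contMDiff_const)
    have hRc := hm.contDiffAt_section_chart s x₀ hy hs (f := fun g => R g⁻¹)
      (hm.contMDiff.comp (contMDiff_inv 𝓘(ℂ, 𝔼) ω))
    have hWc : ContDiffAt ℂ ω W y :=
      contDiffAt_const.clm_comp (hRc.clm_comp (hσc.fderiv_right (m := ω) (by simp)))
    have e : (fun z => LinearMap.toMatrix (finBasis ℂ E) (finBasis ℂ E)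
        (W z : E →ₗ[ℂ] E) i j) = fun z => (toContinuousLinearMap
          ((finBasis ℂ E).coord i)) (W z (finBasis ℂ E j)) := by
      funext z
      rw [LinearMap.toMatrix_apply]
      rfl
    rw [e]
    exact (ContinuousLinearMap.contDiff _).contDiffAt.comp y (hWc.clm_apply contDiffAt_const)
  · exact (LinearMap.isUnit_det _ ((LinearMap.isUnit_iff_ker_eq_bot _).2
      (LinearMap.ker_eq_bot.2 hWinj))).ne_zero
  · have hn : ‖R g v‖ ≠ 0 := norm_ne_zero_iff.2 (hm.apply_ne_zero g)
    have hvol := hm.volumeRatio_eq hG hu g 1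
    rw [hB, gramDet_comp, det_restrictScalars_real, ← hvol, volumeRatio]
    have he : Real.exp (-2 * Real.log (‖R g v‖ ^ 2)) = (‖R g v‖ ^ 4)⁻¹ := by
      have h2 : 0 < ‖R g v‖ ^ 2 := by positivity
      rw [neg_mul, Real.exp_neg, two_mul, Real.exp_add, Real.exp_log h2, ← pow_add]
    change _ = _ * Real.exp (-2 * Real.log (‖R g v‖ ^ 2))
    rw [he]
    field_simp

end IsFlagModel

open CircleBundle

/-! ### The contact form -/

lemma hasFDerivAt_of_hasMFDerivAt {W F : Type*} [NormedAddCommGroup W] [NormedSpace ℝ W]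
    [NormedAddCommGroup F] [NormedSpace ℝ F] {M : Type*} [TopologicalSpace M] [ChartedSpace W M]
    {f : M → F} {p : M} {D : W →L[ℝ] F} (h : HasMFDerivAt 𝓘(ℝ, W) 𝓘(ℝ, F) f p (D : W →L[ℝ] F)) :
    HasFDerivAt (f ∘ (extChartAt 𝓘(ℝ, W) p).symm) D (extChartAt 𝓘(ℝ, W) p p) := by
  have h1 : HasFDerivWithinAt (f ∘ (extChartAt 𝓘(ℝ, W) p).symm) D (range 𝓘(ℝ, W))
    (extChartAt 𝓘(ℝ, W) p p) := h.2
  rwa [ModelWithCorners.range_eq_univ, hasFDerivWithinAt_univ] at h1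

namespace CircleBundle

/-- The differential of the fibre coordinate `a_U`. -/
def dCoord (s : LocalSection 𝔼 E P) (p : CircleBundle E χ) : CircleModel E →L[ℝ] ℂ :=
  mfderiv 𝐈 𝓘(ℝ, ℂ) (fun q : CircleBundle E χ => (fiberCoord s q : ℂ)) p

lemma hasMFDerivAt_coord (h : p.proj ∈ s.U) :
    HasMFDerivAt 𝐈 𝓘(ℝ, ℂ) (fun q : CircleBundle E χ => (fiberCoord s q : ℂ)) p
      (dCoord s p : CircleModel E →L[ℝ] ℂ) :=
  (((contMDiff_coe_circle _).comp p (contMDiffAt_fiberCoord h)).mdifferentiableAt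
    (by simp)).hasMFDerivAt

/-- The differential of the bundle projection, on the model spaces. -/
def dProj (p : CircleBundle E χ) : CircleModel E →L[ℝ] E := p.projDeriv

lemma hasMFDerivAt_proj (p : CircleBundle E χ) : HasMFDerivAt 𝐈 𝓘(ℝ, E)
    (fun q : CircleBundle E χ => q.proj) p (dProj p : CircleModel E →L[ℝ] E) :=
  ((contMDiff_proj p).mdifferentiableAt (by simp)).hasMFDerivAt

lemma dProj_eq (p : CircleBundle E χ) : dProj p = ContinuousLinearMap.fst ℝ _ _ := by
  have := isManifold_real_of_complex (F := E) (X := Gc ⧸ P) hq.isManifold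
  have h1 := hasFDerivAt_of_hasMFDerivAt (HasMFDerivAt.comp p
    (mdifferentiableAt_extChartAt (I := 𝓘(ℝ, E)) (mem_chart_source E p.proj)).hasMFDerivAt
    (hasMFDerivAt_proj p))
  have h2 : HasFDerivAt _ (chartDeriv p.proj p.proj ∘L dProj p : CircleModel E →L[ℝ] E) _ := h1
  rw [chartDeriv_self] at h2
  refine h2.unique ((hasFDerivAt_fst (𝕜 := ℝ)).congr_of_eventuallyEq ?_)
  filter_upwards [(isOpen_extChartAt_target p).mem_nhds (_root_.mem_extChartAt_target p)] with y hy
  exact (𝐱 p.proj).right_inv (CircleBundle.mem_extChartAt_target.1 hy).1.1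

/-- The real-valued form `dθ_U`. -/
def angleForm (s : LocalSection 𝔼 E P) (p : CircleBundle E χ) : CircleModel E →L[ℝ] ℝ :=
  Complex.reCLM ∘L ((I * fiberCoord s p : ℂ)⁻¹ • dCoord s p)

lemma angleForm_eq (h : p.proj ∈ s.U)
    (w : CircleModel E) : (angleForm s p w : ℂ) = (I * fiberCoord s p : ℂ)⁻¹ * dCoord s p w := by
  set y₀ := 𝐞 p p
  have h1 := hasFDerivAt_of_hasMFDerivAt (hasMFDerivAt_coord h)
  have h2 := h1.norm_sq
  have e0 : (𝐞 p).symm y₀ = p := extChartAt_to_inv p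
  have h3 : (fun y => ‖((fun q : CircleBundle E χ => (fiberCoord s q : ℂ)) ∘
      (𝐞 p).symm) y‖ ^ 2) = fun _ => (1 : ℝ) := by
    funext y
    change ‖((fiberCoord s _ : Circle) : ℂ)‖ ^ 2 = 1
    rw [Circle.norm_coe, one_pow]
  rw [h3] at h2
  have h4 := DFunLike.congr_fun (h2.unique (hasFDerivAt_const 1 y₀)) w
  have h5 : (2 : ℕ) • inner ℝ ((fiberCoord s ((𝐞 p).symm y₀) : ℂ)) (dCoord s p w) = 0 := h4
  rw [e0, Complex.inner, smul_eq_zero] at h5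
  have h6 : (dCoord s p w * (starRingEnd ℂ) (fiberCoord s p : ℂ)).re = 0 := by
    rcases h5 with h5 | h5
    · norm_num at h5
    · simpa [mul_comm] using h5
  have h7 : (I * fiberCoord s p : ℂ)⁻¹ * dCoord s p w
      = -I * (dCoord s p w * (starRingEnd ℂ) (fiberCoord s p : ℂ)) := by
    rw [mul_inv, Complex.inv_I, ← Circle.coe_inv, Circle.coe_inv_eq_conj]
    ring
  apply Complex.ext
  · rfl
  · rw [h7]
    simp [h6]

lemma dCoord_eq (h : p.proj ∈ s.U)
    (w : CircleModel E) : dCoord s p w = I * fiberCoord s p * angleForm s p w := by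
  rw [angleForm_eq h, mul_inv_cancel_left₀]
  exact mul_ne_zero Complex.I_ne_zero (Circle.coe_ne_zero _)

/-- Change of section: if `f` is the transition function and `g = log |f|`, then
`dg + i dθ' = df / f + i dθ`. -/
lemma angleForm_change {s s' : LocalSection 𝔼 E P} {p : CircleBundle E χ} (h : p.proj ∈ s.U)
    (h' : p.proj ∈ s'.U) {g : Gc ⧸ P → ℝ} {g' : E →L[ℝ] ℝ}
    (hg : HasMFDerivAt 𝓘(ℝ, E) 𝓘(ℝ, ℝ) g p.proj (g' : E →L[ℝ] ℝ))
    (hexp : ∀ᶠ x in 𝓝 p.proj, ‖(χ.ratio (s'.s x) (s.s x) : ℂ)‖ = Real.exp (g x)) :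
    ∃ L : E →L[ℂ] ℂ, ∀ w, (g' (dProj p w) : ℂ) + I * angleForm s' p w
      = L (dProj p w) + I * angleForm s p w := by
  let f : Gc ⧸ P → ℂ := fun x => χ.ratio (s'.s x) (s.s x)
  have hf : MDifferentiableAt 𝓘(ℂ, E) 𝓘(ℂ, ℂ) f p.proj :=
    ((χ.contMDiffOn_ratio s' s).contMDiffAt ((s'.isOpen.inter s.isOpen).mem_nhds
      ⟨h', h⟩)).mdifferentiableAt (by simp)
  let L₀ : E →L[ℂ] ℂ := mfderiv 𝓘(ℂ, E) 𝓘(ℂ, ℂ) f p.proj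
  have hL₀ : HasMFDerivAt 𝓘(ℂ, E) 𝓘(ℂ, ℂ) f p.proj (L₀ : E →L[ℂ] ℂ) := hf.hasMFDerivAt
  have hf0 : f p.proj ≠ 0 := Units.ne_zero _
  refine ⟨(f p.proj)⁻¹ • L₀, fun w => ?_⟩
  set y₀ := 𝐞 p p
  have e0 : (𝐞 p).symm y₀ = p := extChartAt_to_inv p
  have d1 := hasFDerivAt_of_hasMFDerivAt (hasMFDerivAt_coord h)
  have d2 := hasFDerivAt_of_hasMFDerivAt (hasMFDerivAt_coord h')
  have d3 : HasFDerivAt _ ((L₀.restrictScalars ℝ) ∘L dProj p) y₀ := hasFDerivAt_of_hasMFDerivAt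
    (HasMFDerivAt.comp p (hasMFDerivAt_real_of_complex hL₀) (hasMFDerivAt_proj p))
  have d4 : HasFDerivAt _ (g' ∘L dProj p) y₀ := hasFDerivAt_of_hasMFDerivAt
    (HasMFDerivAt.comp p hg (hasMFDerivAt_proj p))
  have d5 := d2.mul (Complex.ofRealCLM.hasFDerivAt.comp y₀ d4.exp)
  have d6 := d3.mul d1
  have hev : ∀ᶠ q : CircleBundle E χ in 𝓝 p, (fiberCoord s' q : ℂ) * (Real.exp (g q.proj) : ℂ)
      = f q.proj * fiberCoord s q := by
    filter_upwards [continuous_proj.continuousAt.preimage_mem_nhds (s.isOpen.mem_nhds h),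
      continuous_proj.continuousAt.preimage_mem_nhds (s'.isOpen.mem_nhds h'),
      continuous_proj.continuousAt.eventually hexp] with q h1 h2 h3
    have h0 : ((‖(χ.ratio (s'.s q.proj) (s.s q.proj) : ℂ)‖ : ℝ) : ℂ) ≠ 0 :=
      Complex.ofReal_ne_zero.2 (norm_ne_zero_iff.2 (Units.ne_zero _))
    rw [fiberCoord_change h1 h2, ← h3, Circle.coe_mul, coe_phase]
    change _ = (χ.ratio (s'.s q.proj) (s.s q.proj) : ℂ) * _
    field_simp
  have hc : Filter.Tendsto (𝐞 p).symm (𝓝 y₀) (𝓝 p) := by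
    have := (continuousAt_extChartAt_symm (I := 𝐈) p).tendsto
    rwa [e0] at this
  have d7 := d6.congr_of_eventuallyEq (hc.eventually hev)
  have d8 := DFunLike.congr_fun (d5.unique d7) w
  have e1 : (fiberCoord s' ((𝐞 p).symm y₀) : ℂ) *
      ((Real.exp (g ((𝐞 p).symm y₀).proj) * g' (dProj p w) : ℝ) : ℂ)
      + (Real.exp (g ((𝐞 p).symm y₀).proj) : ℂ) * dCoord s' p w
      = f ((𝐞 p).symm y₀).proj * dCoord s p w
      + (fiberCoord s ((𝐞 p).symm y₀) : ℂ) * L₀ (dProj p w) := d8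
  have e2 := hev.self_of_nhds
  rw [e0, dCoord_eq h, dCoord_eq h'] at e1
  have e3 : (fiberCoord s p : ℂ) ≠ 0 := Circle.coe_ne_zero _
  change _ = (f p.proj)⁻¹ * L₀ (dProj p w) + _
  push_cast at e1 e2
  refine mul_left_cancel₀ (mul_ne_zero hf0 e3) ?_
  rw [mul_add, mul_add, ← mul_assoc _ (f p.proj)⁻¹]
  have e4 : f p.proj * fiberCoord s p * (f p.proj)⁻¹ = fiberCoord s p := by field_simp
  rw [e4]
  linear_combination e1 + (-(g' (dProj p w) : ℂ) - I * angleForm s' p w) * e2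

end CircleBundle

/-- The potential `log ‖s_U v‖²`. -/
def logNorm (R : Gc → V →L[ℂ] V) (v : V) (s : LocalSection 𝔼 E P) (x : Gc ⧸ P) : ℝ :=
  Real.log (‖R (s.s x) v‖ ^ 2)

/-- The differential of `log ‖s_U v‖²`. -/
def dLogNorm (R : Gc → V →L[ℂ] V) (v : V) (s : LocalSection 𝔼 E P) (x : Gc ⧸ P) : E →L[ℝ] ℝ :=
  mfderiv 𝓘(ℝ, E) 𝓘(ℝ, ℝ) (logNorm R v s) x

/-- The form `dθ_U - c d log ‖s_U v‖² ∘ J`. -/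
def contactAt (R : Gc → V →L[ℂ] V) (v : V) (c : ℝ) (s : LocalSection 𝔼 E P)
    (p : CircleBundle E χ) : CircleModel E →L[ℝ] ℝ :=
  angleForm s p - c • (dLogNorm R v s p.proj ∘L 𝐉 ∘L dProj p)

lemma contactFormAt_eq (ρ : Representation ℂ Gc V) (v : V) (ℓ k : ℕ) {s : LocalSection 𝔼 E P}
    {p : CircleBundle E χ} (h : p.proj ∈ s.U) (w : CircleModel E) :
    contactFormAt ρ v ℓ k s p w = (contactAt (fun g => toContinuousLinearMap (ρ g)) v
      (ℓ / (2 * k)) s p w : ℂ) := by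
  set D := dLogNorm (fun g => toContinuousLinearMap (ρ g)) v s p.proj with hD
  have e1 : contactFormAt ρ v ℓ k s p w = (-(ℓ * I / (2 * k)) : ℂ) *
      ((1 / 2 : ℂ) * ((D (dProj p w) : ℂ) - I * (D (𝐉 (dProj p w)) : ℂ))
      - (1 / 2 : ℂ) * ((D (dProj p w) : ℂ) + I * (D (𝐉 (dProj p w)) : ℂ)))
      + (I * fiberCoord s p : ℂ)⁻¹ * dCoord s p w := rfl
  have e2 : contactAt (fun g => toContinuousLinearMap (ρ g)) v (ℓ / (2 * k)) s p w
      = angleForm s p w - ℓ / (2 * k) * D (𝐉 (dProj p w)) := rfl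
  rw [e1, e2, ← angleForm_eq h]
  push_cast
  linear_combination (ℓ * D (𝐉 (dProj p w)) / (2 * k) : ℂ) * Complex.I_mul_I

namespace IsFlagModel
include hm

lemma hasMFDerivAt_logNorm (s : LocalSection 𝔼 E P) {x : Gc ⧸ P} (hx : x ∈ s.U) :
    HasMFDerivAt 𝓘(ℝ, E) 𝓘(ℝ, ℝ) (logNorm R v s) x (dLogNorm R v s x : E →L[ℝ] ℝ) := by
  obtain ⟨D, hD, -⟩ := hm.exists_hasMFDerivAt_section s hx
  have h1 := (hasMFDerivAt_real_of_complex hD).mdifferentiableAt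
  have h2 : DifferentiableAt ℝ (fun w : V => Real.log (‖w‖ ^ 2)) (R (s.s x) v) :=
    (hasFDerivAt_log_norm_sq (σ := id) differentiableAt_id (hm.apply_ne_zero _)).differentiableAt
  exact (MDifferentiableAt.comp x h2.mdifferentiableAt h1).hasMFDerivAt

include hG hu in
lemma norm_ratio_eq [PreconnectedSpace Gc] {k : ℕ} (hχ : χ.IsCanonicalRoot (E := E) k) (ℓ : ℕ)
    {g h : Gc} (hgh : 𝛑 g = 𝛑 h) :
    ‖((χ.pow ℓ).ratio g h : ℂ)‖ = Real.exp (ℓ / (2 * k) *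
      (Real.log (‖R h v‖ ^ 2) - Real.log (‖R g v‖ ^ 2))) := by
  have hk : (k : ℝ) ≠ 0 := Nat.cast_ne_zero.2 (hm.canonicalRoot_ne_zero hG hu hχ)
  have hp := QuotientGroup.eq.1 hgh
  have e1 : h = g * (⟨_, hp⟩ : P) := (mul_inv_cancel_left g h).symm
  have e2 : ‖R h v‖ = ‖(χ.toHom ⟨_, hp⟩ : ℂ)‖ ^ k * ‖R g v‖ := by
    conv_lhs => rw [e1]
    rw [hm.apply_mul, hm.apply_eq_char_smul, map_smul, norm_smul, hm.norm_char_eq hG hu hχ]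
  have h0 : 0 < ‖(χ.toHom ⟨_, hp⟩ : ℂ)‖ := norm_pos_iff.2 (Units.ne_zero _)
  have h1 : ‖R g v‖ ≠ 0 := norm_ne_zero_iff.2 (hm.apply_ne_zero g)
  rw [χ.ratio_pow, Units.val_pow_eq_pow_val, norm_pow, χ.ratio_eq hgh, e2, Real.log_pow, Real.log_pow,
    Real.log_mul (pow_ne_zero _ h0.ne') h1, Real.log_pow]
  have e3 : (ℓ : ℝ) / (2 * k) * ((2 : ℕ) * (k * Real.log ‖(χ.toHom ⟨_, hp⟩ : ℂ)‖ + Real.log ‖R g v‖)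
      - (2 : ℕ) * Real.log ‖R g v‖) = ℓ * Real.log ‖(χ.toHom ⟨_, hp⟩ : ℂ)‖ := by
    push_cast
    field_simp
    ring
  rw [e3, Real.exp_nat_mul, Real.exp_log h0]

include hG hu in
/-- The contact form does not depend on the local section. -/
lemma contactAt_eq [PreconnectedSpace Gc] {k : ℕ} (hχ : χ.IsCanonicalRoot (E := E) k) {ℓ : ℕ}
    {s s' : LocalSection 𝔼 E P} {p : CircleBundle E (χ.pow ℓ)} (h : p.proj ∈ s.U)
    (h' : p.proj ∈ s'.U) :
    contactAt R v (ℓ / (2 * k)) s' p = contactAt R v (ℓ / (2 * k)) s p := by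
  set c : ℝ := ℓ / (2 * k) with hc
  let g : Gc ⧸ P → ℝ := fun x => c * (logNorm R v s x - logNorm R v s' x)
  have hg : HasMFDerivAt 𝓘(ℝ, E) 𝓘(ℝ, ℝ) g p.proj
      (c • (dLogNorm R v s p.proj - dLogNorm R v s' p.proj) : E →L[ℝ] ℝ) :=
    ((hm.hasMFDerivAt_logNorm s h).sub (hm.hasMFDerivAt_logNorm s' h')).const_smul c
  obtain ⟨L, hL⟩ := angleForm_change h h' hg (by
    filter_upwards [s.isOpen.mem_nhds h, s'.isOpen.mem_nhds h'] with x hx hx'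
    exact hm.norm_ratio_eq hG hu hχ ℓ ((s'.mk_s x hx').trans (s.mk_s x hx).symm))
  -- the real part of the identity holds for all tangent vectors of the base
  have hre : ∀ u : E, c * (dLogNorm R v s p.proj u - dLogNorm R v s' p.proj u) = (L u).re := by
    intro u
    have h1 := congrArg Complex.re (hL (u, 0))
    rw [dProj_eq] at h1
    simpa using h1
  refine ContinuousLinearMap.ext fun w => ?_
  have h1 := congrArg Complex.im (hL w)
  have h2 := hre (𝐉 (dProj p w))
  have h3 : (L (𝐉 (dProj p w))).re = -(L (dProj p w)).im := by
    rw [complexStructure_apply, map_smul, smul_eq_mul]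
    simp
  have h4 : angleForm s' p w = (L (dProj p w)).im + angleForm s p w := by simpa using h1
  change angleForm s' p w - c * dLogNorm R v s' p.proj (𝐉 (dProj p w))
    = angleForm s p w - c * dLogNorm R v s p.proj (𝐉 (dProj p w))
  linear_combination h4 + h2 + h3

end IsFlagModel

/-! ### The structure tensors in charts -/

lemma exists_eq_smul_of_ne_zero {b : EuclideanSpace ℝ (Fin 1)} (hb : b ≠ 0)
    (a : EuclideanSpace ℝ (Fin 1)) : ∃ r : ℝ, a = r • b :=
  (exists_smul_eq_of_finrank_eq_one (K := ℝ) (by simp) hb a).imp fun _ h => h.symm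

namespace CircleBundle

/-- The vector field `∂/∂θ`, with values in the model space. -/
def angularVector (p : CircleBundle E χ) : CircleModel E := p.angular

lemma hasMFDerivAt_rotate (p : CircleBundle E χ) :
    HasMFDerivAt 𝓘(ℝ, ℝ) 𝐈 (fun t : ℝ => p.rotate (Circle.exp t)) 0
      (ContinuousLinearMap.toSpanSingleton ℝ (angularVector p) : ℝ →L[ℝ] CircleModel E) := by
  have h0 : p.proj ∈ (𝐬 p.proj).U := mem_sectionAt _
  have h1 : ContMDiffAt 𝓘(ℝ, ℝ) 𝐈 ∞
      (fun t : ℝ => p.rotate (Circle.exp t)) 0 := by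
    refine contMDiffAt_of_coord (s := 𝐬 p.proj) h0 contMDiffAt_const ?_
    simp only [fiberCoord_rotate]
    exact contMDiffAt_const.mul (contMDiff_circleExp _)
  have h2 := (h1.mdifferentiableAt (by simp)).hasMFDerivAt
  let D : ℝ →L[ℝ] CircleModel E := mfderiv 𝓘(ℝ, ℝ) 𝐈 (fun t : ℝ => p.rotate (Circle.exp t)) 0
  have e : D = ContinuousLinearMap.toSpanSingleton ℝ (angularVector p) :=
    ContinuousLinearMap.ext_ring (one_smul ℝ (D 1)).symm
  rw [← e]
  exact h2

lemma rotate_one (p : CircleBundle E χ) : p.rotate 1 = p := by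
  refine ext_of_fiberCoord (s := 𝐬 p.proj) (mem_sectionAt _) rfl ?_
  rw [fiberCoord_rotate, mul_one]

lemma dProj_angularVector (p : CircleBundle E χ) : dProj p (angularVector p) = 0 := by
  have e : p.rotate (Circle.exp 0) = p := by rw [Circle.exp_zero, rotate_one]
  have h1 : HasMFDerivAt 𝐈 𝓘(ℝ, E) (fun q : CircleBundle E χ => q.proj)
      (p.rotate (Circle.exp 0)) (dProj p : CircleModel E →L[ℝ] E) := by
    rw [e]
    exact hasMFDerivAt_proj p
  have h2 := HasMFDerivAt.comp (0 : ℝ) h1 (hasMFDerivAt_rotate p)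
  have h3 := hasMFDerivAt_unique h2 (hasMFDerivAt_const (I := 𝓘(ℝ, ℝ)) p.proj (0 : ℝ))
  have h4 := DFunLike.congr_fun h3 1
  have h5 : dProj p ((1 : ℝ) • angularVector p) = 0 := h4
  rwa [one_smul] at h5

lemma angularForm_angularVector (h : p.proj ∈ s.U) : angleForm s p (angularVector p) = 1 := by
  have e : p.rotate (Circle.exp 0) = p := by rw [Circle.exp_zero, rotate_one]
  have h1 : HasMFDerivAt 𝐈 𝓘(ℝ, ℂ) (fun q : CircleBundle E χ =>
      (fiberCoord s q : ℂ)) (p.rotate (Circle.exp 0)) (dCoord s p : CircleModel E →L[ℝ] ℂ) := by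
    rw [e]
    exact hasMFDerivAt_coord h
  have h2 : HasMFDerivAt 𝓘(ℝ, ℝ) 𝓘(ℝ, ℂ) _ (0 : ℝ) (dCoord s p ∘L
    ContinuousLinearMap.toSpanSingleton ℝ (angularVector p) : ℝ →L[ℝ] ℂ) :=
    HasMFDerivAt.comp (0 : ℝ) h1 (hasMFDerivAt_rotate p)
  have h2' : HasFDerivAt _ (dCoord s p ∘L ContinuousLinearMap.toSpanSingleton ℝ (angularVector p)) 0 :=
    hasMFDerivAt_iff_hasFDerivAt.1 h2
  have h3 := h2'.hasDerivAt
  have h4 : HasDerivAt (fun t : ℝ => (fiberCoord s p : ℂ) * Complex.exp (t * I))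
      (fiberCoord s p * (Complex.exp ((0 : ℝ) * I) * (1 * I))) 0 :=
    ((Complex.ofRealCLM.hasDerivAt.mul_const I).cexp.const_mul _)
  have h5 := h3.unique (h4.congr_of_eventuallyEq (Filter.Eventually.of_forall fun t => by
    change ((fiberCoord s (p.rotate (Circle.exp t)) : Circle) : ℂ) = _
    rw [fiberCoord_rotate, Circle.coe_mul, Circle.coe_exp]))
  have h6 : dCoord s p (angularVector p) = I * fiberCoord s p := by
    have h7 : dCoord s p ((1 : ℝ) • angularVector p) = _ := h5
    rw [one_smul] at h7
    rw [h7]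
    simp [mul_comm]
  have h7 := angleForm_eq h (angularVector p)
  rw [h6, inv_mul_cancel₀ (mul_ne_zero Complex.I_ne_zero (Circle.coe_ne_zero _))] at h7
  exact_mod_cast h7

/-- A vertical vector on which a linear form `β` with `β(∂/∂θ) ≠ 0` vanishes is zero. -/
lemma eq_zero_of_dProj (p : CircleBundle E χ) {β : CircleModel E →L[ℝ] ℝ}
    (hβ : β (angularVector p) ≠ 0) {w : CircleModel E} (h1 : dProj p w = 0) (h2 : β w = 0) :
    w = 0 := by
  have e1 := dProj_angularVector p
  rw [dProj_eq] at h1 e1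
  have e2 : (angularVector p).2 ≠ 0 := fun h => hβ (by
    rw [show angularVector p = 0 from Prod.ext e1 h, map_zero])
  obtain ⟨r, hr⟩ := exists_eq_smul_of_ne_zero e2 w.2
  have e3 : w = r • angularVector p := Prod.ext (by
    change w.1 = r • (angularVector p).1
    rw [show w.1 = 0 from h1, show (angularVector p).1 = 0 from e1, smul_zero]) hr
  rw [e3, map_smul, smul_eq_mul] at h2
  rw [e3, (mul_eq_zero.1 h2).resolve_right hβ, zero_smul]

/-- The inverse of the chart of the circle around the fibre coordinate of `p`. -/
def circleChartInv (p : CircleBundle E χ) (t : EuclideanSpace ℝ (Fin 1)) : ℂ :=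
  ((extChartAt (𝓡 1) (fiberCoord (𝐬 p.proj) p)).symm t : Circle)

/-- The form `dθ` in the chart of the circle. -/
def chartAngle (p : CircleBundle E χ) (t : EuclideanSpace ℝ (Fin 1)) :
    EuclideanSpace ℝ (Fin 1) →L[ℝ] ℝ :=
  Complex.reCLM ∘L ((I * circleChartInv p t)⁻¹ • fderiv ℝ (circleChartInv p) t)

section Chart
variable {y : CircleModel E} (hy : y ∈ (extChartAt 𝓘(ℝ, CircleModel E) p).target)
include hy

lemma dProj_chartInvDeriv : dProj ((𝐞 p).symm y) ∘L chartInvDeriv p y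
    = chartInvDeriv p.proj y.1 ∘L ContinuousLinearMap.fst ℝ _ _ := by
  have := isManifold_real_of_complex (F := E) (X := Gc ⧸ P) hq.isManifold
  have h1 := HasMFDerivAt.comp y (hasMFDerivAt_proj _) (hasMFDerivAt_extChartAt_symm hy)
  have h2 := HasMFDerivAt.comp y (hasMFDerivAt_extChartAt_symm (M := Gc ⧸ P)
    (mem_extChartAt_target.1 hy).1.1) (hasFDerivAt_fst (𝕜 := ℝ) (p := y)).hasMFDerivAt
  exact hasMFDerivAt_unique h1 h2

lemma contDiffAt_circleChartInv : ContDiffAt ℝ ∞ (circleChartInv p) y.2 := by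
  have h := (mem_extChartAt_target.1 hy).2
  exact ((contMDiff_coe_circle _).comp y.2 ((contMDiffOn_extChartAt_symm (n := ∞) _ y.2 h).contMDiffAt
    ((isOpen_extChartAt_target _).mem_nhds h))).contDiffAt

lemma dCoord_chartInvDeriv : dCoord (𝐬 p.proj)
      ((𝐞 p).symm y) ∘L chartInvDeriv p y
    = fderiv ℝ (circleChartInv p) y.2 ∘L ContinuousLinearMap.snd ℝ _ _ := by
  have h0 := (mem_extChartAt_target.1 hy).1.2
  have h1 : HasMFDerivAt 𝐈 𝓘(ℝ, ℂ) _ y (dCoord (𝐬 p.proj)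
      ((𝐞 p).symm y) ∘L chartInvDeriv p y : CircleModel E →L[ℝ] ℂ) :=
    HasMFDerivAt.comp y (hasMFDerivAt_coord (χ := χ) h0) (hasMFDerivAt_extChartAt_symm hy)
  have h1' : HasFDerivAt _ (dCoord (𝐬 p.proj)
      ((𝐞 p).symm y) ∘L chartInvDeriv p y) y :=
    hasMFDerivAt_iff_hasFDerivAt.1 h1
  refine h1'.unique ((((contDiffAt_circleChartInv hy).differentiableAt (by simp)).hasFDerivAt.comp y
      hasFDerivAt_snd).congr_of_eventuallyEq ?_)
  filter_upwards [(isOpen_extChartAt_target p).mem_nhds hy] with z hz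
  exact congrArg Subtype.val (fiberCoord_extChartAt_symm (mem_extChartAt_target.1 hz).1.2)

lemma angleForm_chartInvDeriv : angleForm (𝐬 p.proj)
      ((𝐞 p).symm y) ∘L chartInvDeriv p y
    = chartAngle p y.2 ∘L ContinuousLinearMap.snd ℝ _ _ := by
  refine ContinuousLinearMap.ext fun u => ?_
  have h1 := DFunLike.congr_fun (dCoord_chartInvDeriv hy) u
  have h2 : (fiberCoord (𝐬 p.proj) ((𝐞 p).symm y) : ℂ)
      = circleChartInv p y.2 :=
    congrArg Subtype.val (fiberCoord_extChartAt_symm (mem_extChartAt_target.1 hy).1.2)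
  change ((I * _)⁻¹ * _ : ℂ).re = ((I * _)⁻¹ * _ : ℂ).re
  rw [h2]
  exact congrArg (fun z => ((I * circleChartInv p y.2)⁻¹ * z).re) h1

lemma contDiffAt_chartAngle : ContDiffAt ℝ ∞ (chartAngle p) y.2 := by
  have h := contDiffAt_circleChartInv hy
  have h0 : I * circleChartInv p y.2 ≠ 0 := mul_ne_zero Complex.I_ne_zero (Circle.coe_ne_zero _)
  exact contDiffAt_const.clm_comp (((contDiffAt_const.mul h).inv h0).smul
    (h.fderiv_right (m := ∞) (by simp)))
end Chart

end CircleBundle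

/-! ### The Sasaki structure of the circle bundle -/

/-- The contact form `dθ_U - c d log ‖s_U v‖² ∘ J`, for the chosen section at the base point. -/
def contactForm (R : Gc → V →L[ℂ] V) (v : V) (c : ℝ) (p : CircleBundle E χ) :
    CircleModel E →L[ℝ] ℝ :=
  contactAt R v c (𝐬 p.proj) p

/-- The composition of the differential of the projection, the complex structure of the base, and
an arbitrary lift to the total space. -/
def liftComplex (p : CircleBundle E χ) : CircleModel E →L[ℝ] CircleModel E :=
  ContinuousLinearMap.inl ℝ _ _ ∘L 𝐉 ∘L dProj p

/-- The horizontal lift of the complex structure of the base. -/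
def sasakiEndo (R : Gc → V →L[ℂ] V) (v : V) (c : ℝ) (p : CircleBundle E χ) :
    CircleModel E →L[ℝ] CircleModel E :=
  liftComplex p - (contactForm R v c p ∘L liftComplex p).smulRight (angularVector p)

/-- The metric `π* g + κ² η ⊗ η`, where `g` is `1 / (n + 1)` times the invariant Kähler metric. -/
def sasakiMetric (dR : 𝔼 →L[ℂ] V →L[ℂ] V) (R : Gc → V →L[ℂ] V) (v : V) (c κ : ℝ)
    (p : CircleBundle E χ) : CircleModel E →L[ℝ] CircleModel E →L[ℝ] ℝ :=
  ((finrank ℂ E + 1 : ℝ)⁻¹ • flagForm E P dR R v p.proj).bilinearComp (dProj p) (dProj p)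
    + (κ • contactForm R v c p).smulRight (κ • contactForm R v c p)

lemma sasakiMetric_apply (c κ : ℝ) (p : CircleBundle E χ) (u w : CircleModel E) :
    sasakiMetric dR R v c κ p u w = (finrank ℂ E + 1 : ℝ)⁻¹ *
      flagForm E P dR R v p.proj (dProj p u) (dProj p w)
        + κ * contactForm R v c p u * (κ * contactForm R v c p w) := rfl

lemma contactForm_angularVector (c : ℝ) (p : CircleBundle E χ) :
    contactForm R v c p (angularVector p) = 1 := by
  change angleForm _ p (angularVector p) - c * dLogNorm R v _ p.proj (𝐉 (dProj p (angularVector p))) = 1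
  rw [angularForm_angularVector (mem_sectionAt _), dProj_angularVector, map_zero, map_zero, mul_zero,
    sub_zero]

lemma dProj_sasakiEndo (c : ℝ) (p : CircleBundle E χ) (u : CircleModel E) :
    dProj p (sasakiEndo R v c p u) = 𝐉 (dProj p u) := by
  change dProj p (liftComplex p u - contactForm R v c p (liftComplex p u) • angularVector p) = _
  rw [map_sub, map_smul, dProj_angularVector, smul_zero, sub_zero]
  exact (DFunLike.congr_fun (dProj_eq p) (liftComplex p u) :)

lemma contactForm_sasakiEndo (c : ℝ) (p : CircleBundle E χ) (u : CircleModel E) :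
    contactForm R v c p (sasakiEndo R v c p u) = 0 := by
  change contactForm R v c p (liftComplex p u
    - contactForm R v c p (liftComplex p u) • angularVector p) = _
  rw [map_sub, map_smul, contactForm_angularVector, smul_eq_mul, mul_one, sub_self]

/-- The contact form in the chart around `p`: `κ (dθ - c d log ‖s v‖² ∘ J)`. -/
def chartContact (R : Gc → V →L[ℂ] V) (v : V) (c κ : ℝ) (p : CircleBundle E χ)
    (y : CircleModel E) : CircleModel E →L[ℝ] ℝ :=
  κ • (chartAngle p y.2 ∘L ContinuousLinearMap.snd ℝ _ _
    - c • (fderiv ℝ (fun z => logNorm R v (𝐬 p.proj)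
      ((𝐱 p.proj).symm z)) y.1 ∘L 𝐉 ∘L ContinuousLinearMap.fst ℝ _ _))

/-- The domain in the model space `E` of the local formulas around `p`. -/
def baseDomain (p : CircleBundle E χ) : Set E :=
  (𝐱 p.proj).target ∩ (𝐱 p.proj).symm ⁻¹' (𝐬 p.proj).U

lemma isOpen_baseDomain (p : CircleBundle E χ) : IsOpen (baseDomain p) :=
  (continuousOn_extChartAt_symm p.proj).isOpen_inter_preimage (isOpen_extChartAt_target _)
    (LocalSection.isOpen _)

namespace IsFlagModel
include hm

lemma flagForm_comm (x : Gc ⧸ P) (u w : E) :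
    flagForm E P dR R v x u w = flagForm E P dR R v x w u := by
  obtain ⟨g, hg⟩ := QuotientGroup.mk_surjective x
  rw [hm.flagForm_eq hg, hm.flagForm_eq hg, isoForm_apply, isoForm_apply, fubiniStudy_comm]

lemma flagForm_pos (x : Gc ⧸ P) {u : E} (hu : u ≠ 0) : 0 < flagForm E P dR R v x u u := by
  obtain ⟨g, hg⟩ := QuotientGroup.mk_surjective x
  rw [hm.flagForm_eq hg]
  refine lt_of_le_of_ne ?_ fun h => hu ?_
  · rw [isoForm_apply]
    exact fubiniStudy_self_nonneg _ _
  · have h1 := hm.isoForm_self_eq_zero g h.symm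
    rw [← smulDeriv_inv_apply 𝔼 g⁻¹ x u, h1, map_zero]

lemma sasakiMetric_comm (c κ : ℝ) (p : CircleBundle E χ) (u w : CircleModel E) :
    sasakiMetric dR R v c κ p u w = sasakiMetric dR R v c κ p w u := by
  rw [sasakiMetric_apply, sasakiMetric_apply, hm.flagForm_comm]
  ring

lemma sasakiMetric_pos (c : ℝ) {κ : ℝ} (hκ : κ ≠ 0) (p : CircleBundle E χ) {u : CircleModel E}
    (hu : u ≠ 0) : 0 < sasakiMetric dR R v c κ p u u := by
  rw [sasakiMetric_apply]
  by_cases h : dProj p u = 0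
  · have h1 : contactForm R v c p u ≠ 0 := fun h1 => hu (eq_zero_of_dProj p
      (by rw [contactForm_angularVector]; exact one_ne_zero) h h1)
    rw [h, map_zero, mul_zero, zero_add]
    exact mul_self_pos.2 (mul_ne_zero hκ h1)
  · exact add_pos_of_pos_of_nonneg (mul_pos (by positivity) (hm.flagForm_pos _ h)) (mul_self_nonneg _)

section Chart
variable {y : CircleModel E} (hy : y ∈ (extChartAt 𝓘(ℝ, CircleModel E) p).target)
include hy

lemma chartInvDeriv_complexStructure (u : E) :
    chartInvDeriv p.proj y.1 (𝐉 u) = 𝐉 (chartInvDeriv p.proj y.1 u) := by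
  have := hq.isManifold
  have h1 := (mem_extChartAt_target.1 hy).1.1
  have h2 := (((contMDiffOn_extChartAt_symm (I := 𝓘(ℂ, E)) (n := ω) p.proj y.1 h1).contMDiffAt
    ((isOpen_extChartAt_target p.proj).mem_nhds h1)).mdifferentiableAt (by simp)).hasMFDerivAt
  rw [chartInvDeriv_eq 𝔼 h2]
  exact (map_smul (_ : E →L[ℂ] E) I u)

lemma contactAt_chartInvDeriv (c : ℝ) : contactAt R v c (𝐬 p.proj)
      ((𝐞 p).symm y) ∘L chartInvDeriv p y
    = chartContact R v c 1 p y := by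
  have h0 := (mem_extChartAt_target.1 hy).1
  have := isManifold_real_of_complex (F := E) (X := Gc ⧸ P) hq.isManifold
  have h1 : HasMFDerivAt 𝓘(ℝ, E) 𝓘(ℝ, ℝ) _ y.1
    (dLogNorm R v _ ((𝐱 p.proj).symm y.1) ∘L chartInvDeriv p.proj y.1 : E →L[ℝ] ℝ) :=
    HasMFDerivAt.comp y.1 (hm.hasMFDerivAt_logNorm _ h0.2)
    (hasMFDerivAt_extChartAt_symm (M := Gc ⧸ P) h0.1)
  have h2 : HasFDerivAt (fun z => logNorm R v (𝐬 p.proj)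
      ((𝐱 p.proj).symm z)) (dLogNorm R v _ ((𝐱 p.proj).symm y.1)
        ∘L chartInvDeriv p.proj y.1) y.1 := hasMFDerivAt_iff_hasFDerivAt.1 h1
  refine ContinuousLinearMap.ext fun u => ?_
  have h3 := DFunLike.congr_fun (angleForm_chartInvDeriv hy) u
  have h4 := DFunLike.congr_fun (dProj_chartInvDeriv hy) u
  have h5 : dProj ((𝐞 p).symm y) (chartInvDeriv p y u) = chartInvDeriv p.proj y.1 u.1 := h4
  rw [chartContact, h2.fderiv, one_smul]
  change angleForm _ _ (chartInvDeriv p y u) - c * dLogNorm R v _ _ (𝐉 (dProj _ (chartInvDeriv p y u)))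
    = chartAngle p y.2 u.2 - c * dLogNorm R v _ _ (chartInvDeriv p.proj y.1 (𝐉 u.1))
  rw [h5, hm.chartInvDeriv_complexStructure hy]
  exact congrArg (· - _) h3

end Chart

lemma contDiffAt_logNorm_chart {p : CircleBundle E χ} {z : E} (hz : z ∈ baseDomain p) :
    ContDiffAt ℝ ∞ (fun z => logNorm R v (𝐬 p.proj) ((𝐱 p.proj).symm z)) z := by
  have h1 : ContDiffAt ℂ ω (fun z => R ((𝐬 p.proj).s
      ((𝐱 p.proj).symm z)) v) z := hm.contDiffAt_section_chart _ p.proj hz.1 hz.2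
    (f := fun g => R g v) (hm.contMDiff.clm_apply contMDiff_const)
  have h2 := (h1.restrict_scalars ℝ).of_le (m := ∞) (by simp)
  have h3 := (contDiffAt_const (c := reInner V)).clm_apply h2 |>.clm_apply h2
  have h4 : ∀ z, (reInner V (R ((𝐬 p.proj).s ((𝐱 p.proj).symm z)) v)
      (R ((𝐬 p.proj).s ((𝐱 p.proj).symm z)) v))
      = ‖R ((𝐬 p.proj).s ((𝐱 p.proj).symm z)) v‖ ^ 2 :=
    fun z => reInner_self _
  simp only [h4] at h3
  exact h3.log (pow_ne_zero _ (norm_ne_zero_iff.2 (hm.apply_ne_zero _)))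

lemma contDiffAt_chartContact (c κ : ℝ) {p : CircleBundle E χ} {y : CircleModel E}
    (hy : y ∈ (𝐞 p).target) :
    ContDiffAt ℝ ∞ (chartContact R v c κ p) y := by
  have h1 := ((hm.contDiffAt_logNorm_chart (mem_extChartAt_target.1 hy).1).fderiv_right (m := ∞)
    (by simp)).comp y contDiffAt_fst
  have h2 := (contDiffAt_chartAngle hy).comp y contDiffAt_snd
  exact ((h2.clm_comp contDiffAt_const).sub ((h1.clm_comp contDiffAt_const).const_smul c)).const_smul κ

/-- The curvature of the contact form. -/
lemma fderiv_chartContact_sub (c κ : ℝ) {p : CircleBundle E χ} {y : CircleModel E}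
    (hy : y ∈ (𝐞 p).target) (u w : CircleModel E) :
    fderiv ℝ (chartContact R v c κ p) y u w - fderiv ℝ (chartContact R v c κ p) y w u
      = κ * c * leviForm (fun z => logNorm R v (𝐬 p.proj)
      ((𝐱 p.proj).symm z)) y.1 (𝐉 u.1) w.1 := by
  set F : E → ℝ := fun z => logNorm R v (𝐬 p.proj) ((𝐱 p.proj).symm z) with hF
  have h0 := hm.contDiffAt_logNorm_chart (mem_extChartAt_target.1 hy).1
  have h1 : HasFDerivAt (fun y : CircleModel E => fderiv ℝ F y.1)
      (fderiv ℝ (fderiv ℝ F) y.1 ∘L ContinuousLinearMap.fst ℝ _ _) y :=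
    ((h0.fderiv_right (m := ∞) (by simp)).differentiableAt (by simp)).hasFDerivAt.comp y hasFDerivAt_fst
  have h2 : HasFDerivAt (fun y : CircleModel E => chartAngle p y.2)
      (fderiv ℝ (chartAngle p) y.2 ∘L ContinuousLinearMap.snd ℝ _ _) y :=
    ((contDiffAt_chartAngle hy).differentiableAt (by simp)).hasFDerivAt.comp y hasFDerivAt_snd
  have h3 := (((h2.clm_comp (hasFDerivAt_const (ContinuousLinearMap.snd ℝ E _) y)).sub
    ((h1.clm_comp (hasFDerivAt_const (𝐉 ∘L ContinuousLinearMap.fst ℝ E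
      (EuclideanSpace ℝ (Fin 1))) y)).const_smul c)).const_smul κ)
  have h4 : ∀ u w : CircleModel E, fderiv ℝ (chartContact R v c κ p) y u w
      = κ * (fderiv ℝ (chartAngle p) y.2 u.2 w.2 - c * fderiv ℝ (fderiv ℝ F) y.1 u.1 (𝐉 w.1)) := by
    intro u w
    have h5 : fderiv ℝ (chartContact R v c κ p) y = _ := h3.fderiv
    rw [h5]
    simp
  have h5 : ∀ (b : EuclideanSpace ℝ (Fin 1) →L[ℝ] EuclideanSpace ℝ (Fin 1) →L[ℝ] ℝ) (s t), b s t = b t s := by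
    intro b s t
    by_cases hs : s = 0
    · simp [hs]
    · obtain ⟨r, rfl⟩ := exists_eq_smul_of_ne_zero hs t
      simp
  have h6 := (h0.isSymmSndFDerivAt two_le_infty).eq
  rw [h4, h4, leviForm_apply, complexStructure_sq, h5 _ u.2 w.2, h6 u.1 (𝐉 w.1), h6 w.1 (𝐉 u.1), map_neg]
  rw [h6 (𝐉 u.1) w.1, neg_apply, h6 u.1 (𝐉 w.1)]
  ring

lemma leviForm_logNorm_chart {p : CircleBundle E χ} {z : E} (hz : z ∈ baseDomain p) (u w : E) :
    leviForm (fun z => logNorm R v (𝐬 p.proj) ((𝐱 p.proj).symm z)) z u w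
      = 4 * pullFubiniStudy (fun z => R ((𝐬 p.proj).s ((𝐱 p.proj).symm z)) v) z u w :=
  leviForm_log_norm_sq (isOpen_baseDomain p) (fun _ hz => hm.contDiffAt_section_chart _ p.proj hz.1
    hz.2 (f := fun g => R g v) (hm.contMDiff.clm_apply contMDiff_const))
    (fun _ _ => hm.apply_ne_zero _) hz u w

include hG hu in
/-- The circle bundle is locally modelled on the Kähler metric with potential
`log ‖s_U v‖² / (4 (n + 1))`. -/
lemma isLocalModel [PreconnectedSpace Gc] {k : ℕ} (hχ : χ.IsCanonicalRoot (E := E) k) {ℓ : ℕ}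
    {κ : ℝ} (hκ : κ * (ℓ / (2 * k)) = (2 * (finrank ℂ E + 1 : ℝ))⁻¹)
    (p : CircleBundle E (χ.pow ℓ)) :
    IsLocalModel (M := CircleBundle E (χ.pow ℓ)) (sasakiMetric dR R v (ℓ / (2 * k)) κ)
      (sasakiEndo R v (ℓ / (2 * k))) (fun q => κ⁻¹ • angularVector q)
      (fun q => κ • contactForm R v (ℓ / (2 * k)) q) p
      (fun z => (finrank ℂ E + 1 : ℝ)⁻¹ • pullFubiniStudy (fun z =>
        R ((𝐬 p.proj).s ((𝐱 p.proj).symm z)) v) z)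
      (baseDomain p) (chartContact R v (ℓ / (2 * k)) κ p)
      (𝐞 p).target := by
  set c : ℝ := ℓ / (2 * k)
  set σ : E → V := fun z => R ((𝐬 p.proj).s ((𝐱 p.proj).symm z)) v
  set T := (𝐞 p).target
  have hn : (0 : ℝ) < finrank ℂ E + 1 := by positivity
  have hκ0 : κ ≠ 0 := fun h => by
    rw [h, zero_mul] at hκ
    exact (inv_pos.2 (mul_pos two_pos hn)).ne hκ
  have hlevi : ∀ z ∈ baseDomain p, ∀ u w, leviForm (fun z => logNorm R v (𝐬 p.proj)
      ((𝐱 p.proj).symm z)) z u w = 4 * pullFubiniStudy σ z u w :=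
    fun z hz => hm.leviForm_logNorm_chart hz
  have hA : ∀ z ∈ baseDomain p, Function.Injective (chartInvDeriv p.proj z) ∧ ∀ u w,
      flagForm E P dR R v ((𝐱 p.proj).symm z) (chartInvDeriv p.proj z u)
        (chartInvDeriv p.proj z w) = pullFubiniStudy σ z u w := fun z hz => by
    have := hq.isManifold
    have h1 := (((contMDiffOn_extChartAt_symm (I := 𝓘(ℂ, E)) (n := ω) p.proj z hz.1).contMDiffAt
      ((isOpen_extChartAt_target p.proj).mem_nhds hz.1)).mdifferentiableAt (by simp)).hasMFDerivAt
    rw [chartInvDeriv_eq 𝔼 h1]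
    exact ⟨chartInvDeriv_injective (𝔼 := 𝔼) hz.1 h1, hm.flagForm_chart _ p.proj hz.2 h1⟩
  -- the contact form, and the differential of the projection, in the chart
  have hform : ∀ y ∈ T, ∀ u, κ * contactForm R v c ((𝐞 p).symm y)
      (chartInvDeriv p y u) = chartContact R v c κ p y u := fun y hy u => by
    have h1 : contactForm R v c ((𝐞 p).symm y)
      = contactAt R v c (𝐬 p.proj) ((𝐞 p).symm y) :=
      hm.contactAt_eq hG hu hχ (mem_extChartAt_target.1 hy).1.2 (mem_sectionAt _)
    have h2 := congrArg (fun l : CircleModel E →L[ℝ] ℝ => κ * l u) (hm.contactAt_chartInvDeriv hy c)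
    rw [h1]
    refine h2.trans ?_
    change κ * ((1 : ℝ) * _) = κ * _
    rw [one_mul]
  have hproj : ∀ y ∈ T, ∀ u, dProj ((𝐞 p).symm y) (chartInvDeriv p y u)
      = chartInvDeriv p.proj y.1 u.1 := fun y hy u =>
    DFunLike.congr_fun (dProj_chartInvDeriv hy) u
  have hinj : ∀ y ∈ T, Function.Injective (chartInvDeriv p.proj y.1) := fun y hy =>
    (hA y.1 (mem_extChartAt_target.1 hy).1).1
  have hfield : ∀ y ∈ T, chartInvDeriv p y (chartField (M := CircleBundle E (χ.pow ℓ))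
      (fun q => κ⁻¹ • angularVector q) p y) = κ⁻¹ • angularVector ((𝐞 p).symm y) :=
    fun y hy => chartInvDeriv_chartField _ hy
  have hendo : ∀ y ∈ T, ∀ u, chartInvDeriv p y (chartEndo (sasakiEndo R v c) p y u)
      = sasakiEndo R v c ((𝐞 p).symm y) (chartInvDeriv p y u) :=
    fun y hy u => congrArg (fun l : CircleModel E →L[ℝ] CircleModel E =>
      l (sasakiEndo R v c ((𝐞 p).symm y) (chartInvDeriv p y u)))
      (chartInvDeriv_comp hy)
  have hfst : ∀ y ∈ T, (chartField (M := CircleBundle E (χ.pow ℓ))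
      (fun q => κ⁻¹ • angularVector q) p y).1 = 0 := fun y hy => hinj y hy (by
    refine (hproj y hy _).symm.trans ((congrArg (dProj _) (hfield y hy)).trans ?_)
    rw [map_smul, dProj_angularVector, smul_zero, map_zero])
  have hone : ∀ y ∈ T, chartContact R v c κ p y (chartField (M := CircleBundle E (χ.pow ℓ))
      (fun q => κ⁻¹ • angularVector q) p y) = 1 := fun y hy => by
    refine (hform y hy _).symm.trans ((congrArg (κ * contactForm R v c _ ·) (hfield y hy)).trans ?_)
    rw [map_smul, contactForm_angularVector, smul_eq_mul, mul_one, mul_inv_cancel₀ hκ0]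
  exact {
    kaehler := by
      refine IsKaehlerOn.of_potential (c := (4 * (finrank ℂ E + 1 : ℝ))⁻¹) (isOpen_baseDomain p)
        (fun z hz => hm.contDiffAt_logNorm_chart hz) (fun z hz u w => ?_) fun z hz u hu => ?_
      · rw [hlevi z hz]
        change (finrank ℂ E + 1 : ℝ)⁻¹ * (pullFubiniStudy σ z u w) = _
        field_simp
      · change 0 < (finrank ℂ E + 1 : ℝ)⁻¹ * pullFubiniStudy σ z u u
        rw [← (hA z hz).2]
        exact mul_pos (inv_pos.2 hn) (hm.flagForm_pos _ fun h => hu ((hA z hz).1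
          (h.trans (map_zero (chartInvDeriv p.proj z)).symm)))
    conn := {
      isOpen := isOpen_extChartAt_target p
      fst_mem := fun y hy => (mem_extChartAt_target.1 hy).1
      smooth := fun y hy => hm.contDiffAt_chartContact c κ hy
      curv := fun y hy u w => by
        rw [hm.fderiv_chartContact_sub c κ hy, hlevi _ (mem_extChartAt_target.1 hy).1, hκ]
        change _ = 2 * ((finrank ℂ E + 1 : ℝ)⁻¹ * _)
        field_simp
        norm_num
      exists_vertical := fun y hy => ⟨_, hfst y hy, hone y hy⟩
      eq_zero := fun y hy u h1 h2 => by
        have h3 : chartInvDeriv p y u = 0 := eq_zero_of_dProj _ (β := contactForm R v c _)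
          (by rw [contactForm_angularVector]; exact one_ne_zero)
          (by rw [hproj y hy, h1, map_zero])
          ((mul_eq_zero.1 ((hform y hy u).trans h2)).resolve_left hκ0)
        have h4 := DFunLike.congr_fun (chartDeriv_comp hy) u
        exact h4.symm.trans ((congrArg _ h3).trans (map_zero (chartDeriv p _))) }
    mem := _root_.mem_extChartAt_target p
    subset := subset_rfl
    form := fun y hy => ContinuousLinearMap.ext fun u => hform y hy u
    metric := fun y hy => ContinuousLinearMap.ext fun u => ContinuousLinearMap.ext fun w => by
      rw [liftMetric_apply, ← hform y hy, ← hform y hy]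
      change sasakiMetric dR R v c κ ((𝐞 p).symm y)
        (chartInvDeriv p y u) (chartInvDeriv p y w) = (finrank ℂ E + 1 : ℝ)⁻¹ *
          pullFubiniStudy σ y.1 u.1 w.1 + _
      rw [sasakiMetric_apply, hproj y hy, hproj y hy, ← (hA y.1 (mem_extChartAt_target.1 hy).1).2]
      rfl
    endo_fst := fun y hy u => hinj y hy (by
      rw [← hproj y hy, hendo y hy, dProj_sasakiEndo, hproj y hy,
        hm.chartInvDeriv_complexStructure hy])
    form_endo := fun y hy u => by rw [← hform y hy, hendo y hy, contactForm_sasakiEndo, mul_zero]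
    field_fst := hfst
    form_field := hone }

end IsFlagModel

/-! ### The Sasaki–Einstein structure -/

lemma isVonNBounded_of_pos {W : Type*} [NormedAddCommGroup W] [NormedSpace ℝ W]
    [FiniteDimensional ℝ W] [Nontrivial W] {b : W →L[ℝ] W →L[ℝ] ℝ} (h : ∀ u, u ≠ 0 → 0 < b u u) :
    Bornology.IsVonNBounded ℝ {u | b u u < 1} := by
  have hc : Continuous fun u => b u u := b.continuous.clm_apply continuous_id
  obtain ⟨u₀, h0, hmin⟩ := (isCompact_sphere (0 : W) 1).exists_isMinOn
    (NormedSpace.sphere_nonempty.2 zero_le_one) hc.continuousOn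
  have hpos := h u₀ (Metric.ne_of_mem_sphere h0 one_ne_zero)
  refine (NormedSpace.isVonNBounded_iff ℝ).2 (isBounded_iff_forall_norm_le.2
    ⟨Real.sqrt (b u₀ u₀)⁻¹, fun u hu => ?_⟩)
  refine Real.le_sqrt_of_sq_le ?_
  rw [← one_div, le_div_iff₀ hpos]
  by_cases hu0 : u = 0
  · simp [hu0]
  have hn : ‖u‖ ≠ 0 := norm_ne_zero_iff.2 hu0
  have h1 : b u₀ u₀ ≤ b (‖u‖⁻¹ • u) (‖u‖⁻¹ • u) := hmin (by simp [norm_smul, hn])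
  rw [map_smul, map_smul, smul_apply, smul_eq_mul, smul_eq_mul] at h1
  have h2 := mul_le_mul_of_nonneg_left h1 (sq_nonneg ‖u‖)
  have h3 : ‖u‖ ^ 2 * (‖u‖⁻¹ * (‖u‖⁻¹ * b u u)) = b u u := by field_simp
  exact (h2.trans_eq h3).trans (le_of_lt hu)

lemma gramDet_toBilin_smul {E : Type*} [NormedAddCommGroup E] [NormedSpace ℝ E]
    [FiniteDimensional ℝ E] (r : ℝ) (B : E →L[ℝ] E →L[ℝ] ℝ) :
    gramDet (toBilin (r • B)) = r ^ finrank ℝ E * gramDet (toBilin B) := by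
  rw [gramDet_toBilin, gramDet_toBilin]
  exact (Matrix.det_smul (Matrix.of fun i j => B (finBasis ℝ E i) (finBasis ℝ E j)) r).trans
    (by rw [Fintype.card_fin])

namespace IsFlagModel
variable [PreconnectedSpace Gc] {k : ℕ} (hχ : χ.IsCanonicalRoot (E := E) k) {ℓ : ℕ} {κ : ℝ}
  (hκ : κ * (ℓ / (2 * k)) = (2 * (finrank ℂ E + 1 : ℝ))⁻¹)
include hκ

lemma factor_ne_zero : κ ≠ 0 := fun h => by
  rw [h, zero_mul] at hκ
  exact (inv_pos.2 (by positivity)).ne hκ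

/-- The Sasaki structure `(g, φ, κ⁻¹ ∂/∂θ, κ η)` of the circle bundle. -/
def sasakiStructure : StructureTensors 𝐈 (CircleBundle E (χ.pow ℓ)) where
  g := {
    inner := sasakiMetric dR R v (ℓ / (2 * k)) κ
    symm := hm.sasakiMetric_comm _ κ
    pos := fun p _ hu => hm.sasakiMetric_pos _ (factor_ne_zero hκ) p hu
    isVonNBounded := fun p => isVonNBounded_of_pos fun _ hu =>
      hm.sasakiMetric_pos (ℓ / (2 * k)) (factor_ne_zero hκ) p hu
    contMDiff := contMDiff_bilinear fun p => (hm.isLocalModel hG hu hχ hκ p).contDiffAt_metric }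
  φ := sasakiEndo R v (ℓ / (2 * k))
  ξ := fun p => κ⁻¹ • angularVector p
  η := fun p => κ • contactForm R v (ℓ / (2 * k)) p
  smooth_φ := contMDiff_endo fun p => (hm.isLocalModel hG hu hχ hκ p).contDiffAt_endo
  smooth_ξ := isSmoothField_of_chart fun p => (hm.isLocalModel hG hu hχ hκ p).contDiffAt_field
  smooth_η := contMDiff_oneForm fun p => (hm.isLocalModel hG hu hχ hκ p).contDiffAt_form

lemma isSasakiEinstein_sasakiStructure :
    IsSasakiEinstein (finrank ℂ E) (hm.sasakiStructure hG hu hχ hκ) where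
  finrank_eq := by
    have h1 : finrank ℝ E = 2 * finrank ℂ E := finrank_real_of_complex E
    rw [Module.finrank_prod, h1, finrank_euclideanSpace_fin]
  contact p := (hm.isLocalModel hG hu hχ hκ p).exists_wedgePow_ne_zero
  eta_xi p := by
    refine (map_smul (κ • contactForm R v _ p) κ⁻¹ (angularVector p)).trans ?_
    rw [smul_apply, contactForm_angularVector, smul_eq_mul, smul_eq_mul, mul_one,
      inv_mul_cancel₀ (factor_ne_zero hκ)]
  phi_phi p u := (hm.isLocalModel hG hu hχ hκ p).phi_phi u
  metric_phi p u w := (hm.isLocalModel hG hu hχ hκ p).metric_phi u w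
  extD_eta p u w := (hm.isLocalModel hG hu hχ hκ p).extD_eta u w
  killing X Y hX hY p := (hm.isLocalModel hG hu hχ hκ p).killing hX hY
  normal X Y hX hY p := (hm.isLocalModel hG hu hχ hκ p).normal hX hY
  einstein := by
    refine ⟨finrank ℝ E, fun p u w => ?_⟩
    have hn : (0 : ℝ) < finrank ℂ E + 1 := by positivity
    obtain ⟨C, j, hj⟩ := hm.exists_gramDet_eq hG hu (𝐬 p.proj) p.proj
    refine (hm.isLocalModel hG hu hχ hκ p).ricci_eq (c := 4 * (finrank ℂ E + 1 : ℝ))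
      (C := (finrank ℂ E + 1 : ℝ)⁻¹ ^ finrank ℝ E * C) (j := j)
      (fun z hz => hm.contDiffAt_logNorm_chart hz)
      (fun z hz => (hj z hz.1 hz.2).1) (fun z hz => (hj z hz.1 hz.2).2.1) (fun z hz => ?_)
      (fun z hz a b => ?_) ?_ u w
    · rw [gramDet_toBilin_smul]
      have h1 := (hj z hz.1 hz.2).2.2
      refine (congrArg ((finrank ℂ E + 1 : ℝ)⁻¹ ^ finrank ℝ E * ·) h1).trans ?_
      rw [← mul_assoc, ← mul_assoc]
      rfl
    · refine (hm.leviForm_logNorm_chart hz a b).trans ?_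
      change _ = 4 * (finrank ℂ E + 1 : ℝ) * ((finrank ℂ E + 1 : ℝ)⁻¹ * pullFubiniStudy _ z a b)
      field_simp
    · rw [show finrank ℝ E = 2 * finrank ℂ E from finrank_real_of_complex E]
      push_cast
      ring

/-- The metric is determined by the contact form and `φ`, because `dη = 2 g(φ ·, ·)`. -/
lemma inner_sasakiStructure (p : CircleBundle E (χ.pow ℓ)) (u w : CircleModel E) :
    (hm.sasakiStructure hG hu hχ hκ).g.inner p u w = κ * (1 / 2 * extD 𝐈
        (contactForm R v (ℓ / (2 * k)) : ∀ _ : CircleBundle E (χ.pow ℓ), _) p u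
          ((hm.sasakiStructure hG hu hχ hκ).φ p w)
      + κ * (contactForm R v (ℓ / (2 * k)) p u * contactForm R v (ℓ / (2 * k)) p w)) := by
  have hM := hm.isLocalModel hG hu hχ hκ p
  let η' : ∀ p : CircleBundle E (χ.pow ℓ), TangentSpace 𝐈 p →L[ℝ] ℝ :=
    fun p => κ • contactForm R v (ℓ / (2 * k)) p
  let η : ∀ p : CircleBundle E (χ.pow ℓ), TangentSpace 𝐈 p →L[ℝ] ℝ := contactForm R v (ℓ / (2 * k))
  have h1 : chartForm 𝐈 η p = κ⁻¹ • chartForm 𝐈 η' p := by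
    refine funext fun y => ContinuousLinearMap.ext fun u => ?_
    exact (inv_mul_cancel_left₀ (factor_ne_zero hκ) _).symm
  have h2 : ∀ a b : CircleModel E, extD 𝐈 η' p a b
      = κ * extD 𝐈 η p a b := by
    intro a b
    have h3 := fderiv_const_smul (hM.contDiffAt_form.differentiableAt (by simp)) κ⁻¹
    have h4 : ∀ a b : CircleModel E, fderiv ℝ (chartForm 𝐈 η p)
        (𝐞 p p) a b = κ⁻¹ *
      fderiv ℝ (chartForm 𝐈 η' p) (𝐞 p p) a b := by
      intro a b
      rw [h1]
      exact congrArg (fun l : CircleModel E →L[ℝ] CircleModel E →L[ℝ] ℝ => l a b) h3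
    change _ = κ * (_ - _)
    rw [h4, h4, ← mul_sub, mul_inv_cancel_left₀ (factor_ne_zero hκ)]
    rfl
  refine ((hM.metric_eq u w).trans
    (congrArg (fun t => 1 / 2 * t + η' p u * η' p w) (h2 u _))).trans ?_
  have h5 : ∀ x a b : ℝ, 1 / 2 * (κ * x) + (κ * a) * (κ * b) = κ * (1 / 2 * x + κ * (a * b)) := by
    intros
    ring
  exact h5 _ _ _

end IsFlagModel

/-! ### Invariance of the Sasaki structure -/

/-- The translate `x ↦ a s(a⁻¹ x)` of a local section. -/
def LocalSection.translate (s : LocalSection 𝔼 E P) (a : Gc) : LocalSection 𝔼 E P where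
  U := (fun x => a⁻¹ • x) ⁻¹' s.U
  isOpen := s.isOpen.preimage (contMDiff_smul_quotient 𝔼 E a⁻¹).continuous
  s x := a * s.s (a⁻¹ • x)
  holomorphic := contMDiffOn_const.mul (s.holomorphic.comp
    (contMDiff_smul_quotient 𝔼 E a⁻¹).contMDiffOn fun _ hx => hx)
  mk_s y hy := by
    change a • (𝛑 (s.s (a⁻¹ • y)) : Gc ⧸ P) = y
    rw [s.mk_s _ hy, smul_inv_smul]

namespace CircleBundle

lemma fiberCoord_translate (h : p.proj ∈ s.U)
    (a : Gc) : fiberCoord (s.translate a) (translate a p) = fiberCoord s p := by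
  have e : (𝛑 (a * s.s p.proj)) = a • p.proj := by
    change a • (𝛑 (s.s p.proj)) = _
    rw [s.mk_s _ h]
  conv_lhs => rw [eq_point h, translate_point]
  rw [fiberCoord_point (by
    rw [e]
    change a⁻¹ • a • p.proj ∈ s.U
    rwa [inv_smul_smul]), e]
  change phase (χ.ratio (a * s.s (a⁻¹ • a • p.proj)) _) * _ = _
  rw [inv_smul_smul, χ.ratio_self, map_one, one_mul]

lemma translate_rotate (a : Gc) (p : CircleBundle E χ) (z : Circle) :
    translate a (p.rotate z) = (translate a p).rotate z :=
  congrArg (fun w : Circle => (⟨a • p.proj, w⟩ : CircleBundle E χ)) (mul_assoc _ _ _).symm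

lemma contMDiff_translate (a : Gc) : ContMDiff 𝐈 𝐈 ∞
    (translate a : CircleBundle E χ → CircleBundle E χ) := fun _ =>
  contMDiffAt_translate contMDiffAt_const contMDiffAt_id

/-- The differential of a translation, on the model space. -/
def dTranslate (a : Gc) (p : CircleBundle E χ) : CircleModel E →L[ℝ] CircleModel E :=
  mfderiv 𝐈 𝐈 (translate a) p

lemma hasMFDerivAt_translate (a : Gc) (p : CircleBundle E χ) :
    HasMFDerivAt 𝐈 𝐈 (translate a) p (dTranslate a p : CircleModel E →L[ℝ] CircleModel E) :=
  ((contMDiff_translate a p).mdifferentiableAt (by simp)).hasMFDerivAt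

lemma dProj_dTranslate (a : Gc) (p : CircleBundle E χ) (u : CircleModel E) :
    dProj (translate a p) (dTranslate a p u) = smulDeriv a p.proj (dProj p u) := by
  have h1 := HasMFDerivAt.comp p (hasMFDerivAt_proj (translate a p)) (hasMFDerivAt_translate a p)
  have h2 := HasMFDerivAt.comp p
    (hasMFDerivAt_real_of_complex (hasMFDerivAt_smul 𝔼 (E := E) a p.proj)) (hasMFDerivAt_proj p)
  exact DFunLike.congr_fun (hasMFDerivAt_unique h1 h2) u

lemma dTranslate_angularVector (a : Gc) (p : CircleBundle E χ) :
    dTranslate a p (angularVector p) = angularVector (translate a p) := by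
  have e : p.rotate (Circle.exp 0) = p := by rw [Circle.exp_zero, rotate_one]
  have h1 : HasMFDerivAt 𝐈 𝐈 (translate a)
      (p.rotate (Circle.exp 0)) (dTranslate a p : CircleModel E →L[ℝ] CircleModel E) := by
    rw [e]
    exact hasMFDerivAt_translate a p
  have h2 := HasMFDerivAt.comp (0 : ℝ) h1 (hasMFDerivAt_rotate p)
  rw [show translate a ∘ (fun t : ℝ => p.rotate (Circle.exp t))
    = fun t : ℝ => (translate a p).rotate (Circle.exp t) from
      funext fun t => translate_rotate a p _] at h2
  have h3 : dTranslate a p ((1 : ℝ) • angularVector p) = (1 : ℝ) • angularVector (translate a p) :=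
    congrArg (fun l : ℝ →L[ℝ] CircleModel E => l 1)
      (hasMFDerivAt_unique h2 (hasMFDerivAt_rotate (translate a p)))
  rwa [one_smul, one_smul] at h3

lemma angleForm_dTranslate (h : p.proj ∈ s.U)
    (a : Gc) (u : CircleModel E) :
    angleForm (s.translate a) (translate a p) (dTranslate a p u) = angleForm s p u := by
  have h' : (translate a p).proj ∈ (s.translate a).U := by
    change a⁻¹ • a • p.proj ∈ s.U
    rwa [inv_smul_smul]
  have h1 := HasMFDerivAt.comp p (hasMFDerivAt_coord h') (hasMFDerivAt_translate a p)
  have h2 := h1.congr_of_eventuallyEq (f₁ := fun q : CircleBundle E χ => (fiberCoord s q : ℂ)) (by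
    filter_upwards [continuous_proj.continuousAt.preimage_mem_nhds (s.isOpen.mem_nhds h)] with q hq
    exact congrArg Subtype.val (fiberCoord_translate hq a).symm)
  have h3 : dCoord (s.translate a) (translate a p) (dTranslate a p u) = dCoord s p u :=
    DFunLike.congr_fun (hasMFDerivAt_unique h2 (hasMFDerivAt_coord h)) u
  exact congrArg₂ (fun z w : ℂ => ((I * z)⁻¹ * w).re)
    (congrArg Subtype.val (fiberCoord_translate h a)) h3

end CircleBundle

namespace IsFlagModel
variable [PreconnectedSpace Gc] {k : ℕ} (hχ : χ.IsCanonicalRoot (E := E) k) {ℓ : ℕ}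
include hm hG hu hχ

/-- Translation by `a` maps `s_U` to a section with the same norms `‖s_U v‖`, if `a` is unitary. -/
lemma contactForm_dTranslate (a : G) (p : CircleBundle E (χ.pow ℓ)) (u : CircleModel E) :
    contactForm R v (ℓ / (2 * k)) (translate (ι a) p) (dTranslate (ι a) p u)
      = contactForm R v (ℓ / (2 * k)) p u := by
  set s := 𝐬 p.proj
  have h : p.proj ∈ s.U := mem_sectionAt _
  have h' : ι a • p.proj ∈ (s.translate (ι a)).U := by
    change (ι a)⁻¹ • ι a • p.proj ∈ s.U
    rwa [inv_smul_smul]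
  have h1 := HasMFDerivAt.comp p.proj (hm.hasMFDerivAt_logNorm _ h')
    (hasMFDerivAt_real_of_complex (hasMFDerivAt_smul 𝔼 (E := E) (ι a) p.proj))
  rw [show logNorm R v (s.translate (ι a)) ∘ (fun z => ι a • z) = logNorm R v s from
    funext fun z => by
      change Real.log (‖R (ι a * s.s ((ι a)⁻¹ • ι a • z)) v‖ ^ 2) = Real.log (‖R (s.s z) v‖ ^ 2)
      rw [inv_smul_smul, hm.apply_mul, hu]] at h1
  have h2 : ∀ w : E, dLogNorm R v (s.translate (ι a)) (ι a • p.proj) (smulDeriv (ι a) p.proj w)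
      = dLogNorm R v s p.proj w := fun w =>
    DFunLike.congr_fun (hasMFDerivAt_unique h1 (hm.hasMFDerivAt_logNorm s h)) w
  have h3 : contactForm R v (ℓ / (2 * k)) (translate (ι a) p)
      = contactAt R v (ℓ / (2 * k)) (s.translate (ι a)) (translate (ι a) p) :=
    hm.contactAt_eq hG hu hχ h' (mem_sectionAt _)
  rw [h3]
  change angleForm _ _ _ - _ * dLogNorm R v _ (ι a • p.proj) (𝐉 (dProj _ _))
    = angleForm s p u - _ * dLogNorm R v s p.proj (𝐉 (dProj p u))
  rw [angleForm_dTranslate h, dProj_dTranslate, ← h2]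
  exact congrArg (fun w => _ - _ * dLogNorm R v (s.translate (ι a)) (ι a • p.proj) w)
    (map_smul (smulDeriv (ι a) p.proj) I (dProj p u)).symm

/-- The compact real form acts by automorphisms of the Sasaki structure. -/
lemma isPreservedBy_translate {κ : ℝ}
    (hκ : κ * (ℓ / (2 * k)) = (2 * (finrank ℂ E + 1 : ℝ))⁻¹) (a : G) :
    IsPreservedBy (hm.sasakiStructure hG hu hχ hκ) (translate (ι a)) where
  metric p u w := by
    have key : ∀ u w : CircleModel E, sasakiMetric dR R v (ℓ / (2 * k)) κ (translate (ι a) p)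
        (dTranslate (ι a) p u) (dTranslate (ι a) p w)
          = sasakiMetric dR R v (ℓ / (2 * k)) κ p u w := fun u w => by
      rw [sasakiMetric_apply, sasakiMetric_apply, hm.contactForm_dTranslate hG hu hχ,
        hm.contactForm_dTranslate hG hu hχ, dProj_dTranslate, dProj_dTranslate]
      exact congrArg (fun t => _ * t + _) (hm.flagForm_smul hu a p.proj _ _)
    exact key u w
  phi p u := by
    have key : ∀ u : CircleModel E, dTranslate (ι a) p (sasakiEndo R v (ℓ / (2 * k)) p u)
        = sasakiEndo R v (ℓ / (2 * k)) (translate (ι a) p) (dTranslate (ι a) p u) := fun u => by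
      refine sub_eq_zero.1 (eq_zero_of_dProj (χ := χ.pow ℓ) (translate (ι a) p)
        (β := contactForm R v (ℓ / (2 * k)) (translate (ι a) p)) ?_ ?_ ?_)
      · rw [contactForm_angularVector]
        exact one_ne_zero
      · rw [map_sub, dProj_dTranslate, dProj_sasakiEndo, dProj_sasakiEndo, dProj_dTranslate,
          sub_eq_zero]
        exact map_smul (smulDeriv (ι a) p.proj) I (dProj p u)
      · rw [map_sub, hm.contactForm_dTranslate hG hu hχ, contactForm_sasakiEndo,
          contactForm_sasakiEndo, sub_zero]
    exact key u
  xi p := by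
    refine (map_smul (dTranslate (ι a) p) κ⁻¹ (angularVector p)).trans ?_
    rw [dTranslate_angularVector]
    rfl
  eta p u := congrArg (κ * ·) (hm.contactForm_dTranslate hG hu hχ a p u)

end IsFlagModel

/-! ### Homogeneity -/

namespace IsFlagModel
include hm

/-- A linear form that vanishes on the orbit of `v` also vanishes on its translates by `𝔤`. -/
lemma span_orbit : Submodule.span ℂ (range fun g => R g v) = ⊤ := by
  have hv : ∀ g, R g v ∈ Submodule.span ℂ (range fun g => R g v) := fun g =>
    Submodule.subset_span ⟨g, rfl⟩
  refine hm.irreducible _ (fun x w hw => ?_) fun h => hm.ne_zero ?_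
  · by_contra hx
    obtain ⟨f, hf, hW⟩ := Submodule.exists_le_ker_of_notMem hx
    have hRw : ∀ g, f (R g w) = 0 := fun g => by
      refine LinearMap.mem_ker.1 (hW ?_)
      refine Submodule.span_le (p := (Submodule.span ℂ (range fun g => R g v)).comap
        (R g : V →ₗ[ℂ] V)).2 ?_ hw
      rintro _ ⟨h, rfl⟩
      have := hv (g * h)
      rwa [hm.map_mul] at this
    let T : (V →L[ℂ] V) →L[ℂ] ℂ := (toContinuousLinearMap f).comp (ContinuousLinearMap.apply ℂ V w)
    have h1 : HasMFDerivAt 𝓘(ℂ, 𝔼) 𝓘(ℂ, ℂ) (T ∘ R) 1 (T.comp dR : 𝔼 →L[ℂ] ℂ) :=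
      (T.hasFDerivAt.hasMFDerivAt (x := R 1)).comp (1 : Gc)
        (hasMFDerivAt_representation hm.contMDiff hm.mfderiv_one)
    have h2 : T ∘ R = fun _ => 0 := funext hRw
    rw [h2] at h1
    have h3 := hasMFDerivAt_unique h1 (hasMFDerivAt_const (0 : ℂ) (1 : Gc))
    exact hf (DFunLike.congr_fun h3 x)
  · have := h ▸ hv 1
    rwa [hm.map_one, Submodule.mem_bot] at this

/-- An operator for which every vector of the orbit of `v` is an eigenvector is a scalar: the
eigenvalue is a continuous function on a connected group, with values in a finite set. -/
lemma eq_smul_of_orbit [PreconnectedSpace Gc] {T : V →L[ℂ] V}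
    (hT : ∀ g, ∃ c : ℂ, T (R g v) = c • R g v) : ∃ c : ℂ, ∀ w, T w = c • w := by
  choose c hc using hT
  have h0 : ∀ g, R g v ≠ 0 := hm.apply_ne_zero
  have hR : Continuous fun g => R g v := hm.contMDiff.continuous.clm_apply continuous_const
  have hcont : Continuous c := by
    have : c = fun g => inner ℂ (R g v) (T (R g v)) / inner ℂ (R g v) (R g v) := by
      ext g
      rw [hc, inner_smul_right, mul_div_cancel_right₀ _ (inner_self_ne_zero.2 (h0 g))]
    rw [this]
    exact (hR.inner (T.continuous.comp hR)).div (hR.inner hR) fun g => inner_self_ne_zero.2 (h0 g)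
  have hsub := (Module.End.finite_hasEigenvalue (T : Module.End ℂ V)).countable.isTotallyDisconnected
    (range c) (by
      rintro _ ⟨g, rfl⟩
      exact Module.End.hasEigenvalue_of_hasEigenvector
        ⟨Module.End.mem_eigenspace_iff.2 (hc g), h0 g⟩) (isPreconnected_range hcont)
  refine ⟨c 1, fun w => ?_⟩
  have := LinearMap.ext_on (f := (T : V →ₗ[ℂ] V)) (g := c 1 • LinearMap.id) hm.span_orbit (by
    rintro _ ⟨g, rfl⟩
    change T (R g v) = c 1 • R g v
    rw [hc, hsub ⟨g, rfl⟩ ⟨1, rfl⟩])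
  exact congrArg (fun l : V →ₗ[ℂ] V => l w) this

include hG

/-- The elements of the compact form that act on `V` by scalars form a discrete set, because no
nonzero element of the Lie algebra acts by a scalar. -/
lemma isDiscrete_of_scalar {N : Subgroup G} (hN : ∀ a ∈ N, ∃ c : ℂ, ∀ w, R (ι a) w = c • w) :
    IsDiscrete (N : Set G) := by
  have := hG.lieGroup
  have := topologicalGroup_of_lieGroup (𝓡 d) ∞ (G := G)
  -- the projection of `End V` along the scalars
  let L : (V →L[ℂ] V) →L[ℂ] (V →L[ℂ] V) := ContinuousLinearMap.id ℂ _ -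
    ((inner ℂ v v)⁻¹ • (innerSL ℂ v).comp (ContinuousLinearMap.apply ℂ V v)).smulRight 1
  have hv : inner ℂ v v ≠ 0 := inner_self_ne_zero.2 hm.ne_zero
  have hL : ∀ T, L T = T - ((inner ℂ v v)⁻¹ * inner ℂ v (T v)) • (1 : V →L[ℂ] V) := fun T => rfl
  have hLs : ∀ a ∈ N, L (R (ι a)) = 0 := fun a ha => by
    obtain ⟨c, hc⟩ := hN a ha
    rw [hL, hc, inner_smul_right, mul_comm c, inv_mul_cancel_left₀ hv, sub_eq_zero]
    exact ContinuousLinearMap.ext hc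
  let D : 𝐑 →L[ℝ] (V →L[ℂ] V) := (L.comp dR).restrictScalars ℝ ∘L 𝐝
  have hD : HasMFDerivAt (𝓡 d) 𝓘(ℝ, V →L[ℂ] V) (fun a => L (R (ι a))) (1 : G)
      (D : 𝐑 →L[ℝ] (V →L[ℂ] V)) := by
    have h1 : HasMFDerivAt 𝓘(ℂ, 𝔼) 𝓘(ℂ, V →L[ℂ] V) (L ∘ R) 1 (L.comp dR : 𝔼 →L[ℂ] V →L[ℂ] V) :=
      (L.hasFDerivAt.hasMFDerivAt (x := R 1)).comp (1 : Gc)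
        (hasMFDerivAt_representation hm.contMDiff hm.mfderiv_one)
    have h2 : HasMFDerivAt 𝓘(ℝ, 𝔼) 𝓘(ℝ, V →L[ℂ] V) (L ∘ R) (ι 1)
        ((L.comp dR).restrictScalars ℝ : 𝔼 →L[ℝ] V →L[ℂ] V) := by
      rw [ι.map_one]
      exact hasMFDerivAt_real_of_complex h1
    exact h2.comp (1 : G) (hasMFDerivAt_incl hG)
  have hinj : ∀ x, D x = 0 → x = 0 := fun x hx => by
    have h1 : L (dR (𝐝 x)) = 0 := hx
    rw [hL, sub_eq_zero] at h1
    exact dIncl_injective hG ((hm.eq_zero_of_scalar _ _ (DFunLike.congr_fun h1)).trans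
      (map_zero _).symm)
  obtain ⟨K, -, hK⟩ := LinearMap.exists_antilipschitzWith
    (D : 𝐑 →ₗ[ℝ] (V →L[ℂ] V)) (LinearMap.ker_eq_bot'.2 hinj)
  have h1 := (hasFDerivAt_of_hasMFDerivAt hD).eventually_ne (c := 0) ⟨K, hK⟩
  rw [eventually_nhdsWithin_iff] at h1
  have h2 := (continuousAt_extChartAt (I := 𝓡 d) (1 : G)).eventually h1
  have h3 : ∀ᶠ a : G in 𝓝 1, a ∈ N → a = 1 := by
    filter_upwards [h2, extChartAt_source_mem_nhds (I := 𝓡 d) (1 : G)] with a ha hs haN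
    by_contra hne
    refine ha (fun h => hne ((extChartAt (𝓡 d) (1 : G)).injOn hs (mem_extChartAt_source _) h)) ?_
    change L (R (ι ((extChartAt (𝓡 d) (1 : G)).symm (extChartAt (𝓡 d) 1 a)))) = 0
    rw [(extChartAt (𝓡 d) (1 : G)).left_inv hs]
    exact hLs a haN
  refine ⟨discreteTopology_of_isOpen_singleton_one (G := N) ?_⟩
  refine isOpen_singleton_iff_nhds_eq_pure _ |>.2 (le_antisymm ?_ (pure_le_nhds _))
  rw [Filter.le_pure_iff]
  filter_upwards [continuous_subtype_val.continuousAt.eventually h3] with a ha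
  exact Subtype.ext (ha a.2)

variable {k ℓ : ℕ} {κ : ℝ}
include hu

/-- The effective group is the quotient of `G` by the kernel of the action. An element of the kernel
fixes every line `ℂ g v`, so it acts on `V` by a scalar. -/
lemma isHomogeneousUnder_sasakiStructure [PreconnectedSpace Gc]
    (hχ : χ.IsCanonicalRoot (E := E) k) (hℓ : 0 < ℓ)
    (hκ : κ * (ℓ / (2 * k)) = (2 * (finrank ℂ E + 1 : ℝ))⁻¹) :
    IsHomogeneousUnder (hm.sasakiStructure hG hu hχ hκ) G
      (fun a p => CircleBundle.translate (ι a) p) := by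
  have := hG.lieGroup
  have := hG.connected
  have := topologicalGroup_of_lieGroup (𝓡 d) ∞ (G := G)
  let M := CircleBundle E (χ.pow ℓ)
  let _ : MulAction G M :=
    { smul a p := CircleBundle.translate (ι a) p
      one_smul p := by
        change CircleBundle.translate (ι 1) p = p
        rw [ι.map_one, CircleBundle.translate_one]
      mul_smul a b p := by
        change CircleBundle.translate (ι (a * b)) p = _
        rw [ι.map_mul, CircleBundle.translate_mul]
        rfl }
  let N : Subgroup G := (MulAction.toPermHom G M).ker
  have hN : IsDiscrete (N : Set G) := hm.isDiscrete_of_scalar hG fun a ha => hm.eq_smul_of_orbit fun g => by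
    have h1 : CircleBundle.translate (ι a) (CircleBundle.point E (χ.pow ℓ) g 1) = _ :=
      congrArg (fun s : Equiv.Perm M => s (CircleBundle.point E (χ.pow ℓ) g 1)) ha
    have h2 : (𝛑 (ι a * g)) = 𝛑 g := congrArg (fun p : M => p.proj) h1
    obtain ⟨c, hc⟩ := (hm.mem_iff _).1 (QuotientGroup.eq.1 h2.symm)
    refine ⟨c, ?_⟩
    have h3 := congrArg (R g) hc
    rw [map_smul] at h3
    refine Eq.trans ?_ h3
    change (R (ι a) * R g) v = (R g * R (g⁻¹ * (ι a * g))) v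
    rw [← hm.map_mul, ← hm.map_mul, mul_inv_cancel_left]
  let _ := discreteQuotientChartedSpace (F := 𝐑) hN
  let _ : MulAction (G ⧸ N) M := MulAction.compHom M (QuotientGroup.kerLift (MulAction.toPermHom G M))
  have hmk : ∀ (a : G) (p : M), (a : G ⧸ N) • p = CircleBundle.translate (ι a) p := fun a p => rfl
  refine ⟨d, G ⧸ N, inferInstance, inferInstance, inferInstance, inferInstance, QuotientGroup.mk' N,
    lieGroup_discreteQuotient hN,
    QuotientGroup.mk_surjective.connectedSpace continuous_quot_mk, contMDiffSMul_discreteQuotient hN fun q =>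
      CircleBundle.contMDiffAt_translate ((hG.smooth _).comp q contMDiffAt_fst) contMDiffAt_snd,
    ⟨fun p q => ?_⟩, ⟨fun {a b} h => ?_⟩, fun a => ?_, QuotientGroup.mk'_surjective N, hmk⟩
  · obtain ⟨a, ha⟩ := hm.exists_translate_eq hG hu hχ hℓ p q
    exact ⟨a, ha⟩
  · exact QuotientGroup.kerLift_injective (MulAction.toPermHom G M) (Equiv.ext h)
  · obtain ⟨a, rfl⟩ := QuotientGroup.mk_surjective a
    exact hm.isPreservedBy_translate hG hu hχ hκ a

end IsFlagModel

end Flag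

end SasakiGeom

end

theorem mainTheorem2
    -- the complex Lie group `Gc`, with simple Lie algebra
    {𝔼 : Type*} [NormedAddCommGroup 𝔼] [NormedSpace ℂ 𝔼] [FiniteDimensional ℂ 𝔼]
    {Gc : Type*} [TopologicalSpace Gc] [T2Space Gc] [SecondCountableTopology Gc]
    [ChartedSpace 𝔼 Gc] [Group Gc] [LieGroup 𝓘(ℂ, 𝔼) ω Gc]
    [ConnectedSpace Gc] [SimplyConnectedSpace Gc]
    [LieAlgebra.IsSimple ℂ (GroupLieAlgebra 𝓘(ℂ, 𝔼) Gc)]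
    -- a Cartan subalgebra, a base of the root system, and a parabolic subgroup `P = P_Θ`
    (𝔥 : LieSubalgebra ℂ (GroupLieAlgebra 𝓘(ℂ, 𝔼) Gc)) [𝔥.IsCartanSubalgebra]
    (b : (LieAlgebra.IsKilling.rootSystem 𝔥).Base) (Θ : Finset 𝔥.root) (hΘ : Θ ⊂ b.support)
    (P : Subgroup Gc) (hP : P = adNormalizer (parabolicSubalgebra b Θ))
    -- the complex structure of the flag manifold `X_P = Gc ⧸ P`
    {E : Type*} [NormedAddCommGroup E] [NormedSpace ℂ E] [FiniteDimensional ℂ E]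
    [ChartedSpace E (Gc ⧸ P)] [IsHolomorphicQuotient 𝔼 E P]
    -- the compact real form `G`
    {d : ℕ} {G : Type*} [TopologicalSpace G] [ChartedSpace (EuclideanSpace ℝ (Fin d)) G] [Group G]
    (ι : G →* Gc) (hG : IsCompactRealForm (d := d) 𝔼 ι)
    -- the irreducible module `V(δ_P)`, with a highest weight vector `v` and a `G`-invariant norm
    {V : Type*} [NormedAddCommGroup V] [InnerProductSpace ℂ V] [FiniteDimensional ℂ V]
    [LieRingModule (GroupLieAlgebra 𝓘(ℂ, 𝔼) Gc) V] [LieModule ℂ (GroupLieAlgebra 𝓘(ℂ, 𝔼) Gc) V]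
    (v : V) (hv : IsHighestWeightModule b (deltaWeight b Θ) V v)
    (ρ : Representation ℂ Gc V)
    (hρ : ∀ w : V, ContMDiff 𝓘(ℂ, 𝔼) 𝓘(ℂ, V) ω (fun g : Gc => ρ g w))
    (hρ_bracket : ∀ (x : GroupLieAlgebra 𝓘(ℂ, 𝔼) Gc) (w : V),
      mfderiv 𝓘(ℂ, 𝔼) 𝓘(ℂ, V) (fun g : Gc => ρ g w) 1 x = ⁅x, w⁆)
    (hρ_unitary : ∀ (k : G) (w : V), ‖ρ (ι k) w‖ = ‖w‖)
    -- the root `K^{1/I}` of the canonical bundle, `I` being the Fano index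
    (χ : HolomorphicCharacter 𝔼 P) (hχ : χ.IsCanonicalRoot (E := E) (flagFanoIndex 𝔼 E P))
    (ℓ : ℕ) (hℓ : 0 < ℓ) :
    let n : ℕ := Module.finrank ℂ E
    let I : ℕ := flagFanoIndex 𝔼 E P
    let Q := CircleBundle E χ
    let M := CircleBundle E (χ.pow ℓ)
    -- `M` is the quotient of `Q` by the group `ℤ_ℓ` of `ℓ`-th roots of unity
    (Function.Surjective (CircleBundle.powMap ℓ : Q → M) ∧
      IsLocalDiffeomorph 𝓘(ℝ, CircleModel E) 𝓘(ℝ, CircleModel E) ∞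
        (CircleBundle.powMap ℓ : Q → M) ∧
      ∀ p q : Q, CircleBundle.powMap ℓ p = CircleBundle.powMap ℓ q ↔
        ∃ z : Circle, z ^ ℓ = 1 ∧ q = p.rotate z) ∧
    CompactSpace M ∧ ConnectedSpace M ∧ T2Space M ∧
    ∃ (η : ∀ p : M, TangentSpace 𝓘(ℝ, CircleModel E) p →L[ℝ] ℝ)
      (S : StructureTensors 𝓘(ℝ, CircleModel E) M),
      -- `η` is given by the local formula, for every local section of `Gc → X_P`
      (∀ (s : LocalSection 𝔼 E P) (p : M), p.proj ∈ s.U →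
        ∀ w, (η p w : ℂ) = contactFormAt ρ v ℓ I s p w) ∧
      IsSasakiEinstein n S ∧
      IsHomogeneousUnder S G (fun k p => CircleBundle.translate (ι k) p) ∧
      (∀ p, S.ξ p = (ℓ * (n + 1) / I : ℝ) • CircleBundle.angular p) ∧
      (∀ p, S.η p = (I / (ℓ * (n + 1)) : ℝ) • η p) ∧
      (∀ p u w, S.g.inner p u w = (I / (ℓ * (n + 1)) : ℝ) *
        (1 / 2 * extD 𝓘(ℝ, CircleModel E) η p u (S.φ p w)
          + (I / (ℓ * (n + 1)) : ℝ) * (η p u * η p w))) ∧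
      -- `φ w` is the horizontal lift of `J (π_* w)`
      (∀ p w, η p (S.φ p w) = 0 ∧ p.projDeriv (S.φ p w) = complexStructure E (p.projDeriv w)) := by
  intro n I Q M
  have hm := isFlagModel (E := E) b hΘ hP hv ρ hρ hρ_bracket
  set R : Gc → V →L[ℂ] V := fun g => LinearMap.toContinuousLinearMap (ρ g)
  have hu : ∀ (k : G) (w : V), ‖R (ι k) w‖ = ‖w‖ := hρ_unitary
  have hI : (I : ℝ) ≠ 0 := Nat.cast_ne_zero.2 (hm.canonicalRoot_ne_zero hG hu hχ)
  have hℓ0 : (ℓ : ℝ) ≠ 0 := Nat.cast_ne_zero.2 hℓ.ne'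
  have hn : (n + 1 : ℝ) ≠ 0 := by positivity
  have hκ : (I / (ℓ * (n + 1)) : ℝ) * (ℓ / (2 * I)) = (2 * (n + 1 : ℝ))⁻¹ := by
    field_simp
  refine ⟨⟨CircleBundle.powMap_surjective hℓ, CircleBundle.isLocalDiffeomorph_powMap hℓ,
    CircleBundle.powMap_eq_iff ℓ⟩, hm.compactSpace_circleBundle hG hu hχ hℓ,
    hm.connectedSpace_circleBundle hG hu hχ hℓ, ?_, fun p => contactForm R v (ℓ / (2 * I)) p,
    hm.sasakiStructure hG hu hχ hκ, fun s p hs w => ?_, hm.isSasakiEinstein_sasakiStructure hG hu hχ hκ,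
    hm.isHomogeneousUnder_sasakiStructure hG hu hχ hℓ hκ, fun p => ?_, fun p => rfl,
    hm.inner_sasakiStructure hG hu hχ hκ,
    fun p w => ⟨contactForm_sasakiEndo _ p w, dProj_sasakiEndo _ p w⟩⟩
  · have := hm.t2Space_quotient
    exact CircleBundle.t2Space
  · refine Eq.trans ?_ (contactFormAt_eq ρ v ℓ I hs w).symm
    exact congrArg (fun l : CircleModel E →L[ℝ] ℝ => ((l w : ℝ) : ℂ))
      (hm.contactAt_eq hG hu hχ hs (mem_sectionAt _))
  · refine congrArg (fun c : ℝ => c • CircleBundle.angular p) (inv_div _ _)
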